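/- **Setting.** Let $M$ be a smooth finite-dimensional manifold and $\mathcal G$ the Lie 2-group of a smooth crossed module $(G,H,t,\alpha)$: arrows $(g,h)\colon g\to t(h)g$, product $(g,h)(g',h')=(gg',\,h\,\alpha_g(h'))$, composition $(t(h)g,h')\circ(g,h)=(g,h'h)$. Write $t_*\colon\mathfrak h\to\mathfrak g$, $(\alpha_g)_*\colon\mathfrak h\to\mathfrak h$, $\alpha_*\colon\mathfrak g\times\mathfrak h\to\mathfrak h$ for the derivatives. For points (or arrows) $a,b$ of a torsor, $b:a$ is the element with $a\cdot(b:a)=b$. A $\mathcal G$-torsor is a groupoid with a free and transitive right $\mathcal G$-action; 1- and 2-morphisms are equivariant functors and equivariant natural transformations. Elements of $\ker(s)=\{(1,h)\}$ are identified with $h\in H$. A principal $\mathcal G$-2-bundle $\mathcal P=(\mathcal P_1\rightrightarrows\mathcal P_0)\xrightarrow{\pi}M$ is a Lie groupoid with smooth right $\mathcal G$-action and invariant surjective submersion $\pi$ for which $(p,g)\mapsto(p,p\cdot g)$ is a diffeomorphism onto the fibre product over $M$ (on objects and on arrows). A 2-connection on it is a pair $A\in\Omega^1(\mathcal P_0,\mathfrak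 g)$, $B\in\Omega^2(\mathcal P_0,\mathfrak h)$, where $A$ is a principal connection, $B$ is horizontal with $R_g^*B=(\alpha_{g^{-1}})_*B$, and $t_*B=F_A=dA+\tfrac12[A\wedge A]$. A 1-morphism $(\mathcal P,A,B)\to(\mathcal P',A',B')$ is a pair $(F,\phi)$ of a smooth equivariant functor $F\colon\mathcal P\to\mathcal P'$ over $M$ and a smooth form $\phi\in\Omega^1(\mathcal P_0,\mathfrak h)$ which vanishes on vertical vectors, satisfies $R_g^*\phi=(\alpha_{g^{-1}})_*\phi$ for all $g\in G$, and $$F^*A'=A+t_*\phi,\qquad F^*B'=B+d\phi+\tfrac12[\phi\wedge\phi]+[A\wedge\phi],$$ where $\tfrac12[\phi\wedge\phi](v,w)=[\phi(v),\phi(w)]$ and $[A\wedge\phi](v,w)=\alpha_*(A(v),\phi(w))-\alpha_*(A(w),\phi(v))$. A transport 2-functor is a strict 2-functor $\mathscr F\colon\Pi_2^{\rm thin}(M)\to\mathcal G\textbf{-tor}$ (points, thin homotopy classes of smooth paths with sitting instants, thin homotopy classes of bigons) that is smooth, i.e. depends smoothly on smooth families of loops at a point and of bigons between two points. A 1-morphism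 $\rho\colon\mathscr F\to\mathscr F'$ is a pseudonatural transformation: 1-morphisms $\rho(x)\colon\mathscr F(x)\to\mathscr F'(x)$ and 2-morphisms $\rho(\gamma)\colon\rho(y)\circ\mathscr F(\gamma)\Rightarrow\mathscr F'(\gamma)\circ\rho(x)$ for thin homotopy classes of paths $\gamma\colon x\to y$, with $$\rho(\gamma'\gamma)(p)=\mathscr F'(\gamma')\big(\rho(\gamma)(p)\big)\circ\rho(\gamma')\big(\mathscr F(\gamma)(p)\big),\qquad \mathscr F'(\Sigma)(\rho(x)(p))\circ\rho(\gamma)(p)=\rho(\gamma')(p)\circ\rho(y)\big(\mathscr F(\Sigma)(p)\big)$$ for all bigons $\Sigma\colon\gamma\Rightarrow\gamma'$. Fix identifications of $\mathscr F(x),\mathscr F'(x)$ with the fibres $\mathcal P_x,\mathcal P'_x$ of principal 2-bundles ($x\in M$), write $\mathrm{tra}_\gamma=\mathscr F(\gamma)$, $\mathrm{tra}^2_\Sigma(p)=\mathscr F(\Sigma)(p):\mathrm{id}_{\mathrm{tra}_\gamma(p)}\in H$ and $\rho_H(\gamma)(p)=\rho(\gamma)(p):\mathrm{id}_{\rho(y)(\mathrm{tra}_\gamma(p))}\in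 H$. Call $\rho$ smooth if $\rho(x)(p)$ and $\rho_H(\gamma)(p)$ are smooth along smooth families of points and paths. For a smooth curve $c$ in $\mathcal P_0$ let $c_t$ be its part from $c(0)$ to $c(t)$. **(i)** Suppose that $(\mathcal P,A,B)$ is defined by $\mathscr F$, i.e. for all smooth $c\colon\mathbb R\to\mathcal P_0$ and $S\colon\mathbb R^2\to\mathcal P_0$ $$A(c'(0))=-\tfrac{d}{dt}\big|_{0}\,\mathrm{tra}_{\pi_*c_t}(c(0)):c(t),\qquad B(\partial_1S,\partial_2S)_{(0,0)}=\tfrac{\partial^2}{\partial s\,\partial t}\big|_{0}\,\mathrm{tra}^2_{\bar\Gamma(s,t)}\big(S(s,t)\big),$$ where $\bar\Gamma(s,t)$ is the image under $\pi\circ S$ of the bigon in the rectangle with corners $(0,0),(s,t)$ from the path $(s,t)\to(0,t)\to(0,0)$ to the path $(s,t)\to(s,0)\to(0,0)$; suppose likewise that $(\mathcal P',A',B')$ is defined by $\mathscr F'$. Let $\rho\colon\mathscr F\to\mathscr F'$ be a smooth pseudonatural transformation. Then the $\rho(x)$ form a unique smooth equivariant functor $F\colon\mathcal P\to\mathcal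 P'$ over $M$; there is a unique $\phi\in\Omega^1(\mathcal P_0,\mathfrak h)$ with $$\phi(c'(0))=-\tfrac{d}{dt}\big|_{t=0}\,\rho_H(\pi_*c_t)(c(0))\qquad\text{for all smooth curves }c\text{ in }\mathcal P_0;$$ $(F,\phi)$ is a 1-morphism $(\mathcal P,A,B)\to(\mathcal P',A',B')$; and $R_g^*\phi=(\alpha_{g^{-1}})_*\phi$ also holds for all smooth $g\colon\mathcal P_0\to G$ with $g(p\cdot k)=k^{-1}g(p)k$, where $R_g(p)=p\cdot g(p)$. **(ii)** Conversely, suppose that $\mathscr F$ and $\mathscr F'$ are the transport 2-functors of $(\mathcal P,A,B)$ and $(\mathcal P',A',B')$ obtained by integration: $\mathrm{tra}_\gamma$ is parallel transport, and $\mathrm{tra}^2_\Sigma(p)=h(1)^{-1}$, where $h(0)=1$ and $h'(s)=\big(\int_0^1B(\partial_s\tilde\Sigma,\partial_t\tilde\Sigma)\,dt\big)h(s)$, with $\tilde\Sigma(s,\cdot)$ the horizontal lift of $\Sigma(s,\cdot)$ starting at $p$ (and likewise for $\mathscr F'$). Let $(F,\phi)\colon(\mathcal P,A,B)\to(\mathcal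 P',A',B')$ be a 1-morphism. Then there is exactly one smooth pseudonatural transformation $\rho\colon\mathscr F\to\mathscr F'$ with $\rho(x)=F|_{\mathcal P_x}$ and $$\rho(\gamma)(p):\mathrm{id}_{F(\mathrm{tra}_\gamma(p))}=\mathcal P\exp\int_0^1-\phi(\tilde\gamma'(t))\,dt,$$ i.e. the value at $t=1$ of the solution of $h(0)=1$, $h'(t)=-\phi(\tilde\gamma'(t))\,h(t)$, where $\tilde\gamma$ is the horizontal lift of $\gamma$ starting at $p$. In particular, the 2-morphisms so defined satisfy the two compatibility relations with the composition of paths and with bigons. -/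

import Mathlib

open scoped Manifold ContDiff

set_option linter.checkUnivs false

noncomputable section

universe w₀ w₁

namespace TwoTransport

/-! ### Calculus on manifolds

Manifolds are smooth, finite-dimensional and without boundary: a manifold with model vector space
`E` carries a `ChartedSpace E` structure, used with the model `𝓘(ℝ, E)`.  The tangent space at every
point, and in particular the Lie algebra of a Lie group, has `E` as underlying vector space. -/

section Calculus

variable {E : Type*} [NormedAddCommGroup E] [NormedSpace ℝ E]
  {N : Type*} [TopologicalSpace N] [ChartedSpace E N]
  {V : Type*} [NormedAddCommGroup V] [NormedSpace ℝ V]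

/-- Parameter spaces of smooth families. -/
abbrev Param (k : ℕ) : Type := EuclideanSpace ℝ (Fin k)

/-- The curve `c` is differentiable at `t` with velocity `v`. -/
def HasVelocity (E : Type*) [NormedAddCommGroup E] [NormedSpace ℝ E]
    {N : Type*} [TopologicalSpace N] [ChartedSpace E N] (c : ℝ → N) (t : ℝ) (v : E) : Prop :=
  HasMFDerivAt 𝓘(ℝ, ℝ) 𝓘(ℝ, E) c t (ContinuousLinearMap.toSpanSingleton ℝ v : ℝ →L[ℝ] E)

/-- The velocity of the curve `c` at `t`. -/
def velocity (E : Type*) [NormedAddCommGroup E] [NormedSpace ℝ E]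
    {N : Type*} [TopologicalSpace N] [ChartedSpace E N] (c : ℝ → N) (t : ℝ) :
    TangentSpace 𝓘(ℝ, E) (c t) :=
  (mfderiv 𝓘(ℝ, ℝ) 𝓘(ℝ, E) c t : ℝ →L[ℝ] E) 1

/-- The first partial derivative of a map of two real variables. -/
def partial₁ (E : Type*) [NormedAddCommGroup E] [NormedSpace ℝ E]
    {N : Type*} [TopologicalSpace N] [ChartedSpace E N] (S : ℝ × ℝ → N) (z : ℝ × ℝ) :
    TangentSpace 𝓘(ℝ, E) (S z) :=
  (mfderiv 𝓘(ℝ, ℝ × ℝ) 𝓘(ℝ, E) S z : ℝ × ℝ →L[ℝ] E) (1, 0)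

/-- The second partial derivative of a map of two real variables. -/
def partial₂ (E : Type*) [NormedAddCommGroup E] [NormedSpace ℝ E]
    {N : Type*} [TopologicalSpace N] [ChartedSpace E N] (S : ℝ × ℝ → N) (z : ℝ × ℝ) :
    TangentSpace 𝓘(ℝ, E) (S z) :=
  (mfderiv 𝓘(ℝ, ℝ × ℝ) 𝓘(ℝ, E) S z : ℝ × ℝ →L[ℝ] E) (0, 1)

/-- The rank of the differential of `f` is at most `r` at every point. -/
def RankLE (E : Type*) [NormedAddCommGroup E] [NormedSpace ℝ E]
    {N : Type*} [TopologicalSpace N] [ChartedSpace E N]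
    {W : Type*} [NormedAddCommGroup W] [NormedSpace ℝ W] (r : ℕ) (f : W → N) : Prop :=
  ∀ z : W, Module.finrank ℝ
    (LinearMap.range (mfderiv 𝓘(ℝ, W) 𝓘(ℝ, E) f z : W →L[ℝ] E).toLinearMap) ≤ r

/-- `V`-valued 1-forms on `N` (not necessarily continuous). -/
abbrev OneForm (E : Type*) [NormedAddCommGroup E] [NormedSpace ℝ E]
    (N : Type*) [TopologicalSpace N] [ChartedSpace E N]
    (V : Type*) [NormedAddCommGroup V] [NormedSpace ℝ V] : Type _ :=
  (p : N) → (TangentSpace 𝓘(ℝ, E) p →L[ℝ] V)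

/-- `V`-valued 2-forms on `N` (not necessarily continuous). -/
abbrev TwoForm (E : Type*) [NormedAddCommGroup E] [NormedSpace ℝ E]
    (N : Type*) [TopologicalSpace N] [ChartedSpace E N]
    (V : Type*) [NormedAddCommGroup V] [NormedSpace ℝ V] : Type _ :=
  (p : N) → (TangentSpace 𝓘(ℝ, E) p [⋀^Fin 2]→L[ℝ] V)

/-- The differential of the inverse of the preferred chart at `p`. -/
def chartSymmDeriv (p : N) (x : E) :
    E →L[ℝ] TangentSpace 𝓘(ℝ, E) ((extChartAt 𝓘(ℝ, E) p).symm x) :=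
  mfderiv 𝓘(ℝ, E) 𝓘(ℝ, E) (extChartAt 𝓘(ℝ, E) p).symm x

/-- The 1-form `φ` written in the preferred chart at `p`. -/
def OneForm.inChart (φ : OneForm E N V) (p : N) (x : E) : E →L[ℝ] V :=
  (φ ((extChartAt 𝓘(ℝ, E) p).symm x)).comp (chartSymmDeriv p x)

/-- The 2-form `η` written in the preferred chart at `p`. -/
def TwoForm.inChart (η : TwoForm E N V) (p : N) (x : E) : E [⋀^Fin 2]→L[ℝ] V :=
  (η ((extChartAt 𝓘(ℝ, E) p).symm x)).compContinuousLinearMap (chartSymmDeriv p x)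

/-- Smoothness of a 1-form: its coefficients in charts are smooth. -/
def OneForm.IsSmooth (φ : OneForm E N V) : Prop :=
  ∀ p : N, ContDiffOn ℝ ∞ (φ.inChart p) (extChartAt 𝓘(ℝ, E) p).target

/-- Smoothness of a 2-form: its coefficients in charts are smooth. -/
def TwoForm.IsSmooth (η : TwoForm E N V) : Prop :=
  ∀ p : N, ContDiffOn ℝ ∞ (η.inChart p) (extChartAt 𝓘(ℝ, E) p).target

/-- The exterior derivative of a 1-form, computed at `p` in the preferred chart at `p` (whose
differential at `p` is the identity of the tangent space). -/
def OneForm.d (φ : OneForm E N V) (p : N) (v w : TangentSpace 𝓘(ℝ, E) p) : V :=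
  (fderiv ℝ (φ.inChart p) (extChartAt 𝓘(ℝ, E) p p) (v : E)) (w : E)
    - (fderiv ℝ (φ.inChart p) (extChartAt 𝓘(ℝ, E) p p) (w : E)) (v : E)

end Calculus

section LieGroups

variable {E : Type*} [NormedAddCommGroup E] [NormedSpace ℝ E]

/-- The bracket of the Lie algebra `T₁K` of the Lie group `K`. -/
def lieBr (K : Type*) [TopologicalSpace K] [ChartedSpace E K] [Group K] (v w : E) : E :=
  (⁅(show GroupLieAlgebra 𝓘(ℝ, E) K from v), (show GroupLieAlgebra 𝓘(ℝ, E) K from w)⁆ :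
    GroupLieAlgebra 𝓘(ℝ, E) K)

variable {K : Type*} [TopologicalSpace K] [ChartedSpace E K] [Group K]

/-- The right translate `v · h` of `v ∈ T₁K`. -/
def rightTranslate (v : E) (h : K) : E := (mfderiv 𝓘(ℝ, E) 𝓘(ℝ, E) (fun x : K => x * h) 1 : E →L[ℝ] E) v

/-- The adjoint action of `K` on `T₁K`. -/
def Ad (h : K) : E →L[ℝ] E := mfderiv 𝓘(ℝ, E) 𝓘(ℝ, E) (fun x : K => h * x * h⁻¹) 1

/-- `h` is the path-ordered exponential of `ξ : ℝ → T₁K`, that is, the solution of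
`h' = ξ h` with `h 0 = 1`. -/
def IsPathOrderedExp (ξ : ℝ → E) (h : ℝ → K) : Prop :=
  h 0 = 1 ∧ ∀ t, HasVelocity E h t (rightTranslate (ξ t) (h t))

end LieGroups

/-! ### Smooth crossed modules -/

/-- A smooth crossed module `(G, H, t, α)`; equivalently, the Lie 2-group `G ⋉ H ⇉ G`. -/
structure LieCrossedModule (EG : Type*) [NormedAddCommGroup EG] [NormedSpace ℝ EG]
    (EH : Type*) [NormedAddCommGroup EH] [NormedSpace ℝ EH]
    (G : Type*) [TopologicalSpace G] [ChartedSpace EG G] [Group G]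
    (H : Type*) [TopologicalSpace H] [ChartedSpace EH H] [Group H] where
  /-- the target map -/
  t : H →* G
  /-- the action of `G` on `H` by automorphisms -/
  α : G →* MulAut H
  smooth_t : ContMDiff 𝓘(ℝ, EH) 𝓘(ℝ, EG) ∞ t
  smooth_α : ContMDiff (𝓘(ℝ, EG).prod 𝓘(ℝ, EH)) 𝓘(ℝ, EH) ∞ (fun x : G × H => α x.1 x.2)
  t_α : ∀ g h, t (α g h) = g * t h * g⁻¹
  peiffer : ∀ h h', α (t h) h' = h * h' * h⁻¹

section

variable {EG : Type*} [NormedAddCommGroup EG] [NormedSpace ℝ EG]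
  {EH : Type*} [NormedAddCommGroup EH] [NormedSpace ℝ EH]
  {G : Type*} [TopologicalSpace G] [ChartedSpace EG G] [Group G]
  {H : Type*} [TopologicalSpace H] [ChartedSpace EH H] [Group H]

namespace LieCrossedModule

variable (X : LieCrossedModule EG EH G H)

/-- `t_* : 𝔥 → 𝔤`. -/
def tStar : EH →L[ℝ] EG := mfderiv 𝓘(ℝ, EH) 𝓘(ℝ, EG) X.t 1

/-- `(α_g)_* : 𝔥 → 𝔥`. -/
def αg (g : G) : EH →L[ℝ] EH := mfderiv 𝓘(ℝ, EH) 𝓘(ℝ, EH) (X.α g) 1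

/-- `α_* : 𝔤 × 𝔥 → 𝔥`, the derivative of `α` in both arguments. -/
def αStar (v : EG) (w : EH) : EH :=
  (mfderiv 𝓘(ℝ, EG) 𝓘(ℝ, EH) (fun g : G => X.αg g w) 1 : EG →L[ℝ] EH) v

end LieCrossedModule

/-- A groupoid `Arr ⇉ Obj` with a right action of the 2-group `G ⋉ H ⇉ G`, where
`(g, h) : g ⟶ t h * g`, `(g, h) (g', h') = (g g', h α_g(h'))` and
`(t h * g, h') ∘ (g, h) = (g, h' h)`.  The composition `comp b a` (first `a`, then `b`) is
meaningful only when `tgt a = src b`; its other values are irrelevant. -/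
structure GroupoidAction (X : LieCrossedModule EG EH G H) (Obj Arr : Type*) where
  src : Arr → Obj
  tgt : Arr → Obj
  ident : Obj → Arr
  inv : Arr → Arr
  comp : Arr → Arr → Arr
  src_ident : ∀ p, src (ident p) = p
  tgt_ident : ∀ p, tgt (ident p) = p
  src_comp : ∀ b a, tgt a = src b → src (comp b a) = src a
  tgt_comp : ∀ b a, tgt a = src b → tgt (comp b a) = tgt b
  comp_ident : ∀ a, comp a (ident (src a)) = a
  ident_comp : ∀ a, comp (ident (tgt a)) a = a
  comp_assoc : ∀ c b a, tgt a = src b → tgt b = src c → comp c (comp b a) = comp (comp c b) a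
  src_inv : ∀ a, src (inv a) = tgt a
  tgt_inv : ∀ a, tgt (inv a) = src a
  inv_comp : ∀ a, comp (inv a) a = ident (src a)
  comp_inv : ∀ a, comp a (inv a) = ident (tgt a)
  act₀ : Obj → G → Obj
  act₁ : Arr → G × H → Arr
  act₀_one : ∀ p, act₀ p 1 = p
  act₀_mul : ∀ p g g', act₀ (act₀ p g) g' = act₀ p (g * g')
  act₁_one : ∀ a, act₁ a (1, 1) = a
  act₁_mul : ∀ a k k', act₁ (act₁ a k) k' = act₁ a (k.1 * k'.1, k.2 * X.α k.1 k'.2)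
  src_act : ∀ a k, src (act₁ a k) = act₀ (src a) k.1
  tgt_act : ∀ a k, tgt (act₁ a k) = act₀ (tgt a) (X.t k.2 * k.1)
  ident_act : ∀ p g, ident (act₀ p g) = act₁ (ident p) (g, 1)
  comp_act : ∀ b a g h h', tgt a = src b →
    comp (act₁ b (X.t h * g, h')) (act₁ a (g, h)) = act₁ (comp b a) (g, h' * h)

/-! ### The 2-category of 2-torsors

The objects of a 2-torsor form a `G`-torsor and its arrows a `G ⋉ H`-torsor; they carry the unique
smooth structures for which the orbit maps are diffeomorphisms.  Equivariant maps are smooth for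
these, so that the smooth structures need not be recorded. -/

/-- A 2-torsor: a groupoid with a free and transitive action of the 2-group. -/
structure TwoTorsor (X : LieCrossedModule EG EH G H) where
  Obj : Type w₀
  Arr : Type w₁
  str : GroupoidAction X Obj Arr
  nonempty : Nonempty Obj
  simply₀ : ∀ p q : Obj, ∃! g : G, str.act₀ p g = q
  simply₁ : ∀ a b : Arr, ∃! k : G × H, str.act₁ a k = b

variable {X : LieCrossedModule EG EH G H}

namespace TwoTorsor

/-- The division `q : p` of objects, determined by `p · (q : p) = q`. -/
def div₀ (T : TwoTorsor X) (q p : T.Obj) : G := (T.simply₀ p q).choose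

/-- The division `b : a` of arrows, determined by `a · (b : a) = b`. -/
def div₁ (T : TwoTorsor X) (b a : T.Arr) : G × H := (T.simply₁ a b).choose

end TwoTorsor

/-- 1-morphisms of 2-torsors: equivariant functors. -/
structure TorHom (S T : TwoTorsor X) where
  obj : S.Obj → T.Obj
  arr : S.Arr → T.Arr
  map_src : ∀ a, T.str.src (arr a) = obj (S.str.src a)
  map_tgt : ∀ a, T.str.tgt (arr a) = obj (S.str.tgt a)
  map_ident : ∀ p, arr (S.str.ident p) = T.str.ident (obj p)
  map_comp : ∀ b a, S.str.tgt a = S.str.src b →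
    arr (S.str.comp b a) = T.str.comp (arr b) (arr a)
  map_act₀ : ∀ p g, obj (S.str.act₀ p g) = T.str.act₀ (obj p) g
  map_act₁ : ∀ a k, arr (S.str.act₁ a k) = T.str.act₁ (arr a) k

namespace TorHom

/-- The identity 1-morphism. -/
def id (S : TwoTorsor X) : TorHom S S where
  obj p := p
  arr a := a
  map_src _ := rfl
  map_tgt _ := rfl
  map_ident _ := rfl
  map_comp _ _ _ := rfl
  map_act₀ _ _ := rfl
  map_act₁ _ _ := rfl

/-- The composition of 1-morphisms (first `f`, then `g`). -/
def comp {S T U : TwoTorsor X} (g : TorHom T U) (f : TorHom S T) : TorHom S U where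
  obj p := g.obj (f.obj p)
  arr a := g.arr (f.arr a)
  map_src a := by rw [g.map_src, f.map_src]
  map_tgt a := by rw [g.map_tgt, f.map_tgt]
  map_ident p := by rw [f.map_ident, g.map_ident]
  map_comp b a h := by
    rw [f.map_comp b a h, g.map_comp]
    rw [f.map_tgt, f.map_src, h]
  map_act₀ p k := by rw [f.map_act₀, g.map_act₀]
  map_act₁ a k := by rw [f.map_act₁, g.map_act₁]

theorem obj_bijective {S T : TwoTorsor X} (f : TorHom S T) : Function.Bijective f.obj := by
  constructor
  · intro p q h
    obtain ⟨g, hg, -⟩ := S.simply₀ p q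
    have h1 : T.str.act₀ (f.obj p) g = f.obj p := by rw [← f.map_act₀, hg, h]
    have h2 := (T.simply₀ (f.obj p) (f.obj p)).unique h1 (T.str.act₀_one _)
    rw [← hg, h2, S.str.act₀_one]
  · intro q
    obtain ⟨p⟩ := S.nonempty
    obtain ⟨g, hg, -⟩ := T.simply₀ (f.obj p) q
    exact ⟨S.str.act₀ p g, by rw [f.map_act₀, hg]⟩

/-- The inverse of the (automatically bijective) map on objects of a 1-morphism. -/
def objInv {S T : TwoTorsor X} (f : TorHom S T) (q : T.Obj) : S.Obj :=
  (f.obj_bijective.2 q).choose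

end TorHom

/-- 2-morphisms of 2-torsors: equivariant natural transformations. -/
structure TwoMor {S T : TwoTorsor X} (f g : TorHom S T) where
  app : S.Obj → T.Arr
  src_app : ∀ p, T.str.src (app p) = f.obj p
  tgt_app : ∀ p, T.str.tgt (app p) = g.obj p
  naturality : ∀ a, T.str.comp (app (S.str.tgt a)) (f.arr a)
    = T.str.comp (g.arr a) (app (S.str.src a))
  equivariant : ∀ p k, app (S.str.act₀ p k) = T.str.act₁ (app p) (k, 1)

/-- The `H`-valued function `η_H` with `η(p) : id_{f(p)} = (1, η_H(p))` of a 2-morphism `η`. -/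
def TwoMor.hol {S T : TwoTorsor X} {f g : TorHom S T} (η : TwoMor f g) (p : S.Obj) : H :=
  (T.div₁ (η.app p) (T.str.ident (f.obj p))).2

end

/-! ### Paths, bigons and thin homotopies

Paths and bigons have sitting instants, so that they extend by constants to the whole line and to
the whole plane. -/

section Paths

variable {EM : Type*} [NormedAddCommGroup EM] [NormedSpace ℝ EM]
  {M : Type*} [TopologicalSpace M] [ChartedSpace EM M]

/-- Smooth paths with sitting instants. -/
structure SmoothPath (EM : Type*) [NormedAddCommGroup EM] [NormedSpace ℝ EM]
    {M : Type*} [TopologicalSpace M] [ChartedSpace EM M] (x y : M) where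
  toFun : ℝ → M
  smooth : ContMDiff 𝓘(ℝ, ℝ) 𝓘(ℝ, EM) ∞ toFun
  sitting : ∃ ε > 0, (∀ t ≤ ε, toFun t = x) ∧ ∀ t ≥ 1 - ε, toFun t = y

/-- Bigons `γ₀ ⇒ γ₁`; the first variable parametrizes the homotopy and the second the paths. -/
structure Bigon {x y : M} (γ₀ γ₁ : SmoothPath EM x y) where
  toFun : ℝ × ℝ → M
  smooth : ContMDiff 𝓘(ℝ, ℝ × ℝ) 𝓘(ℝ, EM) ∞ toFun
  sitting : ∃ ε > 0, (∀ s, ∀ t ≤ ε, toFun (s, t) = x) ∧ (∀ s, ∀ t ≥ 1 - ε, toFun (s, t) = y) ∧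
    (∀ s ≤ ε, ∀ t, toFun (s, t) = γ₀.toFun t) ∧ ∀ s ≥ 1 - ε, ∀ t, toFun (s, t) = γ₁.toFun t

/-- Two paths are thinly homotopic if there is a bigon between them of rank at most one. -/
def ThinPath {x y : M} (γ₀ γ₁ : SmoothPath EM x y) : Prop :=
  ∃ S : Bigon γ₀ γ₁, RankLE EM 1 S.toFun

/-- Two bigons are thinly homotopic if there is a homotopy of bigons between them of rank at most
two, along which the source and target paths undergo thin homotopies.  -/
def ThinBigon {x y : M} {γ₀ γ₁ γ₀' γ₁' : SmoothPath EM x y}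
    (S : Bigon γ₀ γ₁) (S' : Bigon γ₀' γ₁') : Prop :=
  ∃ h : ℝ × ℝ × ℝ → M, ContMDiff 𝓘(ℝ, ℝ × ℝ × ℝ) 𝓘(ℝ, EM) ∞ h ∧ RankLE EM 2 h ∧
    (∃ ε > 0,
      (∀ r ≤ ε, ∀ s t, h (r, s, t) = S.toFun (s, t)) ∧
      (∀ r ≥ 1 - ε, ∀ s t, h (r, s, t) = S'.toFun (s, t)) ∧
      (∀ r, ∀ s ≤ ε, ∀ t, h (r, s, t) = h (r, 0, t)) ∧
      (∀ r, ∀ s ≥ 1 - ε, ∀ t, h (r, s, t) = h (r, 1, t)) ∧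
      (∀ r s, ∀ t ≤ ε, h (r, s, t) = x) ∧
      (∀ r s, ∀ t ≥ 1 - ε, h (r, s, t) = y)) ∧
    RankLE EM 1 (fun z : ℝ × ℝ => h (z.1, 0, z.2)) ∧
    RankLE EM 1 (fun z : ℝ × ℝ => h (z.1, 1, z.2))

theorem contMDiff_glue {W : Type*} [NormedAddCommGroup W] [NormedSpace ℝ W] {f g : W → M}
    {τ : W → ℝ} (hτ : Continuous τ) (hf : ContMDiff 𝓘(ℝ, W) 𝓘(ℝ, EM) ∞ f)
    (hg : ContMDiff 𝓘(ℝ, W) 𝓘(ℝ, EM) ∞ g) {δ : ℝ} (hδ : 0 < δ)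
    (hfg : ∀ z, 1 / 2 ≤ τ z → τ z ≤ 1 / 2 + δ → f z = g z) :
    ContMDiff 𝓘(ℝ, W) 𝓘(ℝ, EM) ∞ (fun z => if τ z ≤ 1 / 2 then f z else g z) := by
  intro z
  rcases lt_or_ge (τ z) (1 / 2 + δ) with h | h
  · refine (hf z).congr_of_eventuallyEq ?_
    filter_upwards [hτ.continuousAt.eventually_lt continuousAt_const h] with w hw
    by_cases hw' : τ w ≤ 1 / 2
    · rw [if_pos hw']
    · rw [if_neg hw', hfg w (le_of_lt (not_le.1 hw')) hw.le]
  · refine (hg z).congr_of_eventuallyEq ?_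
    have h' : 1 / 2 < τ z := by linarith
    filter_upwards [continuousAt_const.eventually_lt hτ.continuousAt h'] with w hw
    rw [if_neg (not_le.2 hw)]

theorem smoothTransition_smooth : ContDiff ℝ ∞ Real.smoothTransition :=
  Real.smoothTransition.contDiff (n := ⊤)

namespace SmoothPath

/-- The constant path. -/
def const (x : M) : SmoothPath EM x x where
  toFun _ := x
  smooth := contMDiff_const
  sitting := ⟨1, one_pos, fun _ _ => rfl, fun _ _ => rfl⟩

/-- The concatenation: first `γ`, then `δ`. -/
def concat {x y z : M} (γ : SmoothPath EM x y) (δ : SmoothPath EM y z) : SmoothPath EM x z where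
  toFun t := if t ≤ 1 / 2 then γ.toFun (2 * t) else δ.toFun (2 * t - 1)
  smooth := by
    obtain ⟨ε, hε, -, h1⟩ := γ.sitting
    obtain ⟨ε', hε', h0, -⟩ := δ.sitting
    refine contMDiff_glue (τ := fun t => t) continuous_id
      (f := fun t => γ.toFun (2 * t)) (g := fun t => δ.toFun (2 * t - 1)) ?_ ?_
      (δ := ε' / 2) (by positivity) ?_
    · exact γ.smooth.comp (ContDiff.contMDiff (by fun_prop))
    · exact δ.smooth.comp (ContDiff.contMDiff (by fun_prop))
    · intro t ht ht'
      rw [h1 _ (by linarith), h0 _ (by linarith)]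
  sitting := by
    obtain ⟨ε, hε, h0, h1⟩ := γ.sitting
    obtain ⟨ε', hε', h0', h1'⟩ := δ.sitting
    refine ⟨min (1 / 4) (min (ε / 2) (ε' / 2)), by positivity, fun t ht => ?_, fun t ht => ?_⟩
    · have a1 := ht.trans (min_le_left _ _)
      have a2 := ht.trans ((min_le_right _ _).trans (min_le_left _ _))
      rw [if_pos (by linarith), h0 _ (by linarith)]
    · have a1 := min_le_left (1 / 4) (min (ε / 2) (ε' / 2))
      have a2 := (min_le_right (1 / 4) (min (ε / 2) (ε' / 2))).trans (min_le_right _ _)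
      rw [if_neg (by linarith), h1' _ (by linarith)]

/-- The path from `c 0` to `c t` along the curve `c`, reparametrized to have sitting instants. -/
def along (c : ℝ → M) (hc : ContMDiff 𝓘(ℝ, ℝ) 𝓘(ℝ, EM) ∞ c) (t : ℝ) :
    SmoothPath EM (c 0) (c t) where
  toFun s := c (t * Real.smoothTransition (3 * s - 1))
  smooth := by
    have := smoothTransition_smooth
    exact hc.comp (ContDiff.contMDiff (by fun_prop))
  sitting := by
    refine ⟨1 / 4, by norm_num, fun s hs => ?_, fun s hs => ?_⟩
    · rw [Real.smoothTransition.zero_of_nonpos (by linarith), mul_zero]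
    · rw [Real.smoothTransition.one_of_one_le (by linarith), mul_one]

end SmoothPath

namespace Bigon

/-- The identity bigon. -/
def refl {x y : M} (γ : SmoothPath EM x y) : Bigon γ γ where
  toFun z := γ.toFun z.2
  smooth := γ.smooth.comp (ContDiff.contMDiff (by fun_prop))
  sitting := by
    obtain ⟨ε, hε, h0, h1⟩ := γ.sitting
    exact ⟨ε, hε, fun _ => h0, fun _ => h1, fun _ _ _ => rfl, fun _ _ _ => rfl⟩

/-- Vertical composition: first `S`, then `T`. -/
def vcomp {x y : M} {γ₀ γ₁ γ₂ : SmoothPath EM x y} (S : Bigon γ₀ γ₁) (T : Bigon γ₁ γ₂) :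
    Bigon γ₀ γ₂ where
  toFun z := if z.1 ≤ 1 / 2 then S.toFun (2 * z.1, z.2) else T.toFun (2 * z.1 - 1, z.2)
  smooth := by
    obtain ⟨ε, hε, -, -, -, h1⟩ := S.sitting
    obtain ⟨ε', hε', -, -, h0, -⟩ := T.sitting
    refine contMDiff_glue (τ := fun z : ℝ × ℝ => z.1) continuous_fst
      (f := fun z : ℝ × ℝ => S.toFun (2 * z.1, z.2))
      (g := fun z : ℝ × ℝ => T.toFun (2 * z.1 - 1, z.2)) ?_ ?_ (δ := ε' / 2) (by positivity) ?_
    · exact S.smooth.comp (ContDiff.contMDiff (by fun_prop))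
    · exact T.smooth.comp (ContDiff.contMDiff (by fun_prop))
    · intro z hz hz'
      rw [h1 _ (by linarith), h0 _ (by linarith)]
  sitting := by
    obtain ⟨ε, hε, a0, a1, a2, a3⟩ := S.sitting
    obtain ⟨ε', hε', b0, b1, b2, b3⟩ := T.sitting
    have m1 := min_le_left (1 / 4) (min (ε / 2) (ε' / 2))
    have m2 := (min_le_right (1 / 4) (min (ε / 2) (ε' / 2))).trans (min_le_left _ _)
    have m3 := (min_le_right (1 / 4) (min (ε / 2) (ε' / 2))).trans (min_le_right _ _)
    refine ⟨min (1 / 4) (min (ε / 2) (ε' / 2)), by positivity, ?_, ?_, ?_, ?_⟩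
    · intro s t ht
      rw [a0 _ t (by linarith), b0 _ t (by linarith), ite_self]
    · intro s t ht
      rw [a1 _ t (by linarith), b1 _ t (by linarith), ite_self]
    · intro s hs t
      simp only
      rw [if_pos (by linarith), a2 _ (by linarith)]
    · intro s hs t
      simp only
      rw [if_neg (by linarith), b3 _ (by linarith)]

/-- Horizontal composition: first `S`, then `T`. -/
def hcomp {x y z : M} {γ₀ γ₁ : SmoothPath EM x y} {δ₀ δ₁ : SmoothPath EM y z}
    (S : Bigon γ₀ γ₁) (T : Bigon δ₀ δ₁) : Bigon (γ₀.concat δ₀) (γ₁.concat δ₁) where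
  toFun z := if z.2 ≤ 1 / 2 then S.toFun (z.1, 2 * z.2) else T.toFun (z.1, 2 * z.2 - 1)
  smooth := by
    obtain ⟨ε, hε, -, h1, -⟩ := S.sitting
    obtain ⟨ε', hε', h0, -⟩ := T.sitting
    refine contMDiff_glue (τ := fun z : ℝ × ℝ => z.2) continuous_snd
      (f := fun z : ℝ × ℝ => S.toFun (z.1, 2 * z.2))
      (g := fun z : ℝ × ℝ => T.toFun (z.1, 2 * z.2 - 1)) ?_ ?_ (δ := ε' / 2) (by positivity) ?_
    · exact S.smooth.comp (ContDiff.contMDiff (by fun_prop))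
    · exact T.smooth.comp (ContDiff.contMDiff (by fun_prop))
    · intro z hz hz'
      rw [h1 _ _ (by linarith), h0 _ _ (by linarith)]
  sitting := by
    obtain ⟨ε, hε, a0, a1, a2, a3⟩ := S.sitting
    obtain ⟨ε', hε', b0, b1, b2, b3⟩ := T.sitting
    have m1 := min_le_left (1 / 4) (min (ε / 2) (ε' / 2))
    have m2 := (min_le_right (1 / 4) (min (ε / 2) (ε' / 2))).trans (min_le_left _ _)
    have m3 := (min_le_right (1 / 4) (min (ε / 2) (ε' / 2))).trans (min_le_right _ _)
    refine ⟨min (1 / 4) (min (ε / 2) (ε' / 2)), by positivity, ?_, ?_, ?_, ?_⟩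
    · intro s t ht
      simp only
      rw [if_pos (by linarith), a0 _ _ (by linarith)]
    · intro s t ht
      simp only
      rw [if_neg (by linarith), b1 _ _ (by linarith)]
    · intro s hs t
      simp only [SmoothPath.concat]
      rw [a2 _ (by linarith), b2 _ (by linarith)]
    · intro s hs t
      simp only [SmoothPath.concat]
      rw [a3 _ (by linarith), b3 _ (by linarith)]

end Bigon

/-! ### The canonical bigons

For a rectangle with corners `(0,0)` and `(s,t)`, the canonical bigon deforms the path
`(0,0) ⟶ (0,t) ⟶ (s,t)` (along the west and the north side) into the path
`(0,0) ⟶ (s,0) ⟶ (s,t)` (along the south and the east side).  We use its horizontal inverse, in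
which all paths are run backwards, from `(s,t)` to `(0,0)`. -/

/-- The function running from `0` to `1` during the first half of a path. -/
def firstHalf (v : ℝ) : ℝ := Real.smoothTransition (4 * v - 1)

/-- The function running from `0` to `1` during the second half of a path. -/
def secondHalf (v : ℝ) : ℝ := Real.smoothTransition (4 * v - 2)

/-- The interpolation `Γ(s,t)` between the path along west and north (`c = 0`) and the path along
south and east (`c = 1`). -/
def rectangle (s t c v : ℝ) : ℝ × ℝ :=
  (s * ((1 - c) * secondHalf v + c * firstHalf v),
    t * ((1 - c) * firstHalf v + c * secondHalf v))

theorem rectangle_zero (s t c : ℝ) {v : ℝ} (hv : v ≤ 1 / 4) : rectangle s t c v = (0, 0) := by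
  have h1 : firstHalf v = 0 := Real.smoothTransition.zero_of_nonpos (by linarith)
  have h2 : secondHalf v = 0 := Real.smoothTransition.zero_of_nonpos (by linarith)
  simp [rectangle, h1, h2]

theorem rectangle_one (s t c : ℝ) {v : ℝ} (hv : 3 / 4 ≤ v) : rectangle s t c v = (s, t) := by
  have h1 : firstHalf v = 1 := Real.smoothTransition.one_of_one_le (by linarith)
  have h2 : secondHalf v = 1 := Real.smoothTransition.one_of_one_le (by linarith)
  simp [rectangle, h1, h2]

theorem rectangle_smooth (s t : ℝ) :
    ContDiff ℝ ∞ (fun z : ℝ × ℝ => rectangle s t z.1 z.2) := by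
  have := smoothTransition_smooth
  unfold rectangle firstHalf secondHalf
  fun_prop

/-- The `S`-image of the reversed boundary path of the rectangle: along north and west for `c = 0`
and along east and south for `c = 1`. -/
def backPath (S : ℝ × ℝ → M) (hS : ContMDiff 𝓘(ℝ, ℝ × ℝ) 𝓘(ℝ, EM) ∞ S) (s t c : ℝ) :
    SmoothPath EM (S (s, t)) (S (0, 0)) where
  toFun v := S (rectangle s t c (1 - v))
  smooth := by
    have h : ContDiff ℝ ∞ (fun v : ℝ => (c, 1 - v)) := by fun_prop
    exact hS.comp ((rectangle_smooth s t).comp h).contMDiff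
  sitting := ⟨1 / 4, by norm_num, fun v hv => by rw [rectangle_one _ _ _ (by linarith)],
    fun v hv => by rw [rectangle_zero _ _ _ (by linarith)]⟩

/-- The `S`-image of the horizontal inverse of the canonical bigon `Γ(s,t)`. -/
def backBigon (S : ℝ × ℝ → M) (hS : ContMDiff 𝓘(ℝ, ℝ × ℝ) 𝓘(ℝ, EM) ∞ S) (s t : ℝ) :
    Bigon (backPath S hS s t 0) (backPath S hS s t 1) where
  toFun z := S (rectangle s t (Real.smoothTransition (3 * z.1 - 1)) (1 - z.2))
  smooth := by
    have := smoothTransition_smooth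
    have h : ContDiff ℝ ∞
        (fun z : ℝ × ℝ => (Real.smoothTransition (3 * z.1 - 1), 1 - z.2)) := by fun_prop
    exact hS.comp ((rectangle_smooth s t).comp h).contMDiff
  sitting := by
    refine ⟨1 / 4, by norm_num, ?_, ?_, ?_, ?_⟩
    · intro u v hv
      rw [rectangle_one _ _ _ (by linarith)]
    · intro u v hv
      rw [rectangle_zero _ _ _ (by linarith)]
    · intro u hu v
      simp only [backPath]
      rw [Real.smoothTransition.zero_of_nonpos (by linarith)]
    · intro u hu v
      simp only [backPath]
      rw [Real.smoothTransition.one_of_one_le (by linarith)]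

end Paths

section Main

variable {EM : Type*} [NormedAddCommGroup EM] [NormedSpace ℝ EM]
  {M : Type*} [TopologicalSpace M] [ChartedSpace EM M]
  {EG : Type*} [NormedAddCommGroup EG] [NormedSpace ℝ EG]
  {EH : Type*} [NormedAddCommGroup EH] [NormedSpace ℝ EH]
  {G : Type*} [TopologicalSpace G] [ChartedSpace EG G] [Group G]
  {H : Type*} [TopologicalSpace H] [ChartedSpace EH H] [Group H]
  {X : LieCrossedModule EG EH G H}

/-! ### Transport 2-functors and their 1-morphisms -/

/-- A transport 2-functor: a strict 2-functor from the thin fundamental 2-groupoid of `M` to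
2-torsors, subject to smoothness conditions.  It is presented by its values on representatives:
values on paths and bigons depend only on thin homotopy classes, and all compositions and
identities are preserved. -/
structure TransportTwoFunctor (X : LieCrossedModule EG EH G H)
    (EM : Type*) [NormedAddCommGroup EM] [NormedSpace ℝ EM]
    (M : Type*) [TopologicalSpace M] [ChartedSpace EM M] where
  obj : M → TwoTorsor.{w₀, w₁} X
  map : ∀ {x y : M}, SmoothPath EM x y → TorHom (obj x) (obj y)
  map₂ : ∀ {x y : M} {γ γ' : SmoothPath EM x y}, Bigon γ γ' → TwoMor (map γ) (map γ')
  map_thin : ∀ {x y : M} (γ γ' : SmoothPath EM x y), ThinPath γ γ' → map γ = map γ'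
  map₂_thin : ∀ {x y : M} {γ₀ γ₁ γ₀' γ₁' : SmoothPath EM x y} (S : Bigon γ₀ γ₁)
    (S' : Bigon γ₀' γ₁'), ThinBigon S S' → (map₂ S).app = (map₂ S').app
  map_const : ∀ x : M, map (SmoothPath.const x) = TorHom.id (obj x)
  map_concat : ∀ {x y z : M} (γ : SmoothPath EM x y) (δ : SmoothPath EM y z),
    map (γ.concat δ) = (map δ).comp (map γ)
  map₂_refl : ∀ {x y : M} (γ : SmoothPath EM x y) (p : (obj x).Obj),
    (map₂ (Bigon.refl γ)).app p = (obj y).str.ident ((map γ).obj p)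
  map₂_vcomp : ∀ {x y : M} {γ₀ γ₁ γ₂ : SmoothPath EM x y} (S : Bigon γ₀ γ₁) (T : Bigon γ₁ γ₂)
    (p : (obj x).Obj),
    (map₂ (S.vcomp T)).app p = (obj y).str.comp ((map₂ T).app p) ((map₂ S).app p)
  map₂_hcomp : ∀ {x y z : M} {γ₀ γ₁ : SmoothPath EM x y} {δ₀ δ₁ : SmoothPath EM y z}
    (S : Bigon γ₀ γ₁) (T : Bigon δ₀ δ₁) (p : (obj x).Obj),
    (map₂ (S.hcomp T)).app p =
      (obj z).str.comp ((map₂ T).app ((map γ₁).obj p)) ((map δ₀).arr ((map₂ S).app p))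
  /-- The map from loops at `x` to the automorphisms of the value at `x`, which are identified
  with `G` by means of `p`, is smooth. -/
  smooth_loops : ∀ (x : M) (p : (obj x).Obj) (k : ℕ) (c : Param k → SmoothPath EM x x),
    ContMDiff 𝓘(ℝ, Param k × ℝ) 𝓘(ℝ, EM) ∞ (fun z : Param k × ℝ => (c z.1).toFun z.2) →
    ContMDiff 𝓘(ℝ, Param k) 𝓘(ℝ, EG) ∞ (fun u => (obj x).div₀ ((map (c u)).obj p) p)
  /-- The map from bigons between paths from `x` to `y` to `H`, with the identification of
  2-morphisms with elements of `H` given by `p`, is smooth. -/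
  smooth_bigons : ∀ (x y : M) (p : (obj x).Obj) (k : ℕ) (γ γ' : Param k → SmoothPath EM x y)
    (S : ∀ u, Bigon (γ u) (γ' u)),
    ContMDiff 𝓘(ℝ, Param k × ℝ × ℝ) 𝓘(ℝ, EM) ∞
      (fun z : Param k × ℝ × ℝ => (S z.1).toFun z.2) →
    ContMDiff 𝓘(ℝ, Param k) 𝓘(ℝ, EH) ∞ (fun u => (map₂ (S u)).hol p)

/-- A pseudonatural transformation of transport 2-functors: 1-morphisms `obj x`, and for each thin
homotopy class of paths `γ` from `x` to `y` a 2-morphism `map γ` from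
`(obj y) ∘ 𝓕(γ)` to `𝓕'(γ) ∘ (obj x)`, compatible with composition of paths and with bigons. -/
structure PseudoNat (𝓕 𝓕' : TransportTwoFunctor X EM M) where
  obj : ∀ x : M, TorHom (𝓕.obj x) (𝓕'.obj x)
  map : ∀ {x y : M} (γ : SmoothPath EM x y),
    TwoMor ((obj y).comp (𝓕.map γ)) ((𝓕'.map γ).comp (obj x))
  map_thin : ∀ {x y : M} (γ γ' : SmoothPath EM x y), ThinPath γ γ' → (map γ).app = (map γ').app
  map_concat : ∀ {x y z : M} (γ : SmoothPath EM x y) (δ : SmoothPath EM y z) (p : (𝓕.obj x).Obj),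
    (map (γ.concat δ)).app p = (𝓕'.obj z).str.comp ((𝓕'.map δ).arr ((map γ).app p))
      ((map δ).app ((𝓕.map γ).obj p))
  map_bigon : ∀ {x y : M} {γ γ' : SmoothPath EM x y} (S : Bigon γ γ') (p : (𝓕.obj x).Obj),
    (𝓕'.obj y).str.comp ((𝓕'.map₂ S).app ((obj x).obj p)) ((map γ).app p) =
      (𝓕'.obj y).str.comp ((map γ').app p) ((obj y).arr ((𝓕.map₂ S).app p))

/-! ### Principal 2-bundles with 2-connection -/

/-- A principal 2-bundle over `M`: a Lie groupoid `P₁ ⇉ P₀` with a smooth action of the 2-group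
and an invariant surjective submersion functor to `M ⇉ M`, for which the map
`(p, g) ↦ (p, p · g)` is an isomorphism onto the fibre product.  Smoothness on fibre products is
tested on smooth families. -/
structure PrincipalTwoBundle (X : LieCrossedModule EG EH G H)
    (EM : Type*) [NormedAddCommGroup EM] [NormedSpace ℝ EM]
    (M : Type*) [TopologicalSpace M] [ChartedSpace EM M] where
  P₀ : Type w₀
  P₁ : Type w₁
  [topology₀ : TopologicalSpace P₀]
  [charts₀ : ChartedSpace (EM × EG) P₀]
  [manifold₀ : IsManifold 𝓘(ℝ, EM × EG) ∞ P₀]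
  [hausdorff₀ : T2Space P₀]
  [topology₁ : TopologicalSpace P₁]
  [charts₁ : ChartedSpace (EM × EG × EH) P₁]
  [manifold₁ : IsManifold 𝓘(ℝ, EM × EG × EH) ∞ P₁]
  [hausdorff₁ : T2Space P₁]
  str : GroupoidAction X P₀ P₁
  /-- The projection on objects; on arrows it is `proj ∘ src = proj ∘ tgt`. -/
  proj : P₀ → M
  smooth_src : ContMDiff 𝓘(ℝ, EM × EG × EH) 𝓘(ℝ, EM × EG) ∞ str.src
  submersion_src : Manifold.IsSubmersion 𝓘(ℝ, EM × EG × EH) 𝓘(ℝ, EM × EG) ∞ str.src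
  smooth_tgt : ContMDiff 𝓘(ℝ, EM × EG × EH) 𝓘(ℝ, EM × EG) ∞ str.tgt
  smooth_ident : ContMDiff 𝓘(ℝ, EM × EG) 𝓘(ℝ, EM × EG × EH) ∞ str.ident
  smooth_inv : ContMDiff 𝓘(ℝ, EM × EG × EH) 𝓘(ℝ, EM × EG × EH) ∞ str.inv
  smooth_comp : ∀ (k : ℕ) (b a : Param k → P₁), (∀ u, str.tgt (a u) = str.src (b u)) →
    ContMDiff 𝓘(ℝ, Param k) 𝓘(ℝ, EM × EG × EH) ∞ b →
    ContMDiff 𝓘(ℝ, Param k) 𝓘(ℝ, EM × EG × EH) ∞ a →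
    ContMDiff 𝓘(ℝ, Param k) 𝓘(ℝ, EM × EG × EH) ∞ (fun u => str.comp (b u) (a u))
  smooth_act₀ : ContMDiff (𝓘(ℝ, EM × EG).prod 𝓘(ℝ, EG)) 𝓘(ℝ, EM × EG) ∞
    (fun z : P₀ × G => str.act₀ z.1 z.2)
  smooth_act₁ : ContMDiff (𝓘(ℝ, EM × EG × EH).prod (𝓘(ℝ, EG).prod 𝓘(ℝ, EH)))
    𝓘(ℝ, EM × EG × EH) ∞ (fun z : P₁ × (G × H) => str.act₁ z.1 z.2)
  smooth_proj : ContMDiff 𝓘(ℝ, EM × EG) 𝓘(ℝ, EM) ∞ proj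
  surjective_proj : Function.Surjective proj
  submersion_proj : Manifold.IsSubmersion 𝓘(ℝ, EM × EG) 𝓘(ℝ, EM) ∞ proj
  submersion_proj₁ : Manifold.IsSubmersion 𝓘(ℝ, EM × EG × EH) 𝓘(ℝ, EM) ∞
    (fun a => proj (str.src a))
  proj_arr : ∀ a, proj (str.tgt a) = proj (str.src a)
  proj_act : ∀ p g, proj (str.act₀ p g) = proj p
  simply₀ : ∀ p q : P₀, proj p = proj q → ∃! g : G, str.act₀ p g = q
  simply₁ : ∀ a b : P₁, proj (str.src a) = proj (str.src b) → ∃! k : G × H, str.act₁ a k = b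
  smooth_div₀ : ∀ (k : ℕ) (p : Param k → P₀) (g : Param k → G),
    ContMDiff 𝓘(ℝ, Param k) 𝓘(ℝ, EM × EG) ∞ p →
    ContMDiff 𝓘(ℝ, Param k) 𝓘(ℝ, EM × EG) ∞ (fun u => str.act₀ (p u) (g u)) →
    ContMDiff 𝓘(ℝ, Param k) 𝓘(ℝ, EG) ∞ g
  smooth_div₁ : ∀ (k : ℕ) (a : Param k → P₁) (g : Param k → G × H),
    ContMDiff 𝓘(ℝ, Param k) 𝓘(ℝ, EM × EG × EH) ∞ a →
    ContMDiff 𝓘(ℝ, Param k) 𝓘(ℝ, EM × EG × EH) ∞ (fun u => str.act₁ (a u) (g u)) →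
    ContMDiff 𝓘(ℝ, Param k) (𝓘(ℝ, EG).prod 𝓘(ℝ, EH)) ∞ g

attribute [instance] PrincipalTwoBundle.topology₀ PrincipalTwoBundle.charts₀
  PrincipalTwoBundle.manifold₀ PrincipalTwoBundle.hausdorff₀ PrincipalTwoBundle.topology₁
  PrincipalTwoBundle.charts₁ PrincipalTwoBundle.manifold₁ PrincipalTwoBundle.hausdorff₁

namespace PrincipalTwoBundle

variable (P : PrincipalTwoBundle X EM M)

/-- Tangent vectors of `P₀`. -/
abbrev Tangent (p : P.P₀) : Type _ := TangentSpace 𝓘(ℝ, EM × EG) p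

/-- The composition of arrows in a fibre. -/
def fiberComp {x : M} (b a : {a : P.P₁ // P.proj (P.str.src a) = x}) :
    {a : P.P₁ // P.proj (P.str.src a) = x} :=
  open Classical in
  if h : P.str.tgt a.1 = P.str.src b.1 then
    ⟨P.str.comp b.1 a.1, by rw [P.str.src_comp _ _ h, a.2]⟩
  else a

theorem fiberComp_val {x : M} (b a : {a : P.P₁ // P.proj (P.str.src a) = x})
    (h : P.str.tgt a.1 = P.str.src b.1) : (P.fiberComp b a).1 = P.str.comp b.1 a.1 := by
  rw [fiberComp, dif_pos h]

/-- The groupoid with action given by the fibre of a principal 2-bundle. -/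
def fiberAction (x : M) : GroupoidAction X {p : P.P₀ // P.proj p = x}
    {a : P.P₁ // P.proj (P.str.src a) = x} where
  src a := ⟨P.str.src a.1, a.2⟩
  tgt a := ⟨P.str.tgt a.1, (P.proj_arr _).trans a.2⟩
  ident p := ⟨P.str.ident p.1, by rw [P.str.src_ident, p.2]⟩
  inv a := ⟨P.str.inv a.1, by rw [P.str.src_inv, P.proj_arr, a.2]⟩
  comp b a := P.fiberComp b a
  src_ident p := Subtype.ext (P.str.src_ident _)
  tgt_ident p := Subtype.ext (P.str.tgt_ident _)
  src_comp b a h := Subtype.ext (by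
    have h' : P.str.tgt a.1 = P.str.src b.1 := congrArg Subtype.val h
    exact (congrArg P.str.src (P.fiberComp_val b a h')).trans (P.str.src_comp _ _ h'))
  tgt_comp b a h := Subtype.ext (by
    have h' : P.str.tgt a.1 = P.str.src b.1 := congrArg Subtype.val h
    exact (congrArg P.str.tgt (P.fiberComp_val b a h')).trans (P.str.tgt_comp _ _ h'))
  comp_ident a := Subtype.ext
    ((P.fiberComp_val _ _ (P.str.tgt_ident _)).trans (P.str.comp_ident _))
  ident_comp a := Subtype.ext
    ((P.fiberComp_val _ _ (P.str.src_ident _).symm).trans (P.str.ident_comp _))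
  comp_assoc c b a h1 h2 := Subtype.ext (by
    have h1' : P.str.tgt a.1 = P.str.src b.1 := congrArg Subtype.val h1
    have h2' : P.str.tgt b.1 = P.str.src c.1 := congrArg Subtype.val h2
    have e1 := P.fiberComp_val b a h1'
    have e2 := P.fiberComp_val c b h2'
    have e3 := P.fiberComp_val c (P.fiberComp b a)
      ((congrArg P.str.tgt e1).trans ((P.str.tgt_comp _ _ h1').trans h2'))
    have e4 := P.fiberComp_val (P.fiberComp c b) a
      (h1'.trans ((congrArg P.str.src e2).trans (P.str.src_comp _ _ h2')).symm)
    refine (e3.trans ?_).trans e4.symm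
    rw [e1, e2]
    exact P.str.comp_assoc _ _ _ h1' h2')
  src_inv a := Subtype.ext (P.str.src_inv _)
  tgt_inv a := Subtype.ext (P.str.tgt_inv _)
  inv_comp a := Subtype.ext
    ((P.fiberComp_val _ _ (P.str.src_inv _).symm).trans (P.str.inv_comp _))
  comp_inv a := Subtype.ext
    ((P.fiberComp_val _ _ (P.str.tgt_inv _)).trans (P.str.comp_inv _))
  act₀ p g := ⟨P.str.act₀ p.1 g, by rw [P.proj_act, p.2]⟩
  act₁ a k := ⟨P.str.act₁ a.1 k, by rw [P.str.src_act, P.proj_act, a.2]⟩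
  act₀_one p := Subtype.ext (P.str.act₀_one _)
  act₀_mul p g g' := Subtype.ext (P.str.act₀_mul _ _ _)
  act₁_one a := Subtype.ext (P.str.act₁_one _)
  act₁_mul a k k' := Subtype.ext (P.str.act₁_mul _ _ _)
  src_act a k := Subtype.ext (P.str.src_act _ _)
  tgt_act a k := Subtype.ext (P.str.tgt_act _ _)
  ident_act p g := Subtype.ext (P.str.ident_act _ _)
  comp_act b a g h h' hab := Subtype.ext (by
    have hab' : P.str.tgt a.1 = P.str.src b.1 := congrArg Subtype.val hab
    refine (P.fiberComp_val _ _ ?_).trans ((P.str.comp_act _ _ g h h' hab').trans ?_)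
    · exact (P.str.tgt_act _ _).trans ((congrArg (fun q => P.str.act₀ q _) hab').trans
        (P.str.src_act b.1 (X.t h * g, h')).symm)
    · exact congrArg (fun c => P.str.act₁ c _) (P.fiberComp_val b a hab').symm)

/-- The fibre of a principal 2-bundle, as a 2-torsor. -/
def fiber (x : M) : TwoTorsor X where
  Obj := {p : P.P₀ // P.proj p = x}
  Arr := {a : P.P₁ // P.proj (P.str.src a) = x}
  str := P.fiberAction x
  nonempty := (P.surjective_proj x).elim fun p hp => ⟨⟨p, hp⟩⟩
  simply₀ p q := by
    obtain ⟨g, hg, hu⟩ := P.simply₀ p.1 q.1 (p.2.trans q.2.symm)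
    exact ⟨g, Subtype.ext hg, fun g' hg' => hu g' (congrArg Subtype.val hg')⟩
  simply₁ a b := by
    obtain ⟨k, hk, hu⟩ := P.simply₁ a.1 b.1 (a.2.trans b.2.symm)
    exact ⟨k, Subtype.ext hk, fun k' hk' => hu k' (congrArg Subtype.val hk')⟩

/-- The fundamental vector field at `p` of `v ∈ 𝔤`. -/
def fundamental (p : P.P₀) (v : EG) : P.Tangent p :=
  (mfderiv 𝓘(ℝ, EG) 𝓘(ℝ, EM × EG) (fun g : G => P.str.act₀ p g) 1 : EG →L[ℝ] EM × EG) v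

/-- The differential of the right translation `R_g` at `p`. -/
def dR (g : G) (p : P.P₀) : P.Tangent p →L[ℝ] P.Tangent (P.str.act₀ p g) :=
  mfderiv 𝓘(ℝ, EM × EG) 𝓘(ℝ, EM × EG) (fun q : P.P₀ => P.str.act₀ q g) p

end PrincipalTwoBundle

/-- A 2-connection `(A, B)` on a principal 2-bundle. -/
structure TwoConnection (P : PrincipalTwoBundle X EM M) where
  A : OneForm (EM × EG) P.P₀ EG
  B : TwoForm (EM × EG) P.P₀ EH
  smooth_A : OneForm.IsSmooth A
  smooth_B : TwoForm.IsSmooth B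
  A_fundamental : ∀ (p : P.P₀) (v : EG), A p (P.fundamental p v) = v
  A_equivariant : ∀ (g : G) (p : P.P₀) (v : P.Tangent p),
    A (P.str.act₀ p g) (P.dR g p v) = Ad g⁻¹ (A p v)
  B_horizontal : ∀ (p : P.P₀) (v : EG) (w : P.Tangent p), B p ![P.fundamental p v, w] = 0
  B_equivariant : ∀ (g : G) (p : P.P₀) (v w : P.Tangent p),
    B (P.str.act₀ p g) ![P.dR g p v, P.dR g p w] = X.αg g⁻¹ (B p ![v, w])
  /-- `t_* B = F_A = dA + ½ [A ∧ A]` -/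
  fake_flat : ∀ (p : P.P₀) (v w : P.Tangent p),
    X.tStar (B p ![v, w]) = OneForm.d A p v w + lieBr G (A p v) (A p w)

/-- A morphism of principal 2-bundles: a smooth equivariant functor over the identity of `M`. -/
structure TwoBundleMap (P P' : PrincipalTwoBundle X EM M) where
  obj : P.P₀ → P'.P₀
  arr : P.P₁ → P'.P₁
  smooth_obj : ContMDiff 𝓘(ℝ, EM × EG) 𝓘(ℝ, EM × EG) ∞ obj
  smooth_arr : ContMDiff 𝓘(ℝ, EM × EG × EH) 𝓘(ℝ, EM × EG × EH) ∞ arr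
  map_proj : ∀ p, P'.proj (obj p) = P.proj p
  map_src : ∀ a, P'.str.src (arr a) = obj (P.str.src a)
  map_tgt : ∀ a, P'.str.tgt (arr a) = obj (P.str.tgt a)
  map_ident : ∀ p, arr (P.str.ident p) = P'.str.ident (obj p)
  map_comp : ∀ b a, P.str.tgt a = P.str.src b →
    arr (P.str.comp b a) = P'.str.comp (arr b) (arr a)
  map_act₀ : ∀ p g, obj (P.str.act₀ p g) = P'.str.act₀ (obj p) g
  map_act₁ : ∀ a k, arr (P.str.act₁ a k) = P'.str.act₁ (arr a) k

/-- The differential of a bundle map on objects. -/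
def TwoBundleMap.dObj {P P' : PrincipalTwoBundle X EM M} (F : TwoBundleMap P P') (p : P.P₀) :
    P.Tangent p →L[ℝ] P'.Tangent (F.obj p) :=
  mfderiv 𝓘(ℝ, EM × EG) 𝓘(ℝ, EM × EG) F.obj p

/-- `(F, φ)` is a 1-morphism `(P, A, B) ⟶ (P', A', B')` of 2-bundles with 2-connection. -/
structure IsOneMorphism {P P' : PrincipalTwoBundle X EM M} (C : TwoConnection P)
    (C' : TwoConnection P') (F : TwoBundleMap P P') (φ : OneForm (EM × EG) P.P₀ EH) : Prop where
  smooth : OneForm.IsSmooth φ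
  horizontal : ∀ (p : P.P₀) (v : EG), φ p (P.fundamental p v) = 0
  /-- `R_g^* φ = (α_g⁻¹)_* φ` for all `g ∈ G` -/
  equivariant : ∀ (g : G) (p : P.P₀) (v : P.Tangent p),
    φ (P.str.act₀ p g) (P.dR g p v) = X.αg g⁻¹ (φ p v)
  /-- `F^* A' = A + t_* φ` -/
  pullback_A : ∀ (p : P.P₀) (v : P.Tangent p),
    C'.A (F.obj p) (F.dObj p v) = C.A p v + X.tStar (φ p v)
  /-- `F^* B' = B + dφ + ½ [φ ∧ φ] + [A ∧ φ]` -/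
  pullback_B : ∀ (p : P.P₀) (v w : P.Tangent p),
    C'.B (F.obj p) ![F.dObj p v, F.dObj p w] =
      C.B p ![v, w] + OneForm.d φ p v w + lieBr H (φ p v) (φ p w)
        + (X.αStar (C.A p v) (φ p w) - X.αStar (C.A p w) (φ p v))

/-- `R_g^* φ = (α_g⁻¹)_* φ` for all equivariant smooth maps `g : P₀ → G`, that is, for all gauge
transformations. -/
def IsGaugeEquivariant {P : PrincipalTwoBundle X EM M} (φ : OneForm (EM × EG) P.P₀ EH) : Prop :=
  ∀ g : P.P₀ → G, ContMDiff 𝓘(ℝ, EM × EG) 𝓘(ℝ, EG) ∞ g →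
    (∀ p k, g (P.str.act₀ p k) = k⁻¹ * g p * k) →
    ∀ (p : P.P₀) (v : P.Tangent p),
      φ (P.str.act₀ p (g p))
        ((mfderiv 𝓘(ℝ, EM × EG) 𝓘(ℝ, EM × EG) (fun q : P.P₀ => P.str.act₀ q (g q)) p :
          P.Tangent p →L[ℝ] P.Tangent (P.str.act₀ p (g p))) v) = X.αg (g p)⁻¹ (φ p v)

/-! ### The correspondence between transport 2-functors and 2-connections -/

/-- An identification of the values of a transport 2-functor with the fibres of a principal
2-bundle (any such 1-morphisms of 2-torsors are invertible). -/
abbrev Realization (𝓕 : TransportTwoFunctor X EM M) (P : PrincipalTwoBundle X EM M) : Type _ :=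
  ∀ x : M, TorHom (𝓕.obj x) (P.fiber x)

namespace Realization

variable {𝓕 : TransportTwoFunctor X EM M} {P : PrincipalTwoBundle X EM M}

/-- The transport along paths, on the fibres of the bundle. -/
def tra (ι : Realization 𝓕 P) {x y : M} (γ : SmoothPath EM x y) (p : (P.fiber x).Obj) :
    (P.fiber y).Obj :=
  (ι y).obj ((𝓕.map γ).obj ((ι x).objInv p))

/-- The 2-transport along bigons, as an `H`-valued function on the fibres of the bundle. -/
def tra₂ (ι : Realization 𝓕 P) {x y : M} {γ γ' : SmoothPath EM x y} (S : Bigon γ γ')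
    (p : (P.fiber x).Obj) : H :=
  (𝓕.map₂ S).hol ((ι x).objInv p)

/-- The 2-bundle with 2-connection `(P, A, B)` is the one defined by the transport 2-functor `𝓕`,
by differentiation.  For all smooth curves `c` in `P₀`, with `c_t` the part of `c` between the
parameters `0` and `t`,
`A(c'(0)) = - d/dt|₀ (tra(c_t)(c(0)) : c(t))`,
and for all smooth maps `S` from the plane to `P₀`
`B(∂₁S, ∂₂S) = ∂²/∂s∂t|₀ tra²(S_* Γ(s,t))⁻¹(S(s,t)) : id`. -/
structure Defines (ι : Realization 𝓕 P) (C : TwoConnection P) : Prop where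
  deriv_A : ∀ (c : ℝ → P.P₀) (hc : ContMDiff 𝓘(ℝ, ℝ) 𝓘(ℝ, EM × EG) ∞ c),
    HasVelocity EG
      (fun t => (P.fiber (P.proj (c t))).div₀
        (ι.tra (SmoothPath.along (fun t => P.proj (c t)) (P.smooth_proj.comp hc) t) ⟨c 0, rfl⟩)
        ⟨c t, rfl⟩)
      0 (- C.A (c 0) (velocity (EM × EG) c 0))
  deriv_B : ∀ (S : ℝ × ℝ → P.P₀) (hS : ContMDiff 𝓘(ℝ, ℝ × ℝ) 𝓘(ℝ, EM × EG) ∞ S),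
    ∃ b : ℝ → EH,
      (∀ s, HasVelocity EH
        (fun t => ι.tra₂ (backBigon (fun z => P.proj (S z)) (P.smooth_proj.comp hS) s t)
          ⟨S (s, t), rfl⟩) 0 (b s)) ∧
      HasDerivAt b
        (C.B (S (0, 0)) ![partial₁ (EM × EG) S (0, 0), partial₂ (EM × EG) S (0, 0)]) 0

end Realization

/-- The curve `c` in `P₀` is the horizontal lift of the path `γ` starting at `p`. -/
structure IsHorizontalLift {P : PrincipalTwoBundle X EM M} (C : TwoConnection P) {x y : M}
    (γ : SmoothPath EM x y) (p : P.P₀) (c : ℝ → P.P₀) : Prop where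
  smooth : ContMDiff 𝓘(ℝ, ℝ) 𝓘(ℝ, EM × EG) ∞ c
  lifts : ∀ t, P.proj (c t) = γ.toFun t
  start : c 0 = p
  horizontal : ∀ t, C.A (c t) (velocity (EM × EG) c t) = 0

/-- The map `L` from the plane to `P₀` lifts the bigon `S` horizontally along each path, starting
at `p`. -/
structure IsHorizontalBigonLift {P : PrincipalTwoBundle X EM M} (C : TwoConnection P) {x y : M}
    {γ γ' : SmoothPath EM x y} (S : Bigon γ γ') (p : P.P₀) (L : ℝ × ℝ → P.P₀) : Prop where
  smooth : ContMDiff 𝓘(ℝ, ℝ × ℝ) 𝓘(ℝ, EM × EG) ∞ L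
  lifts : ∀ z, P.proj (L z) = S.toFun z
  start : ∀ s, L (s, 0) = p
  horizontal : ∀ z, C.A (L z) (partial₂ (EM × EG) L z) = 0

/-- `𝓕` is the transport 2-functor of the 2-bundle with 2-connection `(P, A, B)`, obtained by
integration: `𝓕` is parallel transport along paths, and its value on a bigon is the inverse of the
path-ordered exponential of `s ↦ ∫₀¹ B(∂_s, ∂_t) dt`, with `B` evaluated on the horizontal lift of
the bigon. -/
structure Realization.IsTransportOf {𝓕 : TransportTwoFunctor X EM M}
    {P : PrincipalTwoBundle X EM M} (ι : Realization 𝓕 P) (C : TwoConnection P) : Prop where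
  parallel : ∀ {x y : M} (γ : SmoothPath EM x y) (p : (P.fiber x).Obj),
    ∃ c, IsHorizontalLift C γ p.1 c ∧ (ι.tra γ p).1 = c 1
  parallel₂ : ∀ {x y : M} {γ γ' : SmoothPath EM x y} (S : Bigon γ γ') (p : (P.fiber x).Obj),
    ∃ L, IsHorizontalBigonLift C S p.1 L ∧
      ∃ h : ℝ → H, IsPathOrderedExp
          (fun s => ∫ t in (0 : ℝ)..1,
            C.B (L (s, t)) ![partial₁ (EM × EG) L (s, t), partial₂ (EM × EG) L (s, t)]) h ∧
        ι.tra₂ S p = (h 1)⁻¹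

namespace PseudoNat

variable {𝓕 𝓕' : TransportTwoFunctor X EM M} {P P' : PrincipalTwoBundle X EM M}

/-- The `H`-valued function `ρ_H(γ)` with `ρ(γ)(p) : id_{F(tra_γ(p))} = (1, ρ_H(γ)(p))`. -/
def hol (ρ : PseudoNat 𝓕 𝓕') (ι : Realization 𝓕 P) {x y : M} (γ : SmoothPath EM x y)
    (p : (P.fiber x).Obj) : H :=
  (ρ.map γ).hol ((ι x).objInv p)

/-- Smoothness of a pseudonatural transformation: `ρ(x)` depends smoothly on the point, and
`ρ(γ)(p)` depends smoothly on the path and the point. -/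
structure IsSmooth (ρ : PseudoNat 𝓕 𝓕') (ι : Realization 𝓕 P) (ι' : Realization 𝓕' P') :
    Prop where
  smooth_obj : ∀ (k : ℕ) (p : Param k → P.P₀),
    ContMDiff 𝓘(ℝ, Param k) 𝓘(ℝ, EM × EG) ∞ p →
    ContMDiff 𝓘(ℝ, Param k) 𝓘(ℝ, EM × EG) ∞ (fun u =>
      ((ι' (P.proj (p u))).obj
        ((ρ.obj (P.proj (p u))).obj ((ι (P.proj (p u))).objInv ⟨p u, rfl⟩))).1)
  smooth_map : ∀ (k : ℕ) (p : Param k → P.P₀) (y : Param k → M)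
    (γ : ∀ u, SmoothPath EM (P.proj (p u)) (y u)),
    ContMDiff 𝓘(ℝ, Param k) 𝓘(ℝ, EM × EG) ∞ p →
    ContMDiff 𝓘(ℝ, Param k × ℝ) 𝓘(ℝ, EM) ∞ (fun z : Param k × ℝ => (γ z.1).toFun z.2) →
    ContMDiff 𝓘(ℝ, Param k) 𝓘(ℝ, EH) ∞ (fun u => ρ.hol ι (γ u) ⟨p u, rfl⟩)

/-- `F` is the bundle map given by the 1-morphisms `ρ(x)`. -/
structure Induces (ρ : PseudoNat 𝓕 𝓕') (ι : Realization 𝓕 P) (ι' : Realization 𝓕' P')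
    (F : TwoBundleMap P P') : Prop where
  obj : ∀ (x : M) (q : (𝓕.obj x).Obj),
    F.obj ((ι x).obj q).1 = ((ι' x).obj ((ρ.obj x).obj q)).1
  arr : ∀ (x : M) (a : (𝓕.obj x).Arr),
    F.arr ((ι x).arr a).1 = ((ι' x).arr ((ρ.obj x).arr a)).1

/-- `φ` is the derivative of `ρ`: for all smooth curves `c` in `P₀`, with `c_t` the part of `c`
between the parameters `0` and `t`, `φ(c'(0)) = - d/dt|₀ ρ_H(c_t)(c(0))`. -/
def HasDerivative (ρ : PseudoNat 𝓕 𝓕') (ι : Realization 𝓕 P)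
    (φ : OneForm (EM × EG) P.P₀ EH) : Prop :=
  ∀ (c : ℝ → P.P₀) (hc : ContMDiff 𝓘(ℝ, ℝ) 𝓘(ℝ, EM × EG) ∞ c),
    HasVelocity EH
      (fun t => ρ.hol ι
        (SmoothPath.along (fun t => P.proj (c t)) (P.smooth_proj.comp hc) t) ⟨c 0, rfl⟩)
      0 (- φ (c 0) (velocity (EM × EG) c 0))

/-- `ρ` is the path-ordered exponential of `-φ` along horizontal lifts. -/
def IsIntegral (ρ : PseudoNat 𝓕 𝓕') (ι : Realization 𝓕 P) (C : TwoConnection P)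
    (φ : OneForm (EM × EG) P.P₀ EH) : Prop :=
  ∀ {x y : M} (γ : SmoothPath EM x y) (p : (P.fiber x).Obj),
    ∃ c, IsHorizontalLift C γ p.1 c ∧
      ∃ h : ℝ → H, IsPathOrderedExp (fun t => - φ (c t) (velocity (EM × EG) c t)) h ∧
        ρ.hol ι γ p = h 1

end PseudoNat

end Main

end TwoTransport

end

/-! Every arrow of a 2-torsor is `id_p · (1, h)` for a unique object `p` and a unique `h ∈ H`, so
the two-dimensional data are functions with values in `H`. In these terms a pseudonatural
transformation consists of equivariant maps `F` of the fibres and functions `ρ_H` with `tra'_γ(F p)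
= F(tra_γ p) · t(ρ_H(γ)(p))`, with `ρ_H(γ'γ)(p) = ρ_H(γ')(tra_γ p) ρ_H(γ)(p)`, and with `ρ_H(γ)
tra²'_Σ = tra²_Σ ρ_H(γ')` for bigons `Σ : γ ⇒ γ'` (`tra_fib`, `hol_concat`, `hol_bigon` in
`PseudoNat`). Both directions compare these group-valued identities with their infinitesimal forms.
The language is that of right logarithmic derivatives `h' = ξ h`, with the Maurer-Cartan equation
(`maurerCartan_equation`) exchanging derivatives in two parameters.

Differentiation. The candidate for `φ` at a point is minus the derivative of `ρ_H` along straight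
paths in a chart, which is linear by construction. Any smooth curve can be written `c(r) = c(0) + r
e(r)` with `e` smooth, and a two-parameter family then shows that only `e(0) = c'(0)` matters
(`hasVelocity_holAt_param`, `exists_hasDerivativeAt`). A curve `c · g` has the same projection as
`c`, so only `g(0)` enters the derivative: this gives horizontality and all forms of equivariance.
The logarithmic derivative of the transport identity is `F^*A' = A + t_*φ`. For `F^*B'`, the bigon
identity is applied to small rectangles, whose boundary values of `ρ_H` split into contributions of
the four sides, and differentiated once in each direction. The sides give `dφ`, the conjugation by
one of them gives `[φ ∧ φ]`, and the displacement of the base points by transport gives `[A ∧ φ]`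
(`pullback_B_of_defines`).

Integration. For a horizontal curve `c` and a solution of `h' = -φ(c') h`, the curve `F(c) · t(h)`
is horizontal for `A'`, because the contribution of `t(h)` cancels `t_*φ`. Uniqueness of horizontal
lifts then yields the transport identity, and uniqueness of solutions yields multiplicativity and
equivariance. For a bigon, let `k(s, t)` be the partial path-ordered exponential along the path with
parameter `s`. Fake flatness expresses `A(∂_s)` by the integral of `B`
(`TwoConnection.ev_partial₁_of_horizontal`), and the pullback formula for `B'` together with the
Maurer-Cartan equation determines `∂_s k` (`logForm_transversal`). At the common end point `φ(∂_s)`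
vanishes, and the two sides of the bigon identity solve the same equation in `s`
(`IsOneMorphism.bigon`).

The analysis is developed from scratch: smooth dependence of solutions on parameters comes from the
inverse function theorem on spaces of continuous functions on the unit interval
(`exists_smooth_solution`), and the group structure extends local solutions to all times. -/

open scoped Topology

noncomputable section

namespace TwoTransport

universe u v

/-! ### Smoothness of superposition operators on continuous functions. -/

section Nemytskii

open ContinuousLinearMap

/-- The unit interval. -/
abbrev UI : Type := Set.Icc (0 : ℝ) 1

variable {Y : Type u} [NormedAddCommGroup Y] [NormedSpace ℝ Y]
  {F : Type (max u v)} [NormedAddCommGroup F] [NormedSpace ℝ F]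

/-- Composition with a continuous map, as a map of spaces of continuous functions. -/
def postcomp (f : Y → F) (hf : Continuous f) (y : C(UI, Y)) : C(UI, F) := ⟨fun v => f (y v), by fun_prop⟩

/-- Pointwise application of a continuous family of linear maps. -/
def applyFamily (L : C(UI, Y →L[ℝ] F)) : C(UI, Y) →L[ℝ] C(UI, F) :=
  LinearMap.mkContinuous
    { toFun := fun y => ⟨fun v => L v (y v), by fun_prop⟩
      map_add' := fun y z => by ext v; simp
      map_smul' := fun r y => by ext v; simp } ‖L‖ (fun y => by
      refine (ContinuousMap.norm_le _ (by positivity)).2 fun v => ?_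
      exact (le_opNorm _ _).trans (mul_le_mul (L.norm_coe_le_norm v) (y.norm_coe_le_norm v)
        (norm_nonneg _) (norm_nonneg L)))

@[simp] theorem applyFamily_apply (L : C(UI, Y →L[ℝ] F)) (y : C(UI, Y)) (v : UI) :
    applyFamily L y v = L v (y v) := rfl

theorem norm_applyFamily_le (L : C(UI, Y →L[ℝ] F)) : ‖applyFamily L‖ ≤ ‖L‖ :=
  LinearMap.mkContinuous_norm_le _ (norm_nonneg L) _

theorem isBoundedLinearMap_applyFamily :
    IsBoundedLinearMap ℝ (fun L : C(UI, Y →L[ℝ] F) => applyFamily L) where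
  map_add _ _ := rfl
  map_smul _ _ := rfl
  bound := ⟨1, one_pos, fun L => (norm_applyFamily_le L).trans (one_mul ‖L‖).ge⟩

/-- The remainder is estimated pointwise by the mean value inequality. The estimate is uniform in
`v` because `fderiv ℝ f` is uniformly continuous near the compact range of `y`. -/
theorem postcomp_hasFDerivAt {f : Y → F} (hf : ContDiff ℝ 1 f) (y : C(UI, Y)) :
    HasFDerivAt (postcomp f hf.continuous)
      (applyFamily (postcomp (fderiv ℝ f) (hf.continuous_fderiv one_ne_zero) y)) y := by
  have hc : Continuous (fderiv ℝ f) := hf.continuous_fderiv one_ne_zero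
  rw [hasFDerivAt_iff_isLittleO_nhds_zero, Asymptotics.isLittleO_iff]
  intro ε hε
  have hK : IsCompact (Set.range y) := isCompact_range y.continuous
  have hu := hK.uniformContinuousAt_of_continuousAt (fderiv ℝ f)
    (fun a _ => hc.continuousAt) (Metric.dist_mem_uniformity hε)
  obtain ⟨δ, hδ, hδ'⟩ := Metric.mem_uniformity_dist.1 hu
  filter_upwards [Metric.ball_mem_nhds (0 : C(UI, Y)) hδ] with η hη
  rw [mem_ball_zero_iff] at hη
  refine (ContinuousMap.norm_le _ (by positivity)).2 fun v => ?_
  have key : ∀ z ∈ Metric.ball (y v) δ, ‖fderiv ℝ f z - fderiv ℝ f (y v)‖ ≤ ε := by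
    intro z hz
    have := hδ' (a := y v) (b := z) (by rw [dist_comm]; exact hz) ⟨v, rfl⟩
    simp only [Set.mem_ofPred_eq] at this
    rw [dist_comm, dist_eq_norm] at this
    exact this.le
  have hm := (convex_ball (y v) δ).norm_image_sub_le_of_norm_hasFDerivWithin_le'
    (f := f) (f' := fderiv ℝ f) (φ := fderiv ℝ f (y v)) (C := ε) (x := y v) (y := y v + η v)
    (fun z _ => ((hf.differentiable one_ne_zero).differentiableAt.hasFDerivAt).hasFDerivWithinAt) key
    (Metric.mem_ball_self hδ) (by
      rw [Metric.mem_ball, dist_eq_norm, add_sub_cancel_left]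
      exact (η.norm_coe_le_norm v).trans_lt hη)
  rw [add_sub_cancel_left] at hm
  exact hm.trans (mul_le_mul_of_nonneg_left (η.norm_coe_le_norm v) hε.le : _ ≤ ε * ‖η‖)

/-- The derivative of a superposition operator is the superposition operator of `fderiv ℝ f`
followed by a bounded linear map, so induction on the order applies. The target `F` must vary in the
induction; its universe `max u v` is chosen so that `Y →L[ℝ] F` is again an admissible target. -/
theorem postcomp_contDiff_nat (n : ℕ) : ∀ {F : Type (max u v)} [NormedAddCommGroup F] [NormedSpace ℝ F]
    {f : Y → F} (hf : ContDiff ℝ ∞ f), ContDiff ℝ n (postcomp f hf.continuous) := by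
  induction n with
  | zero =>
    intro F _ _ f hf
    refine contDiff_zero.2 ?_
    have h1 : ContDiff ℝ 1 f := hf.of_le (by norm_cast)
    exact continuous_iff_continuousAt.2 fun y => (postcomp_hasFDerivAt h1 y).continuousAt
  | succ n ih =>
    intro F _ _ f hf
    have h1 : ContDiff ℝ 1 f := hf.of_le (by norm_cast)
    have hd : ContDiff ℝ ∞ (fderiv ℝ f) := hf.fderiv_right (by norm_cast)
    have hL : ContDiff ℝ n (fun L : C(UI, Y →L[ℝ] F) => applyFamily L) :=
      IsBoundedLinearMap.contDiff (𝕜 := ℝ) (isBoundedLinearMap_applyFamily.{u, v} (Y := Y) (F := F))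
    have := contDiff_succ_iff_hasFDerivAt.2
      (⟨fun y => applyFamily (postcomp (fderiv ℝ f) hd.continuous y),
          hL.comp (ih hd), fun y => postcomp_hasFDerivAt h1 y⟩ :
        ∃ f' : C(UI, Y) → (C(UI, Y) →L[ℝ] C(UI, F)), ContDiff ℝ n f' ∧
          ∀ y, HasFDerivAt (postcomp f hf.continuous) (f' y) y)
    exact_mod_cast this

theorem postcomp_contDiff {f : Y → F} (hf : ContDiff ℝ ∞ f) :
    ContDiff ℝ ∞ (postcomp f hf.continuous) :=
  contDiff_infty.2 fun n => postcomp_contDiff_nat n hf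

end Nemytskii

/-! ### Integration as a bounded operator on continuous functions. -/

section Integration

variable {E : Type u} [NormedAddCommGroup E]

/-- The constant extension of a continuous function on the unit interval. -/
def extendUI (x : C(UI, E)) (v : ℝ) : E := x (Set.projIcc 0 1 zero_le_one v)

theorem continuous_extendUI (x : C(UI, E)) : Continuous (extendUI x) := by
  unfold extendUI; fun_prop

theorem extendUI_of_mem (x : C(UI, E)) {v : ℝ} (hv : v ∈ Set.Icc (0 : ℝ) 1) :
    extendUI x v = x ⟨v, hv⟩ := by
  rw [extendUI, Set.projIcc_of_mem]

theorem norm_extendUI_le (x : C(UI, E)) (v : ℝ) : ‖extendUI x v‖ ≤ ‖x‖ := x.norm_coe_le_norm _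

variable [NormedSpace ℝ E]

/-- Integration from `0` to `v`. -/
def integrate : C(UI, E) →L[ℝ] C(UI, E) :=
  LinearMap.mkContinuous
    { toFun := fun x => ⟨fun v => ∫ τ in (0 : ℝ)..v, extendUI x τ, by
        have := intervalIntegral.continuous_primitive (μ := MeasureTheory.volume)
          (fun a b => (continuous_extendUI x).intervalIntegrable a b) 0
        exact this.comp continuous_subtype_val⟩
      map_add' := fun y z => by
        ext v
        exact intervalIntegral.integral_add ((continuous_extendUI y).intervalIntegrable _ _)
          ((continuous_extendUI z).intervalIntegrable _ _)
      map_smul' := fun r y => by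
        ext v
        exact intervalIntegral.integral_smul _ _ } 1 (fun x => by
      refine (ContinuousMap.norm_le _ (by positivity)).2 fun v => ?_
      refine (intervalIntegral.norm_integral_le_of_norm_le_const
        (C := ‖x‖) fun τ _ => norm_extendUI_le x τ).trans ?_
      rw [one_mul, sub_zero, abs_of_nonneg v.2.1]
      exact mul_le_of_le_one_right (norm_nonneg _) v.2.2)

theorem integrate_apply (x : C(UI, E)) (v : UI) :
    integrate x v = ∫ τ in (0 : ℝ)..v, extendUI x τ := rfl

theorem integrate_zero (x : C(UI, E)) : integrate x 0 = 0 := by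
  rw [integrate_apply]; simp

theorem hasDerivAt_extend_integrate [CompleteSpace E] (x : C(UI, E)) {v : ℝ} (hv : v ∈ Set.Ioo (0 : ℝ) 1) :
    HasDerivAt (extendUI (integrate x)) (x ⟨v, Set.Ioo_subset_Icc_self hv⟩) v := by
  have h := intervalIntegral.integral_hasDerivAt_right
    ((continuous_extendUI x).intervalIntegrable 0 v)
    ((continuous_extendUI x).stronglyMeasurableAtFilter _ _) (continuous_extendUI x).continuousAt
  rw [extendUI_of_mem _ (Set.Ioo_subset_Icc_self hv)] at h
  refine h.congr_of_eventuallyEq ?_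
  filter_upwards [isOpen_Ioo.mem_nhds hv] with w hw
  rw [extendUI_of_mem _ (Set.Ioo_subset_Icc_self hw), integrate_apply]

end Integration

/-! ### Smooth division by the variable, and smooth dependence of ODE solutions on parameters. -/

section Applications

variable {W : Type} [NormedAddCommGroup W] [NormedSpace ℝ W]
  {E : Type u} [NormedAddCommGroup E] [NormedSpace ℝ E]

/-- Constant functions. -/
def constUI : E →L[ℝ] C(UI, E) :=
  LinearMap.mkContinuous
    { toFun := fun x => ContinuousMap.const _ x
      map_add' := fun y z => rfl
      map_smul' := fun r y => rfl } 1 (fun x => by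
      refine (ContinuousMap.norm_le _ (by positivity)).2 fun v => ?_
      exact (one_mul ‖x‖).ge)

@[simp] theorem constUI_apply (x : E) (v : UI) : constUI x v = x := rfl

/-- The function `v ↦ v • x`. -/
def rampUI : E →L[ℝ] C(UI, E) :=
  LinearMap.mkContinuous
    { toFun := fun x => ⟨fun v => (v : ℝ) • x, by fun_prop⟩
      map_add' := fun y z => by ext; simp
      map_smul' := fun r y => by ext v; exact smul_comm _ _ _ } 1 (fun x => by
      refine (ContinuousMap.norm_le _ (by positivity)).2 fun v => ?_
      simp only [LinearMap.coe_mk, AddHom.coe_mk, ContinuousMap.coe_mk, norm_smul, one_mul]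
      rw [Real.norm_of_nonneg v.2.1]
      exact mul_le_of_le_one_left (norm_nonneg _) v.2.2)

@[simp] theorem rampUI_apply (x : E) (v : UI) : rampUI x v = (v : ℝ) • x := rfl

/-- Division of a smooth function by its argument. -/
theorem exists_smooth_quotient [CompleteSpace E] {c : ℝ → E} (hc : ContDiff ℝ ∞ c) :
    ∃ e : ℝ → E, ContDiff ℝ ∞ e ∧ (∀ r, c r = c 0 + r • e r) ∧ e 0 = deriv c 0 := by
  have hd : ContDiff ℝ ∞ (deriv c) := (contDiff_infty_iff_deriv.1 hc).2
  have hdiff : Differentiable ℝ c := (contDiff_infty_iff_deriv.1 hc).1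
  have hformula : ∀ r : ℝ, (integrate (postcomp (deriv c) hd.continuous (rampUI r)) 1 : E) =
      ∫ τ in (0 : ℝ)..1, deriv c (r * τ) := by
    intro r
    rw [integrate_apply]
    refine intervalIntegral.integral_congr fun τ hτ => ?_
    rw [Set.Icc.coe_one, Set.uIcc_of_le zero_le_one] at hτ
    rw [extendUI_of_mem _ hτ]
    simp [postcomp, mul_comm]
  -- Hadamard's formula `e(r) = ∫₀¹ c'(rτ) dτ`. Written as linear map, superposition, linear map, it
  -- is smooth without any differentiation under the integral sign.
  refine ⟨fun r => integrate (postcomp (deriv c) hd.continuous (rampUI r)) 1, ?_, ?_, ?_⟩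
  · have h1 := (postcomp_contDiff.{0, u} hd).comp (rampUI (E := ℝ)).contDiff
    have h2 := (integrate (E := E)).contDiff.comp (n := ∞) h1
    exact (ContinuousMap.evalCLM ℝ (1 : UI)).contDiff.comp h2
  · intro r
    change c r = c 0 + r • (integrate (postcomp (deriv c) hd.continuous (rampUI r)) 1 : E)
    rw [hformula]
    have h3 : r • ∫ τ in (0 : ℝ)..1, deriv c (r * τ) = ∫ τ in (0 : ℝ)..r, deriv c τ := by
      have := intervalIntegral.smul_integral_comp_mul_left (a := 0) (b := 1) (deriv c) r
      rwa [mul_zero, mul_one] at this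
    rw [h3, intervalIntegral.integral_deriv_eq_sub (fun x _ => hdiff x)
      (hd.continuous.intervalIntegrable _ _)]
    abel
  · change (integrate (postcomp (deriv c) hd.continuous (rampUI (0 : ℝ))) 1 : E) = _
    rw [hformula]
    simp

/-- Smooth dependence on parameters of the solutions of a family of ordinary differential equations
which is stationary for one value of the parameter. -/
theorem exists_smooth_solution [CompleteSpace W] [CompleteSpace E] {f : W × ℝ × E → E}
    (hf : ContDiff ℝ ∞ f) (w₀ : W) (x₀ : E) (h0 : ∀ v x, f (w₀, v, x) = 0) :
    ∃ x : W → C(UI, E), ContDiffAt ℝ ∞ x w₀ ∧ x w₀ = constUI x₀ ∧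
      ∀ᶠ w in 𝓝 w₀, (x w 0 = x₀ ∧ ∀ v (hv : v ∈ Set.Ioo (0 : ℝ) 1),
        HasDerivAt (extendUI (x w)) (f (w, v, x w ⟨v, Set.Ioo_subset_Icc_self hv⟩)) v) := by
  let ev : W × C(UI, E) →L[ℝ] C(UI, W) × C(UI, E) :=
    (constUI (E := W)).prodMap (ContinuousLinearMap.id ℝ C(UI, E))
  have hpairc : ∃ Lm : W × C(UI, E) → C(UI, W × ℝ × E), ContDiff ℝ ∞ Lm ∧
      ∀ z v, Lm z v = (z.1, (v : ℝ), z.2 v) := by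
    let inlY : C(UI, W) →L[ℝ] C(UI, W × ℝ × E) :=
      applyFamily (ContinuousMap.const _ (ContinuousLinearMap.inl ℝ W (ℝ × E)))
    let inrY : C(UI, E) →L[ℝ] C(UI, W × ℝ × E) :=
      applyFamily (ContinuousMap.const _ ((ContinuousLinearMap.inr ℝ W (ℝ × E)).comp
        (ContinuousLinearMap.inr ℝ ℝ E)))
    let mid : C(UI, W × ℝ × E) := ⟨fun v => (0, (v : ℝ), 0), by fun_prop⟩
    refine ⟨fun z => inlY (constUI z.1) + inrY z.2 + mid, ?_, ?_⟩
    · fun_prop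
    · intro z v
      simp [inlY, inrY, mid]
  obtain ⟨Lm, hLm, hLm'⟩ := hpairc
  -- The Picard integral operator: `x` solves the equation for the parameter `w` with initial value
  -- `x₀` exactly when `x = x₀ + Nf (w, x)`.
  let Nf : W × C(UI, E) → C(UI, E) := fun z => integrate (postcomp f hf.continuous (Lm z))
  have hNf : ContDiff ℝ ∞ Nf :=
    (integrate (E := E)).contDiff.comp ((postcomp_contDiff.{u, u} hf).comp hLm)
  have hNf0 : ∀ x, Nf (w₀, x) = 0 := by
    intro x
    have : postcomp f hf.continuous (Lm (w₀, x)) = 0 := by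
      ext v
      simp [postcomp, hLm', h0]
    simp only [Nf, this, map_zero]
  -- The integral equation now reads `Ψ (w, x) = (w, 0)`, so a smooth local inverse of `Ψ` produces
  -- solutions that depend smoothly on `w`.
  let Ψ : W × C(UI, E) → W × C(UI, E) := fun z => (z.1, z.2 - constUI x₀ - Nf z)
  have hΨ : ContDiff ℝ ∞ Ψ := contDiff_fst.prodMk ((contDiff_snd.sub contDiff_const).sub hNf)
  let a : W × C(UI, E) := (w₀, constUI x₀)
  set D := fderiv ℝ Nf a with hD
  have hDN : HasFDerivAt Nf D a := (hNf.differentiable (by simp)).differentiableAt.hasFDerivAt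
  have hD2 : ∀ x, D (0, x) = 0 := by
    intro x
    have h1 : HasFDerivAt (fun x => Nf (w₀, x)) (D.comp (ContinuousLinearMap.inr ℝ W C(UI, E)))
        (constUI x₀) := by
      refine HasFDerivAt.comp (f := fun x => (w₀, x)) (constUI x₀) hDN ?_
      exact hasFDerivAt_prodMk_right w₀ (constUI x₀)
    have h2 : HasFDerivAt (fun x => Nf (w₀, x)) (0 : C(UI, E) →L[ℝ] C(UI, E)) (constUI x₀) := by
      simp only [hNf0]; exact hasFDerivAt_const _ _
    have := congrArg (fun L => L x) (h1.unique h2)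
    simpa using this
  -- Stationarity at `w₀` makes `D` vanish on `0 × C(UI, E)`. The derivative of `Ψ` is therefore a
  -- shear, inverted by a change of sign; no contraction estimate is needed.
  let e' : (W × C(UI, E)) ≃L[ℝ] (W × C(UI, E)) :=
    ContinuousLinearEquiv.equivOfInverse
      ((ContinuousLinearMap.fst ℝ W C(UI, E)).prod
        (ContinuousLinearMap.snd ℝ W C(UI, E) - D))
      ((ContinuousLinearMap.fst ℝ W C(UI, E)).prod
        (ContinuousLinearMap.snd ℝ W C(UI, E) + D))
      (fun z => by
        have : D (z.1, z.2 - D z) = D z := by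
          have h := D.map_add z (0, - D z)
          rw [hD2, add_zero, Prod.add_def] at h
          simpa [sub_eq_add_neg] using h
        ext1 <;> simp [this])
      (fun z => by
        have : D (z.1, z.2 + D z) = D z := by
          have h := D.map_add z (0, D z)
          rw [hD2, add_zero, Prod.add_def] at h
          simpa using h
        ext1 <;> simp [this])
  have hΨ' : HasFDerivAt Ψ (e' : (W × C(UI, E)) →L[ℝ] (W × C(UI, E))) a := by
    have h1 : HasFDerivAt (fun z : W × C(UI, E) => z.2 - constUI x₀ - Nf z)
      (ContinuousLinearMap.snd ℝ W C(UI, E) - D) a := (hasFDerivAt_snd.sub_const _).sub hDN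
    exact hasFDerivAt_fst.prodMk h1
  have hn : (∞ : WithTop ℕ∞) ≠ 0 := by simp
  let inv := (hΨ.contDiffAt (x := a)).localInverse hΨ' hn
  have hinv : ContDiffAt ℝ ∞ inv (Ψ a) := (hΨ.contDiffAt (x := a)).to_localInverse hΨ' hn
  have ha : Ψ a = (w₀, 0) := by simp [Ψ, a, hNf0]
  have hright : ∀ᶠ y in 𝓝 (Ψ a), Ψ (inv y) = y :=
    ((hΨ.contDiffAt (x := a)).hasStrictFDerivAt' hΨ' hn).eventually_right_inverse
  have hinva : inv (Ψ a) = a :=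
    ((hΨ.contDiffAt (x := a)).localInverse_apply_image hΨ' hn)
  rw [ha] at hinv hright hinva
  refine ⟨fun w => (inv (w, 0)).2, ?_, by simp only [hinva]; rfl, ?_⟩
  · exact contDiffAt_snd.comp w₀ (hinv.comp w₀ (contDiffAt_id.prodMk contDiffAt_const))
  · have hev := (Continuous.tendsto (by fun_prop : Continuous fun w : W => (w, (0 : C(UI, E)))) w₀).eventually hright
    filter_upwards [hev] with w hw
    have e1 : (inv (w, 0)).1 = w := congrArg Prod.fst hw
    have e2 : (inv (w, 0)).2 = constUI x₀ + Nf (inv (w, 0)) := by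
      have : (inv (w, 0)).2 - constUI x₀ - Nf (inv (w, 0)) = 0 := congrArg Prod.snd hw
      rw [sub_sub, sub_eq_zero] at this
      exact this
    have e3 : inv (w, 0) = (w, (inv (w, 0)).2) := Prod.ext e1 rfl
    set x := (inv (w, 0)).2 with hx
    rw [e3] at e2
    constructor
    · rw [e2]; simp [Nf, integrate_zero]
    · intro v hv
      have h4 := hasDerivAt_extend_integrate (postcomp f hf.continuous (Lm (w, x))) hv
      have h5 : postcomp f hf.continuous (Lm (w, x)) ⟨v, Set.Ioo_subset_Icc_self hv⟩ =
          f (w, v, x ⟨v, Set.Ioo_subset_Icc_self hv⟩) := by simp [postcomp, hLm']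
      rw [h5] at h4
      have h6 : extendUI x = fun v => x₀ + extendUI (Nf (w, x)) v := by
        funext v; conv_lhs => rw [extendUI, e2]
        rfl
      rw [h6]
      exact h4.const_add x₀

end Applications

/-! ### Velocities of curves in manifolds and their chain rules. -/

section Velocity

variable {E : Type*} [NormedAddCommGroup E] [NormedSpace ℝ E]
  {N : Type*} [TopologicalSpace N] [ChartedSpace E N]
  {E' : Type*} [NormedAddCommGroup E'] [NormedSpace ℝ E']
  {N' : Type*} [TopologicalSpace N'] [ChartedSpace E' N']
  {E'' : Type*} [NormedAddCommGroup E''] [NormedSpace ℝ E'']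
  {N'' : Type*} [TopologicalSpace N''] [ChartedSpace E'' N'']

theorem hasVelocity_of_hasMFDerivAt {c : ℝ → N} {t : ℝ} {L : ℝ →L[ℝ] E}
    (h : HasMFDerivAt 𝓘(ℝ, ℝ) 𝓘(ℝ, E) c t L) {v : E} (hv : L 1 = v) : HasVelocity E c t v := by
  have e : L = ContinuousLinearMap.toSpanSingleton ℝ v := by ext; simp [hv]
  subst e
  exact h

theorem HasVelocity.hasMFDerivAt_comp {c : ℝ → N} {t : ℝ} {v : E} (hc : HasVelocity E c t v)
    {f : N → N'} {f' : E →L[ℝ] E'} (hf : HasMFDerivAt 𝓘(ℝ, E) 𝓘(ℝ, E') f (c t) f') :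
    HasVelocity E' (fun t => f (c t)) t (f' v) := by
  have h := HasMFDerivAt.comp t hf hc
  have e : ((f' : E →L[ℝ] E').comp (ContinuousLinearMap.toSpanSingleton ℝ v : ℝ →L[ℝ] E)) =
      ContinuousLinearMap.toSpanSingleton ℝ (f' v) := by ext; simp
  unfold HasVelocity
  rw [← e]
  exact h

theorem HasVelocity.mdifferentiableAt_comp {c : ℝ → N} {t : ℝ} {v : E} (hc : HasVelocity E c t v)
    {f : N → N'} (hf : MDifferentiableAt 𝓘(ℝ, E) 𝓘(ℝ, E') f (c t)) :
    HasVelocity E' (fun t => f (c t)) t ((mfderiv 𝓘(ℝ, E) 𝓘(ℝ, E') f (c t) : E →L[ℝ] E') v) :=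
  hc.hasMFDerivAt_comp hf.hasMFDerivAt

theorem HasVelocity.comp_contMDiff {c : ℝ → N} {t : ℝ} {v : E} (hc : HasVelocity E c t v)
    {f : N → N'} (hf : ContMDiff 𝓘(ℝ, E) 𝓘(ℝ, E') ∞ f) :
    HasVelocity E' (fun t => f (c t)) t ((mfderiv 𝓘(ℝ, E) 𝓘(ℝ, E') f (c t) : E →L[ℝ] E') v) :=
  hc.mdifferentiableAt_comp (hf.mdifferentiableAt (by simp))

theorem HasVelocity.congr {c d : ℝ → N} {t : ℝ} {v : E} (hc : HasVelocity E c t v)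
    (h : d =ᶠ[𝓝 t] c) : HasVelocity E d t v := by
  have := HasMFDerivAt.congr_of_eventuallyEq hc h
  exact this

theorem HasVelocity.unique {c : ℝ → N} {t : ℝ} {v w : E} (hc : HasVelocity E c t v)
    (hc' : HasVelocity E c t w) : v = w := by
  have h : (ContinuousLinearMap.toSpanSingleton ℝ v : ℝ →L[ℝ] E) =
      ContinuousLinearMap.toSpanSingleton ℝ w := hasMFDerivAt_unique hc hc'
  simpa using congrArg (fun L : ℝ →L[ℝ] E => L 1) h

theorem HasVelocity.velocity_eq {c : ℝ → N} {t : ℝ} {v : E} (hc : HasVelocity E c t v) :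
    velocity E c t = v := by
  have h := HasMFDerivAt.mfderiv hc
  unfold velocity
  rw [h]
  exact (one_smul ℝ v)

theorem hasVelocity_of_mdifferentiableAt {c : ℝ → N} {t : ℝ}
    (hc : MDifferentiableAt 𝓘(ℝ, ℝ) 𝓘(ℝ, E) c t) : HasVelocity E c t (velocity E c t) := by
  have h := hc.hasMFDerivAt
  have e : (mfderiv 𝓘(ℝ, ℝ) 𝓘(ℝ, E) c t : ℝ →L[ℝ] E) =
      ContinuousLinearMap.toSpanSingleton ℝ (velocity E c t : E) := by
    refine ContinuousLinearMap.ext_ring ?_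
    exact (one_smul ℝ _).symm
  have h' : HasMFDerivAt 𝓘(ℝ, ℝ) 𝓘(ℝ, E) c t
      (ContinuousLinearMap.toSpanSingleton ℝ (velocity E c t : E) : ℝ →L[ℝ] E) := e ▸ h
  exact h'

theorem hasVelocity_of_contMDiff {c : ℝ → N} (hc : ContMDiff 𝓘(ℝ, ℝ) 𝓘(ℝ, E) ∞ c) (t : ℝ) :
    HasVelocity E c t (velocity E c t) :=
  hasVelocity_of_mdifferentiableAt (hc.mdifferentiableAt (by simp))

theorem HasVelocity.continuousAt {c : ℝ → N} {t : ℝ} {v : E} (hc : HasVelocity E c t v) :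
    ContinuousAt c t := HasMFDerivAt.continuousAt hc

theorem hasVelocity_iff_hasDerivAt {c : ℝ → E} {t : ℝ} {v : E} :
    HasVelocity E c t v ↔ HasDerivAt c v t := by
  unfold HasVelocity
  rw [hasDerivAt_iff_hasFDerivAt]
  exact hasMFDerivAt_iff_hasFDerivAt

theorem hasVelocity_const (p : N) (t : ℝ) : HasVelocity E (fun _ => p) t 0 := by
  have h := hasMFDerivAt_const (I := 𝓘(ℝ, ℝ)) (I' := 𝓘(ℝ, E)) p t
  have e : (ContinuousLinearMap.toSpanSingleton ℝ (0 : E) : ℝ →L[ℝ] E) = 0 := by ext; simp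
  unfold HasVelocity
  rw [e]
  exact h

theorem HasVelocity.comp_real {c : ℝ → N} {f : ℝ → ℝ} {t r : ℝ} {v : E}
    (hc : HasVelocity E c (f t) v) (hf : HasDerivAt f r t) :
    HasVelocity E (fun t => c (f t)) t (r • v) := by
  have h := (hasVelocity_iff_hasDerivAt.2 hf).hasMFDerivAt_comp hc
  simpa using h

theorem HasVelocity.comp₂ {a : ℝ → N} {b : ℝ → N'} {t : ℝ} {v : E} {w : E'}
    (ha : HasVelocity E a t v) (hb : HasVelocity E' b t w) {f : N × N' → N''}
    (hf : MDifferentiableAt (𝓘(ℝ, E).prod 𝓘(ℝ, E')) 𝓘(ℝ, E'') f (a t, b t)) :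
    HasVelocity E'' (fun t => f (a t, b t)) t
      ((mfderiv 𝓘(ℝ, E) 𝓘(ℝ, E'') (fun z => f (z, b t)) (a t) : E →L[ℝ] E'') v +
        (mfderiv 𝓘(ℝ, E') 𝓘(ℝ, E'') (fun z => f (a t, z)) (b t) : E' →L[ℝ] E'') w) := by
  have h1 : HasMFDerivAt 𝓘(ℝ, ℝ) (𝓘(ℝ, E).prod 𝓘(ℝ, E')) (fun t => (a t, b t)) t
      ((ContinuousLinearMap.toSpanSingleton ℝ v : ℝ →L[ℝ] E).prod
        (ContinuousLinearMap.toSpanSingleton ℝ w : ℝ →L[ℝ] E')) := HasMFDerivAt.prodMk ha hb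
  have hf' := hf.hasMFDerivAt
  have h2 := HasMFDerivAt.comp (I' := 𝓘(ℝ, E).prod 𝓘(ℝ, E')) (g := f) (f := fun t => (a t, b t)) t hf' h1
  have e := mfderiv_prod_eq_add_comp (I := 𝓘(ℝ, E)) (I' := 𝓘(ℝ, E')) (I'' := 𝓘(ℝ, E'')) hf
  refine hasVelocity_of_hasMFDerivAt h2 ?_
  rw [e]
  change (mfderiv 𝓘(ℝ, E) 𝓘(ℝ, E'') (fun z => f (z, b t)) (a t) : E →L[ℝ] E'')
      ((1 : ℝ) • v) + (mfderiv 𝓘(ℝ, E') 𝓘(ℝ, E'') (fun z => f (a t, z)) (b t) : E' →L[ℝ] E'')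
      ((1 : ℝ) • w) = _
  simp

theorem hasVelocity_partial₁ {S : ℝ × ℝ → N} (hS : ContMDiff 𝓘(ℝ, ℝ × ℝ) 𝓘(ℝ, E) ∞ S) (s t : ℝ) :
    HasVelocity E (fun s => S (s, t)) s (partial₁ E S (s, t)) := by
  have h1 : HasFDerivAt (fun s : ℝ => (s, t)) (ContinuousLinearMap.inl ℝ ℝ ℝ) s :=
    hasFDerivAt_prodMk_left s t
  have hg := (hS.mdifferentiableAt (x := (s, t)) (by simp)).hasMFDerivAt
  have h2 := HasMFDerivAt.comp (I' := 𝓘(ℝ, ℝ × ℝ)) (g := S) (f := fun s => (s, t)) s hg h1.hasMFDerivAt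
  exact hasVelocity_of_hasMFDerivAt h2 rfl

theorem hasVelocity_partial₂ {S : ℝ × ℝ → N} (hS : ContMDiff 𝓘(ℝ, ℝ × ℝ) 𝓘(ℝ, E) ∞ S) (s t : ℝ) :
    HasVelocity E (fun t => S (s, t)) t (partial₂ E S (s, t)) := by
  have h1 : HasFDerivAt (fun t : ℝ => (s, t)) (ContinuousLinearMap.inr ℝ ℝ ℝ) t :=
    hasFDerivAt_prodMk_right s t
  have hg := (hS.mdifferentiableAt (x := (s, t)) (by simp)).hasMFDerivAt
  have h2 := HasMFDerivAt.comp (I' := 𝓘(ℝ, ℝ × ℝ)) (g := S) (f := fun t => (s, t)) t hg h1.hasMFDerivAt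
  exact hasVelocity_of_hasMFDerivAt h2 rfl

/-! ### Charts -/

variable [IsManifold 𝓘(ℝ, E) ∞ N] [IsManifold 𝓘(ℝ, E') ∞ N']

theorem mdifferentiableAt_extChart {p q : N} (hq : q ∈ (extChartAt 𝓘(ℝ, E) p).source) :
    MDifferentiableAt 𝓘(ℝ, E) 𝓘(ℝ, E) (extChartAt 𝓘(ℝ, E) p) q := by
  rw [extChartAt_source] at hq
  exact (contMDiffAt_extChartAt' (n := ∞) hq).mdifferentiableAt (by simp)

theorem contMDiffAt_extChart_symm {p : N} {x : E} (hx : x ∈ (extChartAt 𝓘(ℝ, E) p).target) :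
    ContMDiffAt 𝓘(ℝ, E) 𝓘(ℝ, E) ∞ (extChartAt 𝓘(ℝ, E) p).symm x :=
  (contMDiffOn_extChartAt_symm p).contMDiffAt
    ((isOpen_extChartAt_target (I := 𝓘(ℝ, E)) p).mem_nhds hx)

/-- Tangent spaces are modelled on `E` through the preferred chart at the base point, so at that
point coordinate velocities and velocities coincide. -/
theorem chartSymmDeriv_self (p : N) :
    (chartSymmDeriv p (extChartAt 𝓘(ℝ, E) p p) : E →L[ℝ] E) = ContinuousLinearMap.id ℝ E := by
  have h := mfderivWithin_range_extChartAt_symm (I := 𝓘(ℝ, E)) (x := p)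
  rw [ModelWithCorners.range_eq_univ, mfderivWithin_univ] at h
  exact h

theorem hasMFDerivAt_extChart_symm {p : N} {x : E} (hx : x ∈ (extChartAt 𝓘(ℝ, E) p).target) :
    HasMFDerivAt 𝓘(ℝ, E) 𝓘(ℝ, E) (extChartAt 𝓘(ℝ, E) p).symm x (chartSymmDeriv p x) :=
  ((contMDiffAt_extChart_symm hx).mdifferentiableAt (by simp)).hasMFDerivAt

theorem HasVelocity.hasDerivAt_extChart {c : ℝ → N} {t : ℝ} {v : E} (hc : HasVelocity E c t v)
    {p : N} (hp : c t ∈ (extChartAt 𝓘(ℝ, E) p).source) :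
    HasDerivAt (fun t => extChartAt 𝓘(ℝ, E) p (c t))
      ((mfderiv 𝓘(ℝ, E) 𝓘(ℝ, E) (extChartAt 𝓘(ℝ, E) p) (c t) : E →L[ℝ] E) v) t :=
  hasVelocity_iff_hasDerivAt.1 (hc.mdifferentiableAt_comp (mdifferentiableAt_extChart hp))

theorem HasVelocity.hasDerivAt_extChart_self {c : ℝ → N} {t : ℝ} {v : E} (hc : HasVelocity E c t v)
    {p : N} (hp : c t = p) :
    HasDerivAt (fun t => extChartAt 𝓘(ℝ, E) p (c t)) v t := by
  subst hp
  have h := hc.hasDerivAt_extChart (mem_extChartAt_source (I := 𝓘(ℝ, E)) (c t))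
  rw [mfderiv_extChartAt_self] at h
  exact h

theorem hasVelocity_extChart_symm {y : ℝ → E} {t : ℝ} {v : E} (hy : HasDerivAt y v t) {p : N}
    (hp : y t ∈ (extChartAt 𝓘(ℝ, E) p).target) :
    HasVelocity E (fun t => (extChartAt 𝓘(ℝ, E) p).symm (y t)) t
      ((chartSymmDeriv p (y t) : E →L[ℝ] E) v) :=
  (hasVelocity_iff_hasDerivAt.2 hy).hasMFDerivAt_comp (hasMFDerivAt_extChart_symm hp)

theorem hasVelocity_of_hasDerivAt_extChart {c : ℝ → N} {t : ℝ} {v : E} {p : N} (hp : c t = p)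
    (hcont : ContinuousAt c t)
    (h : HasDerivAt (fun t => extChartAt 𝓘(ℝ, E) p (c t)) v t) : HasVelocity E c t v := by
  subst hp
  have h1 := hasVelocity_extChart_symm h (p := c t) (mem_extChartAt_target (I := 𝓘(ℝ, E)) (c t))
  rw [chartSymmDeriv_self] at h1
  refine HasVelocity.congr (v := v) h1 ?_
  filter_upwards [hcont.preimage_mem_nhds (extChartAt_source_mem_nhds (I := 𝓘(ℝ, E)) (c t))] with r hr
  exact ((extChartAt 𝓘(ℝ, E) (c t)).left_inv hr).symm

theorem eventually_eq_of_velocity_zero {c : ℝ → N} {t : ℝ}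
    (h : ∀ᶠ r in 𝓝 t, HasVelocity E c r 0) : ∀ᶠ r in 𝓝 t, c r = c t := by
  have hcont := h.self_of_nhds.continuousAt
  have hs := hcont.preimage_mem_nhds (extChartAt_source_mem_nhds (I := 𝓘(ℝ, E)) (c t))
  obtain ⟨ε, hε, hball⟩ := Metric.eventually_nhds_iff_ball.1 (h.and hs)
  have hd : ∀ r ∈ Metric.ball t ε,
      HasDerivAt (fun r => extChartAt 𝓘(ℝ, E) (c t) (c r)) (0 : E) r := by
    intro r hr
    have := (hball r hr).1.hasDerivAt_extChart (hball r hr).2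
    exact (ContinuousLinearMap.map_zero (mfderiv 𝓘(ℝ, E) 𝓘(ℝ, E) (extChartAt 𝓘(ℝ, E) (c t)) (c r) : E →L[ℝ] E)) ▸ this
  filter_upwards [Metric.ball_mem_nhds t hε] with r hr
  have e := (convex_ball t ε).is_const_of_fderivWithin_eq_zero (𝕜 := ℝ)
    (f := fun r => extChartAt 𝓘(ℝ, E) (c t) (c r))
    (fun r hr => (hd r hr).differentiableAt.differentiableWithinAt)
    (fun r hr => by
      rw [fderivWithin_of_isOpen Metric.isOpen_ball hr]
      have := (hd r hr).hasFDerivAt.fderiv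
      rw [this]
      exact ContinuousLinearMap.ext_ring (by simp))
    hr (Metric.mem_ball_self hε)
  exact (extChartAt 𝓘(ℝ, E) (c t)).injOn (hball r hr).2 (mem_extChartAt_source _) e

theorem eq_of_velocity_zero {c : ℝ → N} {s : Set ℝ} (hs : IsOpen s) (hs' : IsPreconnected s)
    (h : ∀ t ∈ s, HasVelocity E c t 0) {a b : ℝ} (ha : a ∈ s) (hb : b ∈ s) : c a = c b := by
  have : PreconnectedSpace s := isPreconnected_iff_preconnectedSpace.1 hs'
  have hl : IsLocallyConstant (s.domRestrict c) := by
    refine (IsLocallyConstant.iff_eventually_eq _).2 fun x => ?_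
    have h1 : ∀ᶠ r in 𝓝 (x : ℝ), c r = c x := eventually_eq_of_velocity_zero
      (by filter_upwards [hs.mem_nhds x.2] with r hr using h r hr)
    exact (continuous_subtype_val.tendsto x).eventually h1
  exact hl.apply_eq_of_preconnectedSpace ⟨a, ha⟩ ⟨b, hb⟩

/-- Solutions built on the closed unit interval are only known to be differentiable in its interior;
continuity and the Hausdorff property carry constancy over to the end points. -/
theorem eq_of_velocity_zero_Icc [T2Space N] {c : ℝ → N} (hcont : ContinuousOn c (Set.Icc 0 1))
    (h : ∀ t ∈ Set.Ioo (0 : ℝ) 1, HasVelocity E c t 0) : c 1 = c 0 := by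
  have hm : (1 / 2 : ℝ) ∈ Set.Ioo (0 : ℝ) 1 := by norm_num
  have h1 : Set.EqOn c (fun _ => c (1 / 2)) (Set.Ioo 0 1) := fun t ht =>
    eq_of_velocity_zero isOpen_Ioo isPreconnected_Ioo h ht hm
  have h2 : Set.EqOn c (fun _ => c (1 / 2)) (Set.Icc 0 1) :=
    h1.of_subset_closure hcont continuousOn_const Set.Ioo_subset_Icc_self
      (closure_Ioo (zero_ne_one (α := ℝ))).ge
  exact (h2 (Set.right_mem_Icc.2 zero_le_one)).trans (h2 (Set.left_mem_Icc.2 zero_le_one)).symm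

end Velocity

/-! ### Globally defined parametrizations, and smoothness tested on families. -/

section Parametrizations

variable {E : Type*} [NormedAddCommGroup E] [NormedSpace ℝ E] [FiniteDimensional ℝ E]
  {N : Type*} [TopologicalSpace N] [ChartedSpace E N]
  {W : Type*} [NormedAddCommGroup W] [NormedSpace ℝ W] [FiniteDimensional ℝ W]

/-- Take `κ y = x + χ(y)(y - x)` with a bump function `χ` at `x`: the displacement is kept near `x`
and shrunk so as to remain in `O`. Composition with `κ` turns maps that are smooth only near `x`
into globally smooth maps with the same germ at `x`. -/
theorem exists_smooth_cutoff (x : E) {O : Set E} (hO : O ∈ 𝓝 x) :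
    ∃ κ : E → E, ContDiff ℝ ∞ κ ∧ (∀ᶠ y in 𝓝 x, κ y = y) ∧ ∀ y, κ y ∈ O := by
  obtain ⟨ε, hε, hball⟩ := Metric.mem_nhds_iff.1 hO
  let χ : ContDiffBump x := ⟨ε / 2, ε, by positivity, by linarith⟩
  refine ⟨fun y => x + χ y • (y - x), ?_, ?_, ?_⟩
  · exact contDiff_const.add (χ.contDiff.smul (contDiff_id.sub contDiff_const))
  · filter_upwards [χ.eventuallyEq_one] with y hy
    rw [hy]; simp
  · intro y
    apply hball
    rw [Metric.mem_ball, dist_eq_norm, add_sub_cancel_left, norm_smul,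
      Real.norm_of_nonneg χ.nonneg]
    by_cases hy : y ∈ Metric.ball x ε
    · rw [Metric.mem_ball, dist_eq_norm] at hy
      exact (mul_le_of_le_one_left (norm_nonneg _) χ.le_one).trans_lt hy
    · have : χ y = 0 := χ.zero_of_le_dist (not_lt.1 hy)
      rw [this, zero_mul]; exact hε

variable [IsManifold 𝓘(ℝ, E) ∞ N]

theorem exists_chart_param (p : N) {x : E} (hx : x ∈ (extChartAt 𝓘(ℝ, E) p).target) {O : Set N}
    (hO : O ∈ 𝓝 ((extChartAt 𝓘(ℝ, E) p).symm x)) :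
    ∃ Ψ : E → N, ContMDiff 𝓘(ℝ, E) 𝓘(ℝ, E) ∞ Ψ ∧
      (∀ᶠ y in 𝓝 x, Ψ y = (extChartAt 𝓘(ℝ, E) p).symm y) ∧ ∀ y, Ψ y ∈ O := by
  have hc := contMDiffAt_extChart_symm hx
  obtain ⟨κ, hκ, hκx, hκO⟩ := exists_smooth_cutoff x
    (Filter.inter_mem ((isOpen_extChartAt_target (I := 𝓘(ℝ, E)) p).mem_nhds hx)
      (hc.continuousAt.preimage_mem_nhds hO))
  refine ⟨fun y => (extChartAt 𝓘(ℝ, E) p).symm (κ y), fun y => ?_, ?_, fun y => (hκO y).2⟩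
  · exact (contMDiffAt_extChart_symm (hκO y).1).comp y hκ.contMDiff.contMDiffAt
  · filter_upwards [hκx] with y hy
    rw [hy]

/-- A parametrization of a neighbourhood of `p` whose differential is the identity. -/
theorem exists_param (p : N) {O : Set N} (hO : O ∈ 𝓝 p) :
    ∃ Ψ : E → N, ContMDiff 𝓘(ℝ, E) 𝓘(ℝ, E) ∞ Ψ ∧
      (∀ᶠ y in 𝓝 (extChartAt 𝓘(ℝ, E) p p), Ψ y = (extChartAt 𝓘(ℝ, E) p).symm y) ∧ ∀ y, Ψ y ∈ O :=
  exists_chart_param p (mem_extChartAt_target (I := 𝓘(ℝ, E)) p)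
    (by rwa [extChartAt_to_inv])

theorem exists_curve (p : N) (v : E) : ∃ c : ℝ → N, ContMDiff 𝓘(ℝ, ℝ) 𝓘(ℝ, E) ∞ c ∧ c 0 = p ∧
    HasVelocity E c 0 v := by
  obtain ⟨Ψ, hΨ, hΨe, -⟩ := exists_param (E := E) p (O := Set.univ) Filter.univ_mem
  set x := extChartAt 𝓘(ℝ, E) p p with hx
  have h0 : Ψ x = p := by rw [hΨe.self_of_nhds, hx, extChartAt_to_inv]
  refine ⟨fun t => Ψ (x + t • v), ?_, by simpa using h0, ?_⟩
  · exact hΨ.comp (ContDiff.contMDiff (by fun_prop))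
  · have hd : HasDerivAt (fun t : ℝ => x + t • v) v 0 := by
      simpa using ((hasDerivAt_id (0 : ℝ)).smul_const v).const_add x
    refine HasVelocity.congr (v := v) (c := fun t => (extChartAt 𝓘(ℝ, E) p).symm (x + t • v)) ?_ ?_
    · have := hasVelocity_extChart_symm (p := p) hd (by
        rw [zero_smul, add_zero]; exact mem_extChartAt_target (I := 𝓘(ℝ, E)) p)
      rw [zero_smul, add_zero, chartSymmDeriv_self] at this
      exact this
    · have hc : ContinuousAt (fun t : ℝ => x + t • v) 0 := hd.continuousAt
      have hΨe' : ∀ᶠ y in 𝓝 (x + (0 : ℝ) • v), Ψ y = (extChartAt 𝓘(ℝ, E) p).symm y := by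
        simpa using hΨe
      exact hc.eventually hΨe'

variable {E' : Type*} [NormedAddCommGroup E'] [NormedSpace ℝ E']
  {N' : Type*} [TopologicalSpace N'] [ChartedSpace E' N'] 

/-- Smoothness can be tested on smooth families. -/
theorem contMDiffAt_of_families {f : N → N'} {p : N} {O : Set N} (hO : O ∈ 𝓝 p)
    (h : ∀ q : Param (Module.finrank ℝ E) → N, ContMDiff 𝓘(ℝ, Param (Module.finrank ℝ E)) 𝓘(ℝ, E) ∞ q →
      (∀ u, q u ∈ O) → ContMDiff 𝓘(ℝ, Param (Module.finrank ℝ E)) 𝓘(ℝ, E') ∞ (fun u => f (q u))) :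
    ContMDiffAt 𝓘(ℝ, E) 𝓘(ℝ, E') ∞ f p := by
  obtain ⟨Ψ, hΨ, hΨe, hΨO⟩ := exists_param (E := E) p hO
  -- The admissible test families are indexed by Euclidean spaces, hence the passage through
  -- `toEuclidean`. Near `p` the chart inverts the parametrization and recovers `f` itself.
  have h1 := h (fun u => Ψ ((toEuclidean (E := E)).symm u))
    (hΨ.comp (toEuclidean (E := E)).symm.contDiff.contMDiff) (fun u => hΨO _)
  have h2 : ContMDiffAt 𝓘(ℝ, E) 𝓘(ℝ, E') ∞ (fun q => f (Ψ ((toEuclidean (E := E)).symm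
      (toEuclidean (E := E) (extChartAt 𝓘(ℝ, E) p q))))) p := by
    have h3 : ContMDiffAt 𝓘(ℝ, E) 𝓘(ℝ, Param (Module.finrank ℝ E)) ∞
        (fun q => toEuclidean (E := E) (extChartAt 𝓘(ℝ, E) p q)) p :=
      ContMDiffAt.comp p (toEuclidean (E := E)).contDiff.contMDiff.contMDiffAt
        (contMDiffAt_extChartAt (I := 𝓘(ℝ, E)) (x := p))
    exact ContMDiffAt.comp (g := fun u => f (Ψ ((toEuclidean (E := E)).symm u))) p (h1 _) h3
  refine h2.congr_of_eventuallyEq ?_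
  have hcont : ContinuousAt (extChartAt 𝓘(ℝ, E) p) p := continuousAt_extChartAt p
  filter_upwards [hcont.eventually hΨe, extChartAt_source_mem_nhds (I := 𝓘(ℝ, E)) p] with q hq hq'
  rw [ContinuousLinearEquiv.symm_apply_apply, hq, (extChartAt 𝓘(ℝ, E) p).left_inv hq']

end Parametrizations

/-! ### Pullbacks of forms to vector spaces. -/

section Forms

variable {E : Type*} [NormedAddCommGroup E] [NormedSpace ℝ E]
  {N : Type*} [TopologicalSpace N] [ChartedSpace E N]
  {V : Type*} [NormedAddCommGroup V] [NormedSpace ℝ V]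
  {W : Type*} [NormedAddCommGroup W] [NormedSpace ℝ W]

/-- The pullback of a 1-form to a vector space. -/
def OneForm.pullback (φ : OneForm E N V) (S : W → N) (z : W) : W →L[ℝ] V :=
  (φ (S z) : E →L[ℝ] V).comp (mfderiv 𝓘(ℝ, W) 𝓘(ℝ, E) S z : W →L[ℝ] E)

theorem OneForm.congr_point (φ : OneForm E N V) {p q : N} (h : p = q) :
    (φ p : E →L[ℝ] V) = (φ q : E →L[ℝ] V) := by subst h; rfl

theorem TwoForm.congr_point (φ : TwoForm E N V) {p q : N} (h : p = q) :
    (φ p : E [⋀^Fin 2]→L[ℝ] V) = (φ q : E [⋀^Fin 2]→L[ℝ] V) := by subst h; rfl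

variable [IsManifold 𝓘(ℝ, E) ∞ N]

theorem contDiffAt_chart_comp {S : W → N} {z : W}
    (hS : ContMDiffAt 𝓘(ℝ, W) 𝓘(ℝ, E) ∞ S z) {p : N} (hp : S z ∈ (extChartAt 𝓘(ℝ, E) p).source) :
    ContDiffAt ℝ ∞ (fun z => extChartAt 𝓘(ℝ, E) p (S z)) z := by
  rw [extChartAt_source] at hp
  exact ((contMDiffAt_extChartAt' (n := ∞) hp).comp z hS).contDiffAt

theorem mfderiv_eq_chart {S : W → N} (hS : ContMDiff 𝓘(ℝ, W) 𝓘(ℝ, E) ∞ S) {p : N} {z : W}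
    (hp : S z ∈ (extChartAt 𝓘(ℝ, E) p).source) :
    (mfderiv 𝓘(ℝ, W) 𝓘(ℝ, E) S z : W →L[ℝ] E) =
      (chartSymmDeriv p (extChartAt 𝓘(ℝ, E) p (S z)) : E →L[ℝ] E).comp
        (fderiv ℝ (fun z => extChartAt 𝓘(ℝ, E) p (S z)) z) := by
  have h1 := (contDiffAt_chart_comp (hS z) hp).differentiableAt (by simp)
  have h2 := HasMFDerivAt.comp z
    (hasMFDerivAt_extChart_symm ((extChartAt 𝓘(ℝ, E) p).map_source hp)) h1.hasFDerivAt.hasMFDerivAt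
  have h3 : HasMFDerivAt 𝓘(ℝ, W) 𝓘(ℝ, E) S z _ := h2.congr_of_eventuallyEq (by
    filter_upwards [hS.continuous.continuousAt.preimage_mem_nhds
      ((isOpen_extChartAt_source (I := 𝓘(ℝ, E)) p).mem_nhds hp)] with w hw
    exact ((extChartAt 𝓘(ℝ, E) p).left_inv hw).symm)
  exact h3.mfderiv

theorem OneForm.pullback_eq_chart (φ : OneForm E N V) {S : W → N}
    (hS : ContMDiff 𝓘(ℝ, W) 𝓘(ℝ, E) ∞ S) {p : N} {z : W}
    (hp : S z ∈ (extChartAt 𝓘(ℝ, E) p).source) :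
    φ.pullback S z = (φ.inChart p (extChartAt 𝓘(ℝ, E) p (S z))).comp
      (fderiv ℝ (fun z => extChartAt 𝓘(ℝ, E) p (S z)) z) := by
  have h := φ.congr_point ((extChartAt 𝓘(ℝ, E) p).left_inv hp)
  unfold OneForm.pullback OneForm.inChart
  rw [mfderiv_eq_chart hS hp, ← h]
  rfl

theorem OneForm.pullback_eventuallyEq_chart (φ : OneForm E N V) {S : W → N}
    (hS : ContMDiff 𝓘(ℝ, W) 𝓘(ℝ, E) ∞ S) {p : N} {z : W}
    (hp : S z ∈ (extChartAt 𝓘(ℝ, E) p).source) :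
    φ.pullback S =ᶠ[𝓝 z] fun z => (φ.inChart p (extChartAt 𝓘(ℝ, E) p (S z))).comp
      (fderiv ℝ (fun z => extChartAt 𝓘(ℝ, E) p (S z)) z) := by
  filter_upwards [hS.continuous.continuousAt.preimage_mem_nhds
    ((isOpen_extChartAt_source (I := 𝓘(ℝ, E)) p).mem_nhds hp)] with w hw
  exact φ.pullback_eq_chart hS hw

omit [IsManifold 𝓘(ℝ, E) ∞ N] in
theorem OneForm.IsSmooth.contDiffAt_inChart {φ : OneForm E N V} (hφ : φ.IsSmooth) {p q : N}
    (hp : q ∈ (extChartAt 𝓘(ℝ, E) p).source) :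
    ContDiffAt ℝ ∞ (φ.inChart p) (extChartAt 𝓘(ℝ, E) p q) :=
  (hφ p).contDiffAt ((isOpen_extChartAt_target (I := 𝓘(ℝ, E)) p).mem_nhds
    ((extChartAt 𝓘(ℝ, E) p).map_source hp))

theorem OneForm.IsSmooth.contDiff_pullback {φ : OneForm E N V} (hφ : φ.IsSmooth) {S : W → N}
    (hS : ContMDiff 𝓘(ℝ, W) 𝓘(ℝ, E) ∞ S) : ContDiff ℝ ∞ (φ.pullback S) := by
  refine contDiff_iff_contDiffAt.2 fun z => ?_
  have hp : S z ∈ (extChartAt 𝓘(ℝ, E) (S z)).source := mem_extChartAt_source _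
  refine ContDiffAt.congr_of_eventuallyEq ?_ (φ.pullback_eventuallyEq_chart hS hp)
  have h1 := contDiffAt_chart_comp (hS z) hp
  refine ContDiffAt.clm_comp (ContDiffAt.comp (g := φ.inChart (S z)) z (hφ.contDiffAt_inChart hp) h1) ?_
  exact h1.fderiv_right (by norm_cast)

/-- In the chart at `S z` the derivative of the pullback has one term from the coefficients, which
gives `d`, and one term with the second derivative of the coordinate expression of `S`, which is
symmetric and cancels. -/
theorem OneForm.IsSmooth.d_pullback {φ : OneForm E N V} (hφ : φ.IsSmooth) {S : W → N}
    (hS : ContMDiff 𝓘(ℝ, W) 𝓘(ℝ, E) ∞ S) (z u v : W) :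
    fderiv ℝ (φ.pullback S) z u v - fderiv ℝ (φ.pullback S) z v u =
      φ.d (S z) ((mfderiv 𝓘(ℝ, W) 𝓘(ℝ, E) S z : W →L[ℝ] E) u)
        ((mfderiv 𝓘(ℝ, W) 𝓘(ℝ, E) S z : W →L[ℝ] E) v) := by
  have hp : S z ∈ (extChartAt 𝓘(ℝ, E) (S z)).source := mem_extChartAt_source _
  have h1 := contDiffAt_chart_comp (hS z) hp
  set x : W → E := fun w => extChartAt 𝓘(ℝ, E) (S z) (S w) with hx
  have h3 : ContDiffAt ℝ ∞ (fderiv ℝ x) z := h1.fderiv_right (by norm_cast)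
  have h4 : HasFDerivAt (fun w => φ.inChart (S z) (x w)) _ z :=
    HasFDerivAt.comp (g := φ.inChart (S z)) z
      ((hφ.contDiffAt_inChart hp).differentiableAt (by simp)).hasFDerivAt
      (h1.differentiableAt (by simp)).hasFDerivAt
  have h5 := h4.clm_comp (h3.differentiableAt (by simp)).hasFDerivAt
  have h6 := (h5.congr_of_eventuallyEq (φ.pullback_eventuallyEq_chart hS hp)).fderiv
  have hsymm : fderiv ℝ (fderiv ℝ x) z u v = fderiv ℝ (fderiv ℝ x) z v u :=
    (h1.isSymmSndFDerivAt (by simp; norm_cast)).eq u v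
  have h7 : (mfderiv 𝓘(ℝ, W) 𝓘(ℝ, E) S z : W →L[ℝ] E) = fderiv ℝ x z := by
    rw [mfderiv_eq_chart hS hp, chartSymmDeriv_self]
    rfl
  rw [h6, h7]
  simp only [OneForm.d, add_apply, ContinuousLinearMap.comp_apply,
    ContinuousLinearMap.compL_apply, ContinuousLinearMap.flip_apply, hsymm]
  abel

theorem TwoForm.IsSmooth.continuous_pullback {η : TwoForm E N V} (hη : η.IsSmooth) {S : W → N}
    (hS : ContMDiff 𝓘(ℝ, W) 𝓘(ℝ, E) ∞ S) (u v : W) :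
    Continuous (fun z => (η (S z) : E [⋀^Fin 2]→L[ℝ] V)
      ![(mfderiv 𝓘(ℝ, W) 𝓘(ℝ, E) S z : W →L[ℝ] E) u, (mfderiv 𝓘(ℝ, W) 𝓘(ℝ, E) S z : W →L[ℝ] E) v]) := by
  refine continuous_iff_continuousAt.2 fun z => ?_
  have hp : S z ∈ (extChartAt 𝓘(ℝ, E) (S z)).source := mem_extChartAt_source _
  set x : W → E := fun w => extChartAt 𝓘(ℝ, E) (S z) (S w) with hx
  have h1 : ContDiffAt ℝ ∞ x z := contDiffAt_chart_comp (hS z) hp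
  have h3 : ContinuousAt (fderiv ℝ x) z :=
    (h1.fderiv_right (m := ∞) (by norm_cast)).continuousAt
  have h4 : ContinuousAt (fun w => TwoForm.inChart η (S z) (x w)) z :=
    ContinuousAt.comp (f := x) (g := TwoForm.inChart η (S z)) (((hη (S z)).contDiffAt ((isOpen_extChartAt_target (I := 𝓘(ℝ, E)) (S z)).mem_nhds
    ((extChartAt 𝓘(ℝ, E) (S z)).map_source hp))).continuousAt) h1.continuousAt
  have h5 : ContinuousAt (fun w => TwoForm.inChart η (S z) (x w) ![fderiv ℝ x w u, fderiv ℝ x w v]) z := by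
    have h6 : ContinuousAt (fun w => (![fderiv ℝ x w u, fderiv ℝ x w v] : Fin 2 → E)) z := by
      refine continuousAt_pi.2 fun i => ?_
      fin_cases i
      · exact h3.clm_apply continuousAt_const
      · exact h3.clm_apply continuousAt_const
    exact h4.eval h6
  refine h5.congr ?_
  filter_upwards [hS.continuous.continuousAt.preimage_mem_nhds
    ((isOpen_extChartAt_source (I := 𝓘(ℝ, E)) (S z)).mem_nhds hp)] with w hw
  have h := η.congr_point ((extChartAt 𝓘(ℝ, E) (S z)).left_inv hw)
  rw [mfderiv_eq_chart hS hw, ← h]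
  unfold TwoForm.inChart
  change (η _ : E [⋀^Fin 2]→L[ℝ] V) _ = (η _ : E [⋀^Fin 2]→L[ℝ] V) _
  congr 1
  funext i
  fin_cases i <;> rfl

end Forms

/-! ### Right logarithmic derivatives of curves in Lie groups. -/

section LogDeriv

variable {E : Type*} [NormedAddCommGroup E] [NormedSpace ℝ E]
  {K : Type*} [TopologicalSpace K] [ChartedSpace E K] [Group K]

/-- The curve `h` in the Lie group `K` has right logarithmic derivative `ξ` at `t`, that is,
`h' = ξ h`. -/
def HasLogDeriv (h : ℝ → K) (t : ℝ) (ξ : E) : Prop := HasVelocity E h t (rightTranslate (E := E) ξ (h t))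

/-- The right Maurer-Cartan form. -/
def maurerCartan (E : Type*) [NormedAddCommGroup E] [NormedSpace ℝ E]
    (K : Type*) [TopologicalSpace K] [ChartedSpace E K] [Group K] : OneForm E K E :=
  fun h => (mfderiv 𝓘(ℝ, E) 𝓘(ℝ, E) (fun x : K => x * h⁻¹) h : E →L[ℝ] E)

theorem rightTranslate_add (v w : E) (h : K) :
    rightTranslate (E := E) (v + w) h = rightTranslate (E := E) v h + rightTranslate (E := E) w h :=
  ContinuousLinearMap.map_add (mfderiv 𝓘(ℝ, E) 𝓘(ℝ, E) (fun x : K => x * h) 1) v w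

theorem rightTranslate_smul (r : ℝ) (v : E) (h : K) :
    rightTranslate (E := E) (r • v) h = r • rightTranslate (E := E) v h :=
  ContinuousLinearMap.map_smul (mfderiv 𝓘(ℝ, E) 𝓘(ℝ, E) (fun x : K => x * h) 1) r v

theorem rightTranslate_zero (h : K) : rightTranslate (E := E) (0 : E) h = 0 :=
  ContinuousLinearMap.map_zero (mfderiv 𝓘(ℝ, E) 𝓘(ℝ, E) (fun x : K => x * h) 1)

theorem rightTranslate_one (v : E) : rightTranslate (E := E) v (1 : K) = v := by
  unfold rightTranslate
  have : (fun x : K => x * 1) = fun x => x := by funext x; rw [mul_one]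
  rw [this]
  have h := mfderiv_id (I := 𝓘(ℝ, E)) (x := (1 : K))
  exact congrArg (fun L : E →L[ℝ] E => L v) h

variable [LieGroup 𝓘(ℝ, E) ∞ K]

theorem mdiff_mul_right (k h : K) : MDifferentiableAt 𝓘(ℝ, E) 𝓘(ℝ, E) (fun x : K => x * k) h :=
  (contMDiff_mul_right (I := 𝓘(ℝ, E)) (n := ∞) (a := k)).mdifferentiableAt (by simp)

theorem mdiff_mul_left (k h : K) : MDifferentiableAt 𝓘(ℝ, E) 𝓘(ℝ, E) (fun x : K => k * x) h :=
  (contMDiff_mul_left (I := 𝓘(ℝ, E)) (n := ∞) (a := k)).mdifferentiableAt (by simp)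

theorem mdiff_conj (k h : K) :
    MDifferentiableAt 𝓘(ℝ, E) 𝓘(ℝ, E) (fun x : K => k * x * k⁻¹) h :=
  MDifferentiableAt.comp (I' := 𝓘(ℝ, E)) h (mdiff_mul_right k⁻¹ (k * h)) (mdiff_mul_left k h)

theorem mfderiv_mul_right_comp (h k g : K) (v : E) :
    (mfderiv 𝓘(ℝ, E) 𝓘(ℝ, E) (fun x : K => x * k) (g * h) : E →L[ℝ] E)
      ((mfderiv 𝓘(ℝ, E) 𝓘(ℝ, E) (fun x : K => x * h) g : E →L[ℝ] E) v) =
      (mfderiv 𝓘(ℝ, E) 𝓘(ℝ, E) (fun x : K => x * (h * k)) g : E →L[ℝ] E) v := by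
  have e : (fun x : K => x * (h * k)) = (fun x : K => x * k) ∘ (fun x : K => x * h) := by
    funext x; simp [mul_assoc]
  rw [e, mfderiv_comp (I' := 𝓘(ℝ, E)) g (mdiff_mul_right k (g * h)) (mdiff_mul_right h g)]
  rfl

theorem mfderiv_mul_right_rightTranslate (v : E) (h k : K) :
    (mfderiv 𝓘(ℝ, E) 𝓘(ℝ, E) (fun x : K => x * k) h : E →L[ℝ] E) (rightTranslate (E := E) v h) =
      rightTranslate (E := E) v (h * k) := by
  have := mfderiv_mul_right_comp h k 1 v
  rw [one_mul] at this
  exact this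

theorem maurerCartan_rightTranslate (v : E) (h : K) :
    (maurerCartan E K h : E →L[ℝ] E) (rightTranslate (E := E) v h) = v := by
  have := mfderiv_mul_right_rightTranslate v h h⁻¹
  rw [mul_inv_cancel, rightTranslate_one] at this
  exact this

theorem rightTranslate_maurerCartan (h : K) (v : E) :
    rightTranslate (E := E) ((maurerCartan E K h : E →L[ℝ] E) v) h = v := by
  have := mfderiv_mul_right_comp h⁻¹ h h v
  rw [mul_inv_cancel, inv_mul_cancel] at this
  exact this.trans (rightTranslate_one_at h v)
where
  rightTranslate_one_at (h : K) (v : E) :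
      (mfderiv 𝓘(ℝ, E) 𝓘(ℝ, E) (fun x : K => x * 1) h : E →L[ℝ] E) v = v := by
    have : (fun x : K => x * 1) = fun x => x := by funext x; rw [mul_one]
    rw [this]
    have h := mfderiv_id (I := 𝓘(ℝ, E)) (x := h)
    exact congrArg (fun L : E →L[ℝ] E => L v) h

theorem HasVelocity.hasLogDeriv {h : ℝ → K} {t : ℝ} {v : E} (hv : HasVelocity E h t v) :
    HasLogDeriv h t ((maurerCartan E K (h t) : E →L[ℝ] E) v) := by
  unfold HasLogDeriv
  rw [rightTranslate_maurerCartan]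
  exact hv

theorem HasLogDeriv.unique {h : ℝ → K} {t : ℝ} {ξ η : E} (h1 : HasLogDeriv h t ξ)
    (h2 : HasLogDeriv h t η) : ξ = η := by
  rw [← maurerCartan_rightTranslate ξ (h t), HasVelocity.unique h1 h2, maurerCartan_rightTranslate]

omit [LieGroup 𝓘(ℝ, E) ∞ K] in
theorem hasLogDeriv_iff_of_eq_one {h : ℝ → K} {t : ℝ} {ξ : E} (h1 : h t = 1) :
    HasLogDeriv h t ξ ↔ HasVelocity E h t ξ := by
  unfold HasLogDeriv
  rw [h1, rightTranslate_one]

omit [LieGroup 𝓘(ℝ, E) ∞ K] in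
theorem HasLogDeriv.congr {h k : ℝ → K} {t : ℝ} {ξ : E} (h1 : HasLogDeriv h t ξ)
    (hk : k =ᶠ[𝓝 t] h) : HasLogDeriv k t ξ := by
  unfold HasLogDeriv
  rw [hk.self_of_nhds]
  exact HasVelocity.congr h1 hk

omit [LieGroup 𝓘(ℝ, E) ∞ K] in
theorem HasLogDeriv.continuousAt {h : ℝ → K} {t : ℝ} {ξ : E} (h1 : HasLogDeriv h t ξ) :
    ContinuousAt h t := HasVelocity.continuousAt h1

omit [LieGroup 𝓘(ℝ, E) ∞ K] in
theorem hasLogDeriv_const (k : K) (t : ℝ) : HasLogDeriv (fun _ => k) t (0 : E) := by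
  unfold HasLogDeriv
  rw [rightTranslate_zero]
  exact hasVelocity_const k t

theorem HasLogDeriv.mul_right {h : ℝ → K} {t : ℝ} {ξ : E} (h1 : HasLogDeriv h t ξ) (k : K) :
    HasLogDeriv (fun t => h t * k) t ξ := by
  have := HasVelocity.mdifferentiableAt_comp h1 (mdiff_mul_right k (h t))
  rw [mfderiv_mul_right_rightTranslate] at this
  exact this

omit [LieGroup 𝓘(ℝ, E) ∞ K] in
theorem HasLogDeriv.comp_real {h : ℝ → K} {f : ℝ → ℝ} {t r : ℝ} {ξ : E}
    (hh : HasLogDeriv h (f t) ξ) (hf : HasDerivAt f r t) :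
    HasLogDeriv (fun t => h (f t)) t (r • ξ) := by
  have := HasVelocity.comp_real (c := h) hh hf
  unfold HasLogDeriv
  rw [rightTranslate_smul]
  exact this

/-- This is the derivative of `k (x h) = (k x k⁻¹)(k h)` at `x = 1`. -/
theorem mfderiv_mul_left_rightTranslate (v : E) (k h : K) :
    (mfderiv 𝓘(ℝ, E) 𝓘(ℝ, E) (fun x : K => k * x) h : E →L[ℝ] E) (rightTranslate (E := E) v h) =
      rightTranslate (E := E) ((Ad k : E →L[ℝ] E) v) (k * h) := by
  have e : (fun x : K => k * x) ∘ (fun x : K => x * h) =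
      (fun x : K => x * (k * h)) ∘ (fun x : K => k * x * k⁻¹) := by
    funext x; simp [mul_assoc]
  have hconj : MDifferentiableAt 𝓘(ℝ, E) 𝓘(ℝ, E) (fun x : K => k * x * k⁻¹) 1 :=
    MDifferentiableAt.comp (I' := 𝓘(ℝ, E)) 1 (mdiff_mul_right k⁻¹ (k * 1)) (mdiff_mul_left k 1)
  have h1 := mfderiv_comp (I' := 𝓘(ℝ, E)) (1 : K) (mdiff_mul_left k (1 * h)) (mdiff_mul_right h 1)
  have h2 := mfderiv_comp (I' := 𝓘(ℝ, E)) (1 : K) (mdiff_mul_right (k * h) (k * 1 * k⁻¹)) hconj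
  rw [e, h2] at h1
  have h3 := congrArg (fun L : E →L[ℝ] E => L v) h1
  have e1 : k * 1 * k⁻¹ = 1 := by simp
  have h4 : (mfderiv 𝓘(ℝ, E) 𝓘(ℝ, E) (fun x : K => k * x) (1 * h) : E →L[ℝ] E) (rightTranslate (E := E) v h) =
      (mfderiv 𝓘(ℝ, E) 𝓘(ℝ, E) (fun x : K => x * (k * h)) (k * 1 * k⁻¹) : E →L[ℝ] E)
        ((Ad k : E →L[ℝ] E) v) := h3.symm
  rw [one_mul, e1] at h4
  exact h4

theorem HasLogDeriv.mul_left {h : ℝ → K} {t : ℝ} {ξ : E} (h1 : HasLogDeriv h t ξ) (k : K) :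
    HasLogDeriv (fun t => k * h t) t ((Ad k : E →L[ℝ] E) ξ) := by
  have := HasVelocity.mdifferentiableAt_comp h1 (mdiff_mul_left k (h t))
  rw [mfderiv_mul_left_rightTranslate] at this
  exact this

theorem HasLogDeriv.mul {a b : ℝ → K} {t : ℝ} {ξ η : E} (ha : HasLogDeriv a t ξ)
    (hb : HasLogDeriv b t η) :
    HasLogDeriv (fun t => a t * b t) t (ξ + (Ad (a t) : E →L[ℝ] E) η) := by
  have h := HasVelocity.comp₂ ha hb (f := fun x : K × K => x.1 * x.2)
    ((contMDiff_mul 𝓘(ℝ, E) ∞).mdifferentiableAt (by simp))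
  simp only at h
  rw [mfderiv_mul_right_rightTranslate, mfderiv_mul_left_rightTranslate] at h
  have e := rightTranslate_add ξ ((Ad (a t) : E →L[ℝ] E) η) (a t * b t)
  unfold HasLogDeriv
  rw [e]
  exact h

/-- The product rule applied to the constant curve `a⁻¹ a` determines the logarithmic derivative of
the inverse. -/
theorem HasLogDeriv.inv {a : ℝ → K} {t : ℝ} {ξ : E} (ha : HasLogDeriv a t ξ) :
    HasLogDeriv (fun t => (a t)⁻¹) t (-(Ad (a t)⁻¹ : E →L[ℝ] E) ξ) := by
  obtain ⟨ζ, h1⟩ : ∃ ζ : E, HasLogDeriv (fun t => (a t)⁻¹) t ζ :=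
    ⟨_, (HasVelocity.comp_contMDiff ha (contMDiff_inv 𝓘(ℝ, E) ∞)).hasLogDeriv⟩
  have h2 : HasLogDeriv (fun t => (a t)⁻¹ * a t) t (ζ + (Ad (a t)⁻¹ : E →L[ℝ] E) ξ) :=
    HasLogDeriv.mul h1 ha
  simp only [inv_mul_cancel] at h2
  have h3 := h2.unique (hasLogDeriv_const 1 t)
  rw [← eq_neg_of_add_eq_zero_left h3]
  exact h1

theorem Ad_mul (h k : K) (v : E) :
    (Ad (h * k) : E →L[ℝ] E) v = (Ad h : E →L[ℝ] E) ((Ad k : E →L[ℝ] E) v) := by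
  have h1 : HasMFDerivAt 𝓘(ℝ, E) 𝓘(ℝ, E) (fun x : K => k * x * k⁻¹) 1 (Ad k : E →L[ℝ] E) :=
    (mdiff_conj k 1).hasMFDerivAt
  have h2 : HasMFDerivAt 𝓘(ℝ, E) 𝓘(ℝ, E) (fun x : K => h * x * h⁻¹) (k * 1 * k⁻¹)
      (Ad h : E →L[ℝ] E) := by
    rw [show k * 1 * k⁻¹ = 1 by simp]
    exact (mdiff_conj h 1).hasMFDerivAt
  have h3 := HasMFDerivAt.comp (I' := 𝓘(ℝ, E)) (g := fun x : K => h * x * h⁻¹)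
    (f := fun x : K => k * x * k⁻¹) 1 h2 h1
  have e : (fun x : K => h * x * h⁻¹) ∘ (fun x : K => k * x * k⁻¹) =
      fun x : K => (h * k) * x * (h * k)⁻¹ := by
    funext x; simp [mul_assoc]
  rw [e] at h3
  have h4 : HasMFDerivAt 𝓘(ℝ, E) 𝓘(ℝ, E) (fun x : K => (h * k) * x * (h * k)⁻¹) 1
    (Ad (h * k) : E →L[ℝ] E) := (mdiff_conj (h * k) 1).hasMFDerivAt
  exact congrArg (fun L : E →L[ℝ] E => L v) (hasMFDerivAt_unique h4 h3)

omit [LieGroup 𝓘(ℝ, E) ∞ K] in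
theorem Ad_one (v : E) : (Ad (1 : K) : E →L[ℝ] E) v = v := by
  have e : (fun x : K => 1 * x * 1⁻¹) = fun x => x := by funext x; simp
  unfold Ad
  rw [e]
  exact congrArg (fun L : E →L[ℝ] E => L v) (mfderiv_id (I := 𝓘(ℝ, E)) (x := (1 : K)))

theorem Ad_inv_Ad (h : K) (v : E) : (Ad h⁻¹ : E →L[ℝ] E) ((Ad h : E →L[ℝ] E) v) = v := by
  rw [← Ad_mul, inv_mul_cancel, Ad_one]

theorem Ad_Ad_inv (h : K) (v : E) : (Ad h : E →L[ℝ] E) ((Ad h⁻¹ : E →L[ℝ] E) v) = v := by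
  rw [← Ad_mul, mul_inv_cancel, Ad_one]

/-- Logarithmic derivative of the left quotient of two curves with equal logarithmic derivatives. -/
theorem HasLogDeriv.inv_mul_of_eq {a b : ℝ → K} {t : ℝ} {ξ : E} (ha : HasLogDeriv a t ξ)
    (hb : HasLogDeriv b t ξ) : HasVelocity E (fun t => (a t)⁻¹ * b t) t 0 := by
  have h := ha.inv.mul hb
  rw [neg_add_cancel] at h
  have h' : HasVelocity E (fun t => (a t)⁻¹ * b t) t (rightTranslate (E := E) 0 _) := h
  rwa [rightTranslate_zero] at h'

/-- Two solutions of `h' = ξ h` differ by a constant right factor, since `a⁻¹ b` has zero velocity.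
No regularity of `ξ` is required. -/
theorem eq_of_hasLogDeriv {a b : ℝ → K} {ξ : ℝ → E} {s : Set ℝ} (hs : IsOpen s)
    (hs' : IsPreconnected s) (ha : ∀ t ∈ s, HasLogDeriv a t (ξ t))
    (hb : ∀ t ∈ s, HasLogDeriv b t (ξ t)) {t₀ : ℝ} (ht₀ : t₀ ∈ s) (h0 : a t₀ = b t₀) {t : ℝ}
    (ht : t ∈ s) : a t = b t := by
  have h := eq_of_velocity_zero (E := E) (c := fun t => (a t)⁻¹ * b t) hs hs'
    (fun r hr => (ha r hr).inv_mul_of_eq (hb r hr)) ht ht₀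
  simp only [h0, inv_mul_cancel] at h
  exact (inv_mul_eq_one.1 h)

theorem eq_of_hasLogDeriv_univ {a b : ℝ → K} {ξ : ℝ → E} (ha : ∀ t, HasLogDeriv a t (ξ t))
    (hb : ∀ t, HasLogDeriv b t (ξ t)) (t₀ : ℝ) (h0 : a t₀ = b t₀) : a = b :=
  funext fun _ => eq_of_hasLogDeriv isOpen_univ isPreconnected_univ (fun t _ => ha t)
    (fun t _ => hb t) (Set.mem_univ t₀) h0 (Set.mem_univ _)

theorem eq_one_of_hasLogDeriv_Icc [T2Space K] {a b : ℝ → K} {ξ : ℝ → E}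
    (hac : ContinuousOn a (Set.Icc 0 1)) (hbc : ContinuousOn b (Set.Icc 0 1))
    (ha : ∀ t ∈ Set.Ioo (0 : ℝ) 1, HasLogDeriv a t (ξ t))
    (hb : ∀ t ∈ Set.Ioo (0 : ℝ) 1, HasLogDeriv b t (ξ t)) (h0 : a 0 = b 0) : a 1 = b 1 := by
  have : IsTopologicalGroup K := topologicalGroup_of_lieGroup 𝓘(ℝ, E) ∞
  have h := eq_of_velocity_zero_Icc (E := E) (c := fun t => (a t)⁻¹ * b t) (hac.inv.mul hbc)
    (fun r hr => (ha r hr).inv_mul_of_eq (hb r hr))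
  simp only [h0, inv_mul_cancel] at h
  exact (inv_mul_eq_one.1 h)

variable {E' : Type*} [NormedAddCommGroup E'] [NormedSpace ℝ E']
  {K' : Type*} [TopologicalSpace K'] [ChartedSpace E' K'] [Group K'] [LieGroup 𝓘(ℝ, E') ∞ K']

theorem HasLogDeriv.map {a : ℝ → K} {t : ℝ} {ξ : E} (ha : HasLogDeriv a t ξ) (f : K →* K')
    (hf : ContMDiff 𝓘(ℝ, E) 𝓘(ℝ, E') ∞ f) :
    HasLogDeriv (E := E') (fun t => f (a t)) t ((mfderiv 𝓘(ℝ, E) 𝓘(ℝ, E') f 1 : E →L[ℝ] E') ξ) := by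
  have h := HasVelocity.comp_contMDiff ha hf
  have hd : ∀ x, MDifferentiableAt 𝓘(ℝ, E) 𝓘(ℝ, E') f x := fun x => hf.mdifferentiableAt (by simp)
  have e : f ∘ (fun x : K => x * a t) = (fun x : K' => x * f (a t)) ∘ f := by
    funext x; simp
  have h1 := mfderiv_comp (I' := 𝓘(ℝ, E)) (1 : K) (hd (1 * a t)) (mdiff_mul_right (a t) 1)
  have h2 := mfderiv_comp (I' := 𝓘(ℝ, E')) (1 : K) (mdiff_mul_right (f (a t)) (f 1)) (hd 1)
  rw [e, h2] at h1
  have h3 := congrArg (fun L : E →L[ℝ] E' => L ξ) h1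
  have h4 : (mfderiv 𝓘(ℝ, E) 𝓘(ℝ, E') f (1 * a t) : E →L[ℝ] E') (rightTranslate (E := E) ξ (a t)) =
      (mfderiv 𝓘(ℝ, E') 𝓘(ℝ, E') (fun x : K' => x * f (a t)) (f 1) : E' →L[ℝ] E')
        ((mfderiv 𝓘(ℝ, E) 𝓘(ℝ, E') f 1 : E →L[ℝ] E') ξ) := h3.symm
  rw [one_mul, map_one] at h4
  rw [h4] at h
  exact h

end LogDeriv

/-! ### Differentials at a fixed point as smooth functions of parameters. -/

section FixedPoint

variable {E : Type*} [NormedAddCommGroup E] [NormedSpace ℝ E]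
  {N : Type*} [TopologicalSpace N] [ChartedSpace E N] [IsManifold 𝓘(ℝ, E) ∞ N]
  {E' : Type*} [NormedAddCommGroup E'] [NormedSpace ℝ E']
  {N' : Type*} [TopologicalSpace N'] [ChartedSpace E' N'] [IsManifold 𝓘(ℝ, E') ∞ N']
  {E'' : Type*} [NormedAddCommGroup E''] [NormedSpace ℝ E'']
  {N'' : Type*} [TopologicalSpace N''] [ChartedSpace E'' N''] [IsManifold 𝓘(ℝ, E'') ∞ N'']

/-- The differential at a fixed point depends smoothly on parameters. -/
theorem contMDiff_hasMFDerivAt_of_fixed {f : N → N' → N''} {n₀ : N'} {n₁ : N''}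
    {D : N → E' →L[ℝ] E''}
    (hf : ContMDiff (𝓘(ℝ, E).prod 𝓘(ℝ, E')) 𝓘(ℝ, E'') ∞ (fun z : N × N' => f z.1 z.2))
    (h0 : ∀ k, f k n₀ = n₁) (hD : ∀ k, HasMFDerivAt 𝓘(ℝ, E') 𝓘(ℝ, E'') (f k) n₀ (D k)) :
    ContMDiff 𝓘(ℝ, E) 𝓘(ℝ, E' →L[ℝ] E'') ∞ D := by
  intro k
  have h1 := ContMDiffAt.mfderiv (I := 𝓘(ℝ, E')) (I' := 𝓘(ℝ, E'')) (J := 𝓘(ℝ, E)) (m := ∞) (x₀ := k)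
    f (fun _ => n₀) (hf (k, n₀)) contMDiffAt_const (by norm_cast)
  refine h1.congr_of_eventuallyEq (Filter.Eventually.of_forall fun x => ?_)
  rw [inTangentCoordinates_eq_mfderiv_comp (by simp) (by rw [h0, h0]; simp)]
  have e1 : (mfderiv 𝓘(ℝ, E') 𝓘(ℝ, E') (extChartAt 𝓘(ℝ, E') n₀).symm (extChartAt 𝓘(ℝ, E') n₀ n₀) :
      E' →L[ℝ] E') = ContinuousLinearMap.id ℝ E' := chartSymmDeriv_self (E := E') n₀
  -- All maps `f x` send `n₀` to the same `n₁`, so every change of coordinates that enters the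
  -- tangent bundle description is taken at the centre of its chart and is the identity.
  have e2 : ∀ q r : N'', q = n₁ → r = n₁ →
      (mfderiv 𝓘(ℝ, E'') 𝓘(ℝ, E'') (extChartAt 𝓘(ℝ, E'') q) r : E'' →L[ℝ] E'') =
      ContinuousLinearMap.id ℝ E'' := by
    rintro q r rfl rfl
    exact mfderiv_extChartAt_self (I := 𝓘(ℝ, E''))
  have e3 : (mfderiv 𝓘(ℝ, E') 𝓘(ℝ, E'') (f x) n₀ : E' →L[ℝ] E'') = D x := (hD x).mfderiv
  simp only [ModelWithCorners.range_eq_univ, mfderivWithin_univ]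
  have e4 : ∀ v, D x v = (mfderiv 𝓘(ℝ, E'') 𝓘(ℝ, E'') (extChartAt 𝓘(ℝ, E'') (f k n₀)) (f x n₀) :
      E'' →L[ℝ] E'') ((mfderiv 𝓘(ℝ, E') 𝓘(ℝ, E'') (f x) n₀ : E' →L[ℝ] E'')
    ((mfderiv 𝓘(ℝ, E') 𝓘(ℝ, E') (extChartAt 𝓘(ℝ, E') n₀).symm (extChartAt 𝓘(ℝ, E') n₀ n₀) :
      E' →L[ℝ] E') v)) := by
    intro v
    rw [e1, e2 _ _ (h0 k) (h0 x), e3]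
    rfl
  exact ContinuousLinearMap.ext e4

end FixedPoint

theorem hasFDerivAt_comp_of_eq {E F V : Type*} [NormedAddCommGroup E] [NormedSpace ℝ E]
    [NormedAddCommGroup F] [NormedSpace ℝ F] [NormedAddCommGroup V] [NormedSpace ℝ V]
    {g : F → V} {f : E → F} (x : E) {y : F} {g' : F →L[ℝ] V} {f' : E →L[ℝ] F}
    (hg : HasFDerivAt g g' y) (hf : HasFDerivAt f f' x) (hy : f x = y) :
    HasFDerivAt (fun z => g (f z)) (g'.comp f') x := by
  subst hy
  exact hg.comp x hf

/-! ### Multiplication in the chart at the identity, and a formula for the bracket. -/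

section ChartMul

variable (E : Type*) [NormedAddCommGroup E] [NormedSpace ℝ E]
  (K : Type*) [TopologicalSpace K] [ChartedSpace E K] [Group K]

/-- The preferred chart of a Lie group at the identity. -/
abbrev chartOne : PartialEquiv K E := extChartAt 𝓘(ℝ, E) (1 : K)

/-- The coordinates of the identity. -/
abbrev coordOne : E := chartOne E K 1

/-- The multiplication of a Lie group in the chart at the identity. -/
def chartMul (z : E × E) : E := chartOne E K ((chartOne E K).symm z.1 * (chartOne E K).symm z.2)

/-- The right translation `v ↦ v · x` in the chart at the identity. -/
def rightChart (x : E) : E →L[ℝ] E := fderiv ℝ (fun y => chartMul E K (y, x)) (coordOne E K)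

/-- The left translation `v ↦ x · v` in the chart at the identity. -/
def leftChart (x : E) : E →L[ℝ] E := fderiv ℝ (fun y => chartMul E K (x, y)) (coordOne E K)

theorem coordOne_mem : coordOne E K ∈ (chartOne E K).target := mem_extChartAt_target _

theorem chartOne_symm_coordOne : (chartOne E K).symm (coordOne E K) = 1 := extChartAt_to_inv _

variable {E K}

theorem chartMul_coordOne_left {x : E} (hx : x ∈ (chartOne E K).target) :
    chartMul E K (coordOne E K, x) = x := by
  simp only [chartMul, chartOne_symm_coordOne, one_mul, (chartOne E K).right_inv hx]

theorem chartMul_coordOne_right {x : E} (hx : x ∈ (chartOne E K).target) :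
    chartMul E K (x, coordOne E K) = x := by
  simp only [chartMul, chartOne_symm_coordOne, mul_one, (chartOne E K).right_inv hx]

variable [LieGroup 𝓘(ℝ, E) ∞ K]

theorem contDiffAt_chartMul {x y : E} (hx : x ∈ (chartOne E K).target)
    (hy : y ∈ (chartOne E K).target)
    (h : (chartOne E K).symm x * (chartOne E K).symm y ∈ (chartOne E K).source) :
    ContDiffAt ℝ ∞ (chartMul E K) (x, y) := by
  refine contDiffAt_chart_comp (z := (x, y)) (S := fun z : E × E => (chartOne E K).symm z.1 *
    (chartOne E K).symm z.2) ?_ h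
  refine ContMDiffAt.mul ?_ ?_
  · exact ContMDiffAt.comp (g := (chartOne E K).symm) (x, y) (contMDiffAt_extChart_symm hx)
      contDiffAt_fst.contMDiffAt
  · exact ContMDiffAt.comp (g := (chartOne E K).symm) (x, y) (contMDiffAt_extChart_symm hy)
      contDiffAt_snd.contMDiffAt

theorem contDiffAt_chartMul_left {x : E} (hx : x ∈ (chartOne E K).target) :
    ContDiffAt ℝ ∞ (chartMul E K) (coordOne E K, x) :=
  contDiffAt_chartMul (coordOne_mem E K) hx (by
    rw [chartOne_symm_coordOne, one_mul]; exact (chartOne E K).map_target hx)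

theorem contDiffAt_chartMul_right {x : E} (hx : x ∈ (chartOne E K).target) :
    ContDiffAt ℝ ∞ (chartMul E K) (x, coordOne E K) :=
  contDiffAt_chartMul hx (coordOne_mem E K) (by
    rw [chartOne_symm_coordOne, mul_one]; exact (chartOne E K).map_target hx)

theorem contDiffAt_rightChart {x : E} (hx : x ∈ (chartOne E K).target) :
    ContDiffAt ℝ ∞ (rightChart E K) x := by
  refine ContDiffAt.fderiv (n := ∞) (f := fun x y => chartMul E K (y, x))
    (g := fun _ => coordOne E K) ?_ contDiffAt_const (by norm_cast)
  exact ContDiffAt.comp (g := chartMul E K) (x, coordOne E K) (contDiffAt_chartMul_left hx)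
    (contDiffAt_snd.prodMk contDiffAt_fst)

theorem contDiffAt_leftChart {x : E} (hx : x ∈ (chartOne E K).target) :
    ContDiffAt ℝ ∞ (leftChart E K) x := by
  refine ContDiffAt.fderiv (n := ∞) (f := fun x y => chartMul E K (x, y))
    (g := fun _ => coordOne E K) ?_ contDiffAt_const (by norm_cast)
  exact ContDiffAt.comp (g := chartMul E K) (x, coordOne E K) (contDiffAt_chartMul_right hx)
    (contDiffAt_fst.prodMk contDiffAt_snd)

theorem rightChart_apply {x : E} (hx : x ∈ (chartOne E K).target) (v : E) :
    rightChart E K x v = fderiv ℝ (chartMul E K) (coordOne E K, x) (v, 0) := by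
  have h := HasFDerivAt.comp (f := fun y => (y, x)) (coordOne E K)
    ((contDiffAt_chartMul_left hx).differentiableAt (by simp)).hasFDerivAt
    (hasFDerivAt_prodMk_left (coordOne E K) x)
  exact congrArg (fun L : E →L[ℝ] E => L v) h.fderiv

theorem leftChart_apply {x : E} (hx : x ∈ (chartOne E K).target) (v : E) :
    leftChart E K x v = fderiv ℝ (chartMul E K) (x, coordOne E K) (0, v) := by
  have h := ((contDiffAt_chartMul_right hx).differentiableAt (by simp)).hasFDerivAt.comp
    (coordOne E K) (hasFDerivAt_prodMk_right x (coordOne E K))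
  exact congrArg (fun L : E →L[ℝ] E => L v) h.fderiv

omit [LieGroup 𝓘(ℝ, E) ∞ K] in
theorem chartOne_target_mem_nhds {x : E} (hx : x ∈ (chartOne E K).target) :
    (chartOne E K).target ∈ 𝓝 x := (isOpen_extChartAt_target (I := 𝓘(ℝ, E)) (1 : K)).mem_nhds hx

omit [LieGroup 𝓘(ℝ, E) ∞ K] in
theorem rightChart_coordOne : rightChart E K (coordOne E K) = ContinuousLinearMap.id ℝ E := by
  have h : (fun y => chartMul E K (y, coordOne E K)) =ᶠ[𝓝 (coordOne E K)] fun y => y := by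
    filter_upwards [chartOne_target_mem_nhds (coordOne_mem E K)] with y hy
    exact chartMul_coordOne_right hy
  rw [rightChart, h.fderiv_eq, fderiv_fun_id]

omit [LieGroup 𝓘(ℝ, E) ∞ K] in
theorem leftChart_coordOne : leftChart E K (coordOne E K) = ContinuousLinearMap.id ℝ E := by
  have h : (fun y => chartMul E K (coordOne E K, y)) =ᶠ[𝓝 (coordOne E K)] fun y => y := by
    filter_upwards [chartOne_target_mem_nhds (coordOne_mem E K)] with y hy
    exact chartMul_coordOne_left hy
  rw [leftChart, h.fderiv_eq, fderiv_fun_id]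

theorem hasFDerivAt_rightChart {x : E} (hx : x ∈ (chartOne E K).target) :
    HasFDerivAt (fun y => chartMul E K (y, x)) (rightChart E K x) (coordOne E K) :=
  (DifferentiableAt.comp (g := chartMul E K) (f := fun y => (y, x)) (coordOne E K)
    ((contDiffAt_chartMul_left hx).differentiableAt (by simp))
    (hasFDerivAt_prodMk_left (coordOne E K) x).differentiableAt).hasFDerivAt

theorem hasFDerivAt_leftChart {x : E} (hx : x ∈ (chartOne E K).target) :
    HasFDerivAt (fun y => chartMul E K (x, y)) (leftChart E K x) (coordOne E K) :=
  (DifferentiableAt.comp (g := chartMul E K) (f := fun y => (x, y)) (coordOne E K)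
    ((contDiffAt_chartMul_right hx).differentiableAt (by simp))
    (hasFDerivAt_prodMk_right x (coordOne E K)).differentiableAt).hasFDerivAt

theorem fderiv_rightChart (v w : E) :
    fderiv ℝ (rightChart E K) (coordOne E K) v w =
      fderiv ℝ (fderiv ℝ (chartMul E K)) (coordOne E K, coordOne E K) (0, v) (w, 0) := by
  have hx := coordOne_mem E K
  have h1 : HasFDerivAt (fderiv ℝ (chartMul E K)) _ (coordOne E K, coordOne E K) :=
    (((contDiffAt_chartMul_left hx).fderiv_right (m := ∞) (by norm_cast)).differentiableAt
      (by simp)).hasFDerivAt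
  have h2 := (h1.comp (coordOne E K) (hasFDerivAt_prodMk_right (coordOne E K) (coordOne E K))).clm_apply
    (hasFDerivAt_const ((w, 0) : E × E) (coordOne E K))
  have h3 := (((contDiffAt_rightChart hx).differentiableAt (by simp)).hasFDerivAt).clm_apply
    (hasFDerivAt_const w (coordOne E K))
  have h4 : (fun x => rightChart E K x w) =ᶠ[𝓝 (coordOne E K)]
      fun x => fderiv ℝ (chartMul E K) (coordOne E K, x) (w, 0) := by
    filter_upwards [chartOne_target_mem_nhds hx] with y hy
    exact rightChart_apply hy w
  have h5 := (h2.congr_of_eventuallyEq h4).unique h3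
  have h6 := congrArg (fun L : E →L[ℝ] E => L v) h5
  simpa using h6.symm

theorem fderiv_leftChart (v w : E) :
    fderiv ℝ (leftChart E K) (coordOne E K) v w =
      fderiv ℝ (fderiv ℝ (chartMul E K)) (coordOne E K, coordOne E K) (v, 0) (0, w) := by
  have hx := coordOne_mem E K
  have h1 : HasFDerivAt (fderiv ℝ (chartMul E K)) _ (coordOne E K, coordOne E K) :=
    (((contDiffAt_chartMul_left hx).fderiv_right (m := ∞) (by norm_cast)).differentiableAt
      (by simp)).hasFDerivAt
  have h2 := (HasFDerivAt.comp (f := fun y => (y, coordOne E K)) (coordOne E K) h1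
    (hasFDerivAt_prodMk_left (coordOne E K) (coordOne E K))).clm_apply
    (hasFDerivAt_const ((0, w) : E × E) (coordOne E K))
  have h3 := (((contDiffAt_leftChart hx).differentiableAt (by simp)).hasFDerivAt).clm_apply
    (hasFDerivAt_const w (coordOne E K))
  have h4 : (fun x => leftChart E K x w) =ᶠ[𝓝 (coordOne E K)]
      fun x => fderiv ℝ (chartMul E K) (x, coordOne E K) (0, w) := by
    filter_upwards [chartOne_target_mem_nhds hx] with y hy
    exact leftChart_apply hy w
  have h5 := (h2.congr_of_eventuallyEq h4).unique h3
  have h6 := congrArg (fun L : E →L[ℝ] E => L v) h5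
  simpa using h6.symm

/-- Both sides are the mixed second derivative of the multiplication at the identity, read in the
two possible orders. -/
theorem fderiv_leftChart_eq (v w : E) :
    fderiv ℝ (leftChart E K) (coordOne E K) v w = fderiv ℝ (rightChart E K) (coordOne E K) w v := by
  rw [fderiv_leftChart, fderiv_rightChart]
  exact ((contDiffAt_chartMul_left (coordOne_mem E K)).isSymmSndFDerivAt
    (by simp; norm_cast)).eq (v, 0) (0, w)

/-- The left invariant vector field in the chart at the identity. -/
def leftInvariantChart (E : Type*) [NormedAddCommGroup E] [NormedSpace ℝ E]
    (K : Type*) [TopologicalSpace K] [ChartedSpace E K] [Group K] (v : E) : E → E :=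
  VectorField.mpullbackWithin 𝓘(ℝ, E) 𝓘(ℝ, E) (chartOne E K).symm
      (mulInvariantVectorField (I := 𝓘(ℝ, E)) (G := K) v) Set.univ

variable [FiniteDimensional ℝ E]

/-- Both sides are the velocity of `h c(t)` for a curve `c` through `1` with velocity `v`, in the
chart at `1`. -/
theorem leftInvariantChart_eq {x : E} (hx : x ∈ (chartOne E K).target) (v : E) :
    leftInvariantChart E K v x = leftChart E K x v := by
  obtain ⟨c, -, hc0, hc⟩ := exists_curve (E := E) (1 : K) v
  set h := (chartOne E K).symm x with hh
  have hhs : h ∈ (chartOne E K).source := (chartOne E K).map_target hx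
  have h1 := hc.mdifferentiableAt_comp (mdiff_mul_left (E := E) h (c 0))
  have h2 : HasDerivAt (fun t => chartOne E K (c t)) v 0 := hc.hasDerivAt_extChart_self hc0
  have h3 : HasDerivAt (fun t => chartMul E K (x, chartOne E K (c t))) (leftChart E K x v) 0 := by
    exact HasFDerivAt.comp_hasDerivAt_of_eq (f := fun t => chartOne E K (c t)) 0
      (hasFDerivAt_leftChart hx) h2
      (by rw [hc0])
  have hs : ∀ᶠ t in 𝓝 (0 : ℝ), c t ∈ (chartOne E K).source ∧ h * c t ∈ (chartOne E K).source := by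
    have e1 := hc.continuousAt.preimage_mem_nhds (extChartAt_source_mem_nhds' (I := 𝓘(ℝ, E)) 
      (x := (1 : K)) (x' := c 0) (by rw [hc0]; exact mem_extChartAt_source _))
    have e2 := h1.continuousAt.preimage_mem_nhds (extChartAt_source_mem_nhds' (I := 𝓘(ℝ, E)) 
      (x := (1 : K)) (x' := h * c 0) (by rw [hc0, mul_one]; exact hhs))
    exact Filter.Eventually.and e1 e2
  have h5 : HasVelocity E (fun t => h * c t) 0 ((chartSymmDeriv (1 : K) x : E →L[ℝ] E)
      (leftChart E K x v)) := by
    have hx0 : chartMul E K (x, chartOne E K (c 0)) = x := by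
      rw [hc0]; exact chartMul_coordOne_right hx
    have h6 := hasVelocity_extChart_symm h3 (p := (1 : K)) (by rw [hx0]; exact hx)
    have e : ∀ z, z = x → (chartSymmDeriv (1 : K) x : E →L[ℝ] E) (leftChart E K x v) =
        (chartSymmDeriv (1 : K) z : E →L[ℝ] E) (leftChart E K x v) := by rintro _ rfl; rfl
    rw [e _ hx0]
    refine HasVelocity.congr h6 ?_
    filter_upwards [hs] with t ht
    simp only [chartMul]
    rw [(chartOne E K).left_inv ht.1, (chartOne E K).left_inv ht.2]
  have h7 := h1.unique h5
  have h8 : (mulInvariantVectorField (I := 𝓘(ℝ, E)) (G := K) v h : E) =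
      (chartSymmDeriv (1 : K) x : E →L[ℝ] E) (leftChart E K x v) := by
    rw [← h7, hc0]; rfl
  have h9 : (mfderivWithin 𝓘(ℝ, E) 𝓘(ℝ, E) (chartOne E K).symm Set.univ x).IsInvertible := by
    have := isInvertible_mfderivWithin_extChartAt_symm (I := 𝓘(ℝ, E)) (x := (1 : K)) hx
    rwa [ModelWithCorners.range_eq_univ] at this
  unfold leftInvariantChart
  rw [VectorField.mpullbackWithin_apply]
  refine (congrArg (mfderivWithin 𝓘(ℝ, E) 𝓘(ℝ, E) (chartOne E K).symm Set.univ x).inverse h8).trans ?_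
  have h10 : (chartSymmDeriv (1 : K) x : E →L[ℝ] E) =
    mfderivWithin 𝓘(ℝ, E) 𝓘(ℝ, E) (chartOne E K).symm Set.univ x := by
      rw [mfderivWithin_univ]; rfl
  rw [h10]
  exact h9.inverse_apply_eq.2 rfl

/-- The bracket is that of left-invariant fields, whose chart expressions are `x ↦ leftChart E K x
v`. Symmetry of the mixed second derivative rewrites the result with right translations, the form
needed for right logarithmic derivatives. -/
theorem lieBr_eq (v w : E) :
    lieBr K v w = fderiv ℝ (rightChart E K) (coordOne E K) w v -
      fderiv ℝ (rightChart E K) (coordOne E K) v w := by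
  have hx := coordOne_mem E K
  have hL : ∀ v, leftInvariantChart E K v =ᶠ[𝓝 (coordOne E K)] fun x => leftChart E K x v := by
    intro v
    filter_upwards [chartOne_target_mem_nhds hx] with y hy
    exact leftInvariantChart_eq hy v
  have hd : ∀ v, fderiv ℝ (fun x => leftChart E K x v) (coordOne E K) =
      (fderiv ℝ (leftChart E K) (coordOne E K)).flip v := by
    intro v
    have h3 := (((contDiffAt_leftChart hx).differentiableAt (by simp)).hasFDerivAt).clm_apply
      (hasFDerivAt_const v (coordOne E K))
    rw [h3.fderiv]
    ext u; simp
  have h1 : lieBr K v w = VectorField.lieBracket ℝ (leftInvariantChart E K v)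
      (leftInvariantChart E K w) (coordOne E K) := by
    have e : (mfderiv 𝓘(ℝ, E) 𝓘(ℝ, E) (extChartAt 𝓘(ℝ, E) (1 : K)) 1 : E →L[ℝ] E) =
      ContinuousLinearMap.id ℝ E := mfderiv_extChartAt_self
    have e' : ∀ u : E, (mfderiv 𝓘(ℝ, E) 𝓘(ℝ, E) (extChartAt 𝓘(ℝ, E) (1 : K)) 1 :
        E →L[ℝ] E).inverse u = u := by
      intro u
      have : ContinuousLinearMap.inverse (ContinuousLinearMap.id ℝ E) u = u := by simp
      exact (congrArg (fun L : E →L[ℝ] E => L.inverse u) e).trans this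
    have e2 : (chartOne E K).symm ⁻¹' Set.univ ∩ Set.range 𝓘(ℝ, E) = Set.univ := by simp
    rw [← VectorField.lieBracketWithin_univ, ← e2]
    unfold leftInvariantChart
    rw [← ModelWithCorners.range_eq_univ 𝓘(ℝ, E)]
    exact e' _
  rw [h1, (hL v).lieBracket_vectorField_eq (hL w),
    VectorField.lieBracket_eq]
  simp only [hd, leftChart_coordOne, ContinuousLinearMap.flip_apply, ContinuousLinearMap.id_apply]
  rw [fderiv_leftChart_eq, fderiv_leftChart_eq]

theorem lieBr_swap (v w : E) : lieBr K v w = - lieBr K w v := by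
  rw [lieBr_eq, lieBr_eq, neg_sub]

theorem lieBr_add_left (u v w : E) : lieBr K (u + v) w = lieBr K u w + lieBr K v w := by
  simp only [lieBr_eq, map_add, add_apply]; abel

theorem lieBr_smul_left (r : ℝ) (v w : E) : lieBr K (r • v) w = r • lieBr K v w := by
  simp only [lieBr_eq, map_smul, smul_apply, smul_sub]

theorem lieBr_neg_left (v w : E) : lieBr K (-v) w = - lieBr K v w := by
  simpa using lieBr_smul_left (K := K) (-1) v w

theorem lieBr_neg_right (v w : E) : lieBr K v (-w) = - lieBr K v w := by
  rw [lieBr_swap, lieBr_neg_left, ← lieBr_swap v w]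

theorem lieBr_add_right (u v w : E) : lieBr K u (v + w) = lieBr K u v + lieBr K u w := by
  rw [lieBr_swap, lieBr_add_left, lieBr_swap v, lieBr_swap w]; abel

omit [FiniteDimensional ℝ E] in
-- The equation `a' = ξ a` becomes `y' = rightChart y ξ` in coordinates; translation back to `1` by
-- the fixed element `(a t)⁻¹` reduces this to the definition of `rightChart`.
theorem HasLogDeriv.hasDerivAt_chart {a : ℝ → K} {t : ℝ} {ξ : E} (ha : HasLogDeriv a t ξ)
    (hs : a t ∈ (chartOne E K).source) :
    HasDerivAt (fun r => chartOne E K (a r)) (rightChart E K (chartOne E K (a t)) ξ) t := by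
  have hx : chartOne E K (a t) ∈ (chartOne E K).target := (chartOne E K).map_source hs
  have h1 : HasLogDeriv (fun r => a r * (a t)⁻¹) t ξ := ha.mul_right _
  have h1' := (hasLogDeriv_iff_of_eq_one (by simp)).1 h1
  have h2 : HasDerivAt (fun r => chartOne E K (a r * (a t)⁻¹)) ξ t :=
    h1'.hasDerivAt_extChart_self (by simp)
  have h3 := HasFDerivAt.comp_hasDerivAt_of_eq t (hasFDerivAt_rightChart hx) h2
    (by rw [mul_inv_cancel])
  refine HasDerivAt.congr_of_eventuallyEq h3 ?_
  have e2 := h1.continuousAt.preimage_mem_nhds (extChartAt_source_mem_nhds' (I := 𝓘(ℝ, E)) 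
      (x := (1 : K)) (x' := a t * (a t)⁻¹) (by rw [mul_inv_cancel]; exact mem_extChartAt_source _))
  filter_upwards [e2] with r hr
  simp only [Function.comp, chartMul]
  rw [(chartOne E K).left_inv hs, (chartOne E K).left_inv hr, inv_mul_cancel_right]

omit [FiniteDimensional ℝ E] in
theorem rightChart_injective {x : E} (hx : x ∈ (chartOne E K).target) :
    Function.Injective (rightChart E K x) := by
  set h := (chartOne E K).symm x with hh
  have hhs : h ∈ (chartOne E K).source := (chartOne E K).map_target hx
  have h1 : DifferentiableAt ℝ (fun y => chartOne E K ((chartOne E K).symm y * h⁻¹)) x := by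
    refine (contDiffAt_chart_comp (z := x) (S := fun y => (chartOne E K).symm y * h⁻¹) ?_ ?_).differentiableAt
      (by simp)
    · exact (contMDiffAt_extChart_symm hx).mul contMDiffAt_const
    · rw [← hh, mul_inv_cancel]; exact mem_extChartAt_source _
  have h2 := hasFDerivAt_rightChart (E := E) (K := K) hx
  have h3 := hasFDerivAt_comp_of_eq (coordOne E K) h1.hasFDerivAt h2 (chartMul_coordOne_left hx)
  have h4 : ((fun y => chartOne E K ((chartOne E K).symm y * h⁻¹)) ∘ fun y => chartMul E K (y, x))
      =ᶠ[𝓝 (coordOne E K)] fun y => y := by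
    have hc : ContinuousAt (fun y => (chartOne E K).symm y * h) (coordOne E K) :=
      ((contMDiffAt_extChart_symm (coordOne_mem E K)).mul contMDiffAt_const).continuousAt
    have e2 := hc.preimage_mem_nhds (extChartAt_source_mem_nhds' (I := 𝓘(ℝ, E)) 
      (x := (1 : K)) (by rw [chartOne_symm_coordOne, one_mul]; exact hhs))
    filter_upwards [e2, chartOne_target_mem_nhds (coordOne_mem E K)] with y hy hy'
    simp only [Function.comp, chartMul]
    rw [(chartOne E K).left_inv hy, mul_inv_cancel_right, (chartOne E K).right_inv hy']
  have h5 := (hasFDerivAt_id (coordOne E K)).unique (h3.congr_of_eventuallyEq h4.symm)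
  intro v w hvw
  have e : ∀ v, v = fderiv ℝ (fun y => chartOne E K ((chartOne E K).symm y * h⁻¹)) x
    (rightChart E K x v) := fun v => congrArg (fun L : E →L[ℝ] E => L v) h5
  rw [e v, e w, hvw]

omit [FiniteDimensional ℝ E] in
-- Some logarithmic derivative `ζ` exists because the curve is differentiable, and injectivity of
-- `rightChart` at the current point identifies `ζ` with `ξ`.
theorem hasLogDeriv_of_chart {y : ℝ → E} {t : ℝ} {ξ : E} (hy : y t ∈ (chartOne E K).target)
    (h : HasDerivAt y (rightChart E K (y t) ξ) t) :
    HasLogDeriv (fun r => (chartOne E K).symm (y r)) t ξ := by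
  obtain ⟨ζ, hζ⟩ : ∃ ζ : E, HasLogDeriv (fun r => (chartOne E K).symm (y r)) t ζ :=
    ⟨_, (hasVelocity_extChart_symm h hy).hasLogDeriv⟩
  have h1 := hζ.hasDerivAt_chart ((chartOne E K).map_target hy)
  have h2 : HasDerivAt y (rightChart E K (y t) ζ) t := by
    rw [(chartOne E K).right_inv hy] at h1
    refine h1.congr_of_eventuallyEq ?_
    filter_upwards [h.continuousAt.preimage_mem_nhds (chartOne_target_mem_nhds hy)] with r hr
    exact ((chartOne E K).right_inv hr).symm
  rw [rightChart_injective hy (h.unique h2)]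
  exact hζ

end ChartMul

/-! ### Logarithmic derivatives in several variables and the Maurer-Cartan equation. -/

section LogForm

variable {E : Type*} [NormedAddCommGroup E] [NormedSpace ℝ E]
  {K : Type*} [TopologicalSpace K] [ChartedSpace E K] [Group K] [LieGroup 𝓘(ℝ, E) ∞ K]
  {W : Type*} [NormedAddCommGroup W] [NormedSpace ℝ W]

/-- The pullback of the right Maurer-Cartan form along `k`. -/
def logForm (E : Type*) [NormedAddCommGroup E] [NormedSpace ℝ E] {K : Type*} [TopologicalSpace K]
    [ChartedSpace E K] [Group K] (k : W → K) (z : W) : W →L[ℝ] E :=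
  fderiv ℝ (fun y => chartOne E K (k y * (k z)⁻¹)) z

theorem contDiffAt_chart_div {k : W → K} (hk : ContMDiff 𝓘(ℝ, W) 𝓘(ℝ, E) ∞ k) (z : W) :
    ContDiffAt ℝ ∞ (fun x : W × W => chartOne E K (k x.2 * (k x.1)⁻¹)) (z, z) := by
  refine contDiffAt_chart_comp (S := fun x : W × W => k x.2 * (k x.1)⁻¹) ?_ ?_
  · exact (ContMDiffAt.comp (z, z) (hk z) contDiffAt_snd.contMDiffAt).mul
      (ContMDiffAt.comp (z, z) (hk z) contDiffAt_fst.contMDiffAt).inv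
  · rw [mul_inv_cancel]; exact mem_extChartAt_source _

theorem contDiff_logForm {k : W → K} (hk : ContMDiff 𝓘(ℝ, W) 𝓘(ℝ, E) ∞ k) :
    ContDiff ℝ ∞ (logForm E k) :=
  contDiff_iff_contDiffAt.2 fun z =>
    ContDiffAt.fderiv (n := ∞) (f := fun z y => chartOne E K (k y * (k z)⁻¹)) (g := fun z => z)
      (contDiffAt_chart_div hk z) contDiffAt_id (by norm_cast)

theorem hasFDerivAt_logForm {k : W → K} (hk : ContMDiff 𝓘(ℝ, W) 𝓘(ℝ, E) ∞ k) (z : W) :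
    HasFDerivAt (fun y => chartOne E K (k y * (k z)⁻¹)) (logForm E k z) z :=
  (((contDiffAt_chart_div hk z).comp z (f := fun y => (z, y))
    (contDiffAt_const.prodMk contDiffAt_id)).differentiableAt (by simp)).hasFDerivAt

theorem hasLogDeriv_logForm {k : W → K} (hk : ContMDiff 𝓘(ℝ, W) 𝓘(ℝ, E) ∞ k) {c : ℝ → W} {t : ℝ}
    {v : W} (hc : HasDerivAt c v t) : HasLogDeriv (fun t => k (c t)) t (logForm E k (c t) v) := by
  have h1 : HasVelocity E (fun r => k (c r) * (k (c t))⁻¹) t (logForm E k (c t) v) := by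
    refine hasVelocity_of_hasDerivAt_extChart (p := (1 : K)) (by simp) ?_
      ((hasFDerivAt_logForm hk (c t)).comp_hasDerivAt t hc)
    exact (ContMDiffAt.mul (hk (c t)) contMDiffAt_const).continuousAt.comp hc.continuousAt
  have h2 := ((hasLogDeriv_iff_of_eq_one (by simp)).2 h1).mul_right (k (c t))
  simpa using h2

theorem hasLogDeriv_logForm_fst {k : ℝ × ℝ → K} (hk : ContMDiff 𝓘(ℝ, ℝ × ℝ) 𝓘(ℝ, E) ∞ k)
    (s t : ℝ) : HasLogDeriv (fun s => k (s, t)) s (logForm E k (s, t) (1, 0)) :=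
  hasLogDeriv_logForm hk (c := fun s => (s, t)) ((hasDerivAt_id s).prodMk (hasDerivAt_const s t))

theorem hasLogDeriv_logForm_snd {k : ℝ × ℝ → K} (hk : ContMDiff 𝓘(ℝ, ℝ × ℝ) 𝓘(ℝ, E) ∞ k)
    (s t : ℝ) : HasLogDeriv (fun t => k (s, t)) t (logForm E k (s, t) (0, 1)) :=
  hasLogDeriv_logForm hk (c := fun t => (s, t)) ((hasDerivAt_const t s).prodMk (hasDerivAt_id t))

/-- The Maurer-Cartan equation. -/
theorem maurerCartan_equation [FiniteDimensional ℝ E] {k : W → K} (hk : ContMDiff 𝓘(ℝ, W) 𝓘(ℝ, E) ∞ k) (z u v : W) :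
    fderiv ℝ (logForm E k) z v u - fderiv ℝ (logForm E k) z u v =
      lieBr K (logForm E k z v) (logForm E k z u) := by
  set x : W → E := fun y => chartOne E K (k y * (k z)⁻¹) with hxdef
  have hx : ContDiffAt ℝ ∞ x z := (contDiffAt_chart_div hk z).comp z (f := fun y => (z, y))
    (contDiffAt_const.prodMk contDiffAt_id)
  have hxz : x z = coordOne E K := by simp only [hxdef, mul_inv_cancel]
  have hkc : ContinuousAt (fun y => k y * (k z)⁻¹) z :=
    ((hk z).mul contMDiffAt_const).continuousAt
  have hsrc : ∀ᶠ y in 𝓝 z, k y * (k z)⁻¹ ∈ (chartOne E K).source :=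
    hkc.preimage_mem_nhds (extChartAt_source_mem_nhds' (I := 𝓘(ℝ, E)) (x := (1 : K))
      (by rw [mul_inv_cancel]; exact mem_extChartAt_source _))
  -- Near `z` the coordinate expression satisfies `dx = rightChart(x) ∘ logForm`. Symmetry of the
  -- second derivative of `x` at `z`, where `rightChart` is the identity, is then the Maurer-Cartan
  -- equation, with the derivative of `rightChart` producing the bracket.
  have hD : fderiv ℝ x =ᶠ[𝓝 z] fun y => (rightChart E K (x y)).comp (logForm E k y) := by
    filter_upwards [hsrc] with y hy
    have hxy : x y ∈ (chartOne E K).target := (chartOne E K).map_source hy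
    have h2 := hasFDerivAt_rightChart (E := E) (K := K) hxy
    have h3 := hasFDerivAt_comp_of_eq y h2 (hasFDerivAt_logForm hk y)
      (by rw [mul_inv_cancel])
    refine HasFDerivAt.fderiv (h3.congr_of_eventuallyEq ?_)
    have hkc : ContinuousAt (fun w => k w * (k y)⁻¹) y :=
      ((hk y).mul contMDiffAt_const).continuousAt
    filter_upwards [hkc.preimage_mem_nhds (extChartAt_source_mem_nhds' (I := 𝓘(ℝ, E)) (x := (1 : K))
      (by rw [mul_inv_cancel]; exact mem_extChartAt_source _))] with w hw
    simp only [chartMul, hxdef]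
    rw [(chartOne E K).left_inv hw, (chartOne E K).left_inv hy]
    simp [mul_assoc]
  have h1 : HasFDerivAt (fun y => rightChart E K (x y)) _ z :=
    hasFDerivAt_comp_of_eq z (((contDiffAt_rightChart (coordOne_mem E K)).differentiableAt
      (by simp)).hasFDerivAt) (hx.differentiableAt (by simp)).hasFDerivAt hxz
  have h2 := h1.clm_comp (((contDiff_logForm hk).differentiable (by simp) z).hasFDerivAt)
  have h3 := (h2.congr_of_eventuallyEq hD).fderiv
  have hsymm := (hx.isSymmSndFDerivAt (by simp; norm_cast)).eq u v
  have e0 : ∀ w, fderiv ℝ x z w = logForm E k z w := by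
    intro w
    rw [hD.self_of_nhds]
    simp only [hxz, rightChart_coordOne]; rfl
  rw [h3] at hsymm
  simp only [hxz, rightChart_coordOne, add_apply, ContinuousLinearMap.comp_apply,
    ContinuousLinearMap.compL_apply, ContinuousLinearMap.flip_apply, e0,
    ContinuousLinearMap.id_apply] at hsymm
  rw [lieBr_eq, sub_eq_sub_iff_add_eq_add, add_comm (fderiv ℝ (rightChart E K) _ _ _)]
  exact hsymm.symm

end LogForm

/-! ### The derivative of the adjoint action. -/

section AdjointDerivative

variable {E : Type*} [NormedAddCommGroup E] [NormedSpace ℝ E] [FiniteDimensional ℝ E]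
  {K : Type*} [TopologicalSpace K] [ChartedSpace E K] [Group K] [LieGroup 𝓘(ℝ, E) ∞ K]

omit [FiniteDimensional ℝ E] in
theorem contMDiff_Ad : ContMDiff 𝓘(ℝ, E) 𝓘(ℝ, E →L[ℝ] E) ∞ (fun k : K => (Ad k : E →L[ℝ] E)) := by
  refine contMDiff_hasMFDerivAt_of_fixed (f := fun k x : K => k * x * k⁻¹) (n₀ := 1) (n₁ := 1) ?_
    (fun k => by simp) (fun k => (mdiff_conj k 1).hasMFDerivAt)
  exact (contMDiff_fst.mul contMDiff_snd).mul contMDiff_fst.inv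

/-- Apply the Maurer-Cartan equation to `k(s, r) = b(s) x(r)` with `x'(0) = w`. Its form has value
`Ad (b s) w` on `∂_r` along `r = 0` and the constant value `ξ` on `∂_s` along `s = 0`, so only the
derivative of `Ad` and the bracket survive. -/
theorem HasLogDeriv.hasDerivAt_Ad {a : ℝ → K} {t : ℝ} {ξ : E} (ha : HasLogDeriv a t ξ) (w : E) :
    HasDerivAt (fun r => (Ad (a r) : E →L[ℝ] E) w) (lieBr K ξ ((Ad (a t) : E →L[ℝ] E) w)) t := by
  have hsm : ContMDiff 𝓘(ℝ, E) 𝓘(ℝ, E) ∞ (fun k : K => (Ad k : E →L[ℝ] E) w) :=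
    contMDiff_Ad.clm_apply contMDiff_const
  -- reduction to a smooth curve with the same velocity
  obtain ⟨b, hb, hb0, hbv⟩ := exists_curve (E := E) (a t) (rightTranslate (E := E) ξ (a t))
  obtain ⟨x, hx, hx0, hxv⟩ := exists_curve (E := E) (1 : K) w
  have h1 := hasVelocity_iff_hasDerivAt.1 (HasVelocity.comp_contMDiff ha hsm)
  have h2 := hasVelocity_iff_hasDerivAt.1 (HasVelocity.comp_contMDiff hbv hsm)
  have e : ∀ y : K, y = a t →
      (mfderiv 𝓘(ℝ, E) 𝓘(ℝ, E) (fun k : K => (Ad k : E →L[ℝ] E) w) y : E →L[ℝ] E)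
      (rightTranslate (E := E) ξ (a t)) = (mfderiv 𝓘(ℝ, E) 𝓘(ℝ, E)
        (fun k : K => (Ad k : E →L[ℝ] E) w) (a t) : E →L[ℝ] E) (rightTranslate (E := E) ξ (a t)) := by
    rintro _ rfl; rfl
  suffices h3 : HasDerivAt (fun r => (Ad (b r) : E →L[ℝ] E) w)
      (lieBr K ξ ((Ad (a t) : E →L[ℝ] E) w)) 0 by
    have h4 := h3.unique h2
    rw [h4, e _ hb0]
    exact h1
  have hbl : HasLogDeriv b 0 ξ := by
    have := hbv
    rw [← hb0] at this
    exact this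
  set k : ℝ × ℝ → K := fun z => b z.1 * x z.2 with hk
  have hks : ContMDiff 𝓘(ℝ, ℝ × ℝ) 𝓘(ℝ, E) ∞ k :=
    (hb.comp contDiff_fst.contMDiff).mul (hx.comp contDiff_snd.contMDiff)
  have hxl : HasLogDeriv x 0 w := (hasLogDeriv_iff_of_eq_one hx0).2 hxv
  have e1 : ∀ s, logForm E k (s, 0) (0, 1) = (Ad (b s) : E →L[ℝ] E) w := fun s =>
    (hasLogDeriv_logForm_snd hks s 0).unique (hxl.mul_left (b s))
  have e2 : ∀ r, logForm E k (0, r) (1, 0) = ξ := fun r =>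
    (hasLogDeriv_logForm_fst hks 0 r).unique (hbl.mul_right (x r))
  have hd : HasFDerivAt (logForm E k) (fderiv ℝ (logForm E k) (0, 0)) (0, 0) :=
    ((contDiff_logForm hks).differentiable (by simp) (0, 0)).hasFDerivAt
  have d1 : HasDerivAt (fun s : ℝ => logForm E k (s, 0) (0, 1))
      (fderiv ℝ (logForm E k) (0, 0) (1, 0) (0, 1)) 0 := by
    have := (hd.comp_hasDerivAt (0 : ℝ) (f := fun s : ℝ => (s, (0 : ℝ)))
      ((hasDerivAt_id (0 : ℝ)).prodMk (hasDerivAt_const (0 : ℝ) (0 : ℝ)))).clm_apply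
      (hasDerivAt_const (0 : ℝ) ((0, 1) : ℝ × ℝ))
    simpa using this
  have d2 : HasDerivAt (fun r : ℝ => logForm E k (0, r) (1, 0))
      (fderiv ℝ (logForm E k) (0, 0) (0, 1) (1, 0)) 0 := by
    have := (hd.comp_hasDerivAt (0 : ℝ) (f := fun r : ℝ => ((0 : ℝ), r))
      ((hasDerivAt_const (0 : ℝ) (0 : ℝ)).prodMk (hasDerivAt_id (0 : ℝ)))).clm_apply
      (hasDerivAt_const (0 : ℝ) ((1, 0) : ℝ × ℝ))
    simpa using this
  simp only [e1] at d1
  simp only [e2] at d2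
  have h5 := maurerCartan_equation hks (0, 0) (0, 1) (1, 0)
  rw [d2.unique (hasDerivAt_const _ _), sub_zero, e1, e2, hb0] at h5
  rw [← h5]
  exact d1

theorem HasLogDeriv.hasDerivAt_Ad_apply {a : ℝ → K} {t : ℝ} {ξ : E} (ha : HasLogDeriv a t ξ)
    {w : ℝ → E} {w' : E} (hw : HasDerivAt w w' t) :
    HasDerivAt (fun r => (Ad (a r) : E →L[ℝ] E) (w r))
      (lieBr K ξ ((Ad (a t) : E →L[ℝ] E) (w t)) + (Ad (a t) : E →L[ℝ] E) w') t := by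
  have h1 : HasVelocity (E →L[ℝ] E) (fun r => (Ad (a r) : E →L[ℝ] E)) t _ :=
    HasVelocity.comp_contMDiff ha contMDiff_Ad
  have h2 := (hasVelocity_iff_hasDerivAt.1 h1)
  have h3 := h2.clm_apply (hasDerivAt_const t (w t))
  have h4 := h3.unique (ha.hasDerivAt_Ad (w t))
  have h5 := h2.clm_apply hw
  simp only [map_zero, add_zero] at h4
  rw [h4] at h5
  exact h5

end AdjointDerivative

/-! ### Infinitesimal action and infinitesimal Peiffer identity of a crossed module. -/

namespace LieCrossedModule

variable {EG : Type*} [NormedAddCommGroup EG] [NormedSpace ℝ EG] [FiniteDimensional ℝ EG]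
  {G : Type*} [TopologicalSpace G] [ChartedSpace EG G] [Group G] [LieGroup 𝓘(ℝ, EG) ∞ G]
  {EH : Type*} [NormedAddCommGroup EH] [NormedSpace ℝ EH] [FiniteDimensional ℝ EH]
  {H : Type*} [TopologicalSpace H] [ChartedSpace EH H] [Group H] [LieGroup 𝓘(ℝ, EH) ∞ H]
  (X : LieCrossedModule EG EH G H)

section
omit [FiniteDimensional ℝ EG] [LieGroup 𝓘(ℝ, EG) ∞ G] [FiniteDimensional ℝ EH] [LieGroup 𝓘(ℝ, EH) ∞ H]

theorem contMDiff_α (g : G) : ContMDiff 𝓘(ℝ, EH) 𝓘(ℝ, EH) ∞ (X.α g) :=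
  X.smooth_α.comp (contMDiff_const.prodMk contMDiff_id)

theorem hasMFDerivAt_α (g : G) : HasMFDerivAt 𝓘(ℝ, EH) 𝓘(ℝ, EH) (X.α g) 1 (X.αg g) :=
  ((X.contMDiff_α g).mdifferentiableAt (by simp)).hasMFDerivAt

theorem αg_mul (g g' : G) (w : EH) : X.αg (g * g') w = X.αg g (X.αg g' w) := by
  have h1 : HasMFDerivAt 𝓘(ℝ, EH) 𝓘(ℝ, EH) (X.α g) (X.α g' 1) (X.αg g) := by
    rw [map_one]; exact X.hasMFDerivAt_α g
  have h2 := HasMFDerivAt.comp (I' := 𝓘(ℝ, EH)) (g := X.α g) (f := X.α g') 1 h1 (X.hasMFDerivAt_α g')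
  have e : (X.α g : H → H) ∘ X.α g' = X.α (g * g') := by
    funext x; simp
  rw [e] at h2
  exact congrArg (fun L : EH →L[ℝ] EH => L w) (hasMFDerivAt_unique (X.hasMFDerivAt_α _) h2)

theorem αg_one (w : EH) : X.αg 1 w = w := by
  have e : (X.α 1 : H → H) = fun x => x := by funext x; simp
  have h := X.hasMFDerivAt_α 1
  rw [e] at h
  exact congrArg (fun L : EH →L[ℝ] EH => L w) (hasMFDerivAt_unique h (hasMFDerivAt_id (1 : H)))

theorem αg_t (h : H) (w : EH) : X.αg (X.t h) w = (Ad h : EH →L[ℝ] EH) w := by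
  have e : (X.α (X.t h) : H → H) = fun x => h * x * h⁻¹ := by funext x; exact X.peiffer h x
  unfold αg Ad
  rw [e]

end

omit [FiniteDimensional ℝ EG] [FiniteDimensional ℝ EH] in
theorem contMDiff_αg : ContMDiff 𝓘(ℝ, EG) 𝓘(ℝ, EH →L[ℝ] EH) ∞ X.αg :=
  contMDiff_hasMFDerivAt_of_fixed (f := fun g h => X.α g h) (n₀ := 1) (n₁ := 1) X.smooth_α
    (fun _ => map_one _) X.hasMFDerivAt_α

omit [FiniteDimensional ℝ EG] [FiniteDimensional ℝ EH] in
theorem contMDiff_αg_apply (w : EH) : ContMDiff 𝓘(ℝ, EG) 𝓘(ℝ, EH) ∞ (fun g => X.αg g w) :=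
  X.contMDiff_αg.clm_apply contMDiff_const

omit [FiniteDimensional ℝ EG] [FiniteDimensional ℝ EH] [LieGroup 𝓘(ℝ, EG) ∞ G]
  [LieGroup 𝓘(ℝ, EH) ∞ H] in
theorem αStar_neg_left (v : EG) (w : EH) : X.αStar (-v) w = - X.αStar v w :=
  ContinuousLinearMap.map_neg (mfderiv 𝓘(ℝ, EG) 𝓘(ℝ, EH) (fun g : G => X.αg g w) 1) v

omit [FiniteDimensional ℝ EG] [FiniteDimensional ℝ EH] [LieGroup 𝓘(ℝ, EG) ∞ G]
  [LieGroup 𝓘(ℝ, EH) ∞ H] in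
theorem αStar_zero_left (w : EH) : X.αStar 0 w = 0 :=
  ContinuousLinearMap.map_zero (mfderiv 𝓘(ℝ, EG) 𝓘(ℝ, EH) (fun g : G => X.αg g w) 1)

omit [FiniteDimensional ℝ EG] [FiniteDimensional ℝ EH] in
-- Factoring `g(r) = (g(r) g(t)⁻¹) g(t)` moves the derivative to the identity, where it is `αStar`
-- by definition.
theorem hasDerivAt_αg {g : ℝ → G} {t : ℝ} {v : EG} (hg : HasLogDeriv g t v) (w : EH) :
    HasDerivAt (fun r => X.αg (g r) w) (X.αStar v (X.αg (g t) w)) t := by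
  have h1 : HasLogDeriv (fun r => g r * (g t)⁻¹) t v := hg.mul_right _
  have h2 := (hasLogDeriv_iff_of_eq_one (by simp)).1 h1
  have h3 := hasVelocity_iff_hasDerivAt.1
    (HasVelocity.comp_contMDiff h2 (X.contMDiff_αg_apply (X.αg (g t) w)))
  have e : ∀ y : G, y = 1 → (mfderiv 𝓘(ℝ, EG) 𝓘(ℝ, EH) (fun k : G => X.αg k (X.αg (g t) w)) y :
      EG →L[ℝ] EH) v = X.αStar v (X.αg (g t) w) := by
    rintro _ rfl; rfl
  rw [e _ (mul_inv_cancel _)] at h3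
  simpa only [← αg_mul, inv_mul_cancel_right] using h3

omit [FiniteDimensional ℝ EG] [FiniteDimensional ℝ EH] in
theorem hasLogDeriv_t {a : ℝ → H} {r : ℝ} {ξ : EH} (ha : HasLogDeriv a r ξ) :
    HasLogDeriv (fun r => X.t (a r)) r (X.tStar ξ) :=
  ha.map X.t X.smooth_t

omit [FiniteDimensional ℝ EG] [FiniteDimensional ℝ EH] [LieGroup 𝓘(ℝ, EG) ∞ G] in
theorem hasLogDeriv_α (g : G) {a : ℝ → H} {r : ℝ} {ξ : EH} (ha : HasLogDeriv a r ξ) :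
    HasLogDeriv (fun r => X.α g (a r)) r (X.αg g ξ) :=
  ha.map (X.α g).toMonoidHom (X.contMDiff_α g)

omit [FiniteDimensional ℝ EG] in
-- This is the infinitesimal Peiffer identity, the derivative of `α_{t(h)} = Ad h` on the Lie
-- algebra along a curve with velocity `v`.
theorem αStar_tStar (v w : EH) : X.αStar (X.tStar v) w = lieBr H v w := by
  obtain ⟨c, -, hc0, hc⟩ := exists_curve (E := EH) (1 : H) v
  have hl : HasLogDeriv c 0 v := (hasLogDeriv_iff_of_eq_one hc0).2 hc
  have h1 := X.hasDerivAt_αg (X.hasLogDeriv_t hl) w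
  have h2 := hl.hasDerivAt_Ad w
  simp only [αg_t] at h1
  have h3 := h1.unique h2
  rwa [hc0, Ad_one] at h3

end LieCrossedModule

/-! ### Existence, and smooth dependence on parameters, of solutions of `h' = ξ h`. -/

section LieGroupODE

variable {E : Type*} [NormedAddCommGroup E] [NormedSpace ℝ E] [FiniteDimensional ℝ E]
  {K : Type*} [TopologicalSpace K] [ChartedSpace E K] [Group K] [LieGroup 𝓘(ℝ, E) ∞ K]
  {W : Type} [NormedAddCommGroup W] [NormedSpace ℝ W] [CompleteSpace W]

/-- Short time solutions of `y' = ξ y` and their smooth dependence on the parameters, the initial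
time and the length of the time interval. -/
theorem exists_local_flow {ξ : W × ℝ → E} (hξ : ContDiff ℝ ∞ ξ) (u₀ : W) (t₀ : ℝ) :
    ∃ Y : W × ℝ × ℝ → K, ContMDiffAt 𝓘(ℝ, W × ℝ × ℝ) 𝓘(ℝ, E) ∞ Y (u₀, t₀, 0) ∧
      (∀ n : ℕ, ∀ᶠ w in 𝓝 ((u₀, t₀, 0) : W × ℝ × ℝ),
        ContMDiffAt 𝓘(ℝ, W × ℝ × ℝ) 𝓘(ℝ, E) n Y w) ∧
      ∀ᶠ w in 𝓝 ((u₀, t₀, 0) : W × ℝ × ℝ), ∃ y : ℝ → K, ContinuousOn y (Set.Icc 0 1) ∧ y 0 = 1 ∧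
        y 1 = Y w ∧ ∀ v ∈ Set.Ioo (0 : ℝ) 1,
          HasLogDeriv y v (w.2.2 • ξ (w.1, w.2.1 + w.2.2 * v)) := by
  have : CompleteSpace E := FiniteDimensional.complete ℝ E
  set x₀ := coordOne E K with hx₀
  obtain ⟨κ, hκ, hκx, hκO⟩ := exists_smooth_cutoff x₀
    (chartOne_target_mem_nhds (coordOne_mem E K))
  -- Time is rescaled to the unit interval, with the length of the interval as an additional
  -- parameter. For length zero the equation is stationary, as `exists_smooth_solution` requires;
  -- `κ` keeps the solution in the domain of the chart.
  set f : (W × ℝ × ℝ) × ℝ × E → E := fun z =>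
    z.1.2.2 • rightChart E K (κ z.2.2) (ξ (z.1.1, z.1.2.1 + z.1.2.2 * z.2.1)) with hf
  have hR : ContDiff ℝ ∞ (fun x => rightChart E K (κ x)) :=
    contDiff_iff_contDiffAt.2 fun x =>
      (contDiffAt_rightChart (hκO x)).comp x hκ.contDiffAt
  have hfs : ContDiff ℝ ∞ f := by
    have h1 : ContDiff ℝ ∞ (fun z : (W × ℝ × ℝ) × ℝ × E =>
      ξ (z.1.1, z.1.2.1 + z.1.2.2 * z.2.1)) := hξ.comp (by fun_prop)
    have h2 : ContDiff ℝ ∞ (fun z : (W × ℝ × ℝ) × ℝ × E => rightChart E K (κ z.2.2)) :=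
      hR.comp (by fun_prop)
    have h3 : ContDiff ℝ ∞ (fun z : (W × ℝ × ℝ) × ℝ × E => z.1.2.2) := by fun_prop
    exact h3.smul (h2.clm_apply h1)
  obtain ⟨x, hxs, hx0, hx⟩ := exists_smooth_solution hfs (u₀, t₀, 0) x₀ (by simp [hf])
  have heval : ContDiffAt ℝ ∞ (fun w => x w 1) (u₀, t₀, 0) :=
    ContDiffAt.comp (g := fun y : C(UI, E) => y 1) _
      (ContinuousMap.evalCLM ℝ (1 : UI) : C(UI, E) →L[ℝ] E).contDiff.contDiffAt hxs
  -- Closeness to the constant solution in the supremum norm keeps the whole solution where `κ` is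
  -- the identity, so the cutoff has no effect on it.
  have htarget : ∀ᶠ w in 𝓝 ((u₀, t₀, 0) : W × ℝ × ℝ), ∀ v, x w v ∈ (chartOne E K).target ∧
      κ (x w v) = x w v := by
    obtain ⟨r, hr, hrs⟩ := Metric.mem_nhds_iff.1
      (Filter.inter_mem (chartOne_target_mem_nhds (coordOne_mem E K)) hκx)
    have h1 := hxs.continuousAt.eventually (Metric.ball_mem_nhds (x (u₀, t₀, 0)) hr)
    filter_upwards [h1] with w hw v
    refine hrs ?_
    rw [hx0] at hw
    exact (ContinuousMap.dist_apply_le_dist v).trans_lt hw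
  have hsymm : ∀ {n : ℕ} {w}, ContDiffAt ℝ n (fun w => x w 1) w → x w 1 ∈ (chartOne E K).target →
      ContMDiffAt 𝓘(ℝ, W × ℝ × ℝ) 𝓘(ℝ, E) n (fun w => (chartOne E K).symm (x w 1)) w := by
    intro n w h1 h2
    exact ContMDiffAt.comp (g := (chartOne E K).symm) w
      ((contMDiffAt_extChart_symm h2).of_le (mod_cast le_top)) h1.contMDiffAt
  refine ⟨fun w => (chartOne E K).symm (x w 1), ?_, fun n => ?_, ?_⟩
  · refine contMDiffAt_infty.2 fun n => hsymm (heval.of_le (mod_cast le_top))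
      (htarget.self_of_nhds 1).1
  -- Smoothness of infinite order at a point need not hold on a neighbourhood, since the
  -- neighbourhood may shrink with the order; each finite order does persist.
  · have h1 : ContDiffAt ℝ n (fun w => x w 1) (u₀, t₀, 0) := heval.of_le (mod_cast le_top)
    filter_upwards [h1.eventually (by simp), htarget] with w hw hw'
    exact hsymm hw (hw' 1).1
  · filter_upwards [hx, htarget] with w hw hw'
    refine ⟨fun v => (chartOne E K).symm (extendUI (x w) v), ?_, ?_, ?_, ?_⟩
    · refine ContinuousOn.comp (t := (chartOne E K).target) (continuousOn_extChartAt_symm _)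
        (continuous_extendUI _).continuousOn fun v hv => (hw' _).1
    · have : extendUI (x w) 0 = x₀ := by
        rw [extendUI_of_mem _ (by simp)]; exact hw.1
      simp only [this]
      exact chartOne_symm_coordOne E K
    · have : extendUI (x w) 1 = x w 1 := by rw [extendUI_of_mem _ (by simp)]; rfl
      simp only [this]
    · intro v hv
      have h1 := hw.2 v hv
      have e : extendUI (x w) v = x w ⟨v, Set.Ioo_subset_Icc_self hv⟩ := extendUI_of_mem _ _
      refine hasLogDeriv_of_chart (by rw [e]; exact (hw' _).1) ?_
      rw [e, map_smul]
      convert h1 using 1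
      simp only [hf]
      rw [(hw' _).2]

/-- Solutions of `h' = ξ h` depend smoothly on time and parameters. -/
theorem contMDiff_of_hasLogDeriv [T2Space K] {ξ : W × ℝ → E} (hξ : ContDiff ℝ ∞ ξ) {h : W × ℝ → K}
    (hh : ∀ u t, HasLogDeriv (fun t => h (u, t)) t (ξ (u, t)))
    (h0 : ContMDiff 𝓘(ℝ, W) 𝓘(ℝ, E) ∞ (fun u => h (u, 0))) :
    ContMDiff 𝓘(ℝ, W × ℝ) 𝓘(ℝ, E) ∞ h := by
  -- By right invariance of the equation, `h` at time `t₀ + ε` is the short-time solution started at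
  -- `1` multiplied by `h` at time `t₀`.
  have key : ∀ u₀ t₀, ∃ Y : W × ℝ × ℝ → K, ContMDiffAt 𝓘(ℝ, W × ℝ × ℝ) 𝓘(ℝ, E) ∞ Y (u₀, t₀, 0) ∧
      (∀ n : ℕ, ∀ᶠ w in 𝓝 ((u₀, t₀, 0) : W × ℝ × ℝ),
        ContMDiffAt 𝓘(ℝ, W × ℝ × ℝ) 𝓘(ℝ, E) n Y w) ∧
      ∀ᶠ w in 𝓝 ((u₀, t₀, 0) : W × ℝ × ℝ), h (w.1, w.2.1 + w.2.2) = Y w * h (w.1, w.2.1) := by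
    intro u₀ t₀
    obtain ⟨Y, hY, hYn, hYe⟩ := exists_local_flow (K := K) hξ u₀ t₀
    refine ⟨Y, hY, hYn, ?_⟩
    filter_upwards [hYe] with w ⟨y, hyc, hy0, hy1, hy⟩
    have h1 : ∀ v, HasLogDeriv (fun v => h (w.1, w.2.1 + w.2.2 * v) * (h (w.1, w.2.1))⁻¹) v
        (w.2.2 • ξ (w.1, w.2.1 + w.2.2 * v)) := fun v => by
      have e : HasDerivAt (fun v : ℝ => w.2.1 + w.2.2 * v) w.2.2 v := by
        simpa using ((hasDerivAt_id v).const_mul w.2.2).const_add w.2.1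
      exact (HasLogDeriv.comp_real (h := fun t => h (w.1, t)) (hh w.1 _) e).mul_right _
    have h2 := eq_one_of_hasLogDeriv_Icc
      (fun v _ => (h1 v).continuousAt.continuousWithinAt) hyc (fun v _ => h1 v) hy
      (by rw [hy0]; simp)
    rw [hy1] at h2
    simp only [mul_one] at h2
    rw [← h2, inv_mul_cancel_right]
  have slice : ∀ u₀ t, ContMDiffAt 𝓘(ℝ, W) 𝓘(ℝ, E) ∞ (fun u => h (u, t)) u₀ := by
    intro u₀ t
    refine contMDiffAt_infty.2 fun n => ?_
    -- For a fixed finite order `n`, the times at which `h` is of class `C^n` in the parameter form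
    -- a clopen set containing `0`. The short-time factor carries regularity forwards and backwards
    -- over intervals of locally uniform length.
    set T : Set ℝ := {a | ContMDiffAt 𝓘(ℝ, W) 𝓘(ℝ, E) n (fun u => h (u, a)) u₀} with hT
    have step : ∀ t₀, ∃ δ > 0, ∀ s ∈ Metric.ball t₀ δ, ∀ b ∈ Metric.ball t₀ δ, s ∈ T → b ∈ T := by
      intro t₀
      obtain ⟨Y, -, hYn, hYe⟩ := key u₀ t₀
      have hboth := (hYn n).and hYe.eventually_nhds
      obtain ⟨δ, hδ, hball⟩ := Metric.eventually_nhds_iff.1 hboth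
      -- Half of `δ` ensures that the elapsed time `b - s` between two points of the ball is itself
      -- smaller than `δ`.
      refine ⟨δ / 2, by positivity, fun s hs b hb hsT => ?_⟩
      rw [Metric.mem_ball] at hs hb
      have hsb : dist (b - s) 0 < δ := by
        rw [dist_zero_right, ← dist_eq_norm]
        calc dist b s ≤ dist b t₀ + dist t₀ s := dist_triangle _ _ _
          _ < δ / 2 + δ / 2 := by rw [dist_comm t₀ s]; gcongr
          _ = δ := by ring
      have hd : dist ((u₀, s, b - s) : W × ℝ × ℝ) (u₀, t₀, 0) < δ := by
        rw [Prod.dist_eq, Prod.dist_eq]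
        simp only [dist_self]
        exact max_lt hδ (max_lt (by linarith) hsb)
      obtain ⟨hn, he⟩ := hball hd
      have hcont : ContinuousAt (fun u : W => ((u, s, b - s) : W × ℝ × ℝ)) u₀ := by fun_prop
      have e1 : ∀ᶠ u in 𝓝 u₀, h (u, b) = Y (u, s, b - s) * h (u, s) := by
        filter_upwards [hcont.eventually he] with u hu
        simpa using hu
      have h1 : ContMDiffAt 𝓘(ℝ, W) 𝓘(ℝ, E) n (fun u => Y (u, s, b - s)) u₀ :=
        ContMDiffAt.comp (g := Y) (f := fun u : W => ((u, s, b - s) : W × ℝ × ℝ)) u₀ hn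
          (ContDiffAt.contMDiffAt (by fun_prop))
      have : ContMDiffMul 𝓘(ℝ, E) n K := ContMDiffMul.of_le (n := ∞) (mod_cast le_top)
      exact (h1.mul hsT).congr_of_eventuallyEq e1
    have hclopen : IsClopen T := by
      constructor
      · refine isClosed_of_closure_subset fun t₀ ht₀ => ?_
        obtain ⟨δ, hδ, hst⟩ := step t₀
        obtain ⟨s, hsb, hsT⟩ := Metric.mem_closure_iff.1 ht₀ δ hδ |>.imp fun s hs => hs.symm
        exact hst s (by rw [Metric.mem_ball, dist_comm]; exact hsb) t₀ (Metric.mem_ball_self hδ) hsT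
      · refine Metric.isOpen_iff.2 fun t₀ ht₀ => ?_
        obtain ⟨δ, hδ, hst⟩ := step t₀
        exact ⟨δ, hδ, fun b hb => hst t₀ (Metric.mem_ball_self hδ) b hb ht₀⟩
    have h0T : (0 : ℝ) ∈ T := (h0 u₀).of_le (mod_cast le_top)
    have := hclopen.eq_univ ⟨0, h0T⟩
    have ht : t ∈ T := by rw [this]; trivial
    exact ht
  rintro ⟨u₀, t₀⟩
  obtain ⟨Y, hY, -, hYe⟩ := key u₀ t₀
  have hcont : ContinuousAt (fun z : W × ℝ => ((z.1, t₀, z.2 - t₀) : W × ℝ × ℝ)) (u₀, t₀) := by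
    fun_prop
  have e1 : ∀ᶠ z : W × ℝ in 𝓝 (u₀, t₀), h z = Y (z.1, t₀, z.2 - t₀) * h (z.1, t₀) := by
    have hYe' : ∀ᶠ w in 𝓝 ((u₀, t₀, t₀ - t₀) : W × ℝ × ℝ),
        h (w.1, w.2.1 + w.2.2) = Y w * h (w.1, w.2.1) := by rwa [sub_self]
    filter_upwards [hcont.eventually hYe'] with z hz
    simpa using hz
  have hY' : ContMDiffAt 𝓘(ℝ, W × ℝ × ℝ) 𝓘(ℝ, E) ∞ Y (u₀, t₀, t₀ - t₀) := by rwa [sub_self]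
  have h1 : ContMDiffAt 𝓘(ℝ, W × ℝ) 𝓘(ℝ, E) ∞ (fun z : W × ℝ => Y (z.1, t₀, z.2 - t₀)) (u₀, t₀) :=
    ContMDiffAt.comp (g := Y) (f := fun z : W × ℝ => ((z.1, t₀, z.2 - t₀) : W × ℝ × ℝ)) (u₀, t₀) hY'
      (ContDiffAt.contMDiffAt (by fun_prop))
  have h2 : ContMDiffAt 𝓘(ℝ, W × ℝ) 𝓘(ℝ, E) ∞ (fun z : W × ℝ => h (z.1, t₀)) (u₀, t₀) :=
    ContMDiffAt.comp (g := fun u => h (u, t₀)) (f := fun z : W × ℝ => z.1) (u₀, t₀) (slice u₀ t₀)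
      (ContDiffAt.contMDiffAt (by fun_prop))
  exact (h1.mul h2).congr_of_eventuallyEq e1

/-- The flow is started at `t₀ - ε` and run for time `2ε`, which puts `t₀` in the interior of the
interval; undoing the rescaling of time gives the solution. -/
theorem exists_local_solution {ξ : ℝ → E} (hξ : ContDiff ℝ ∞ ξ) (t₀ : ℝ) :
    ∃ δ > 0, ∃ y : ℝ → K, ∀ t ∈ Set.Ioo (t₀ - δ) (t₀ + δ), HasLogDeriv y t (ξ t) := by
  obtain ⟨Y, -, -, hYe⟩ := exists_local_flow (K := K) (W := ℝ) (ξ := fun z => ξ z.2)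
    (hξ.comp contDiff_snd) 0 t₀
  have hcont : Filter.Tendsto (fun ε : ℝ => ((0, t₀ - ε, 2 * ε) : ℝ × ℝ × ℝ)) (𝓝[>] 0)
      (𝓝 (0, t₀, 0)) := by
    have : Continuous (fun ε : ℝ => ((0, t₀ - ε, 2 * ε) : ℝ × ℝ × ℝ)) := by fun_prop
    have h := this.tendsto 0
    simp only [sub_zero, mul_zero] at h
    exact h.mono_left nhdsWithin_le_nhds
  obtain ⟨ε, ⟨y, -, -, -, hy⟩, hε⟩ := ((hcont.eventually hYe).and self_mem_nhdsWithin).exists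
  have hε : 0 < ε := hε
  refine ⟨ε, hε, fun t => y ((t - (t₀ - ε)) / (2 * ε)), fun t ht => ?_⟩
  have hmem : (t - (t₀ - ε)) / (2 * ε) ∈ Set.Ioo (0 : ℝ) 1 := by
    constructor
    · apply div_pos _ (by positivity); linarith [ht.1]
    · rw [div_lt_one (by positivity)]; linarith [ht.2]
  have hd : HasDerivAt (fun t => (t - (t₀ - ε)) / (2 * ε)) (1 / (2 * ε)) t :=
    ((hasDerivAt_id t).sub_const _).div_const _
  have h1 := HasLogDeriv.comp_real (h := y) (f := fun t => (t - (t₀ - ε)) / (2 * ε)) (hy _ hmem) hd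
  rw [smul_smul, one_div, inv_mul_cancel₀ (by positivity), one_smul] at h1
  have e : t₀ - ε + 2 * ε * ((t - (t₀ - ε)) / (2 * ε)) = t := by
    field_simp; ring
  rwa [e] at h1

omit [FiniteDimensional ℝ E] in
-- On the overlap the two solutions differ by a constant right factor, and multiplying the second
-- one by this factor keeps it a solution.
theorem exists_glue_solution {ξ : ℝ → E} {a b c d : ℝ} (hac : a ≤ c) (hcb : c < b) (hbd : b ≤ d)
    {h k : ℝ → K} (hh : ∀ t ∈ Set.Ioo a b, HasLogDeriv h t (ξ t))
    (hk : ∀ t ∈ Set.Ioo c d, HasLogDeriv k t (ξ t)) :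
    ∃ m : ℝ → K, ∀ t ∈ Set.Ioo a d, HasLogDeriv m t (ξ t) := by
  obtain ⟨r, hcr, hrb⟩ := exists_between hcb
  have hov : ∀ t ∈ Set.Ioo c b, h t = k t * ((k r)⁻¹ * h r) := fun t ht =>
    eq_of_hasLogDeriv isOpen_Ioo isPreconnected_Ioo
      (fun t ht => hh t ⟨hac.trans_lt ht.1, ht.2⟩)
      (fun t ht => (hk t ⟨ht.1, ht.2.trans_le hbd⟩).mul_right _) (t₀ := r) ⟨hcr, hrb⟩
      (by simp) ht
  refine ⟨fun t => if t < r then h t else k t * ((k r)⁻¹ * h r), fun t ht => ?_⟩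
  rcases lt_or_ge t b with htb | htb
  · refine (hh t ⟨ht.1, htb⟩).congr ?_
    filter_upwards [eventually_lt_nhds htb] with x hx
    by_cases hxr : x < r
    · rw [if_pos hxr]
    · rw [if_neg hxr, hov x ⟨hcr.trans_le (not_lt.1 hxr), hx⟩]
  · refine ((hk t ⟨hcb.trans_le htb, ht.2⟩).mul_right ((k r)⁻¹ * h r)).congr ?_
    filter_upwards [eventually_gt_nhds (hrb.trans_le htb)] with x hx
    rw [if_neg (not_lt.2 hx.le)]

/-- Existence of path-ordered exponentials. -/
theorem exists_isPathOrderedExp {ξ : ℝ → E} (hξ : ContDiff ℝ ∞ ξ) :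
    ∃ h : ℝ → K, IsPathOrderedExp ξ h := by
  -- The radii of symmetric intervals carrying a solution form a clopen set: solutions near `b` and
  -- `-b` can be glued to a solution on a slightly smaller interval.
  set T : Set ℝ := {b | ∃ h : ℝ → K, ∀ t ∈ Set.Ioo (-b) b, HasLogDeriv h t (ξ t)} with hT
  have mono : ∀ {b c}, b ≤ c → c ∈ T → b ∈ T := by
    rintro b c hbc ⟨h, hh⟩
    exact ⟨h, fun t ht => hh t ⟨by linarith [ht.1], by linarith [ht.2]⟩⟩
  have nonpos : ∀ {b}, b ≤ 0 → b ∈ T := fun {b} hb => ⟨fun _ => 1, fun t ht => by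
    linarith [ht.1, ht.2]⟩
  have step : ∀ b, ∃ δ > 0, ∀ c, b - δ < c → c ∈ T → b + δ ∈ T := by
    intro b
    rcases lt_trichotomy b 0 with hb | hb | hb
    · exact ⟨-b, by linarith, fun c _ _ => nonpos (by linarith)⟩
    · subst hb
      obtain ⟨δ, hδ, y, hy⟩ := exists_local_solution (K := K) hξ 0
      refine ⟨δ, hδ, fun c _ _ => ⟨y, fun t ht => hy t (by simpa using ht)⟩⟩
    · obtain ⟨δ₁, hδ₁, y₁, hy₁⟩ := exists_local_solution (K := K) hξ b
      obtain ⟨δ₂, hδ₂, y₂, hy₂⟩ := exists_local_solution (K := K) hξ (-b)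
      have m1 := min_le_left δ₁ (min δ₂ b)
      have m2 := (min_le_right δ₁ (min δ₂ b)).trans (min_le_left _ _)
      have m3 := (min_le_right δ₁ (min δ₂ b)).trans (min_le_right _ _)
      set δ := min δ₁ (min δ₂ b) with hδ
      have hδ0 : 0 < δ := by positivity
      refine ⟨δ, hδ0, fun c hc hcT => ?_⟩
      obtain ⟨b', hb'1, hb'2⟩ := exists_between (show b - δ < min c b from lt_min hc (by linarith))
      obtain ⟨h, hh⟩ := mono (hb'2.le.trans (min_le_left _ _)) hcT
      have hb'b : b' < b := hb'2.trans_le (min_le_right _ _)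
      obtain ⟨m, hm⟩ := exists_glue_solution (a := -b') (b := b') (c := b - δ) (d := b + δ)
        (by linarith) hb'1 (by linarith) hh
        (fun t ht => hy₁ t ⟨by linarith [ht.1], by linarith [ht.2]⟩)
      obtain ⟨m', hm'⟩ := exists_glue_solution (a := -b - δ) (b := -b + δ) (c := -b') (d := b + δ)
        (by linarith) (by linarith) (by linarith)
        (fun t ht => hy₂ t ⟨by linarith [ht.1], by linarith [ht.2]⟩) hm
      exact ⟨m', fun t ht => hm' t ⟨by linarith [ht.1], ht.2⟩⟩
  have hclopen : IsClopen T := by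
    constructor
    · refine isClosed_of_closure_subset fun b hb => ?_
      obtain ⟨δ, hδ, hst⟩ := step b
      obtain ⟨c, hcT, hc⟩ := Metric.mem_closure_iff.1 hb δ hδ
      rw [Real.dist_eq, abs_lt] at hc
      exact mono (by linarith) (hst c (by linarith) hcT)
    · refine Metric.isOpen_iff.2 fun b hb => ?_
      obtain ⟨δ, hδ, hst⟩ := step b
      refine ⟨δ, hδ, fun c hc => ?_⟩
      rw [Metric.mem_ball, Real.dist_eq, abs_lt] at hc
      exact mono (by linarith) (hst b (by linarith) hb)
  have hall : ∀ b, b ∈ T := fun b => by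
    rw [hclopen.eq_univ ⟨0, nonpos le_rfl⟩]; trivial
  choose sol hsol using hall
  have hs : ∀ b, ∀ t ∈ Set.Ioo (-b) b, HasLogDeriv (fun t => sol b t * (sol b 0)⁻¹) t (ξ t) :=
    fun b t ht => (hsol b t ht).mul_right _
  have heq : ∀ b c t, 0 < b → b ≤ c → t ∈ Set.Ioo (-b) b →
      sol b t * (sol b 0)⁻¹ = sol c t * (sol c 0)⁻¹ := fun b c t hb hbc ht =>
    eq_of_hasLogDeriv isOpen_Ioo isPreconnected_Ioo (hs b)
      (fun t ht => hs c t ⟨by linarith [ht.1], by linarith [ht.2]⟩) (t₀ := 0)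
      ⟨by linarith, hb⟩ (by simp) ht
  -- Solutions normalized at `0` agree on common intervals, so the value at `t` may be read off from
  -- any radius exceeding `|t|`.
  refine ⟨fun t => sol (|t| + 1) t * (sol (|t| + 1) 0)⁻¹, by simp, fun t => ?_⟩
  have h1 : HasLogDeriv (fun r => sol (|t| + 2) r * (sol (|t| + 2) 0)⁻¹) t (ξ t) :=
    hs _ t ⟨by linarith [neg_abs_le t], by linarith [le_abs_self t]⟩
  refine h1.congr ?_
  filter_upwards [continuous_abs.continuousAt.eventually (eventually_lt_nhds (lt_add_one |t|))]
    with r hr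
  exact heq _ _ r (by positivity) (by linarith) ⟨by linarith [neg_abs_le r], by
    linarith [le_abs_self r]⟩

end LieGroupODE

/-! ### Arrows, functors and transformations of 2-torsors in terms of `H`. -/

section TorsorAlgebra

variable {EG : Type*} [NormedAddCommGroup EG] [NormedSpace ℝ EG]
  {EH : Type*} [NormedAddCommGroup EH] [NormedSpace ℝ EH]
  {G : Type*} [TopologicalSpace G] [ChartedSpace EG G] [Group G]
  {H : Type*} [TopologicalSpace H] [ChartedSpace EH H] [Group H]
  {X : LieCrossedModule EG EH G H}

namespace GroupoidAction

variable {Obj Arr : Type*} (S : GroupoidAction X Obj Arr)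

/-- The arrow `id_p · (1, h)` from `p` to `p · t(h)`. -/
def arrow (p : Obj) (h : H) : Arr := S.act₁ (S.ident p) (1, h)

theorem src_arrow (p : Obj) (h : H) : S.src (S.arrow p h) = p := by
  rw [arrow, src_act, src_ident, act₀_one]

theorem tgt_arrow (p : Obj) (h : H) : S.tgt (S.arrow p h) = S.act₀ p (X.t h) := by
  rw [arrow, tgt_act, tgt_ident, mul_one]

theorem arrow_one (p : Obj) : S.arrow p 1 = S.ident p := S.act₁_one _

/-- By the Peiffer identity the second arrow is `id_p · (t h, h h' h⁻¹)`, and composition multiplies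
this on the right by `h`. Hence the arrow performed earlier contributes the left factor. -/
theorem comp_arrow (p : Obj) (h h' : H) :
    S.comp (S.arrow (S.act₀ p (X.t h)) h') (S.arrow p h) = S.arrow p (h * h') := by
  have e : S.arrow (S.act₀ p (X.t h)) h' = S.act₁ (S.ident p) (X.t h * 1, h * h' * h⁻¹) := by
    rw [arrow, ident_act, act₁_mul, X.peiffer, one_mul]
  rw [e, arrow, S.comp_act _ _ _ _ _ (by rw [tgt_ident, src_ident])]
  have e2 := S.comp_ident (S.ident p)
  rw [src_ident] at e2
  rw [e2, inv_mul_cancel_right, arrow]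

theorem arrow_act (p : Obj) (h : H) (g : G) :
    S.act₁ (S.arrow p h) (g, 1) = S.arrow (S.act₀ p g) (X.α g⁻¹ h) := by
  rw [arrow, arrow, act₁_mul, ident_act, act₁_mul]
  simp

end GroupoidAction

namespace TwoTorsor

variable (T : TwoTorsor X)

theorem act₀_div₀ (q p : T.Obj) : T.str.act₀ p (T.div₀ q p) = q := (T.simply₀ p q).choose_spec.1

theorem eq_div₀ {q p : T.Obj} {g : G} (h : T.str.act₀ p g = q) : g = T.div₀ q p :=
  (T.simply₀ p q).unique h (T.act₀_div₀ q p)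

theorem act₀_injective (p : T.Obj) : Function.Injective (T.str.act₀ p) := fun _ _ h =>
  (T.simply₀ p _).unique h rfl

theorem act₁_div₁ (b a : T.Arr) : T.str.act₁ a (T.div₁ b a) = b := (T.simply₁ a b).choose_spec.1

/-- The element `h` of `H` for which `a = id · (1, h)`. -/
def arrHol (a : T.Arr) : H := (T.div₁ a (T.str.ident (T.str.src a))).2

theorem arrow_arrHol (a : T.Arr) : T.str.arrow (T.str.src a) (T.arrHol a) = a := by
  have h := T.act₁_div₁ a (T.str.ident (T.str.src a))
  have h1 := congrArg T.str.src h
  rw [T.str.src_act, T.str.src_ident] at h1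
  have h2 : (T.div₁ a (T.str.ident (T.str.src a))).1 = 1 :=
    T.act₀_injective _ (h1.trans (T.str.act₀_one _).symm)
  conv_rhs => rw [← h]
  rw [GroupoidAction.arrow, arrHol, ← h2]

theorem arrHol_arrow (p : T.Obj) (h : H) : T.arrHol (T.str.arrow p h) = h := by
  have h1 := T.arrow_arrHol (T.str.arrow p h)
  rw [T.str.src_arrow] at h1
  have h2 := (T.simply₁ (T.str.ident p) _).unique h1 rfl
  exact congrArg Prod.snd h2

theorem arr_ext {a b : T.Arr} (h : T.str.src a = T.str.src b) (h' : T.arrHol a = T.arrHol b) :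
    a = b := by
  rw [← T.arrow_arrHol a, ← T.arrow_arrHol b, h, h']

theorem tgt_eq (a : T.Arr) : T.str.tgt a = T.str.act₀ (T.str.src a) (X.t (T.arrHol a)) := by
  rw [← T.str.tgt_arrow, T.arrow_arrHol]

theorem arrHol_comp {b a : T.Arr} (h : T.str.tgt a = T.str.src b) :
    T.arrHol (T.str.comp b a) = T.arrHol a * T.arrHol b := by
  have h1 := T.arrow_arrHol b
  rw [← h, T.tgt_eq] at h1
  conv_lhs => rw [← h1, ← T.arrow_arrHol a]
  rw [T.str.src_arrow, T.arrHol_arrow, T.str.comp_arrow, T.arrHol_arrow]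

theorem arrHol_act (a : T.Arr) (g : G) : T.arrHol (T.str.act₁ a (g, 1)) = X.α g⁻¹ (T.arrHol a) := by
  conv_lhs => rw [← T.arrow_arrHol a]
  rw [T.str.arrow_act, T.arrHol_arrow]

theorem arrHol_act₁ (a : T.Arr) (g : G) (h : H) :
    T.arrHol (T.str.act₁ a (g, h)) = X.α g⁻¹ (T.arrHol a * h) := by
  have h1 : T.str.act₁ a (g, h) = T.str.arrow (T.str.act₀ (T.str.src a) g)
      (X.α g⁻¹ (T.arrHol a * h)) := by
    conv_lhs => rw [← T.arrow_arrHol a]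
    rw [← T.str.arrow_act, GroupoidAction.arrow, GroupoidAction.arrow, T.str.act₁_mul,
      T.str.act₁_mul]
    simp
  rw [h1, T.arrHol_arrow]

theorem arrHol_ident (p : T.Obj) : T.arrHol (T.str.ident p) = 1 := by
  rw [← T.str.arrow_one, T.arrHol_arrow]

end TwoTorsor

namespace TorHom

variable {S T U : TwoTorsor X}

theorem arr_arrow (f : TorHom S T) (p : S.Obj) (h : H) :
    f.arr (S.str.arrow p h) = T.str.arrow (f.obj p) h := by
  rw [GroupoidAction.arrow, f.map_act₁, f.map_ident, GroupoidAction.arrow]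

theorem arrHol_arr (f : TorHom S T) (a : S.Arr) : T.arrHol (f.arr a) = S.arrHol a := by
  rw [← S.arrow_arrHol a, f.arr_arrow, T.arrHol_arrow, S.arrHol_arrow]

/-- An arrow is determined by its source and its element of `H`, and equivariance forces functors to
preserve the latter. -/
theorem ext_obj {f g : TorHom S T} (h : ∀ p, f.obj p = g.obj p) : f = g := by
  have h1 : f.obj = g.obj := funext h
  have h2 : f.arr = g.arr := by
    funext a
    refine T.arr_ext ?_ ?_
    · rw [f.map_src, g.map_src, h]
    · rw [f.arrHol_arr, g.arrHol_arr]
  cases f; cases g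
  cases h1; cases h2
  rfl

theorem obj_objInv (f : TorHom S T) (q : T.Obj) : f.obj (f.objInv q) = q :=
  (f.obj_bijective.2 q).choose_spec

theorem objInv_obj (f : TorHom S T) (p : S.Obj) : f.objInv (f.obj p) = p :=
  f.obj_bijective.1 (f.obj_objInv _)

theorem objInv_act (f : TorHom S T) (q : T.Obj) (g : G) :
    f.objInv (T.str.act₀ q g) = S.str.act₀ (f.objInv q) g :=
  f.obj_bijective.1 (by rw [f.obj_objInv, f.map_act₀, f.obj_objInv])

/-- Equivariant maps of objects extend to 1-morphisms. -/
def ofObj (f : S.Obj → T.Obj) (hf : ∀ p g, f (S.str.act₀ p g) = T.str.act₀ (f p) g) :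
    TorHom S T where
  obj := f
  arr a := T.str.arrow (f (S.str.src a)) (S.arrHol a)
  map_src a := T.str.src_arrow _ _
  map_tgt a := by rw [T.str.tgt_arrow, S.tgt_eq, hf]
  map_ident p := by rw [S.arrHol_ident, T.str.arrow_one, S.str.src_ident]
  map_comp b a h := by
    rw [S.str.src_comp _ _ h, S.arrHol_comp h, ← h, S.tgt_eq a, hf, T.str.comp_arrow]
  map_act₀ := hf
  map_act₁ a k := by
    obtain ⟨g, h⟩ := k
    refine T.arr_ext ?_ ?_
    · rw [T.str.src_arrow, T.str.src_act, T.str.src_arrow, S.str.src_act, hf]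
    · rw [T.arrHol_arrow, T.arrHol_act₁, S.arrHol_act₁, T.arrHol_arrow]

end TorHom

namespace TwoMor

variable {S T : TwoTorsor X} {f g : TorHom S T}

theorem hol_eq (η : TwoMor f g) (p : S.Obj) : η.hol p = T.arrHol (η.app p) := by
  rw [hol, TwoTorsor.arrHol, η.src_app]

theorem app_eq (η : TwoMor f g) (p : S.Obj) : η.app p = T.str.arrow (f.obj p) (η.hol p) := by
  rw [η.hol_eq, ← η.src_app, T.arrow_arrHol]

theorem tgt_eq (η : TwoMor f g) (p : S.Obj) :
    g.obj p = T.str.act₀ (f.obj p) (X.t (η.hol p)) := by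
  rw [← η.tgt_app, T.tgt_eq, η.src_app, η.hol_eq]

theorem hol_act (η : TwoMor f g) (p : S.Obj) (k : G) :
    η.hol (S.str.act₀ p k) = X.α k⁻¹ (η.hol p) := by
  rw [η.hol_eq, η.equivariant, T.arrHol_act, η.hol_eq]

theorem ext_hol {η θ : TwoMor f g} (h : ∀ p, η.hol p = θ.hol p) : η = θ := by
  have h1 : η.app = θ.app := by
    funext p; rw [η.app_eq, θ.app_eq, h]
  cases η; cases θ; cases h1; rfl

/-- Equivariant `H`-valued functions define 2-morphisms. -/
def ofHol (η : S.Obj → H) (h : ∀ p, g.obj p = T.str.act₀ (f.obj p) (X.t (η p)))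
    (hη : ∀ p k, η (S.str.act₀ p k) = X.α k⁻¹ (η p)) : TwoMor f g where
  app p := T.str.arrow (f.obj p) (η p)
  src_app p := T.str.src_arrow _ _
  tgt_app p := by rw [T.str.tgt_arrow, h]
  naturality a := by
    have e1 : T.str.tgt (f.arr a) = T.str.src (T.str.arrow (f.obj (S.str.tgt a)) (η (S.str.tgt a))) := by
      rw [f.map_tgt, T.str.src_arrow]
    have e2 : T.str.tgt (T.str.arrow (f.obj (S.str.src a)) (η (S.str.src a))) = T.str.src (g.arr a) := by
      rw [g.map_src, T.str.tgt_arrow, h]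
    refine T.arr_ext ?_ ?_
    · rw [T.str.src_comp _ _ e1, T.str.src_comp _ _ e2, f.map_src, T.str.src_arrow]
    -- Naturality costs no further hypothesis: equivariance of `η` along the target `p · t(h)`
    -- conjugates by `h⁻¹`, by the Peiffer identity, and this moves the two factors past each other.
    · rw [T.arrHol_comp e1, T.arrHol_comp e2, f.arrHol_arr, g.arrHol_arr, T.arrHol_arrow,
        T.arrHol_arrow, S.tgt_eq, hη, ← map_inv, X.peiffer]
      group
  equivariant p k := by
    rw [f.map_act₀, T.str.arrow_act, hη]

theorem ofHol_hol (η : S.Obj → H) (h : ∀ p, g.obj p = T.str.act₀ (f.obj p) (X.t (η p)))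
    (hη : ∀ p k, η (S.str.act₀ p k) = X.α k⁻¹ (η p)) (p : S.Obj) : (ofHol η h hη).hol p = η p := by
  rw [hol_eq]
  exact T.arrHol_arrow _ _

end TwoMor

end TorsorAlgebra

/-! ### Paths -/

section Paths

variable {EM : Type*} [NormedAddCommGroup EM] [NormedSpace ℝ EM]
  {M : Type*} [TopologicalSpace M] [ChartedSpace EM M]

theorem SmoothPath.ext_fun {x y : M} {γ δ : SmoothPath EM x y} (h : ∀ t, γ.toFun t = δ.toFun t) :
    γ = δ := by
  have h1 : γ.toFun = δ.toFun := funext h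
  cases γ; cases δ; cases h1; rfl

theorem SmoothPath.eq_start {x y : M} (γ : SmoothPath EM x y) : γ.toFun 0 = x := by
  obtain ⟨ε, hε, h0, -⟩ := γ.sitting
  exact h0 0 hε.le

theorem SmoothPath.eq_end {x y : M} (γ : SmoothPath EM x y) : γ.toFun 1 = y := by
  obtain ⟨ε, hε, -, h1⟩ := γ.sitting
  exact h1 1 (by linarith)

/-- The image of a path under a smooth map. -/
def SmoothPath.push {V : Type*} [NormedAddCommGroup V] [NormedSpace ℝ V] {c : V → M}
    (hc : ContMDiff 𝓘(ℝ, V) 𝓘(ℝ, EM) ∞ c) {a b : V} (f : SmoothPath V a b) :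
    SmoothPath EM (c a) (c b) where
  toFun t := c (f.toFun t)
  smooth := hc.comp f.smooth
  sitting := by
    obtain ⟨ε, hε, h0, h1⟩ := f.sitting
    exact ⟨ε, hε, fun t ht => by rw [h0 t ht], fun t ht => by rw [h1 t ht]⟩

/-- The straight line between two points of a vector space. -/
def line {V : Type*} [NormedAddCommGroup V] [NormedSpace ℝ V] (a b : V) : SmoothPath V a b where
  toFun s := a + Real.smoothTransition (3 * s - 1) • (b - a)
  smooth := by
    have := smoothTransition_smooth
    exact ContDiff.contMDiff (by fun_prop)
  sitting := by
    refine ⟨1 / 4, by norm_num, fun s hs => ?_, fun s hs => ?_⟩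
    · rw [Real.smoothTransition.zero_of_nonpos (by linarith), zero_smul, add_zero]
    · rw [Real.smoothTransition.one_of_one_le (by linarith), one_smul, add_sub_cancel]

theorem finrank_range_comp_le {V W E : Type*} [NormedAddCommGroup V] [NormedSpace ℝ V]
    [NormedAddCommGroup W] [NormedSpace ℝ W] [NormedAddCommGroup E] [NormedSpace ℝ E]
    [FiniteDimensional ℝ W]
    (L : W →L[ℝ] E) (L' : V →L[ℝ] W) :
    Module.finrank ℝ (LinearMap.range (L.comp L').toLinearMap) ≤
      Module.finrank ℝ (LinearMap.range L.toLinearMap) := by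
  refine Submodule.finrank_mono ?_
  rintro _ ⟨v, rfl⟩
  exact ⟨L' v, rfl⟩

theorem RankLE.comp {V W : Type*} [NormedAddCommGroup V] [NormedSpace ℝ V]
    [NormedAddCommGroup W] [NormedSpace ℝ W] [FiniteDimensional ℝ W] {r : ℕ} {f : W → M}
    (h : RankLE EM r f) (hf : ContMDiff 𝓘(ℝ, W) 𝓘(ℝ, EM) ∞ f) {g : V → W} (hg : ContDiff ℝ ∞ g) :
    RankLE EM r (fun z => f (g z)) := by
  intro z
  have h1 := HasMFDerivAt.comp (I' := 𝓘(ℝ, W)) (g := f) (f := g) z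
    (hf.mdifferentiableAt (x := g z) (by simp)).hasMFDerivAt
    ((hg.differentiable (by simp) z).hasFDerivAt.hasMFDerivAt)
  have h2 : mfderiv 𝓘(ℝ, V) 𝓘(ℝ, EM) (fun z => f (g z)) z = _ := h1.mfderiv
  rw [h2]
  exact (finrank_range_comp_le (V := V) (W := W) (E := EM) _ _).trans (h (g z))

theorem finrank_range_le_domain {W E : Type*} [NormedAddCommGroup W] [NormedSpace ℝ W]
    [NormedAddCommGroup E] [NormedSpace ℝ E] [FiniteDimensional ℝ W] (L : W →L[ℝ] E) :
    Module.finrank ℝ (LinearMap.range L.toLinearMap) ≤ Module.finrank ℝ W :=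
  LinearMap.finrank_range_le _

theorem rankLE_of_le {W : Type*} [NormedAddCommGroup W] [NormedSpace ℝ W] [FiniteDimensional ℝ W]
    (f : W → M) : RankLE EM (Module.finrank ℝ W) f := fun z =>
  finrank_range_le_domain (W := W) (E := EM) (mfderiv 𝓘(ℝ, W) 𝓘(ℝ, EM) f z)

/-- The homotopy interpolates the parameters `f` and `f'` inside `ℝ`, so it factors through a
one-dimensional space and has rank at most one. -/
theorem ThinPath.of_factor {x y : M} {γ γ' : SmoothPath EM x y} {c : ℝ → M}
    (hc : ContMDiff 𝓘(ℝ, ℝ) 𝓘(ℝ, EM) ∞ c) {f f' : ℝ → ℝ} (hf : ContDiff ℝ ∞ f)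
    (hf' : ContDiff ℝ ∞ f') (hγ : ∀ t, γ.toFun t = c (f t)) (hγ' : ∀ t, γ'.toFun t = c (f' t))
    (hend : ∃ ε > 0, (∀ r ∈ Set.Icc (0 : ℝ) 1, ∀ t ≤ ε, c (f t + r * (f' t - f t)) = x) ∧
      (∀ r ∈ Set.Icc (0 : ℝ) 1, ∀ t ≥ 1 - ε, c (f t + r * (f' t - f t)) = y)) : ThinPath γ γ' := by
  obtain ⟨ε, hε, h0, h1⟩ := hend
  have hst : ∀ s, Real.smoothTransition (3 * s - 1) ∈ Set.Icc (0 : ℝ) 1 := fun s =>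
    ⟨Real.smoothTransition.nonneg _, Real.smoothTransition.le_one _⟩
  have hsm : ContDiff ℝ ∞ (fun z : ℝ × ℝ => f z.2 + Real.smoothTransition (3 * z.1 - 1) *
      (f' z.2 - f z.2)) := by
    have := smoothTransition_smooth
    fun_prop
  refine ⟨⟨fun z => c (f z.2 + Real.smoothTransition (3 * z.1 - 1) * (f' z.2 - f z.2)), 
    hc.comp hsm.contMDiff, min ε (1 / 4), by positivity, ?_, ?_, ?_, ?_⟩, ?_⟩
  · exact fun s t ht => h0 _ (hst s) t (ht.trans (min_le_left _ _))
  · exact fun s t ht => h1 _ (hst s) t (by linarith [min_le_left ε (1 / 4)])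
  · intro s hs t
    have := hs.trans (min_le_right _ _)
    rw [Real.smoothTransition.zero_of_nonpos (by linarith), zero_mul, add_zero, hγ]
  · intro s hs t
    have := min_le_right ε (1 / 4)
    rw [Real.smoothTransition.one_of_one_le (by linarith), one_mul, add_sub_cancel, hγ']
  · have h2 := rankLE_of_le (EM := EM) c
    rw [Module.finrank_self] at h2
    exact h2.comp hc hsm

/-- Images under a curve of two paths with the same ends are thinly homotopic. -/
theorem ThinPath.push {c : ℝ → M} (hc : ContMDiff 𝓘(ℝ, ℝ) 𝓘(ℝ, EM) ∞ c) {a b : ℝ}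
    (f f' : SmoothPath ℝ a b) : ThinPath (SmoothPath.push hc f) (SmoothPath.push hc f') := by
  obtain ⟨ε, hε, h0, h1⟩ := f.sitting
  obtain ⟨ε', hε', h0', h1'⟩ := f'.sitting
  refine ThinPath.of_factor hc f.smooth.contDiff f'.smooth.contDiff (fun _ => rfl) (fun _ => rfl)
    ⟨min ε ε', by positivity, fun r _ t ht => ?_, fun r _ t ht => ?_⟩
  · rw [h0 t (ht.trans (min_le_left _ _)), h0' t (ht.trans (min_le_right _ _)), sub_self, mul_zero,
      add_zero]
  · rw [h1 t (by linarith [min_le_left ε ε']), h1' t (by linarith [min_le_right ε ε']), sub_self,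
      mul_zero, add_zero]

/-- Reparametrizations are thin homotopies. -/
theorem ThinPath.reparam {x y : M} {γ γ' : SmoothPath EM x y} (f : SmoothPath ℝ (0 : ℝ) 1)
    (h : ∀ t, γ'.toFun t = γ.toFun (f.toFun t)) : ThinPath γ γ' := by
  obtain ⟨ε, hε, h0, h1⟩ := f.sitting
  obtain ⟨ε', hε', h0', h1'⟩ := γ.sitting
  refine ThinPath.of_factor γ.smooth contDiff_id f.smooth.contDiff (fun _ => rfl) h
    ⟨min ε ε', by positivity, fun r hr t ht => ?_, fun r hr t ht => ?_⟩
  · have a1 := ht.trans (min_le_left _ _)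
    have a2 := ht.trans (min_le_right _ _)
    rw [h0 t a1]
    refine h0' _ ?_
    simp only [id]
    nlinarith [hr.1, hr.2]
  · have a1 := min_le_left ε ε'
    have a2 := min_le_right ε ε'
    rw [h1 t (by linarith)]
    refine h1' _ ?_
    simp only [id]
    nlinarith [hr.1, hr.2]

theorem push_concat {V : Type*} [NormedAddCommGroup V] [NormedSpace ℝ V] {c : V → M}
    (hc : ContMDiff 𝓘(ℝ, V) 𝓘(ℝ, EM) ∞ c) {a b d : V} (f : SmoothPath V a b)
    (g : SmoothPath V b d) :
    SmoothPath.push hc (f.concat g) = (SmoothPath.push hc f).concat (SmoothPath.push hc g) :=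
  SmoothPath.ext_fun fun t => by
    simp only [SmoothPath.push, SmoothPath.concat]
    split_ifs <;> rfl

/-- A bigon of rank one is thinly homotopic to an identity. -/
theorem ThinBigon.refl_of_rankLE {x y : M} {γ γ' : SmoothPath EM x y} (S : Bigon γ γ')
    (hS : RankLE EM 1 S.toFun) : ThinBigon S (Bigon.refl γ) := by
  obtain ⟨ε, hε, hε1, h0, h1, h2, h3⟩ : ∃ ε > 0, ε ≤ 1 / 4 ∧
      (∀ s, ∀ t ≤ ε, S.toFun (s, t) = x) ∧ (∀ s, ∀ t ≥ 1 - ε, S.toFun (s, t) = y) ∧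
      (∀ s ≤ ε, ∀ t, S.toFun (s, t) = γ.toFun t) ∧ ∀ s ≥ 1 - ε, ∀ t, S.toFun (s, t) = γ'.toFun t := by
    obtain ⟨ε, hε, h0, h1, h2, h3⟩ := S.sitting
    have m1 := min_le_left ε (1 / 4)
    have m2 := min_le_right ε (1 / 4)
    exact ⟨min ε (1 / 4), by positivity, m2, fun s t ht => h0 s t (by linarith),
      fun s t ht => h1 s t (by linarith), fun s hs => h2 s (by linarith),
      fun s hs => h3 s (by linarith)⟩
  have hsm := smoothTransition_smooth
  -- A reparametrization equal to `s` up to `1 - ε` and equal to `1` from `1 - ε/2` on. It leaves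
  -- `S` unchanged, and it makes the scaled parameter stationary near `s = 1` at every stage of the
  -- homotopy.
  set τ : ℝ → ℝ := fun s => s + Real.smoothTransition ((s - (1 - ε)) / (ε / 2)) * (1 - s) with hτ
  have hτs : ContDiff ℝ ∞ τ := by
    have : ContDiff ℝ ∞ (fun s : ℝ => (s - (1 - ε)) / (ε / 2)) := by fun_prop
    exact contDiff_id.add ((hsm.comp this).mul (by fun_prop))
  have hτ0 : ∀ s ≤ 1 - ε, τ s = s := fun s hs => by
    simp only [hτ]
    rw [Real.smoothTransition.zero_of_nonpos (div_nonpos_of_nonpos_of_nonneg (by linarith)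
      (by positivity)), zero_mul, add_zero]
  have hτ1 : ∀ s ≥ 1 - ε / 2, τ s = 1 := fun s hs => by
    simp only [hτ]
    rw [Real.smoothTransition.one_of_one_le ((one_le_div (by positivity)).2 (by linarith)), one_mul,
      add_sub_cancel]
  have hτ2 : ∀ s ≥ 1 - ε, τ s ≥ 1 - ε := fun s hs => by
    rcases le_or_gt (1 - ε / 2) s with h | h
    · rw [hτ1 s h]; linarith
    · have := Real.smoothTransition.nonneg ((s - (1 - ε)) / (ε / 2))
      simp only [hτ]
      nlinarith
  -- The homotopy contracts the first parameter of the bigon to `0`. It always factors through `S`,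
  -- so its rank is at most two, and its source and target families inherit rank at most one from
  -- `S`.
  set m : ℝ × ℝ × ℝ → ℝ × ℝ := fun z =>
    ((1 - Real.smoothTransition (3 * z.1 - 1)) * τ z.2.1, z.2.2) with hm
  have hms : ContDiff ℝ ∞ m := by
    refine ContDiff.prodMk (ContDiff.mul ?_ (hτs.comp (by fun_prop))) (by fun_prop)
    fun_prop
  have hpos : ∀ s ≤ ε, ∀ r, (1 - Real.smoothTransition (3 * r - 1)) * τ s ≤ ε := by
    intro s hs r
    rw [hτ0 s (by linarith)]
    have a1 := Real.smoothTransition.nonneg (3 * r - 1)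
    have a2 := Real.smoothTransition.le_one (3 * r - 1)
    rcases le_or_gt s 0 with h | h <;> nlinarith
  have hrank : RankLE EM 2 S.toFun := by
    have h := rankLE_of_le (EM := EM) S.toFun
    rwa [Module.finrank_prod, Module.finrank_self] at h
  refine ⟨fun z => S.toFun (m z), S.smooth.comp hms.contMDiff, hrank.comp S.smooth hms,
    ⟨ε / 2, by positivity, ?_, ?_, ?_, ?_, ?_, ?_⟩, ?_, ?_⟩
  · intro r hr s t
    simp only [hm]
    rw [Real.smoothTransition.zero_of_nonpos (by linarith), sub_zero, one_mul]
    rcases le_total s (1 - ε) with hs | hs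
    · rw [hτ0 s hs]
    · rw [h3 _ (hτ2 s hs), h3 _ hs]
  · intro r hr s t
    simp only [hm]
    rw [Real.smoothTransition.one_of_one_le (by linarith), sub_self, zero_mul, h2 0 hε.le]
    rfl
  · intro r s hs t
    simp only [hm]
    rw [h2 _ (hpos s (by linarith) r), h2 _ (hpos 0 hε.le r)]
  · intro r s hs t
    simp only [hm]
    rw [hτ1 s hs, hτ1 1 (by linarith)]
  · exact fun r s t ht => h0 _ _ (by linarith)
  · exact fun r s t ht => h1 _ _ (by linarith)
  · exact hS.comp S.smooth (g := fun z : ℝ × ℝ => m (z.1, 0, z.2)) (hms.comp (by fun_prop))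
  · exact hS.comp S.smooth (g := fun z : ℝ × ℝ => m (z.1, 1, z.2)) (hms.comp (by fun_prop))

end Paths

/-! ### Transport and pseudonatural transformations on the fibres of the bundles. -/

section Evaluation

variable {EM : Type*} [NormedAddCommGroup EM] [NormedSpace ℝ EM]
  {M : Type*} [TopologicalSpace M] [ChartedSpace EM M]
  {EG : Type*} [NormedAddCommGroup EG] [NormedSpace ℝ EG]
  {EH : Type*} [NormedAddCommGroup EH] [NormedSpace ℝ EH]
  {G : Type*} [TopologicalSpace G] [ChartedSpace EG G] [Group G]
  {H : Type*} [TopologicalSpace H] [ChartedSpace EH H] [Group H]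
  {X : LieCrossedModule EG EH G H}
  {𝓕 𝓕' : TransportTwoFunctor X EM M} {P P' : PrincipalTwoBundle X EM M}

theorem PrincipalTwoBundle.act₀_injective (P : PrincipalTwoBundle X EM M) (p : P.P₀) :
    Function.Injective (P.str.act₀ p) := fun _ g' h =>
  (P.simply₀ p (P.str.act₀ p g') (P.proj_act p g').symm).unique h rfl

namespace Realization

variable (ι : Realization 𝓕 P)

theorem tra_objInv {x y : M} (γ : SmoothPath EM x y) (p : (P.fiber x).Obj) :
    (ι y).objInv (ι.tra γ p) = (𝓕.map γ).obj ((ι x).objInv p) := (ι y).objInv_obj _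

theorem tra_act {x y : M} (γ : SmoothPath EM x y) (p : (P.fiber x).Obj) (g : G) :
    ι.tra γ ((P.fiber x).str.act₀ p g) = (P.fiber y).str.act₀ (ι.tra γ p) g := by
  unfold tra
  rw [(ι x).objInv_act, (𝓕.map γ).map_act₀, (ι y).map_act₀]

theorem tra_concat {x y z : M} (γ : SmoothPath EM x y) (δ : SmoothPath EM y z)
    (p : (P.fiber x).Obj) : ι.tra (γ.concat δ) p = ι.tra δ (ι.tra γ p) := by
  unfold tra
  rw [𝓕.map_concat, (ι y).objInv_obj]; rfl

theorem tra_const (x : M) (p : (P.fiber x).Obj) : ι.tra (SmoothPath.const x) p = p := by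
  unfold tra
  rw [𝓕.map_const]
  exact (ι x).obj_objInv p

theorem tra_thin {x y : M} {γ γ' : SmoothPath EM x y} (h : ThinPath γ γ') (p : (P.fiber x).Obj) :
    ι.tra γ p = ι.tra γ' p := by
  unfold tra
  rw [𝓕.map_thin _ _ h]

theorem hol_refl {x y : M} (γ : SmoothPath EM x y) (q : (𝓕.obj x).Obj) :
    (𝓕.map₂ (Bigon.refl γ)).hol q = 1 := by
  rw [TwoMor.hol_eq, 𝓕.map₂_refl, TwoTorsor.arrHol_ident]

theorem hol_of_rankLE {x y : M} {γ γ' : SmoothPath EM x y} (S : Bigon γ γ')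
    (hS : RankLE EM 1 S.toFun) (q : (𝓕.obj x).Obj) : (𝓕.map₂ S).hol q = 1 := by
  rw [TwoMor.hol_eq, 𝓕.map₂_thin _ _ (ThinBigon.refl_of_rankLE S hS), ← TwoMor.hol_eq, hol_refl]

end Realization

namespace PseudoNat

variable (ρ : PseudoNat 𝓕 𝓕') (ι : Realization 𝓕 P) (ι' : Realization 𝓕' P')

/-- The map on objects of the fibres induced by a pseudonatural transformation. -/
def fib (x : M) (p : (P.fiber x).Obj) : (P'.fiber x).Obj :=
  (ι' x).obj ((ρ.obj x).obj ((ι x).objInv p))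

theorem fib_act (x : M) (p : (P.fiber x).Obj) (g : G) :
    ρ.fib ι ι' x ((P.fiber x).str.act₀ p g) = (P'.fiber x).str.act₀ (ρ.fib ι ι' x p) g := by
  unfold fib
  rw [(ι x).objInv_act, (ρ.obj x).map_act₀, (ι' x).map_act₀]

theorem hol_act {x y : M} (γ : SmoothPath EM x y) (p : (P.fiber x).Obj) (k : G) :
    ρ.hol ι γ ((P.fiber x).str.act₀ p k) = X.α k⁻¹ (ρ.hol ι γ p) := by
  unfold hol
  rw [(ι x).objInv_act, TwoMor.hol_act]

theorem hol_concat {x y z : M} (γ : SmoothPath EM x y) (δ : SmoothPath EM y z)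
    (p : (P.fiber x).Obj) :
    ρ.hol ι (γ.concat δ) p = ρ.hol ι δ (ι.tra γ p) * ρ.hol ι γ p := by
  unfold hol
  rw [ι.tra_objInv, TwoMor.hol_eq, ρ.map_concat, TwoTorsor.arrHol_comp, TorHom.arrHol_arr,
    ← TwoMor.hol_eq, ← TwoMor.hol_eq]
  rw [(ρ.map δ).tgt_app, (𝓕'.map δ).map_src, (ρ.map γ).src_app]
  rfl

theorem hol_thin {x y : M} {γ γ' : SmoothPath EM x y} (h : ThinPath γ γ') (p : (P.fiber x).Obj) :
    ρ.hol ι γ p = ρ.hol ι γ' p := by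
  unfold hol
  rw [TwoMor.hol_eq, ρ.map_thin _ _ h, ← TwoMor.hol_eq]

/-- The constant path equals its concatenation with itself, so its value is an idempotent of the
group. -/
theorem hol_const (x : M) (p : (P.fiber x).Obj) : ρ.hol ι (SmoothPath.const x) p = 1 := by
  have h := ρ.hol_concat ι (SmoothPath.const x) (SmoothPath.const x) p
  have e : (SmoothPath.const (EM := EM) x).concat (SmoothPath.const x) = SmoothPath.const x :=
    SmoothPath.ext_fun fun t => ite_self _
  rw [e, ι.tra_const] at h
  exact left_eq_mul.1 h

/-- This records the target of the arrow `ρ(γ)(p)`; its derivative will be `F^*A' = A + t_*φ`. -/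
theorem tra_fib {x y : M} (γ : SmoothPath EM x y) (p : (P.fiber x).Obj) :
    ι'.tra γ (ρ.fib ι ι' x p) =
      (P'.fiber y).str.act₀ (ρ.fib ι ι' y (ι.tra γ p)) (X.t (ρ.hol ι γ p)) := by
  have h := (ρ.map γ).tgt_eq ((ι x).objInv p)
  unfold Realization.tra fib hol
  rw [(ι' x).objInv_obj, (ι y).objInv_obj, ← (ι' y).map_act₀]
  exact congrArg (ι' y).obj h

/-- The compatibility with bigons, read in `H`. The factors appear in the opposite order to the
composition of arrows, as in `GroupoidAction.comp_arrow`. -/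
theorem hol_bigon {x y : M} {γ γ' : SmoothPath EM x y} (S : Bigon γ γ') (p : (P.fiber x).Obj) :
    ρ.hol ι γ p * ι'.tra₂ S (ρ.fib ι ι' x p) = ι.tra₂ S p * ρ.hol ι γ' p := by
  have h := congrArg ((𝓕'.obj y).arrHol) (ρ.map_bigon S ((ι x).objInv p))
  have e1 : (𝓕'.obj y).str.tgt ((ρ.map γ).app ((ι x).objInv p)) =
      (𝓕'.obj y).str.src ((𝓕'.map₂ S).app ((ρ.obj x).obj ((ι x).objInv p))) := by
    rw [(ρ.map γ).tgt_app, (𝓕'.map₂ S).src_app]; rfl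
  have e2 : (𝓕'.obj y).str.tgt ((ρ.obj y).arr ((𝓕.map₂ S).app ((ι x).objInv p))) =
      (𝓕'.obj y).str.src ((ρ.map γ').app ((ι x).objInv p)) := by
    rw [(ρ.map γ').src_app, (ρ.obj y).map_tgt, (𝓕.map₂ S).tgt_app]; rfl
  rw [TwoTorsor.arrHol_comp _ e1, TwoTorsor.arrHol_comp _ e2, TorHom.arrHol_arr] at h
  unfold Realization.tra₂ fib hol
  rw [(ι' x).objInv_obj, TwoMor.hol_eq, TwoMor.hol_eq, TwoMor.hol_eq, TwoMor.hol_eq]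
  exact h

end PseudoNat

/-! ### Evaluation on underlying functions of paths -/

/-- The end points of a path are part of its type, which obstructs comparisons along curves with
moving ends. Evaluation on the underlying function, which only needs some path with that function,
avoids identifications between these types. -/
theorem SmoothPath.exists_toFun_eq {x y : M} (Γ : SmoothPath EM x y) {x' : M} (hx : x' = x) :
    ∃ Γ' : SmoothPath EM x' (Γ.toFun 1), Γ'.toFun = Γ.toFun := by
  subst hx
  obtain ⟨ε, hε, h0, h1⟩ := Γ.sitting
  exact ⟨⟨Γ.toFun, Γ.smooth, ε, hε, h0, fun t ht => by rw [h1 t ht, Γ.eq_end]⟩, rfl⟩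

/-- The transport along a path given by its underlying function. -/
def Realization.traAt (ι : Realization 𝓕 P) (γ : ℝ → M) (p : P.P₀) : P.P₀ :=
  open Classical in
  if h : ∃ Γ : SmoothPath EM (P.proj p) (γ 1), Γ.toFun = γ then (ι.tra h.choose ⟨p, rfl⟩).1 else p

/-- The value of a pseudonatural transformation on a path given by its underlying function. -/
def PseudoNat.holAt (ρ : PseudoNat 𝓕 𝓕') (ι : Realization 𝓕 P) (γ : ℝ → M) (p : P.P₀) : H :=
  open Classical in
  if h : ∃ Γ : SmoothPath EM (P.proj p) (γ 1), Γ.toFun = γ then ρ.hol ι h.choose ⟨p, rfl⟩ else 1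

/-- The map on objects of total spaces induced by a pseudonatural transformation. -/
def PseudoNat.objAt (ρ : PseudoNat 𝓕 𝓕') (ι : Realization 𝓕 P) (ι' : Realization 𝓕' P')
    (p : P.P₀) : P'.P₀ := (ρ.fib ι ι' (P.proj p) ⟨p, rfl⟩).1

/-- A point of the total space as a point of its fibre. -/
abbrev PrincipalTwoBundle.pt (P : PrincipalTwoBundle X EM M) {x : M} (p : P.P₀)
    (hp : P.proj p = x) : (P.fiber x).Obj := ⟨p, hp⟩

theorem Realization.traAt_eq (ι : Realization 𝓕 P) {x y : M} (Γ : SmoothPath EM x y) {p : P.P₀}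
    (hp : P.proj p = x) : ι.traAt Γ.toFun p = (ι.tra Γ (P.pt p hp)).1 := by
  subst hp
  have h := Γ.exists_toFun_eq rfl
  rw [traAt, dif_pos h]
  have aux : ∀ (y' : M) (_ : y' = y) (Γ' : SmoothPath EM (P.proj p) y') (_ : Γ'.toFun = Γ.toFun),
      (ι.tra Γ' ⟨p, rfl⟩).1 = (ι.tra Γ ⟨p, rfl⟩).1 := by
    rintro _ rfl Γ' h'
    rw [SmoothPath.ext_fun (congrFun h')]
  exact aux _ Γ.eq_end _ h.choose_spec

theorem PseudoNat.holAt_eq (ρ : PseudoNat 𝓕 𝓕') (ι : Realization 𝓕 P) {x y : M}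
    (Γ : SmoothPath EM x y) {p : P.P₀} (hp : P.proj p = x) :
    ρ.holAt ι Γ.toFun p = ρ.hol ι Γ (P.pt p hp) := by
  subst hp
  have h := Γ.exists_toFun_eq rfl
  rw [holAt, dif_pos h]
  have aux : ∀ (y' : M) (_ : y' = y) (Γ' : SmoothPath EM (P.proj p) y') (_ : Γ'.toFun = Γ.toFun),
      ρ.hol ι Γ' ⟨p, rfl⟩ = ρ.hol ι Γ ⟨p, rfl⟩ := by
    rintro _ rfl Γ' h'
    rw [SmoothPath.ext_fun (congrFun h')]
  exact aux _ Γ.eq_end _ h.choose_spec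

theorem PseudoNat.objAt_eq (ρ : PseudoNat 𝓕 𝓕') (ι : Realization 𝓕 P) (ι' : Realization 𝓕' P')
    {x : M} (p : (P.fiber x).Obj) : ρ.objAt ι ι' p.1 = (ρ.fib ι ι' x p).1 := by
  obtain ⟨p, rfl⟩ := p
  rfl

theorem PseudoNat.proj_objAt (ρ : PseudoNat 𝓕 𝓕') (ι : Realization 𝓕 P) (ι' : Realization 𝓕' P')
    (p : P.P₀) : P'.proj (ρ.objAt ι ι' p) = P.proj p := (ρ.fib ι ι' (P.proj p) ⟨p, rfl⟩).2

/-! ### Evaluation along segments of a curve. -/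

section Along

variable (ι : Realization 𝓕 P) (ρ : PseudoNat 𝓕 𝓕')

theorem Realization.proj_traAt {x y : M} (Γ : SmoothPath EM x y) {p : P.P₀} (hp : P.proj p = x) :
    P.proj (ι.traAt Γ.toFun p) = y := by
  rw [ι.traAt_eq Γ hp]; exact (ι.tra Γ (P.pt p hp)).2

theorem Realization.traAt_act {x y : M} (Γ : SmoothPath EM x y) {p : P.P₀} (hp : P.proj p = x)
    (g : G) : ι.traAt Γ.toFun (P.str.act₀ p g) = P.str.act₀ (ι.traAt Γ.toFun p) g := by
  rw [ι.traAt_eq Γ hp, ι.traAt_eq Γ ((P.proj_act p g).trans hp)]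
  exact congrArg Subtype.val (ι.tra_act Γ (P.pt p hp) g)

theorem PseudoNat.holAt_act {x y : M} (Γ : SmoothPath EM x y) {p : P.P₀} (hp : P.proj p = x)
    (g : G) : ρ.holAt ι Γ.toFun (P.str.act₀ p g) = X.α g⁻¹ (ρ.holAt ι Γ.toFun p) := by
  rw [ρ.holAt_eq ι Γ hp, ρ.holAt_eq ι Γ ((P.proj_act p g).trans hp)]
  exact ρ.hol_act ι Γ (P.pt p hp) g

theorem Realization.traAt_concat {x y z : M} (Γ : SmoothPath EM x y) (Δ : SmoothPath EM y z)
    {p : P.P₀} (hp : P.proj p = x) :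
    ι.traAt (Γ.concat Δ).toFun p = ι.traAt Δ.toFun (ι.traAt Γ.toFun p) := by
  rw [ι.traAt_eq (Γ.concat Δ) hp, ι.tra_concat, ι.traAt_eq Δ (ι.proj_traAt Γ hp)]
  congr 3
  exact Subtype.ext (ι.traAt_eq Γ hp).symm

theorem PseudoNat.holAt_concat {x y z : M} (Γ : SmoothPath EM x y) (Δ : SmoothPath EM y z)
    {p : P.P₀} (hp : P.proj p = x) :
    ρ.holAt ι (Γ.concat Δ).toFun p =
      ρ.holAt ι Δ.toFun (ι.traAt Γ.toFun p) * ρ.holAt ι Γ.toFun p := by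
  rw [ρ.holAt_eq ι (Γ.concat Δ) hp, ρ.hol_concat, ρ.holAt_eq ι Δ (ι.proj_traAt Γ hp),
    ρ.holAt_eq ι Γ hp]
  congr 3
  exact Subtype.ext (ι.traAt_eq Γ hp).symm

theorem Realization.traAt_thin {x y : M} {Γ Γ' : SmoothPath EM x y} (h : ThinPath Γ Γ') {p : P.P₀}
    (hp : P.proj p = x) : ι.traAt Γ.toFun p = ι.traAt Γ'.toFun p := by
  rw [ι.traAt_eq Γ hp, ι.traAt_eq Γ' hp, ι.tra_thin h]

theorem PseudoNat.holAt_thin {x y : M} {Γ Γ' : SmoothPath EM x y} (h : ThinPath Γ Γ') {p : P.P₀}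
    (hp : P.proj p = x) : ρ.holAt ι Γ.toFun p = ρ.holAt ι Γ'.toFun p := by
  rw [ρ.holAt_eq ι Γ hp, ρ.holAt_eq ι Γ' hp, ρ.hol_thin ι h]

/-- The part of the curve `c` between the parameters `a` and `b`. -/
def seg (c : ℝ → M) (a b : ℝ) (τ : ℝ) : M := c (a + Real.smoothTransition (3 * τ - 1) • (b - a))

variable {c : ℝ → M} (hc : ContMDiff 𝓘(ℝ, ℝ) 𝓘(ℝ, EM) ∞ c)

omit [TopologicalSpace M] [ChartedSpace EM M] [NormedSpace ℝ EM] [NormedAddCommGroup EM] in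
theorem along_eq_seg {EM : Type*} [NormedAddCommGroup EM] [NormedSpace ℝ EM]
    [TopologicalSpace M] [ChartedSpace EM M] {c : ℝ → M} (hc : ContMDiff 𝓘(ℝ, ℝ) 𝓘(ℝ, EM) ∞ c)
    (t : ℝ) : (SmoothPath.along c hc t).toFun = seg c 0 t := by
  funext τ
  simp only [SmoothPath.along, seg, smul_eq_mul]
  congr 1; ring

include hc

theorem seg_thin {a b : ℝ} (f : SmoothPath ℝ a b) {p : P.P₀} (hp : P.proj p = c a) :
    ι.traAt (fun τ => c (f.toFun τ)) p = ι.traAt (seg c a b) p :=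
  ι.traAt_thin (ThinPath.push hc f (line a b)) hp

theorem holAt_seg_thin {a b : ℝ} (f : SmoothPath ℝ a b) {p : P.P₀} (hp : P.proj p = c a) :
    ρ.holAt ι (fun τ => c (f.toFun τ)) p = ρ.holAt ι (seg c a b) p :=
  ρ.holAt_thin ι (ThinPath.push hc f (line a b)) hp

theorem proj_traAt_seg (a b : ℝ) {p : P.P₀} (hp : P.proj p = c a) :
    P.proj (ι.traAt (seg c a b) p) = c b := ι.proj_traAt (SmoothPath.push hc (line a b)) hp

theorem traAt_seg_act (a b : ℝ) {p : P.P₀} (hp : P.proj p = c a) (g : G) :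
    ι.traAt (seg c a b) (P.str.act₀ p g) = P.str.act₀ (ι.traAt (seg c a b) p) g :=
  ι.traAt_act (SmoothPath.push hc (line a b)) hp g

theorem holAt_seg_act (a b : ℝ) {p : P.P₀} (hp : P.proj p = c a) (g : G) :
    ρ.holAt ι (seg c a b) (P.str.act₀ p g) = X.α g⁻¹ (ρ.holAt ι (seg c a b) p) :=
  ρ.holAt_act ι (SmoothPath.push hc (line a b)) hp g

/-- The parameters need not be ordered: a path in `ℝ` from `a` through `b` to `d` is thinly
homotopic to the direct one, so backtracking cancels. -/
theorem traAt_seg_trans (a b d : ℝ) {p : P.P₀} (hp : P.proj p = c a) :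
    ι.traAt (seg c a d) p = ι.traAt (seg c b d) (ι.traAt (seg c a b) p) := by
  rw [← seg_thin ι hc ((line a b).concat (line b d)) hp]
  have h := ι.traAt_concat (SmoothPath.push hc (line a b)) (SmoothPath.push hc (line b d)) hp
  rw [← push_concat] at h
  exact h

theorem holAt_seg_trans (a b d : ℝ) {p : P.P₀} (hp : P.proj p = c a) :
    ρ.holAt ι (seg c a d) p =
      ρ.holAt ι (seg c b d) (ι.traAt (seg c a b) p) * ρ.holAt ι (seg c a b) p := by
  rw [← holAt_seg_thin ι ρ hc ((line a b).concat (line b d)) hp]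
  have h := ρ.holAt_concat ι (SmoothPath.push hc (line a b)) (SmoothPath.push hc (line b d)) hp
  rw [← push_concat] at h
  exact h

omit hc in
theorem seg_self (a : ℝ) : (SmoothPath.const (EM := EM) (c a)).toFun = seg c a a := by
  funext τ
  simp [SmoothPath.const, seg]

omit hc in
theorem traAt_seg_self (a : ℝ) {p : P.P₀} (hp : P.proj p = c a) : ι.traAt (seg c a a) p = p := by
  rw [← seg_self (EM := EM), ι.traAt_eq (SmoothPath.const (c a)) hp, ι.tra_const]

omit hc in
theorem holAt_seg_self (a : ℝ) {p : P.P₀} (hp : P.proj p = c a) : ρ.holAt ι (seg c a a) p = 1 := by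
  rw [← seg_self (EM := EM), ρ.holAt_eq ι (SmoothPath.const (c a)) hp, ρ.hol_const]

theorem traAt_objAt_seg (ι' : Realization 𝓕' P') (a b : ℝ) {p : P.P₀} (hp : P.proj p = c a) :
    ι'.traAt (seg c a b) (ρ.objAt ι ι' p) =
      P'.str.act₀ (ρ.objAt ι ι' (ι.traAt (seg c a b) p)) (X.t (ρ.holAt ι (seg c a b) p)) := by
  have h := congrArg Subtype.val (ρ.tra_fib ι ι' (SmoothPath.push hc (line a b)) (P.pt p hp))
  have e1 := ρ.holAt_eq ι (SmoothPath.push hc (line a b)) hp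
  have e2 := ι.traAt_eq (SmoothPath.push hc (line a b)) hp
  have e3 := ι'.traAt_eq (SmoothPath.push hc (line a b)) (p := ρ.objAt ι ι' p)
    ((ρ.proj_objAt ι ι' p).trans hp)
  have e4 : P'.pt (ρ.objAt ι ι' p) ((ρ.proj_objAt ι ι' p).trans hp) =
    ρ.fib ι ι' (c a) (P.pt p hp) := Subtype.ext (ρ.objAt_eq ι ι' (P.pt p hp))
  rw [e4] at e3
  have e5 := ρ.objAt_eq ι ι' (ι.tra (SmoothPath.push hc (line a b)) (P.pt p hp))
  rw [← e2] at e5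
  refine (e3.trans h).trans ?_
  have e6 : ρ.holAt ι (seg c a b) p = ρ.hol ι (SmoothPath.push hc (line a b)) (P.pt p hp) := e1
  rw [e6]
  exact congrArg (fun q => P'.str.act₀ q _) e5.symm

end Along

/-! ### Boundary paths of rectangles -/

section Rectangle

variable {S : ℝ × ℝ → M} (hS : ContMDiff 𝓘(ℝ, ℝ × ℝ) 𝓘(ℝ, EM) ∞ S)

include hS

theorem contMDiff_slice_fst (t : ℝ) : ContMDiff 𝓘(ℝ, ℝ) 𝓘(ℝ, EM) ∞ (fun s => S (s, t)) :=
  hS.comp (ContDiff.contMDiff (f := fun s : ℝ => (s, t)) (by fun_prop))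

theorem contMDiff_slice_snd (s : ℝ) : ContMDiff 𝓘(ℝ, ℝ) 𝓘(ℝ, EM) ∞ (fun t => S (s, t)) :=
  hS.comp (ContDiff.contMDiff (f := fun t : ℝ => (s, t)) (by fun_prop))

/-- The path is a concatenation of two sides up to reparametrization: for `v ≤ 1/2` only the
coordinate `s` moves, for `v ≥ 1/2` only `t`. Thin invariance replaces each half by the standard
segment. -/
theorem holAt_backPath_zero (ρ : PseudoNat 𝓕 𝓕') (ι : Realization 𝓕 P) (s t : ℝ) {p : P.P₀}
    (hp : P.proj p = S (s, t)) :
    ρ.holAt ι (backPath S hS s t 0).toFun p =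
      ρ.holAt ι (seg (fun t => S (0, t)) t 0) (ι.traAt (seg (fun s => S (s, t)) s 0) p) *
        ρ.holAt ι (seg (fun s => S (s, t)) s 0) p := by
  set B := backPath S hS s t 0 with hB
  have hsm := smoothTransition_smooth
  have hBf : ∀ v, B.toFun v = S (s * secondHalf (1 - v), t * firstHalf (1 - v)) := fun v => by
    simp [hB, backPath, rectangle]
  have hB0 : B.toFun 0 = S (s, t) := B.eq_start
  let f₁ : SmoothPath ℝ s 0 := ⟨fun v => s * secondHalf (1 - Real.smoothTransition (3 * v - 1) * (1 / 2)),
    ContDiff.contMDiff (by unfold secondHalf; fun_prop), 1 / 4, by norm_num, fun v hv => by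
      rw [Real.smoothTransition.zero_of_nonpos (by linarith), secondHalf,
        Real.smoothTransition.one_of_one_le (by norm_num), mul_one], fun v hv => by
      rw [Real.smoothTransition.one_of_one_le (by linarith), secondHalf,
        Real.smoothTransition.zero_of_nonpos (by norm_num), mul_zero]⟩
  let f₂ : SmoothPath ℝ t 0 := ⟨fun v => t * firstHalf (1 / 2 - Real.smoothTransition (3 * v - 1) * (1 / 2)),
    ContDiff.contMDiff (by unfold firstHalf; fun_prop), 1 / 4, by norm_num, fun v hv => by
      rw [Real.smoothTransition.zero_of_nonpos (by linarith), firstHalf,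
        Real.smoothTransition.one_of_one_le (by norm_num), mul_one], fun v hv => by
      rw [Real.smoothTransition.one_of_one_le (by linarith), firstHalf,
        Real.smoothTransition.zero_of_nonpos (by norm_num), mul_zero]⟩
  have e1 : seg B.toFun 0 (1 / 2) = fun v => S (f₁.toFun v, t) := by
    funext v
    have h1 := Real.smoothTransition.le_one (3 * v - 1)
    simp only [seg, hBf, f₁, smul_eq_mul, sub_zero, zero_add]
    have : firstHalf (1 - Real.smoothTransition (3 * v - 1) * (1 / 2)) = 1 :=
      Real.smoothTransition.one_of_one_le (by linarith)
    rw [this, mul_one]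
  have e2 : seg B.toFun (1 / 2) 1 = fun v => S (0, f₂.toFun v) := by
    funext v
    have h1 := Real.smoothTransition.nonneg (3 * v - 1)
    have e3 : 1 - (1 / 2 + Real.smoothTransition (3 * v - 1) * (1 - 1 / 2)) =
      1 / 2 - Real.smoothTransition (3 * v - 1) * (1 / 2) := by ring
    simp only [seg, hBf, f₂, smul_eq_mul, e3]
    have : secondHalf (1 / 2 - Real.smoothTransition (3 * v - 1) * (1 / 2)) = 0 :=
      Real.smoothTransition.zero_of_nonpos (by linarith)
    rw [this, mul_zero]
  have h1 : ρ.holAt ι B.toFun p = ρ.holAt ι (seg B.toFun 0 1) p := by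
    obtain ⟨ε, hε, hl, hr⟩ := (SmoothPath.push B.smooth (line (0 : ℝ) 1)).sitting
    let Γ : SmoothPath EM (S (s, t)) (S (0, 0)) := ⟨_, SmoothPath.smooth _, ε, hε,
      fun t ht => (hl t ht).trans B.eq_start, fun t ht => (hr t ht).trans B.eq_end⟩
    exact ρ.holAt_thin ι (Γ' := Γ) (ThinPath.reparam (line 0 1) fun v => rfl) hp
  rw [h1, holAt_seg_trans ι ρ B.smooth 0 (1 / 2) 1 (hp.trans hB0.symm), e1, e2]
  have hf1 := holAt_seg_thin ι ρ (contMDiff_slice_fst hS t) f₁ hp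
  have hf2 := seg_thin ι (contMDiff_slice_fst hS t) f₁ hp
  rw [hf1, hf2]
  rw [holAt_seg_thin ι ρ (contMDiff_slice_snd hS 0) f₂
    (proj_traAt_seg ι (contMDiff_slice_fst hS t) s 0 hp)]

/-- The exchange of the two coordinates maps this boundary path to the other one. -/
theorem holAt_backPath_one (ρ : PseudoNat 𝓕 𝓕') (ι : Realization 𝓕 P) (s t : ℝ) {p : P.P₀}
    (hp : P.proj p = S (s, t)) :
    ρ.holAt ι (backPath S hS s t 1).toFun p =
      ρ.holAt ι (seg (fun s => S (s, 0)) s 0) (ι.traAt (seg (fun t => S (s, t)) t 0) p) *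
        ρ.holAt ι (seg (fun t => S (s, t)) t 0) p := by
  have hS' : ContMDiff 𝓘(ℝ, ℝ × ℝ) 𝓘(ℝ, EM) ∞ (fun z : ℝ × ℝ => S (z.2, z.1)) :=
    hS.comp (ContDiff.contMDiff (f := fun z : ℝ × ℝ => (z.2, z.1)) (by fun_prop))
  have e : (backPath S hS s t 1).toFun = (backPath (fun z : ℝ × ℝ => S (z.2, z.1)) hS' t s 0).toFun := by
    funext v
    simp [backPath, rectangle]
  rw [e]
  exact holAt_backPath_zero hS' ρ ι t s hp

end Rectangle

end Evaluation

/-! ### Forms and velocities with values in the model space -/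

section Evaluation

variable {E : Type*} [NormedAddCommGroup E] [NormedSpace ℝ E]
  {N : Type*} [TopologicalSpace N] [ChartedSpace E N]
  {V : Type*} [NormedAddCommGroup V] [NormedSpace ℝ V]

/-- The value of a 1-form on a vector of the model space. -/
def OneForm.ev (φ : OneForm E N V) (p : N) (v : E) : V := φ p v

/-- The value of a 2-form on two vectors of the model space. -/
def TwoForm.ev (η : TwoForm E N V) (p : N) (v w : E) : V := η p ![v, w]

/-- The velocity of a curve, as a vector of the model space. -/
def vel (E : Type*) [NormedAddCommGroup E] [NormedSpace ℝ E]
    {N : Type*} [TopologicalSpace N] [ChartedSpace E N] (c : ℝ → N) (t : ℝ) : E := velocity E c t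

theorem OneForm.ev_add (φ : OneForm E N V) (p : N) (v w : E) :
    φ.ev p (v + w) = φ.ev p v + φ.ev p w := map_add (φ p : E →L[ℝ] V) v w

theorem OneForm.ev_smul (φ : OneForm E N V) (p : N) (r : ℝ) (v : E) :
    φ.ev p (r • v) = r • φ.ev p v := map_smul (φ p : E →L[ℝ] V) r v

theorem TwoForm.ev_add_left (η : TwoForm E N V) (p : N) (v v' w : E) :
    η.ev p (v + v') w = η.ev p v w + η.ev p v' w := by
  have aux : ∀ b : E [⋀^Fin 2]→L[ℝ] V, b ![v + v', w] = b ![v, w] + b ![v', w] := fun b => by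
    have e : ∀ z, Function.update ![v, w] 0 z = ![z, w] := fun z => by
      funext i; fin_cases i <;> simp
    have h := b.toAlternatingMap.map_update_add ![v, w] 0 v v'
    rw [e, e, e] at h
    exact h
  exact aux (η p)

theorem TwoForm.ev_swap (η : TwoForm E N V) (p : N) (v w : E) : η.ev p v w = - η.ev p w v := by
  have aux : ∀ b : E [⋀^Fin 2]→L[ℝ] V, b ![v, w] = - b ![w, v] := fun b => by
    have h := b.toAlternatingMap.map_swap ![w, v] (i := 0) (j := 1) (by simp)
    refine Eq.trans ?_ h
    show b _ = b _
    congr 1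
    funext i
    fin_cases i <;> simp
  exact aux (η p)

theorem TwoForm.ev_add_right (η : TwoForm E N V) (p : N) (v w w' : E) :
    η.ev p v (w + w') = η.ev p v w + η.ev p v w' := by
  rw [η.ev_swap, η.ev_add_left, η.ev_swap p v w, η.ev_swap p v w', neg_add]

theorem HasVelocity.vel_eq {c : ℝ → N} {t : ℝ} {v : E} (hc : HasVelocity E c t v) :
    vel E c t = v := hc.velocity_eq

theorem hasVelocity_vel {c : ℝ → N} (hc : ContMDiff 𝓘(ℝ, ℝ) 𝓘(ℝ, E) ∞ c) (t : ℝ) :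
    HasVelocity E c t (vel E c t) := hasVelocity_of_contMDiff hc t

end Evaluation

/-! ### Velocities under the action, and uniqueness of horizontal lifts. -/

section BundleCalculus

variable {EM : Type*} [NormedAddCommGroup EM] [NormedSpace ℝ EM]
  {M : Type*} [TopologicalSpace M] [ChartedSpace EM M]
  {EG : Type*} [NormedAddCommGroup EG] [NormedSpace ℝ EG]
  {EH : Type*} [NormedAddCommGroup EH] [NormedSpace ℝ EH]
  {G : Type*} [TopologicalSpace G] [ChartedSpace EG G] [Group G] [LieGroup 𝓘(ℝ, EG) ∞ G]
  {H : Type*} [TopologicalSpace H] [ChartedSpace EH H] [Group H]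
  {X : LieCrossedModule EG EH G H} {P : PrincipalTwoBundle X EM M}
  {W : Type*} [NormedAddCommGroup W] [NormedSpace ℝ W] [FiniteDimensional ℝ W]

omit [LieGroup 𝓘(ℝ, EG) ∞ G] in
theorem PrincipalTwoBundle.contMDiff_div₀ (P : PrincipalTwoBundle X EM M) {p : W → P.P₀}
    {g : W → G} (hp : ContMDiff 𝓘(ℝ, W) 𝓘(ℝ, EM × EG) ∞ p)
    (hpg : ContMDiff 𝓘(ℝ, W) 𝓘(ℝ, EM × EG) ∞ (fun u => P.str.act₀ (p u) (g u))) :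
    ContMDiff 𝓘(ℝ, W) 𝓘(ℝ, EG) ∞ g := by
  have e := (toEuclidean (E := W)).symm.contDiff (n := ∞).contMDiff
  have e' := (toEuclidean (E := W)).contDiff (n := ∞).contMDiff
  have h := P.smooth_div₀ _ _ _ (hp.comp e) (hpg.comp e)
  have h2 := h.comp e'
  simpa [Function.comp_def] using h2

omit [LieGroup 𝓘(ℝ, EG) ∞ G] in
theorem PrincipalTwoBundle.contMDiff_div₁ (P : PrincipalTwoBundle X EM M) {a : W → P.P₁}
    {g : W → G × H} (ha : ContMDiff 𝓘(ℝ, W) 𝓘(ℝ, EM × EG × EH) ∞ a)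
    (hag : ContMDiff 𝓘(ℝ, W) 𝓘(ℝ, EM × EG × EH) ∞ (fun u => P.str.act₁ (a u) (g u))) :
    ContMDiff 𝓘(ℝ, W) (𝓘(ℝ, EG).prod 𝓘(ℝ, EH)) ∞ g := by
  have e := (toEuclidean (E := W)).symm.contDiff (n := ∞).contMDiff
  have e' := (toEuclidean (E := W)).contDiff (n := ∞).contMDiff
  have h := P.smooth_div₁ _ _ _ (ha.comp e) (hag.comp e)
  have h2 := h.comp e'
  simpa [Function.comp_def] using h2

omit [LieGroup 𝓘(ℝ, EG) ∞ G] in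
theorem PrincipalTwoBundle.contMDiff_act₀ (P : PrincipalTwoBundle X EM M) {E' : Type*}
    [NormedAddCommGroup E'] [NormedSpace ℝ E'] {N : Type*} [TopologicalSpace N] [ChartedSpace E' N]
    {p : N → P.P₀} {g : N → G} (hp : ContMDiff 𝓘(ℝ, E') 𝓘(ℝ, EM × EG) ∞ p)
    (hg : ContMDiff 𝓘(ℝ, E') 𝓘(ℝ, EG) ∞ g) :
    ContMDiff 𝓘(ℝ, E') 𝓘(ℝ, EM × EG) ∞ (fun u => P.str.act₀ (p u) (g u)) :=
  P.smooth_act₀.comp (hp.prodMk hg)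

/-- The fundamental vector field, with values in the model space. -/
def PrincipalTwoBundle.fund (P : PrincipalTwoBundle X EM M) (p : P.P₀) (ξ : EG) : EM × EG :=
  P.fundamental p ξ

/-- The differential of a right translation, as an endomorphism of the model space. -/
def PrincipalTwoBundle.rt (P : PrincipalTwoBundle X EM M) (g : G) (p : P.P₀) :
    EM × EG →L[ℝ] EM × EG := P.dR g p

theorem PrincipalTwoBundle.mfderiv_orbit (P : PrincipalTwoBundle X EM M) (p : P.P₀) (g : G)
    (ξ : EG) :
    (mfderiv 𝓘(ℝ, EG) 𝓘(ℝ, EM × EG) (fun g : G => P.str.act₀ p g) g : EG →L[ℝ] EM × EG)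
      (rightTranslate (E := EG) ξ g) =
      P.rt g p (P.fund p ξ) := by
  have h1 : MDifferentiableAt 𝓘(ℝ, EG) 𝓘(ℝ, EM × EG) (fun g : G => P.str.act₀ p g) (1 * g) :=
    (P.contMDiff_act₀ contMDiff_const contMDiff_id).mdifferentiableAt (by simp)
  have h2 : MDifferentiableAt 𝓘(ℝ, EM × EG) 𝓘(ℝ, EM × EG) (fun q : P.P₀ => P.str.act₀ q g)
      (P.str.act₀ p 1) :=
    (P.contMDiff_act₀ contMDiff_id contMDiff_const).mdifferentiableAt (by simp)
  have h3 : MDifferentiableAt 𝓘(ℝ, EG) 𝓘(ℝ, EM × EG) (fun g : G => P.str.act₀ p g) 1 :=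
    (P.contMDiff_act₀ contMDiff_const contMDiff_id).mdifferentiableAt (by simp)
  have e1 := mfderiv_comp (I' := 𝓘(ℝ, EG)) (1 : G) h1 (mdiff_mul_right (E := EG) g 1)
  have e2 := mfderiv_comp (I' := 𝓘(ℝ, EM × EG)) (1 : G) h2 h3
  have e3 : ((fun g : G => P.str.act₀ p g) ∘ fun x : G => x * g) =
      (fun q : P.P₀ => P.str.act₀ q g) ∘ fun g : G => P.str.act₀ p g := by
    funext x; exact (P.str.act₀_mul p x g).symm
  rw [e3, e2] at e1
  have e4 := congrArg (fun L : EG →L[ℝ] EM × EG => L ξ) e1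
  have a1 : ∀ y, y = g →
      (mfderiv 𝓘(ℝ, EG) 𝓘(ℝ, EM × EG) (fun g : G => P.str.act₀ p g) y : EG →L[ℝ] EM × EG) =
      mfderiv 𝓘(ℝ, EG) 𝓘(ℝ, EM × EG) (fun g : G => P.str.act₀ p g) g := by rintro _ rfl; rfl
  have a2 : ∀ y, y = p → (mfderiv 𝓘(ℝ, EM × EG) 𝓘(ℝ, EM × EG) (fun q : P.P₀ => P.str.act₀ q g) y
      : EM × EG →L[ℝ] EM × EG) = P.rt g p := by rintro _ rfl; rfl
  rw [← a1 _ (one_mul g), ← a2 _ (P.str.act₀_one p)]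
  exact e4.symm

/-- With right logarithmic derivatives the whole velocity of `c · g` is a right translate by `g(t)`.
Equivariant forms can then be evaluated at once, as in `TwoConnection.A_act` and
`TwoConnection.B_act`. -/
theorem HasVelocity.act₀ {c : ℝ → P.P₀} {g : ℝ → G} {t : ℝ} {v : EM × EG} {ξ : EG}
    (hc : HasVelocity (EM × EG) c t v) (hg : HasLogDeriv g t ξ) :
    HasVelocity (EM × EG) (fun t => P.str.act₀ (c t) (g t)) t
      (P.rt (g t) (c t) (v + P.fund (c t) ξ)) := by
  have h := HasVelocity.comp₂ hc hg (f := fun z : P.P₀ × G => P.str.act₀ z.1 z.2)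
    (P.smooth_act₀.mdifferentiableAt (by simp))
  rw [map_add, ← P.mfderiv_orbit]
  exact h

theorem hasVelocity_fundamental (p : P.P₀) {g : ℝ → G} {t : ℝ} {ξ : EG} (hg : HasLogDeriv g t ξ) :
    HasVelocity (EM × EG) (fun t => P.str.act₀ p (g t)) t
      (P.rt (g t) p (P.fund p ξ)) := by
  have h := (hasVelocity_const (E := EM × EG) p t).act₀ hg
  rwa [zero_add] at h

namespace TwoConnection

variable (C : TwoConnection P)

omit [LieGroup 𝓘(ℝ, EG) ∞ G] in
theorem A_act (p : P.P₀) (g : G) (v : EM × EG) (ξ : EG) :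
    C.A.ev (P.str.act₀ p g) (P.rt g p (v + P.fund p ξ)) =
      (Ad g⁻¹ : EG →L[ℝ] EG) (C.A.ev p v + ξ) := by
  refine (C.A_equivariant g p (v + P.fund p ξ : EM × EG)).trans ?_
  congr 1
  exact (C.A.ev_add p v (P.fund p ξ)).trans (congrArg (C.A.ev p v + ·) (C.A_fundamental p ξ))

omit [LieGroup 𝓘(ℝ, EG) ∞ G] in
theorem B_act (p : P.P₀) (g : G) (v w : EM × EG) (ξ η : EG) :
    C.B.ev (P.str.act₀ p g) (P.rt g p (v + P.fund p ξ)) (P.rt g p (w + P.fund p η)) =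
      X.αg g⁻¹ (C.B.ev p v w) := by
  refine (C.B_equivariant g p (v + P.fund p ξ : EM × EG) (w + P.fund p η : EM × EG)).trans ?_
  congr 1
  have h1 : ∀ ξ (y : EM × EG), C.B.ev p (P.fund p ξ) y = 0 := fun ξ y => C.B_horizontal p ξ y
  change C.B.ev p (v + P.fund p ξ) (w + P.fund p η) = _
  rw [TwoForm.ev_add_left, h1, add_zero, TwoForm.ev_add_right, C.B.ev_swap p v (P.fund p η), h1,
    neg_zero, add_zero]

end TwoConnection

/-- Horizontal lifts are unique. -/
theorem horizontal_unique [T2Space G] (C : TwoConnection P) {c d : ℝ → P.P₀}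
    (hc : ContMDiff 𝓘(ℝ, ℝ) 𝓘(ℝ, EM × EG) ∞ c) (hd : ContMDiff 𝓘(ℝ, ℝ) 𝓘(ℝ, EM × EG) ∞ d)
    (hA : ∀ t, C.A.ev (c t) (vel (EM × EG) c t) = 0)
    (hA' : ∀ t, C.A.ev (d t) (vel (EM × EG) d t) = 0) (hp : ∀ t, P.proj (c t) = P.proj (d t))
    {t₀ : ℝ} (h0 : c t₀ = d t₀) : c = d := by
  -- Two lifts of the same curve differ by a `G`-valued curve, and horizontality of both forces its
  -- logarithmic derivative to vanish.
  choose g hg using fun t => (P.simply₀ (c t) (d t) (hp t)).exists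
  have hd' : d = fun t => P.str.act₀ (c t) (g t) := funext fun t => (hg t).symm
  have hgs : ContMDiff 𝓘(ℝ, ℝ) 𝓘(ℝ, EG) ∞ g := P.contMDiff_div₀ hc (hd' ▸ hd)
  have hg1 : g t₀ = 1 := P.act₀_injective (c t₀) (by rw [hg, ← h0, P.str.act₀_one])
  have hL : ∀ t, HasLogDeriv g t (0 : EG) := fun t => by
    have h1 := (hasVelocity_of_contMDiff hgs t).hasLogDeriv
    have h2 := ((hasVelocity_vel hc t).act₀ h1).congr (.of_eq hd')
    have h4 := C.A_act (c t) (g t) (vel (EM × EG) c t)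
      ((maurerCartan EG G (g t) : EG →L[ℝ] EG) (velocity EG g t))
    rw [← h2.vel_eq, hg, hA', hA, zero_add] at h4
    have h7 := congrArg (Ad (g t) : EG →L[ℝ] EG) h4
    rw [map_zero, Ad_Ad_inv] at h7
    rwa [← h7] at h1
  have h := eq_of_hasLogDeriv_univ hL (fun t => hasLogDeriv_const (1 : G) t) t₀ hg1
  funext t
  rw [← hg t, h, P.str.act₀_one]

end BundleCalculus

/-! ### The 1-form defined by a smooth pseudonatural transformation. -/

section Derivative

variable {EM : Type*} [NormedAddCommGroup EM] [NormedSpace ℝ EM]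
  {M : Type*} [TopologicalSpace M] [ChartedSpace EM M]
  {EG : Type*} [NormedAddCommGroup EG] [NormedSpace ℝ EG]
  {EH : Type*} [NormedAddCommGroup EH] [NormedSpace ℝ EH]
  {G : Type*} [TopologicalSpace G] [ChartedSpace EG G] [Group G]
  {H : Type*} [TopologicalSpace H] [ChartedSpace EH H] [Group H]
  {X : LieCrossedModule EG EH G H}
  {𝓕 𝓕' : TransportTwoFunctor X EM M} {P P' : PrincipalTwoBundle X EM M}
  {ι : Realization 𝓕 P} {ι' : Realization 𝓕' P'} {ρ : PseudoNat 𝓕 𝓕'}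
  {W : Type*} [NormedAddCommGroup W] [NormedSpace ℝ W] [FiniteDimensional ℝ W]

theorem PseudoNat.IsSmooth.contMDiff_holAt (hρ : ρ.IsSmooth ι ι') {p : W → P.P₀}
    (hp : ContMDiff 𝓘(ℝ, W) 𝓘(ℝ, EM × EG) ∞ p) {y : W → M}
    (γ : ∀ u, SmoothPath EM (P.proj (p u)) (y u))
    (hγ : ContMDiff 𝓘(ℝ, W × ℝ) 𝓘(ℝ, EM) ∞ (fun z : W × ℝ => (γ z.1).toFun z.2)) :
    ContMDiff 𝓘(ℝ, W) 𝓘(ℝ, EH) ∞ (fun u => ρ.holAt ι (γ u).toFun (p u)) := by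
  have e := (toEuclidean (E := W)).symm.contDiff (n := ∞)
  have e' := (toEuclidean (E := W)).contDiff (n := ∞)
  have h := hρ.smooth_map _ (fun u => p (toEuclidean.symm u)) _ (fun u => γ (toEuclidean.symm u))
    (hp.comp e.contMDiff)
    (hγ.comp (ContDiff.contMDiff (f := fun z : Param _ × ℝ => (toEuclidean.symm z.1, z.2))
      ((e.comp contDiff_fst).prodMk contDiff_snd)))
  have h2 := h.comp e'.contMDiff
  refine h2.congr fun u => ?_
  rw [ρ.holAt_eq ι (γ u) rfl]
  simp only [Function.comp_def]
  have aux : ∀ u', u' = u → ρ.hol ι (γ u) (P.pt (p u) rfl) = ρ.hol ι (γ u') (P.pt (p u') rfl) := by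
    rintro _ rfl; rfl
  exact aux _ (toEuclidean.symm_apply_apply u)

theorem PseudoNat.IsSmooth.contMDiff_holAt_seg (hρ : ρ.IsSmooth ι ι') {c : W × ℝ → M}
    (hc : ContMDiff 𝓘(ℝ, W × ℝ) 𝓘(ℝ, EM) ∞ c) {a b : W → ℝ} (ha : ContDiff ℝ ∞ a)
    (hb : ContDiff ℝ ∞ b) {p : W → P.P₀} (hp : ContMDiff 𝓘(ℝ, W) 𝓘(ℝ, EM × EG) ∞ p)
    (hpc : ∀ u, P.proj (p u) = c (u, a u)) :
    ContMDiff 𝓘(ℝ, W) 𝓘(ℝ, EH) ∞ (fun u => ρ.holAt ι (seg (fun r => c (u, r)) (a u) (b u)) (p u)) := by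
  have hcu : ∀ u, ContMDiff 𝓘(ℝ, ℝ) 𝓘(ℝ, EM) ∞ (fun r => c (u, r)) := fun u =>
    hc.comp (ContDiff.contMDiff (f := fun r : ℝ => (u, r)) (by fun_prop))
  let γ : ∀ u, SmoothPath EM (P.proj (p u)) (c (u, b u)) := fun u =>
    ⟨seg (fun r => c (u, r)) (a u) (b u), (SmoothPath.push (hcu u) (line (a u) (b u))).smooth, by
      obtain ⟨ε, hε, hl, hr⟩ := (SmoothPath.push (hcu u) (line (a u) (b u))).sitting
      exact ⟨ε, hε, fun t ht => (hl t ht).trans (hpc u).symm, hr⟩⟩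
  refine hρ.contMDiff_holAt hp γ ?_
  have := smoothTransition_smooth
  have h1 : ContDiff ℝ ∞ (fun z : W × ℝ =>
      (z.1, a z.1 + Real.smoothTransition (3 * z.2 - 1) • (b z.1 - a z.1))) := by fun_prop
  exact hc.comp h1.contMDiff

theorem holAt_seg_const (y : M) (a b : ℝ) {p : P.P₀} (hp : P.proj p = y) :
    ρ.holAt ι (seg (fun _ => y) a b) p = 1 := by
  have e : (SmoothPath.const (EM := EM) y).toFun = seg (fun _ => y) a b := rfl
  rw [← e, ρ.holAt_eq ι (SmoothPath.const y) hp, ρ.hol_const]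

variable [FiniteDimensional ℝ EM] [FiniteDimensional ℝ EG]

/-- The value of `ρ` on the straight path from `x` to `x + v` in the parametrization `Ψ`. -/
def straightHol (ρ : PseudoNat 𝓕 𝓕') (ι : Realization 𝓕 P) (Ψ : EM × EG → P.P₀)
    (z : (EM × EG) × (EM × EG)) : H :=
  ρ.holAt ι (seg (fun r : ℝ => P.proj (Ψ (z.1 + r • z.2))) 0 1) (Ψ z.1)

theorem contMDiff_straightHol (hρ : ρ.IsSmooth ι ι') {Ψ : EM × EG → P.P₀}
    (hΨ : ContMDiff 𝓘(ℝ, EM × EG) 𝓘(ℝ, EM × EG) ∞ Ψ) :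
    ContMDiff 𝓘(ℝ, (EM × EG) × (EM × EG)) 𝓘(ℝ, EH) ∞ (straightHol ρ ι Ψ) := by
  refine hρ.contMDiff_holAt_seg
    (c := fun w : ((EM × EG) × (EM × EG)) × ℝ => P.proj (Ψ (w.1.1 + w.2 • w.1.2)))
    ?_ contDiff_const contDiff_const (hΨ.comp contDiff_fst.contMDiff) (fun u => by simp)
  exact P.smooth_proj.comp (hΨ.comp (ContDiff.contMDiff (by fun_prop)))

variable [LieGroup 𝓘(ℝ, EH) ∞ H]

/-- The derivative of `ρ` in the parametrization `Ψ`. -/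
def chartDerivative (ρ : PseudoNat 𝓕 𝓕') (ι : Realization 𝓕 P) (Ψ : EM × EG → P.P₀)
    (x : EM × EG) : EM × EG →L[ℝ] EH :=
  -((logForm EH (straightHol ρ ι Ψ) (x, 0)).comp (ContinuousLinearMap.inr ℝ (EM × EG) (EM × EG)))

theorem contDiff_chartDerivative (hρ : ρ.IsSmooth ι ι') {Ψ : EM × EG → P.P₀}
    (hΨ : ContMDiff 𝓘(ℝ, EM × EG) 𝓘(ℝ, EM × EG) ∞ Ψ) :
    ContDiff ℝ ∞ (chartDerivative ρ ι Ψ) := by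
  have h := contDiff_logForm (contMDiff_straightHol hρ hΨ)
  unfold chartDerivative
  fun_prop

/-- Write `c(r) = x + r e(r)`. The path up to time `t` is the diagonal member of the family of paths
`r ↦ x + (b r) e(a r)`. For `b = 0` this path is constant, so the derivative along the diagonal is
the `b`-derivative at `a = 0`, where the path is straight with direction `e(0) = c'(0)`. -/
theorem hasVelocity_holAt_param (hρ : ρ.IsSmooth ι ι') {Ψ : EM × EG → P.P₀}
    (hΨ : ContMDiff 𝓘(ℝ, EM × EG) 𝓘(ℝ, EM × EG) ∞ Ψ) {c : ℝ → EM × EG} (hc : ContDiff ℝ ∞ c) :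
    HasVelocity EH (fun t => ρ.holAt ι (seg (fun r => P.proj (Ψ (c r))) 0 t) (Ψ (c 0))) 0
      (-(chartDerivative ρ ι Ψ (c 0) (deriv c 0))) := by
  obtain ⟨e, he, hce, he0⟩ := exists_smooth_quotient hc
  set x := c 0 with hx
  let f : ℝ × ℝ → H := fun z =>
    ρ.holAt ι (seg (fun r : ℝ => P.proj (Ψ (x + (z.2 * r) • e (z.1 * r)))) 0 1) (Ψ x)
  have hf : ContMDiff 𝓘(ℝ, ℝ × ℝ) 𝓘(ℝ, EH) ∞ f := by
    refine hρ.contMDiff_holAt_seg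
      (c := fun w : (ℝ × ℝ) × ℝ => P.proj (Ψ (x + (w.1.2 * w.2) • e (w.1.1 * w.2))))
      ?_ contDiff_const contDiff_const contMDiff_const (fun u => by simp)
    exact P.smooth_proj.comp (hΨ.comp (ContDiff.contMDiff (by fun_prop)))
  have e1 : (fun t => ρ.holAt ι (seg (fun r => P.proj (Ψ (c r))) 0 t) (Ψ x)) =
      fun t => f (t, t) := by
    funext t
    have : seg (fun r => P.proj (Ψ (c r))) 0 t =
        seg (fun r : ℝ => P.proj (Ψ (x + (t * r) • e (t * r)))) 0 1 := by
      funext τ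
      simp only [seg, smul_eq_mul, zero_add, sub_zero, mul_one]
      rw [hce, mul_comm]
    simp only [f, this]
  have h10 : logForm EH f (0, 0) (1, 0) = 0 := by
    refine (hasLogDeriv_logForm_fst hf 0 0).unique ?_
    have : (fun s => f (s, 0)) = fun _ => 1 := by
      funext s
      simp only [f, zero_mul, zero_smul, add_zero]
      exact holAt_seg_const _ _ _ rfl
    rw [this]
    exact hasLogDeriv_const _ _
  have h01 : logForm EH f (0, 0) (0, 1) = logForm EH (straightHol ρ ι Ψ) (x, 0) (0, e 0) := by
    refine (hasLogDeriv_logForm_snd hf 0 0).unique ?_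
    have h := hasLogDeriv_logForm (contMDiff_straightHol hρ hΨ) (c := fun u : ℝ => (x, u • e 0))
      (t := 0) (v := (0, e 0)) ((hasDerivAt_const _ _).prodMk (by
        simpa using (hasDerivAt_id (0 : ℝ)).smul_const (e 0)))
    rw [zero_smul] at h
    refine h.congr (.of_eq ?_)
    funext u
    simp only [f, straightHol, zero_mul, mul_smul]
    congr 2
    funext r
    rw [smul_comm]
  have hd := hasLogDeriv_logForm hf (c := fun t : ℝ => (t, t)) (t := 0) (v := (1, 1))
    ((hasDerivAt_id 0).prodMk (hasDerivAt_id 0))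
  have h11 : ((1 : ℝ), (1 : ℝ)) = (1, 0) + (0, 1) := by simp
  rw [h11, map_add, h10, h01, zero_add, hasLogDeriv_iff_of_eq_one] at hd
  · rw [e1, chartDerivative, ← he0]
    simpa using hd
  · rw [← congrFun e1 0]
    exact holAt_seg_self ι ρ (c := fun r => P.proj (Ψ (c r))) 0 rfl

omit [NormedAddCommGroup EM] [NormedSpace ℝ EM] [TopologicalSpace M] [ChartedSpace EM M]
  [FiniteDimensional ℝ EM] in
-- The segment up to time `t` only uses parameters of absolute value at most `|t|`, so derivatives
-- at `0` depend only on the germ of the curve.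
theorem seg_eventuallyEq {N : Type*} {f : N → M} {c d : ℝ → N} (h : c =ᶠ[𝓝 0] d) :
    ∀ᶠ t in 𝓝 (0 : ℝ), seg (fun r => f (c r)) 0 t = seg (fun r => f (d r)) 0 t := by
  obtain ⟨δ, hδ, hb⟩ := Metric.eventually_nhds_iff.1 h
  filter_upwards [Metric.ball_mem_nhds (0 : ℝ) hδ] with t ht
  funext τ
  simp only [seg]
  congr 1
  apply hb
  have h1 := Real.smoothTransition.nonneg (3 * τ - 1)
  have h2 := Real.smoothTransition.le_one (3 * τ - 1)
  rw [Metric.mem_ball, dist_zero_right] at ht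
  rw [dist_zero_right, zero_add, sub_zero, norm_smul, Real.norm_of_nonneg h1]
  exact (mul_le_of_le_one_left (norm_nonneg _) h2).trans_lt ht

/-- A cutoff of the time variable keeps `c` in the chart and gives a globally smooth coordinate
expression with the same germ, to which the computation in a parametrization applies. -/
theorem hasVelocity_holAt_chart (hρ : ρ.IsSmooth ι ι') {Ψ : EM × EG → P.P₀}
    (hΨ : ContMDiff 𝓘(ℝ, EM × EG) 𝓘(ℝ, EM × EG) ∞ Ψ) {p : P.P₀}
    (hp : ∀ᶠ y in 𝓝 (extChartAt 𝓘(ℝ, EM × EG) p p), Ψ y = (extChartAt 𝓘(ℝ, EM × EG) p).symm y)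
    {c : ℝ → P.P₀} (hc : ContMDiff 𝓘(ℝ, ℝ) 𝓘(ℝ, EM × EG) ∞ c) (hc0 : c 0 = p) :
    HasVelocity EH (fun t => ρ.holAt ι (seg (fun r => P.proj (c r)) 0 t) (c 0)) 0
      (-(chartDerivative ρ ι Ψ (extChartAt 𝓘(ℝ, EM × EG) p p) (vel (EM × EG) c 0))) := by
  have hO : {t : ℝ | c t ∈ (extChartAt 𝓘(ℝ, EM × EG) p).source} ∈ 𝓝 (0 : ℝ) :=
    hc.continuous.continuousAt.eventually_mem (by
      rw [hc0]; exact extChartAt_source_mem_nhds p)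
  obtain ⟨κ, hκ, hκ0, hκO⟩ := exists_smooth_cutoff (0 : ℝ) hO
  have hκ00 : κ 0 = 0 := hκ0.self_of_nhds
  set y : ℝ → EM × EG := fun t => extChartAt 𝓘(ℝ, EM × EG) p (c (κ t)) with hy
  have hys : ContDiff ℝ ∞ y := contDiff_iff_contDiffAt.2 fun t =>
    contDiffAt_chart_comp (S := fun t => c (κ t)) (hc.comp hκ.contMDiff t) (hκO t)
  have hy0 : y 0 = extChartAt 𝓘(ℝ, EM × EG) p p := by simp [hy, hκ00, hc0]
  have hcy : (fun t => Ψ (y t)) =ᶠ[𝓝 0] c := by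
    have h1 := hys.continuous.continuousAt (x := 0)
    rw [ContinuousAt, hy0] at h1
    filter_upwards [h1.eventually hp, hκ0] with t ht ht'
    rw [ht]
    simp only [hy]
    rw [(extChartAt 𝓘(ℝ, EM × EG) p).left_inv (hκO t), ht']
  have hder : HasDerivAt y (vel (EM × EG) c 0) 0 := by
    refine ((hasVelocity_vel hc 0).hasDerivAt_extChart_self hc0).congr_of_eventuallyEq ?_
    filter_upwards [hκ0] with t ht
    simp only [hy, ht]
  have h := hasVelocity_holAt_param hρ hΨ hys
  rw [hder.deriv, hy0] at h
  refine h.congr ?_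
  have e0 : Ψ (extChartAt 𝓘(ℝ, EM × EG) p p) = c 0 := by
    rw [← hy0]; exact hcy.self_of_nhds
  filter_upwards [seg_eventuallyEq (f := P.proj) hcy] with t ht
  rw [e0, ← ht]

/-- `φ` is the derivative of `ρ`, in terms of underlying functions. -/
def HasDerivativeAt (ρ : PseudoNat 𝓕 𝓕') (ι : Realization 𝓕 P)
    (φ : OneForm (EM × EG) P.P₀ EH) : Prop :=
  ∀ c : ℝ → P.P₀, ContMDiff 𝓘(ℝ, ℝ) 𝓘(ℝ, EM × EG) ∞ c →
    HasVelocity EH (fun t => ρ.holAt ι (seg (fun r => P.proj (c r)) 0 t) (c 0)) 0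
      (-(φ.ev (c 0) (vel (EM × EG) c 0)))

omit [FiniteDimensional ℝ EM] [FiniteDimensional ℝ EG] [LieGroup 𝓘(ℝ, EH) ∞ H] in
theorem hasDerivative_iff {φ : OneForm (EM × EG) P.P₀ EH} :
    ρ.HasDerivative ι φ ↔ HasDerivativeAt ρ ι φ := by
  refine forall_congr' fun c => forall_congr' fun hc => ?_
  have e : (fun t => ρ.holAt ι (seg (fun r => P.proj (c r)) 0 t) (c 0)) = fun t => ρ.hol ι
      (SmoothPath.along (fun t => P.proj (c t)) (P.smooth_proj.comp hc) t) ⟨c 0, rfl⟩ := by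
    funext t
    exact (congrArg (fun γ => ρ.holAt ι γ (c 0)) (along_eq_seg (P.smooth_proj.comp hc) t)).symm.trans
      (ρ.holAt_eq ι (SmoothPath.along _ (P.smooth_proj.comp hc) t) rfl)
  rw [e]
  rfl

/-- At each point `φ` is defined by a parametrization adapted to that point, so smoothness is not
immediate. Near a given point, however, a single parametrization `Θ` computes the same derivatives
along all straight lines, and its derivative is smooth. -/
theorem exists_hasDerivativeAt (hρ : ρ.IsSmooth ι ι') :
    ∃ φ : OneForm (EM × EG) P.P₀ EH, φ.IsSmooth ∧ HasDerivativeAt ρ ι φ := by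
  choose Ψ hΨ hΨp _ using fun p : P.P₀ => exists_param (E := EM × EG) p Filter.univ_mem
  let φ : OneForm (EM × EG) P.P₀ EH := fun p =>
    (chartDerivative ρ ι (Ψ p) (extChartAt 𝓘(ℝ, EM × EG) p p) : EM × EG →L[ℝ] EH)
  have hφ : HasDerivativeAt ρ ι φ := by
    intro c hc
    exact hasVelocity_holAt_chart hρ (hΨ (c 0)) (hΨp (c 0)) hc rfl
  refine ⟨φ, ?_, hφ⟩
  intro p x hx
  obtain ⟨Θ, hΘ, hΘx, -⟩ := exists_chart_param (E := EM × EG) p hx Filter.univ_mem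
  refine ContDiffAt.contDiffWithinAt ?_
  refine (contDiff_chartDerivative (ρ := ρ) (ι := ι) hρ hΘ).contDiffAt.congr_of_eventuallyEq ?_
  filter_upwards [hΘx.eventually_nhds,
    (isOpen_extChartAt_target (I := 𝓘(ℝ, EM × EG)) p).mem_nhds hx] with z hz hz'
  refine ContinuousLinearMap.ext fun v => ?_
  have hl : HasDerivAt (fun s : ℝ => z + s • v) v 0 := by
    simpa using ((hasDerivAt_id (0 : ℝ)).smul_const v).const_add z
  have h1 := hasVelocity_holAt_param (ρ := ρ) (ι := ι) hρ hΘ (c := fun s : ℝ => z + s • v)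
    (by fun_prop)
  have h2 := hφ (fun s : ℝ => Θ (z + s • v)) (hΘ.comp (ContDiff.contMDiff (by fun_prop)))
  have h3 : HasVelocity (EM × EG) (fun s : ℝ => Θ (z + s • v)) 0 ((chartSymmDeriv p z : EM × EG →L[ℝ] EM × EG) v) := by
    have h := hasVelocity_extChart_symm (p := p) hl (by simpa using hz')
    rw [show z + (0 : ℝ) • v = z by simp] at h
    refine h.congr ?_
    have hcont : Filter.Tendsto (fun s : ℝ => z + s • v) (𝓝 0) (𝓝 z) := by
      have := hl.continuousAt
      simpa [ContinuousAt] using this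
    exact hcont.eventually hz
  have h4 := neg_injective (h1.unique h2)
  rw [hl.deriv, h3.vel_eq] at h4
  simp only [zero_smul, add_zero] at h4
  rw [h4, hz.self_of_nhds]
  rfl

end Derivative

/-! ### Bundle maps assembled from 1-morphisms of the fibres. -/

section BundleMaps

variable {EM : Type*} [NormedAddCommGroup EM] [NormedSpace ℝ EM]
  {M : Type*} [TopologicalSpace M] [ChartedSpace EM M]
  {EG : Type*} [NormedAddCommGroup EG] [NormedSpace ℝ EG]
  {EH : Type*} [NormedAddCommGroup EH] [NormedSpace ℝ EH]
  {G : Type*} [TopologicalSpace G] [ChartedSpace EG G] [Group G]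
  {H : Type*} [TopologicalSpace H] [ChartedSpace EH H] [Group H]
  {X : LieCrossedModule EG EH G H}

theorem TorHom.arr_surjective {S T : TwoTorsor X} (f : TorHom S T) : Function.Surjective f.arr :=
  fun a => ⟨S.str.arrow (f.objInv (T.str.src a)) (T.arrHol a), by
    rw [f.arr_arrow, f.obj_objInv, T.arrow_arrHol]⟩

variable {P P' : PrincipalTwoBundle X EM M} (f : ∀ x, TorHom (P.fiber x) (P'.fiber x))

/-- The map on objects given by 1-morphisms of the fibres. -/
def fiberwiseObj (p : P.P₀) : P'.P₀ := ((f (P.proj p)).obj ⟨p, rfl⟩).1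

/-- The map on arrows given by 1-morphisms of the fibres. -/
def fiberwiseArr (a : P.P₁) : P'.P₁ := ((f (P.proj (P.str.src a))).arr ⟨a, rfl⟩).1

theorem fiberwiseObj_eq {x : M} (p : (P.fiber x).Obj) : fiberwiseObj f p.1 = ((f x).obj p).1 := by
  obtain ⟨p, rfl⟩ := p; rfl

theorem fiberwiseArr_eq {x : M} (a : (P.fiber x).Arr) : fiberwiseArr f a.1 = ((f x).arr a).1 := by
  obtain ⟨a, rfl⟩ := a; rfl

/-- Each arrow is `id · (1, h)`, where `h` depends smoothly on the arrow by smooth division, and its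
image is `id_{F(src)} · (1, h)`. Smoothness on objects is therefore enough. -/
theorem contMDiff_fiberwiseArr [FiniteDimensional ℝ EM] [FiniteDimensional ℝ EG]
    [FiniteDimensional ℝ EH]
    (hf : ContMDiff 𝓘(ℝ, EM × EG) 𝓘(ℝ, EM × EG) ∞ (fiberwiseObj f)) :
    ContMDiff 𝓘(ℝ, EM × EG × EH) 𝓘(ℝ, EM × EG × EH) ∞ (fiberwiseArr f) := by
  intro a
  refine contMDiffAt_of_families Filter.univ_mem fun q hq _ => ?_
  have hol : ∀ u, ∃ h : H, P.str.act₁ (P.str.ident (P.str.src (q u))) (1, h) = q u ∧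
      fiberwiseArr f (q u) = P'.str.act₁ (P'.str.ident (fiberwiseObj f (P.str.src (q u)))) (1, h) := by
    intro u
    let b : (P.fiber (P.proj (P.str.src (q u)))).Arr := ⟨q u, rfl⟩
    refine ⟨(P.fiber _).arrHol b, congrArg Subtype.val ((P.fiber _).arrow_arrHol b), ?_⟩
    have h1 := (f _).arr_arrow ((P.fiber _).str.src b) ((P.fiber _).arrHol b)
    rw [(P.fiber _).arrow_arrHol] at h1
    exact (fiberwiseArr_eq f b).trans (congrArg Subtype.val h1)
  choose h h1 h2 using hol
  have hs := P.contMDiff_div₁ (g := fun u => ((1 : G), h u))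
    (P.smooth_ident.comp (P.smooth_src.comp hq)) (hq.congr h1)
  have h3 := P'.smooth_act₁.comp
    ((P'.smooth_ident.comp (hf.comp (P.smooth_src.comp hq))).prodMk hs)
  exact h3.congr h2

/-- A morphism of principal 2-bundles from 1-morphisms of the fibres. -/
def TwoBundleMap.ofFibers [FiniteDimensional ℝ EM] [FiniteDimensional ℝ EG]
    [FiniteDimensional ℝ EH]
    (hf : ContMDiff 𝓘(ℝ, EM × EG) 𝓘(ℝ, EM × EG) ∞ (fiberwiseObj f)) : TwoBundleMap P P' where
  obj := fiberwiseObj f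
  arr := fiberwiseArr f
  smooth_obj := hf
  smooth_arr := contMDiff_fiberwiseArr f hf
  map_proj p := ((f (P.proj p)).obj ⟨p, rfl⟩).2
  map_src a := congrArg Subtype.val ((f _).map_src ⟨a, rfl⟩)
  map_tgt a := (congrArg Subtype.val ((f (P.proj (P.str.src a))).map_tgt ⟨a, rfl⟩)).trans
    (fiberwiseObj_eq f ((P.fiber (P.proj (P.str.src a))).str.tgt ⟨a, rfl⟩)).symm
  map_ident p := by
    have h := congrArg Subtype.val ((f _).map_ident (⟨p, rfl⟩ : (P.fiber (P.proj p)).Obj))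
    exact (fiberwiseArr_eq f ((P.fiber (P.proj p)).str.ident ⟨p, rfl⟩)).trans h
  map_comp b a hab := by
    let a' : (P.fiber (P.proj (P.str.src a))).Arr := ⟨a, rfl⟩
    let b' : (P.fiber (P.proj (P.str.src a))).Arr := ⟨b, by rw [← hab, P.proj_arr]⟩
    have hab' : (P.fiber _).str.tgt a' = (P.fiber _).str.src b' := Subtype.ext hab
    have h := congrArg Subtype.val ((f _).map_comp b' a' hab')
    have h1 := fiberwiseArr_eq f ((P.fiber _).str.comp b' a')
    have h2 : ((P.fiber _).str.comp b' a').1 = P.str.comp b a := P.fiberComp_val b' a' hab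
    have h3 : P'.str.tgt ((f _).arr a').1 = P'.str.src ((f _).arr b').1 :=
      congrArg Subtype.val (((f _).map_tgt a').trans
        ((congrArg (f _).obj hab').trans ((f _).map_src b').symm))
    rw [← h2, h1, h]
    refine (P'.fiberComp_val _ _ h3).trans ?_
    rw [← fiberwiseArr_eq f a', ← fiberwiseArr_eq f b']
  map_act₀ p g := by
    have h := congrArg Subtype.val ((f (P.proj p)).map_act₀ ⟨p, rfl⟩ g)
    exact (fiberwiseObj_eq f ((P.fiber (P.proj p)).str.act₀ ⟨p, rfl⟩ g)).trans h
  map_act₁ a k := by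
    have h := congrArg Subtype.val ((f (P.proj (P.str.src a))).map_act₁ ⟨a, rfl⟩ k)
    exact (fiberwiseArr_eq f ((P.fiber (P.proj (P.str.src a))).str.act₁ ⟨a, rfl⟩ k)).trans h

theorem TwoBundleMap.ext_maps {F F' : TwoBundleMap P P'} (h : ∀ p, F.obj p = F'.obj p)
    (h' : ∀ a, F.arr a = F'.arr a) : F = F' := by
  cases F; cases F'
  cases (funext h : _ = _)
  cases (funext h' : _ = _)
  rfl

variable {𝓕 𝓕' : TransportTwoFunctor X EM M} {ι : Realization 𝓕 P} {ι' : Realization 𝓕' P'}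
  {ρ : PseudoNat 𝓕 𝓕'}

theorem PseudoNat.Induces.unique {F F' : TwoBundleMap P P'} (hF : ρ.Induces ι ι' F)
    (hF' : ρ.Induces ι ι' F') : F' = F := by
  refine TwoBundleMap.ext_maps (fun p => ?_) (fun a => ?_)
  · obtain ⟨q, hq⟩ := (ι (P.proj p)).obj_bijective.2 (P.pt p rfl)
    have hq' : ((ι (P.proj p)).obj q).1 = p := congrArg Subtype.val hq
    rw [← hq', hF.obj, hF'.obj]
  · obtain ⟨q, hq⟩ := (ι (P.proj (P.str.src a))).arr_surjective ⟨a, rfl⟩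
    have hq' : ((ι (P.proj (P.str.src a))).arr q).1 = a := congrArg Subtype.val hq
    rw [← hq', hF.arr, hF'.arr]

theorem PseudoNat.Induces.objAt {F : TwoBundleMap P P'} (hF : ρ.Induces ι ι' F) (p : P.P₀) :
    F.obj p = ρ.objAt ι ι' p := by
  have h := hF.obj (P.proj p) ((ι _).objInv (P.pt p rfl))
  rw [(ι _).obj_objInv] at h
  exact h

theorem PseudoNat.IsSmooth.exists_induces [FiniteDimensional ℝ EM] [FiniteDimensional ℝ EG]
    [FiniteDimensional ℝ EH] (hρ : ρ.IsSmooth ι ι') :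
    ∃ F : TwoBundleMap P P', ρ.Induces ι ι' F := by
  let f : ∀ x, TorHom (P.fiber x) (P'.fiber x) := fun x => TorHom.ofObj (ρ.fib ι ι' x)
    (ρ.fib_act ι ι' x)
  have hf : ContMDiff 𝓘(ℝ, EM × EG) 𝓘(ℝ, EM × EG) ∞ (fiberwiseObj f) := fun p =>
    contMDiffAt_of_families Filter.univ_mem fun q hq _ => hρ.smooth_obj _ q hq
  have key : ∀ x, (f x).comp (ι x) = (ι' x).comp (ρ.obj x) := fun x => TorHom.ext_obj fun q => by
    show (ι' x).obj ((ρ.obj x).obj ((ι x).objInv ((ι x).obj q))) = _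
    rw [(ι x).objInv_obj]; rfl
  refine ⟨TwoBundleMap.ofFibers f hf, fun x q => ?_, fun x a => ?_⟩
  · exact (fiberwiseObj_eq f _).trans (congrArg (fun k => (k.obj q).1) (key x))
  · exact (fiberwiseArr_eq f _).trans (congrArg (fun k => (k.arr a).1) (key x))

end BundleMaps

/-! ### First-order consequences: equivariance, horizontality and the pullback of `A`. -/

section FirstOrder

variable {EM : Type*} [NormedAddCommGroup EM] [NormedSpace ℝ EM]
  {M : Type*} [TopologicalSpace M] [ChartedSpace EM M]
  {EG : Type*} [NormedAddCommGroup EG] [NormedSpace ℝ EG]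
  {EH : Type*} [NormedAddCommGroup EH] [NormedSpace ℝ EH]
  {G : Type*} [TopologicalSpace G] [ChartedSpace EG G] [Group G] [LieGroup 𝓘(ℝ, EG) ∞ G]
  {H : Type*} [TopologicalSpace H] [ChartedSpace EH H] [Group H] [LieGroup 𝓘(ℝ, EH) ∞ H]
  {X : LieCrossedModule EG EH G H} {P P' : PrincipalTwoBundle X EM M}
  {𝓕 𝓕' : TransportTwoFunctor X EM M} {ι : Realization 𝓕 P} {ι' : Realization 𝓕' P'}
  {ρ : PseudoNat 𝓕 𝓕'}

omit [LieGroup 𝓘(ℝ, EG) ∞ G] [LieGroup 𝓘(ℝ, EH) ∞ H] in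
theorem HasVelocity.orbit (p : P.P₀) {g : ℝ → G} {t : ℝ} {ξ : EG} (hg : HasVelocity EG g t ξ)
    (h1 : g t = 1) :
    HasVelocity (EM × EG) (fun t => P.str.act₀ p (g t)) t (P.fund p ξ) := by
  have h := hg.comp_contMDiff (P.contMDiff_act₀ (contMDiff_const (c := p)) contMDiff_id)
  rw [h1] at h
  exact h

omit [LieGroup 𝓘(ℝ, EG) ∞ G] [LieGroup 𝓘(ℝ, EH) ∞ H] in
theorem HasVelocity.rt (P : PrincipalTwoBundle X EM M) (g : G) {c : ℝ → P.P₀} {t : ℝ}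
    {v : EM × EG} (hc : HasVelocity (EM × EG) c t v) :
    HasVelocity (EM × EG) (fun t => P.str.act₀ (c t) g) t (P.rt g (c t) v) :=
  hc.comp_contMDiff (P.contMDiff_act₀ contMDiff_id (contMDiff_const (c := g)))

variable {φ : OneForm (EM × EG) P.P₀ EH}

omit [LieGroup 𝓘(ℝ, EG) ∞ G] in
-- The curves `c` and `c · g` have the same projection, so `ρ_H` sees only the change of initial
-- point from `c(0)` to `c(0) · g(0)`; the velocity of `g` is irrelevant.
theorem HasDerivativeAt.gauge (hφ : HasDerivativeAt ρ ι φ) {c : ℝ → P.P₀}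
    (hc : ContMDiff 𝓘(ℝ, ℝ) 𝓘(ℝ, EM × EG) ∞ c) {g : ℝ → G}
    (hg : ContMDiff 𝓘(ℝ, ℝ) 𝓘(ℝ, EG) ∞ g) :
    φ.ev (P.str.act₀ (c 0) (g 0)) (vel (EM × EG) (fun t => P.str.act₀ (c t) (g t)) 0) =
      X.αg (g 0)⁻¹ (φ.ev (c 0) (vel (EM × EG) c 0)) := by
  have h1 := hφ _ (P.contMDiff_act₀ hc hg)
  have h2 := hφ _ hc
  have e0 : ρ.holAt ι (seg (fun r => P.proj (c r)) 0 0) (c 0) = 1 :=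
    holAt_seg_self ι ρ (c := fun r => P.proj (c r)) 0 rfl
  have h3 := (hasLogDeriv_iff_of_eq_one (by exact (congrArg (X.α (g 0)⁻¹) e0).trans (map_one _))).1
    (X.hasLogDeriv_α (g 0)⁻¹ ((hasLogDeriv_iff_of_eq_one e0).2 h2))
  have h4 := h1.unique (h3.congr (.of_eq (funext fun t => ?_)))
  · rw [map_neg] at h4
    exact neg_injective h4
  · simp only [P.proj_act]
    exact holAt_seg_act ι ρ (P.smooth_proj.comp hc) 0 t rfl (g 0)

omit [LieGroup 𝓘(ℝ, EH) ∞ H] in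
-- A vertical curve projects to a constant path, on which `ρ_H` is `1`.
theorem HasDerivativeAt.horizontal [FiniteDimensional ℝ EG] (hφ : HasDerivativeAt ρ ι φ)
    (p : P.P₀) (ξ : EG) : φ.ev p (P.fund p ξ) = 0 := by
  obtain ⟨g, hg, hg0, hgv⟩ := exists_curve (1 : G) ξ
  have h1 := hφ (fun t => P.str.act₀ p (g t)) (P.contMDiff_act₀ contMDiff_const hg)
  have h2 : (fun t => ρ.holAt ι (seg (fun r => P.proj (P.str.act₀ p (g r))) 0 t)
      (P.str.act₀ p (g 0))) = fun _ => 1 := by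
    funext t
    simp only [P.proj_act]
    exact holAt_seg_const _ _ _ (P.proj_act _ _)
  rw [h2, (hgv.orbit p hg0).vel_eq, hg0, P.str.act₀_one] at h1
  exact neg_eq_zero.1 (h1.unique (hasVelocity_const _ _))

omit [LieGroup 𝓘(ℝ, EG) ∞ G] in
theorem HasDerivativeAt.gaugeEquivariant [FiniteDimensional ℝ EM] [FiniteDimensional ℝ EG]
    (hφ : HasDerivativeAt ρ ι φ) {g : P.P₀ → G} (hg : ContMDiff 𝓘(ℝ, EM × EG) 𝓘(ℝ, EG) ∞ g)
    (p : P.P₀) (v : EM × EG) :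
    φ.ev (P.str.act₀ p (g p))
      ((mfderiv 𝓘(ℝ, EM × EG) 𝓘(ℝ, EM × EG) (fun q : P.P₀ => P.str.act₀ q (g q)) p :
          EM × EG →L[ℝ] EM × EG) v) = X.αg (g p)⁻¹ (φ.ev p v) := by
  obtain ⟨c, hc, rfl, hcv⟩ := exists_curve p v
  have h := hφ.gauge hc (hg.comp hc)
  rw [hcv.vel_eq] at h
  refine Eq.trans (congrArg (φ.ev _) ?_) h
  exact (hcv.comp_contMDiff (P.contMDiff_act₀ contMDiff_id hg)).vel_eq.symm

omit [LieGroup 𝓘(ℝ, EG) ∞ G] in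
theorem HasDerivativeAt.equivariant [FiniteDimensional ℝ EM] [FiniteDimensional ℝ EG]
    (hφ : HasDerivativeAt ρ ι φ) (g : G) (p : P.P₀) (v : EM × EG) :
    φ.ev (P.str.act₀ p g) (P.rt g p v) = X.αg g⁻¹ (φ.ev p v) :=
  hφ.gaugeEquivariant (g := fun _ => g) contMDiff_const p v

omit [LieGroup 𝓘(ℝ, EG) ∞ G] [LieGroup 𝓘(ℝ, EH) ∞ H] in
theorem HasDerivativeAt.unique [FiniteDimensional ℝ EM] [FiniteDimensional ℝ EG]
    {φ' : OneForm (EM × EG) P.P₀ EH} (hφ : HasDerivativeAt ρ ι φ)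
    (hφ' : HasDerivativeAt ρ ι φ') : φ' = φ := by
  funext p
  refine ContinuousLinearMap.ext fun (v : EM × EG) => ?_
  obtain ⟨c, hc, rfl, hcv⟩ := exists_curve p (v : EM × EG)
  have h := neg_injective ((hφ' c hc).unique (hφ c hc))
  rwa [hcv.vel_eq] at h

omit [LieGroup 𝓘(ℝ, EG) ∞ G] [LieGroup 𝓘(ℝ, EH) ∞ H] in
/-- The transport along a curve, compared with the curve. -/
theorem Realization.Defines.exists_div {C : TwoConnection P} (hC : ι.Defines C) {c : ℝ → P.P₀}
    (hc : ContMDiff 𝓘(ℝ, ℝ) 𝓘(ℝ, EM × EG) ∞ c) :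
    ∃ g : ℝ → G, (∀ t, ι.traAt (seg (fun r => P.proj (c r)) 0 t) (c 0) = P.str.act₀ (c t) (g t)) ∧
      g 0 = 1 ∧ HasLogDeriv g 0 (-(C.A.ev (c 0) (vel (EM × EG) c 0))) := by
  have h := hC.deriv_A c hc
  refine ⟨_, fun t => ?_, ?_, (hasLogDeriv_iff_of_eq_one ?_).2 h⟩
  · refine Eq.trans ?_ (congrArg Subtype.val ((P.fiber (P.proj (c t))).act₀_div₀
      (ι.tra (SmoothPath.along (fun t => P.proj (c t)) (P.smooth_proj.comp hc) t) ⟨c 0, rfl⟩)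
      ⟨c t, rfl⟩)).symm
    exact (congrArg (fun γ => ι.traAt γ (c 0)) (along_eq_seg (P.smooth_proj.comp hc) t)).symm.trans
      (ι.traAt_eq (SmoothPath.along _ (P.smooth_proj.comp hc) t) rfl)
  all_goals
    refine ((P.fiber (P.proj (c 0))).eq_div₀ ?_).symm
    refine Eq.trans ((P.fiber (P.proj (c 0))).str.act₀_one _) (Subtype.ext ?_)
    refine Eq.symm ?_
    refine (ι.traAt_eq (SmoothPath.along _ (P.smooth_proj.comp hc) 0) rfl).symm.trans ?_
    rw [along_eq_seg (P.smooth_proj.comp hc)]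
    exact traAt_seg_self (EM := EM) ι 0 rfl

/-- Both transports are compared with the curves `c` and `F ∘ c`. The transport identity says that
the comparison elements satisfy `g' = g · t(ρ_H)`, and the logarithmic derivative at `0` is the
claim. -/
theorem pullback_A_of_defines [FiniteDimensional ℝ EM] [FiniteDimensional ℝ EG]
    {C : TwoConnection P} {C' : TwoConnection P'}
    (hC : ι.Defines C) (hC' : ι'.Defines C') {F : TwoBundleMap P P'} (hF : ρ.Induces ι ι' F)
    (hφ : HasDerivativeAt ρ ι φ) (p : P.P₀) (v : EM × EG) :
    C'.A.ev (F.obj p) ((F.dObj p : EM × EG →L[ℝ] EM × EG) v) = C.A.ev p v + X.tStar (φ.ev p v) := by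
  obtain ⟨c, hc, rfl, hcv⟩ := exists_curve p v
  obtain ⟨g, hg, hg0, hgd⟩ := hC.exists_div hc
  obtain ⟨g', hg', hg0', hgd'⟩ := hC'.exists_div (F.smooth_obj.comp hc)
  have hv' : vel (EM × EG) (F.obj ∘ c) 0 = (F.dObj (c 0) : EM × EG →L[ℝ] EM × EG) v :=
    (hcv.comp_contMDiff F.smooth_obj).vel_eq
  have e0 : ρ.holAt ι (seg (fun r => P.proj (c r)) 0 0) (c 0) = 1 :=
    holAt_seg_self ι ρ (c := fun r => P.proj (c r)) 0 rfl
  have h1 := X.hasLogDeriv_t ((hasLogDeriv_iff_of_eq_one e0).2 (hφ c hc))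
  have h2 := hgd.mul h1
  have h3 := hgd'.unique (h2.congr (.of_eq (funext fun t => ?_)))
  · rw [hg0, Ad_one, map_neg, ← neg_add, hcv.vel_eq, hv'] at h3
    exact neg_injective h3
  · have h4 := traAt_objAt_seg ι ρ (P.smooth_proj.comp hc) ι' 0 t (p := c 0) rfl
    have h5 := hg' t
    simp only [Function.comp_apply, F.map_proj] at h5
    rw [← hF.objAt] at h4
    have h6 := hg t
    simp only [Function.comp_def] at h4
    rw [h4, h6, ← hF.objAt, F.map_act₀, P'.str.act₀_mul] at h5
    exact (P'.act₀_injective _ h5).symm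

end FirstOrder

/-! ### Mixed derivatives of group-valued maps of two variables. -/

section MixedDerivative

variable {EG : Type*} [NormedAddCommGroup EG] [NormedSpace ℝ EG] [FiniteDimensional ℝ EG]
  {EH : Type*} [NormedAddCommGroup EH] [NormedSpace ℝ EH] [FiniteDimensional ℝ EH]
  {G : Type*} [TopologicalSpace G] [ChartedSpace EG G] [Group G] [LieGroup 𝓘(ℝ, EG) ∞ G]
  {H : Type*} [TopologicalSpace H] [ChartedSpace EH H] [Group H] [LieGroup 𝓘(ℝ, EH) ∞ H]

/-- The asymmetry of mixed logarithmic derivatives is a bracket of the two first derivatives, which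
vanishes as soon as one of them does. -/
theorem logForm_mixed_of_eq_one {k : ℝ × ℝ → H} (hk : ContMDiff 𝓘(ℝ, ℝ × ℝ) 𝓘(ℝ, EH) ∞ k)
    {z : ℝ × ℝ} (h : logForm EH k z (1, 0) = 0 ∨ logForm EH k z (0, 1) = 0) :
    fderiv ℝ (logForm EH k) z (1, 0) (0, 1) = fderiv ℝ (logForm EH k) z (0, 1) (1, 0) := by
  have h1 := maurerCartan_equation hk z (0, 1) (1, 0)
  have z1 : ∀ v : EH, lieBr H 0 v = 0 := fun v => by
    have := lieBr_smul_left (K := H) 0 (0 : EH) v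
    simpa using this
  have z2 : ∀ v : EH, lieBr H v 0 = 0 := fun v => by rw [lieBr_swap, z1, neg_zero]
  have h2 : lieBr H (logForm EH k z (1, 0)) (logForm EH k z (0, 1)) = 0 := by
    rcases h with h | h
    · rw [h, z1]
    · rw [h, z2]
  rw [h2] at h1
  exact sub_eq_zero.1 h1

omit [FiniteDimensional ℝ EH] in
theorem hasDerivAt_slice_fst {L : ℝ × ℝ → ℝ × ℝ →L[ℝ] EH} (hL : ContDiff ℝ ∞ L) (s t : ℝ)
    (v : ℝ × ℝ) : HasDerivAt (fun s => L (s, t) v) (fderiv ℝ L (s, t) (1, 0) v) s := by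
  have h := (hL.differentiable (by simp) (s, t)).hasFDerivAt
  have h2 := h.comp_hasDerivAt_of_eq s ((hasDerivAt_id s).prodMk (hasDerivAt_const s t)) rfl
  exact h2.clm_apply (hasDerivAt_const s v) |>.congr_deriv (by simp)

omit [FiniteDimensional ℝ EH] in
theorem hasDerivAt_slice_snd {L : ℝ × ℝ → ℝ × ℝ →L[ℝ] EH} (hL : ContDiff ℝ ∞ L) (s t : ℝ)
    (v : ℝ × ℝ) : HasDerivAt (fun t => L (s, t) v) (fderiv ℝ L (s, t) (0, 1) v) t := by
  have h := (hL.differentiable (by simp) (s, t)).hasFDerivAt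
  have h2 := h.comp_hasDerivAt_of_eq t ((hasDerivAt_const t s).prodMk (hasDerivAt_id t)) rfl
  exact h2.clm_apply (hasDerivAt_const t v) |>.congr_deriv (by simp)

/-- Interchange of the partial logarithmic derivatives of a map of two real variables which is
constant along one of the axes. -/
theorem hasDerivAt_mixed {k : ℝ × ℝ → H} (hk : ContMDiff 𝓘(ℝ, ℝ × ℝ) 𝓘(ℝ, EH) ∞ k)
    (h : (∀ s, k (s, 0) = 1) ∨ ∀ t, k (0, t) = 1) {ζ : ℝ → EH} {ζ' : EH}
    (hζ : ∀ t, HasLogDeriv (fun s => k (s, t)) 0 (ζ t)) (hζ' : HasDerivAt ζ ζ' 0) :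
    HasDerivAt (fun s => logForm EH k (s, 0) (0, 1)) ζ' 0 := by
  have h1 : ζ = fun t => logForm EH k (0, t) (1, 0) := funext fun t =>
    (hζ t).unique (hasLogDeriv_logForm_fst hk 0 t)
  have h2 := hasDerivAt_slice_fst (contDiff_logForm hk) 0 0 (0, 1)
  rw [logForm_mixed_of_eq_one hk] at h2
  · rw [h1] at hζ'
    rwa [hζ'.unique (hasDerivAt_slice_snd (contDiff_logForm hk) 0 0 (1, 0))]
  · rcases h with h | h
    · left
      refine (hasLogDeriv_logForm_fst hk 0 0).unique ?_
      simp only [h]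
      exact hasLogDeriv_const _ _
    · right
      refine (hasLogDeriv_logForm_snd hk 0 0).unique ?_
      simp only [h]
      exact hasLogDeriv_const _ _

namespace LieCrossedModule

variable (X : LieCrossedModule EG EH G H)

/-- The derivative at `1` of `g ↦ α_g(h) h⁻¹`. -/
def orbitDeriv (h : H) : EG →L[ℝ] EH :=
  mfderiv 𝓘(ℝ, EG) 𝓘(ℝ, EH) (fun g : G => X.α g h * h⁻¹) 1

omit [FiniteDimensional ℝ EG] [FiniteDimensional ℝ EH] [LieGroup 𝓘(ℝ, EG) ∞ G] in
theorem contMDiff_orbit :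
    ContMDiff (𝓘(ℝ, EH).prod 𝓘(ℝ, EG)) 𝓘(ℝ, EH) ∞ (fun z : H × G => X.α z.2 z.1 * z.1⁻¹) :=
  (X.smooth_α.comp (contMDiff_snd.prodMk contMDiff_fst)).mul contMDiff_fst.inv

omit [FiniteDimensional ℝ EG] [FiniteDimensional ℝ EH] [LieGroup 𝓘(ℝ, EG) ∞ G] in
theorem contMDiff_orbit_right (h : H) :
    ContMDiff 𝓘(ℝ, EG) 𝓘(ℝ, EH) ∞ (fun g : G => X.α g h * h⁻¹) :=
  X.contMDiff_orbit.comp (contMDiff_const.prodMk contMDiff_id)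

omit [FiniteDimensional ℝ EG] [FiniteDimensional ℝ EH] in
theorem contMDiff_orbitDeriv : ContMDiff 𝓘(ℝ, EH) 𝓘(ℝ, EG →L[ℝ] EH) ∞ X.orbitDeriv := by
  refine contMDiff_hasMFDerivAt_of_fixed (n₀ := (1 : G)) (n₁ := (1 : H))
    (f := fun h g => X.α g h * h⁻¹) X.contMDiff_orbit (fun h => by simp) fun h => ?_
  exact ((X.contMDiff_orbit_right h).mdifferentiableAt (by simp)).hasMFDerivAt

omit [FiniteDimensional ℝ EG] [FiniteDimensional ℝ EH] [LieGroup 𝓘(ℝ, EG) ∞ G] in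
theorem hasLogDeriv_orbit {g : ℝ → G} {ξ : EG} {t : ℝ} (hg : HasLogDeriv g t ξ) (hg0 : g t = 1)
    (h : H) : HasLogDeriv (fun t => X.α (g t) h) t (X.orbitDeriv h ξ) := by
  have h1 := ((hasLogDeriv_iff_of_eq_one hg0).1 hg).comp_contMDiff (X.contMDiff_orbit_right h)
  rw [hg0] at h1
  have h2 := ((hasLogDeriv_iff_of_eq_one (by simp [hg0])).2 h1).mul_right h
  refine h2.congr (.of_eq (funext fun t => ?_))
  simp

omit [FiniteDimensional ℝ EG] [FiniteDimensional ℝ EH] [LieGroup 𝓘(ℝ, EG) ∞ G]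
  [LieGroup 𝓘(ℝ, EH) ∞ H] in
-- Since `α_g(1) = 1` for all `g`, the motion of `g` does not contribute at a time when `y` passes
-- through `1`.
theorem hasLogDeriv_α_of_eq_one {g : ℝ → G} {ξ : EG} {t : ℝ} (hg : HasVelocity EG g t ξ)
    {y : ℝ → H} {η : EH} (hy : HasLogDeriv y t η) (hy0 : y t = 1) :
    HasLogDeriv (fun t => X.α (g t) (y t)) t (X.αg (g t) η) := by
  have h1 := hg.comp₂ ((hasLogDeriv_iff_of_eq_one hy0).1 hy) (f := fun z : G × H => X.α z.1 z.2)
    (X.smooth_α.mdifferentiableAt (by simp))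
  refine (hasLogDeriv_iff_of_eq_one (by simp [hy0])).2 ?_
  rw [hy0] at h1
  have h2 : (fun z : G => X.α z (1 : H)) = fun _ => 1 := by simp
  have h3 : (mfderiv 𝓘(ℝ, EG) 𝓘(ℝ, EH) (fun z : G => X.α z (1 : H)) (g t) : EG →L[ℝ] EH) ξ = 0 := by
    have : ∀ f : G → H, f = (fun _ => 1) →
        (mfderiv 𝓘(ℝ, EG) 𝓘(ℝ, EH) f (g t) : EG →L[ℝ] EH) ξ = 0 := by
      rintro _ rfl
      rw [mfderiv_const]; rfl
    exact this _ h2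
  have h4 := (congrArg (fun w : EH => w + X.αg (g t) η) h3).trans (zero_add _)
  rw [← h4]
  exact h1

/-- At `h = 1` the operator `orbitDeriv` is zero, so the derivative of `ξ` drops out. What remains
is the mixed derivative of `α_{k(t)}(y(s))`, computed in the other order from `α_{k(t)*} η`. -/
theorem hasDerivAt_orbitDeriv {h : ℝ → H} {η : EH} (hh : HasLogDeriv h 0 η) (hh0 : h 0 = 1)
    {ξ : ℝ → EG} {ξ' : EG} (hξ : HasDerivAt ξ ξ' 0) :
    HasDerivAt (fun s => X.orbitDeriv (h s) (ξ s)) (X.αStar (ξ 0) η) 0 := by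
  have hv := (hasLogDeriv_iff_of_eq_one hh0).1 hh
  -- The derivative depends only on the velocity of the curve at `1`, so `h`, differentiable at a
  -- single time, may be replaced by a smooth curve `y`.
  obtain ⟨L', hL'⟩ : ∃ L' : EG →L[ℝ] EH, ∀ y : ℝ → H, y 0 = 1 → HasVelocity EH y 0 η →
      HasDerivAt (fun s => X.orbitDeriv (y s)) L' 0 := by
    refine ⟨(mfderiv 𝓘(ℝ, EH) 𝓘(ℝ, EG →L[ℝ] EH) X.orbitDeriv 1 : EH →L[ℝ] EG →L[ℝ] EH) η,
      fun y hy0 hy => ?_⟩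
    have h1 := hy.comp_contMDiff X.contMDiff_orbitDeriv
    rw [hy0] at h1
    exact hasVelocity_iff_hasDerivAt.1 h1
  have hL1 : X.orbitDeriv 1 = 0 := by
    have : ∀ f : G → H, f = (fun _ => 1) →
        (mfderiv 𝓘(ℝ, EG) 𝓘(ℝ, EH) f 1 : EG →L[ℝ] EH) = 0 := by
      rintro _ rfl
      exact mfderiv_const
    exact this _ (by simp)
  have h2 := (hL' h hh0 hv).clm_apply hξ
  rw [hh0, hL1] at h2
  refine h2.congr_deriv ?_
  rw [zero_apply, add_zero]
  obtain ⟨k, hk, hk0, hkv⟩ := exists_curve (1 : G) (ξ 0)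
  obtain ⟨y, hy, hy0, hyv⟩ := exists_curve (1 : H) η
  have hkl := (hasLogDeriv_iff_of_eq_one hk0).2 hkv
  have hyl := (hasLogDeriv_iff_of_eq_one hy0).2 hyv
  let Q : ℝ × ℝ → H := fun z => X.α (k z.2) (y z.1)
  have hQ : ContMDiff 𝓘(ℝ, ℝ × ℝ) 𝓘(ℝ, EH) ∞ Q :=
    X.smooth_α.comp ((hk.comp contDiff_snd.contMDiff).prodMk (hy.comp contDiff_fst.contMDiff))
  have h3 := hasDerivAt_mixed hQ (.inr fun t => by simp [Q, hy0])
    (fun t => X.hasLogDeriv_α (k t) hyl) (X.hasDerivAt_αg hkl η)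
  have h4 := (hL' y hy0 hyv).clm_apply (hasDerivAt_const (0 : ℝ) (ξ 0))
  have h5 : (fun s => logForm EH Q (s, 0) (0, 1)) = fun s => X.orbitDeriv (y s) (ξ 0) :=
    funext fun s => (hasLogDeriv_logForm_snd hQ s 0).unique (X.hasLogDeriv_orbit hkl hk0 (y s))
  rw [h5] at h3
  have h6 := h4.unique h3
  rw [hk0, X.αg_one, map_zero, add_zero] at h6
  exact h6

end LieCrossedModule

end MixedDerivative

/-! ### Second-order consequences: the pullback of `B`. -/

section SecondOrder

variable {EM : Type*} [NormedAddCommGroup EM] [NormedSpace ℝ EM]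
  {M : Type*} [TopologicalSpace M] [ChartedSpace EM M]
  {EG : Type*} [NormedAddCommGroup EG] [NormedSpace ℝ EG]
  {EH : Type*} [NormedAddCommGroup EH] [NormedSpace ℝ EH]
  {G : Type*} [TopologicalSpace G] [ChartedSpace EG G] [Group G] [LieGroup 𝓘(ℝ, EG) ∞ G]
  {H : Type*} [TopologicalSpace H] [ChartedSpace EH H] [Group H] [LieGroup 𝓘(ℝ, EH) ∞ H]
  {X : LieCrossedModule EG EH G H} {P P' : PrincipalTwoBundle X EM M}
  {𝓕 𝓕' : TransportTwoFunctor X EM M} {ι : Realization 𝓕 P} {ι' : Realization 𝓕' P'}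
  {ρ : PseudoNat 𝓕 𝓕'} {φ : OneForm (EM × EG) P.P₀ EH}

omit [LieGroup 𝓘(ℝ, EG) ∞ G] [LieGroup 𝓘(ℝ, EH) ∞ H] in
theorem traAt_seg_reverse {c : ℝ → M} (hc : ContMDiff 𝓘(ℝ, ℝ) 𝓘(ℝ, EM) ∞ c) {t : ℝ} {p q : P.P₀}
    (hp : P.proj p = c 0) (hq : P.proj q = c t) {g : G}
    (h : ι.traAt (seg c 0 t) p = P.str.act₀ q g) :
    ι.traAt (seg c t 0) q = P.str.act₀ p g⁻¹ := by
  have h1 := traAt_seg_trans ι hc 0 t 0 hp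
  rw [traAt_seg_self (EM := EM) ι 0 hp, h, traAt_seg_act ι hc t 0 hq] at h1
  rw [h1, P.str.act₀_mul, mul_inv_cancel, P.str.act₀_one]

omit [LieGroup 𝓘(ℝ, EG) ∞ G] in
/-- The derivative of `ρ` along reversed curves. -/
theorem HasDerivativeAt.reverse {C : TwoConnection P} (hC : ι.Defines C)
    (hφ : HasDerivativeAt ρ ι φ) {c : ℝ → P.P₀} (hc : ContMDiff 𝓘(ℝ, ℝ) 𝓘(ℝ, EM × EG) ∞ c) :
    HasLogDeriv (fun t => ρ.holAt ι (seg (fun r => P.proj (c r)) t 0) (c t)) 0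
      (φ.ev (c 0) (vel (EM × EG) c 0)) := by
  obtain ⟨g, hg, hg0, hgd⟩ := hC.exists_div hc
  have hpc := P.smooth_proj.comp hc
  have e0 : ρ.holAt ι (seg (fun r => P.proj (c r)) 0 0) (c 0) = 1 :=
    holAt_seg_self ι ρ (c := fun r => P.proj (c r)) 0 rfl
  have h1 := ((hasLogDeriv_iff_of_eq_one e0).2 (hφ c hc)).inv
  have h2 := X.hasLogDeriv_α_of_eq_one hgd h1 (by rw [e0, inv_one])
  have e1 : X.αg (g 0) (-(Ad (ρ.holAt ι (seg (fun r => P.proj (c r)) 0 0) (c 0))⁻¹ : EH →L[ℝ] EH)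
      (-(φ.ev (c 0) (vel (EM × EG) c 0)))) = φ.ev (c 0) (vel (EM × EG) c 0) := by
    rw [hg0, X.αg_one, e0, inv_one, Ad_one, neg_neg]
  rw [e1] at h2
  refine h2.congr (.of_eq (funext fun t => ?_))
  -- Going to `c(t)` and back has value `1`. As transport arrives at `c(t) · g(t)` and not at
  -- `c(t)`, the value on the reversed path is the inverse twisted by `α_{g(t)}`; this twist is
  -- invisible to first order.
  have h3 := holAt_seg_trans ι ρ hpc 0 t 0 (p := c 0) rfl
  have h4 := hg t
  simp only [Function.comp_def] at h3
  rw [e0, h4] at h3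
  have h5 := holAt_seg_act ι ρ hpc t 0 (p := c t) rfl (g t)
  simp only [Function.comp_def] at h5
  rw [h5] at h3
  have h6 := eq_inv_of_mul_eq_one_left h3.symm
  rw [← h6, ← MulAut.mul_apply, ← map_mul, mul_inv_cancel, map_one, MulAut.one_apply]

omit [LieGroup 𝓘(ℝ, EG) ∞ G] [LieGroup 𝓘(ℝ, EH) ∞ H] in
theorem Realization.Defines.exists_tra₂ {C : TwoConnection P} (hC : ι.Defines C)
    {S : ℝ × ℝ → P.P₀} (hS : ContMDiff 𝓘(ℝ, ℝ × ℝ) 𝓘(ℝ, EM × EG) ∞ S) {f : ℝ × ℝ → M}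
    (hf : ContMDiff 𝓘(ℝ, ℝ × ℝ) 𝓘(ℝ, EM) ∞ f) (hSf : ∀ z, P.proj (S z) = f z) :
    ∃ b : ℝ → EH,
      (∀ s, HasVelocity EH
        (fun t => ι.tra₂ (backBigon f hf s t) (P.pt (S (s, t)) (hSf (s, t)))) 0 (b s)) ∧
      HasDerivAt b (C.B.ev (S (0, 0)) (partial₁ (EM × EG) S (0, 0)) (partial₂ (EM × EG) S (0, 0)))
        0 := by
  obtain rfl : f = fun z => P.proj (S z) := funext fun z => (hSf z).symm
  exact hC.deriv_B S hS

omit [LieGroup 𝓘(ℝ, EG) ∞ G] [LieGroup 𝓘(ℝ, EH) ∞ H] in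
-- A rectangle with a side of length zero is mapped through one coordinate axis.
theorem rankLE_backBigon {f : ℝ × ℝ → M} (hf : ContMDiff 𝓘(ℝ, ℝ × ℝ) 𝓘(ℝ, EM) ∞ f) (s t : ℝ)
    (hst : s = 0 ∨ t = 0) : RankLE EM 1 (backBigon f hf s t).toFun := by
  have hg : ContDiff ℝ ∞ (fun z : ℝ × ℝ =>
      rectangle s t (Real.smoothTransition (3 * z.1 - 1)) (1 - z.2)) := by
    have := smoothTransition_smooth
    unfold rectangle firstHalf secondHalf
    fun_prop
  have key : ∀ j : ℝ → ℝ × ℝ, ContDiff ℝ ∞ j → ∀ g : ℝ × ℝ → ℝ, ContDiff ℝ ∞ g →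
      (∀ z, (backBigon f hf s t).toFun z = f (j (g z))) →
      RankLE EM 1 (backBigon f hf s t).toFun := by
    intro j hj g hg h
    rw [funext h]
    have h1 : RankLE EM 1 (fun r : ℝ => f (j r)) := by
      have := rankLE_of_le (EM := EM) (W := ℝ) (fun r : ℝ => f (j r))
      rwa [Module.finrank_self] at this
    exact h1.comp (hf.comp hj.contMDiff) hg
  rcases hst with rfl | rfl
  · refine key (fun r => (0, r)) (by fun_prop) _ (contDiff_snd.comp hg) fun z => ?_
    simp [backBigon, rectangle]
  · refine key (fun r => (r, 0)) (by fun_prop) _ (contDiff_fst.comp hg) fun z => ?_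
    simp [backBigon, rectangle]

omit [LieGroup 𝓘(ℝ, EG) ∞ G] [LieGroup 𝓘(ℝ, EH) ∞ H] in
theorem tra₂_backBigon_axis (ι : Realization 𝓕 P) {f : ℝ × ℝ → M}
    (hf : ContMDiff 𝓘(ℝ, ℝ × ℝ) 𝓘(ℝ, EM) ∞ f) (s t : ℝ) (hst : s = 0 ∨ t = 0)
    (p : (P.fiber (f (s, t))).Obj) : ι.tra₂ (backBigon f hf s t) p = 1 :=
  Realization.hol_of_rankLE _ (rankLE_backBigon hf s t hst) _

variable [FiniteDimensional ℝ EG] [FiniteDimensional ℝ EH]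

/-- The bigon identity for the rectangle with corners `(0,0)` and `(s,t)` is `r₀ u' = u r₁`. Its
logarithmic `t`-derivative at `t = 0` is an identity in `𝔥` depending on `s`, and the `s`-derivative
of the latter at `s = 0` is the formula. Transport back along one side displaces the base point for
the next by `g` or `k`, whence the terms with `A`. -/
theorem pullback_B_of_defines {C : TwoConnection P} {C' : TwoConnection P'}
    (hC : ι.Defines C) (hC' : ι'.Defines C') (hρ : ρ.IsSmooth ι ι')
    {F : TwoBundleMap P P'} (hF : ρ.Induces ι ι' F) (hφs : φ.IsSmooth)
    (hφ : HasDerivativeAt ρ ι φ) {S : ℝ × ℝ → P.P₀}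
    (hS : ContMDiff 𝓘(ℝ, ℝ × ℝ) 𝓘(ℝ, EM × EG) ∞ S) (v w : EM × EG)
    (hv : partial₁ (EM × EG) S (0, 0) = v) (hw : partial₂ (EM × EG) S (0, 0) = w) :
    C'.B.ev (F.obj (S (0, 0))) ((F.dObj (S (0, 0)) : EM × EG →L[ℝ] EM × EG) v)
        ((F.dObj (S (0, 0)) : EM × EG →L[ℝ] EM × EG) w) =
      C.B.ev (S (0, 0)) v w + φ.d (S (0, 0)) v w + lieBr H (φ.ev (S (0, 0)) v) (φ.ev (S (0, 0)) w)
        + (X.αStar (C.A.ev (S (0, 0)) v) (φ.ev (S (0, 0)) w) -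
            X.αStar (C.A.ev (S (0, 0)) w) (φ.ev (S (0, 0)) v)) := by
  have hsl₁ : ∀ t, ContMDiff 𝓘(ℝ, ℝ) 𝓘(ℝ, EM × EG) ∞ (fun s => S (s, t)) := contMDiff_slice_fst hS
  have hsl₂ : ∀ s, ContMDiff 𝓘(ℝ, ℝ) 𝓘(ℝ, EM × EG) ∞ (fun t => S (s, t)) := contMDiff_slice_snd hS
  have hv₁ : ∀ s t, vel (EM × EG) (fun s => S (s, t)) s = partial₁ (EM × EG) S (s, t) := fun s t =>
    (hasVelocity_partial₁ hS s t).vel_eq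
  have hv₂ : ∀ s t, vel (EM × EG) (fun t => S (s, t)) t = partial₂ (EM × EG) S (s, t) := fun s t =>
    (hasVelocity_partial₂ hS s t).vel_eq
  set f : ℝ × ℝ → M := fun z => P.proj (S z) with hfdef
  have hf : ContMDiff 𝓘(ℝ, ℝ × ℝ) 𝓘(ℝ, EM) ∞ f := P.smooth_proj.comp hS
  have hFS : ContMDiff 𝓘(ℝ, ℝ × ℝ) 𝓘(ℝ, EM × EG) ∞ (fun z => F.obj (S z)) := F.smooth_obj.comp hS
  obtain ⟨b, hb, hbB⟩ := hC.exists_tra₂ hS hf (fun _ => rfl)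
  obtain ⟨b', hb', hbB'⟩ := hC'.exists_tra₂ hFS hf (fun z => F.map_proj (S z))
  set u : ℝ → ℝ → H := fun s t => ι.tra₂ (backBigon f hf s t) (P.pt (S (s, t)) rfl) with hu
  set u' : ℝ → ℝ → H := fun s t =>
    ι'.tra₂ (backBigon f hf s t) (P'.pt (F.obj (S (s, t))) (F.map_proj (S (s, t)))) with hu'
  have u0 : ∀ s, u s 0 = 1 := fun s => tra₂_backBigon_axis ι hf s 0 (.inr rfl) _
  have u0' : ∀ s, u' s 0 = 1 := fun s => tra₂_backBigon_axis ι' hf s 0 (.inr rfl) _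
  -- For `s = 0` the rectangle degenerates. This removes the bracket of `φ(v)` with `b' 0` when `Ad
  -- (a (s, 0)) (b' s)` is differentiated.
  have hb0 : b' 0 = 0 := by
    refine (hb' 0).unique ?_
    have : (fun t => u' 0 t) = fun _ => 1 := funext fun t =>
      tra₂_backBigon_axis ι' hf 0 t (.inl rfl) _
    exact this ▸ hasVelocity_const _ _
  -- the values of `ρ` on the sides of the rectangles
  let a : ℝ × ℝ → H := fun z => ρ.holAt ι (seg (fun s => f (s, z.2)) z.1 0) (S z)
  let e : ℝ × ℝ → H := fun z => ρ.holAt ι (seg (fun t => f (z.1, t)) z.2 0) (S z)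
  have ha : ContMDiff 𝓘(ℝ, ℝ × ℝ) 𝓘(ℝ, EH) ∞ a :=
    hρ.contMDiff_holAt_seg (c := fun w : (ℝ × ℝ) × ℝ => f (w.2, w.1.2))
      (hf.comp (ContDiff.contMDiff (f := fun w : (ℝ × ℝ) × ℝ => (w.2, w.1.2)) (by fun_prop)))
      contDiff_fst contDiff_const hS (fun _ => rfl)
  have a0 : ∀ t, a (0, t) = 1 := fun t => holAt_seg_self ι ρ (c := fun s => f (s, t)) 0 rfl
  have e0 : ∀ s, e (s, 0) = 1 := fun s => holAt_seg_self ι ρ (c := fun t => f (s, t)) 0 rfl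
  have had : ∀ t, HasLogDeriv (fun s => a (s, t)) 0
      (φ.ev (S (0, t)) (partial₁ (EM × EG) S (0, t))) := fun t =>
    hv₁ 0 t ▸ hφ.reverse hC (hsl₁ t)
  have hed : ∀ s, HasLogDeriv (fun t => e (s, t)) 0
      (φ.ev (S (s, 0)) (partial₂ (EM × EG) S (s, 0))) := fun s =>
    hv₂ s 0 ▸ hφ.reverse hC (hsl₂ s)
  choose g hg hg0 hgd using fun t => hC.exists_div (hsl₁ t)
  choose k hk hk0 hkd using fun s => hC.exists_div (hsl₂ s)
  simp only [hv₁] at hgd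
  simp only [hv₂] at hkd
  -- the values of `ρ` on the boundary paths
  let r₀ : ℝ × ℝ → H := fun z => ρ.holAt ι (backPath f hf z.1 z.2 0).toFun (S z)
  let r₁ : ℝ × ℝ → H := fun z => ρ.holAt ι (backPath f hf z.1 z.2 1).toFun (S z)
  have hr₀ : ∀ s t, r₀ (s, t) = X.α (g t s) (e (0, t)) * a (s, t) := by
    intro s t
    have h1 := holAt_backPath_zero hf ρ ι s t (p := S (s, t)) rfl
    rw [traAt_seg_reverse (contMDiff_slice_fst hf t) (p := S (0, t)) (q := S (s, t)) rfl rfl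
      (hg t s), holAt_seg_act ι ρ (contMDiff_slice_snd hf 0) t 0 (p := S (0, t)) rfl, inv_inv] at h1
    exact h1
  have hr₁ : ∀ s t, r₁ (s, t) = X.α (k s t) (a (s, 0)) * e (s, t) := by
    intro s t
    have h1 := holAt_backPath_one hf ρ ι s t (p := S (s, t)) rfl
    rw [traAt_seg_reverse (contMDiff_slice_snd hf s) (p := S (s, 0)) (q := S (s, t)) rfl rfl
      (hk s t), holAt_seg_act ι ρ (contMDiff_slice_fst hf 0) s 0 (p := S (s, 0)) rfl, inv_inv] at h1
    exact h1
  have hr₀s : ContMDiff 𝓘(ℝ, ℝ × ℝ) 𝓘(ℝ, EH) ∞ r₀ := by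
    refine hρ.contMDiff_holAt hS (fun z => backPath f hf z.1 z.2 0) ?_
    have h1 : ContDiff ℝ ∞ (fun z : (ℝ × ℝ) × ℝ => rectangle z.1.1 z.1.2 0 (1 - z.2)) := by
      have := smoothTransition_smooth
      unfold rectangle firstHalf secondHalf
      fun_prop
    exact hf.comp h1.contMDiff
  have hbig : ∀ s t, r₀ (s, t) * u' s t = u s t * r₁ (s, t) := by
    intro s t
    have h1 := ρ.hol_bigon ι ι' (backBigon f hf s t) (P.pt (S (s, t)) rfl)
    have h2 : ρ.fib ι ι' (f (s, t)) (P.pt (S (s, t)) rfl) =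
        P'.pt (F.obj (S (s, t))) (F.map_proj (S (s, t))) := Subtype.ext (hF.objAt _).symm
    rw [h2, ← ρ.holAt_eq ι, ← ρ.holAt_eq ι] at h1
    exact h1
  -- the first side
  let q : ℝ × ℝ → H := fun z => r₀ z * (a z)⁻¹
  have hq : ContMDiff 𝓘(ℝ, ℝ × ℝ) 𝓘(ℝ, EH) ∞ q := hr₀s.mul ha.inv
  have hqe : ∀ s t, q (s, t) = X.α (g t s) (e (0, t)) := fun s t => by
    simp only [q, hr₀, mul_inv_cancel_right]
  have hq0 : ∀ s, q (s, 0) = 1 := fun s => by rw [hqe, e0, map_one]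
  have hA₁ : DifferentiableAt ℝ (fun t => -(C.A.ev (S (0, t)) (partial₁ (EM × EG) S (0, t)))) 0 :=
    (hasDerivAt_slice_snd (C.smooth_A.contDiff_pullback hS) 0 0 (1, 0)).neg.differentiableAt
  have hA₂ : DifferentiableAt ℝ (fun s => -(C.A.ev (S (s, 0)) (partial₂ (EM × EG) S (s, 0)))) 0 :=
    (hasDerivAt_slice_fst (C.smooth_A.contDiff_pullback hS) 0 0 (0, 1)).neg.differentiableAt
  have hφ₁ : HasDerivAt (fun t => φ.ev (S (0, t)) (partial₁ (EM × EG) S (0, t)))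
      (fderiv ℝ (φ.pullback S) (0, 0) (0, 1) (1, 0)) 0 :=
    hasDerivAt_slice_snd (hφs.contDiff_pullback hS) 0 0 (1, 0)
  have hφ₂ : HasDerivAt (fun s => φ.ev (S (s, 0)) (partial₂ (EM × EG) S (s, 0)))
      (fderiv ℝ (φ.pullback S) (0, 0) (1, 0) (0, 1)) 0 :=
    hasDerivAt_slice_fst (hφs.contDiff_pullback hS) 0 0 (0, 1)
  -- The factor `q` is `1` on the axis `t = 0`, so its mixed derivative may be taken with `s` before
  -- `t`. The `s`-derivative moves only the group element `g t s` acting on `e (0, t)`, and produces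
  -- `orbitDeriv`.
  have hqm : HasDerivAt (fun s => logForm EH q (s, 0) (0, 1))
      (X.αStar (-(C.A.ev (S (0, 0)) v)) (φ.ev (S (0, 0)) w)) 0 := by
    have h1 := X.hasDerivAt_orbitDeriv (hed 0) (e0 0) hA₁.hasDerivAt
    rw [hv, hw] at h1
    refine hasDerivAt_mixed hq (.inl hq0) (fun t => ?_) h1
    exact (X.hasLogDeriv_orbit (hgd t) (hg0 t) (e (0, t))).congr (.of_eq (funext fun s => hqe s t))
  have ham := hasDerivAt_mixed ha (.inr a0) had hφ₁
  have hρ₀ : ∀ s, HasLogDeriv (fun t => r₀ (s, t)) 0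
      (logForm EH q (s, 0) (0, 1) + logForm EH a (s, 0) (0, 1)) := fun s => by
    have h1 := (hasLogDeriv_logForm_snd hq s 0).mul (hasLogDeriv_logForm_snd ha s 0)
    rw [hq0, Ad_one] at h1
    exact h1.congr (.of_eq (funext fun t => (inv_mul_cancel_right _ _).symm))
  have hρ₁ : ∀ s, HasLogDeriv (fun t => r₁ (s, t)) 0
      (X.orbitDeriv (a (s, 0)) (-(C.A.ev (S (s, 0)) (partial₂ (EM × EG) S (s, 0)))) +
        (Ad (a (s, 0)) : EH →L[ℝ] EH) (φ.ev (S (s, 0)) (partial₂ (EM × EG) S (s, 0)))) := fun s => by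
    have h1 := (X.hasLogDeriv_orbit (hkd s) (hk0 s) (a (s, 0))).mul (hed s)
    rw [hk0, map_one, MulAut.one_apply] at h1
    exact h1.congr (.of_eq (funext fun t => hr₁ s t))
  -- The `t`-derivative of the bigon identity at fixed `s`, solved for the contribution of the
  -- second functor; the prefactors reduce to `u (s, 0) = 1` and `r₀ (s, 0) = a (s, 0)`.
  have key : ∀ s, (Ad (a (s, 0)) : EH →L[ℝ] EH) (b' s) =
      b s + (X.orbitDeriv (a (s, 0)) (-(C.A.ev (S (s, 0)) (partial₂ (EM × EG) S (s, 0)))) +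
        (Ad (a (s, 0)) : EH →L[ℝ] EH) (φ.ev (S (s, 0)) (partial₂ (EM × EG) S (s, 0)))) -
      (logForm EH q (s, 0) (0, 1) + logForm EH a (s, 0) (0, 1)) := fun s => by
    have h1 := (hρ₀ s).mul ((hasLogDeriv_iff_of_eq_one (u0' s)).2 (hb' s))
    have h2 := ((hasLogDeriv_iff_of_eq_one (u0 s)).2 (hb s)).mul (hρ₁ s)
    have h3 := h1.unique (h2.congr (.of_eq (funext fun t => hbig s t)))
    have h4 : r₀ (s, 0) = a (s, 0) := by rw [hr₀, e0, map_one, one_mul]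
    rw [h4, u0, Ad_one] at h3
    rw [← h3]
    abel
  have hB1 := (had 0).hasDerivAt_Ad_apply hbB'
  have hB2 := (hbB.add ((X.hasDerivAt_orbitDeriv (had 0) (a0 0) hA₂.hasDerivAt).add
    ((had 0).hasDerivAt_Ad_apply hφ₂))).sub (hqm.add ham)
  have hB3 := hB1.unique (hB2.congr_of_eventuallyEq (.of_eq (funext key)))
  have z2 : ∀ v : EH, lieBr H v 0 = 0 := fun v => by
    have := lieBr_smul_left (K := H) 0 (0 : EH) v
    rw [lieBr_swap]
    simpa using this
  have hd := hφs.d_pullback hS (0, 0) (1, 0) (0, 1)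
  have hdv : φ.d (S (0, 0)) v w = fderiv ℝ (φ.pullback S) (0, 0) (1, 0) (0, 1) -
      fderiv ℝ (φ.pullback S) (0, 0) (0, 1) (1, 0) := by
    rw [hd, ← hv, ← hw]; rfl
  have hp₁ : partial₁ (EM × EG) (fun z => F.obj (S z)) (0, 0) =
      (F.dObj (S (0, 0)) : EM × EG →L[ℝ] EM × EG) v := by
    rw [← hv]
    exact (hasVelocity_partial₁ hFS 0 0).unique
      ((hasVelocity_partial₁ hS 0 0).comp_contMDiff F.smooth_obj)
  have hp₂ : partial₂ (EM × EG) (fun z => F.obj (S z)) (0, 0) =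
      (F.dObj (S (0, 0)) : EM × EG →L[ℝ] EM × EG) w := by
    rw [← hw]
    exact (hasVelocity_partial₂ hFS 0 0).unique
      ((hasVelocity_partial₂ hS 0 0).comp_contMDiff F.smooth_obj)
  rw [hb0, map_zero, z2, zero_add, a0, Ad_one, Ad_one, Ad_one, hp₁, hp₂, hv, hw,
    X.αStar_neg_left, X.αStar_neg_left] at hB3
  rw [hB3, hdv]
  abel

theorem exists_oneMorphism [FiniteDimensional ℝ EM] {C : TwoConnection P} {C' : TwoConnection P'}
    (hC : ι.Defines C) (hC' : ι'.Defines C') (hρ : ρ.IsSmooth ι ι') :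
    ∃ (F : TwoBundleMap P P') (φ : OneForm (EM × EG) P.P₀ EH),
      ρ.Induces ι ι' F ∧ ρ.HasDerivative ι φ ∧ IsOneMorphism C C' F φ ∧ IsGaugeEquivariant φ ∧
      (∀ F', ρ.Induces ι ι' F' → F' = F) ∧ (∀ φ', ρ.HasDerivative ι φ' → φ' = φ) := by
  obtain ⟨F, hF⟩ := hρ.exists_induces
  obtain ⟨φ, hφs, hφ⟩ := exists_hasDerivativeAt hρ
  refine ⟨F, φ, hF, hasDerivative_iff.2 hφ, ⟨hφs, hφ.horizontal, hφ.equivariant,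
    pullback_A_of_defines hC hC' hF hφ, ?_⟩, fun g hg _ => hφ.gaugeEquivariant hg,
    fun F' hF' => hF.unique hF', fun φ' hφ' => hφ.unique (hasDerivative_iff.1 hφ')⟩
  intro p v w
  obtain ⟨v', hv'⟩ : ∃ v' : EM × EG, v' = v := ⟨v, rfl⟩
  obtain ⟨w', hw'⟩ : ∃ w' : EM × EG, w' = w := ⟨w, rfl⟩
  obtain ⟨Ψ, hΨ, hΨp, -⟩ := exists_param (E := EM × EG) p Filter.univ_mem
  set x := extChartAt 𝓘(ℝ, EM × EG) p p with hx
  -- An affine plane in the chart at `p` realizes an arbitrary pair of tangent vectors as partial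
  -- derivatives.
  let S : ℝ × ℝ → P.P₀ := fun z => Ψ (x + (z.1 • v' + z.2 • w'))
  have hS : ContMDiff 𝓘(ℝ, ℝ × ℝ) 𝓘(ℝ, EM × EG) ∞ S :=
    hΨ.comp (ContDiff.contMDiff (by fun_prop))
  have hvel : ∀ u : EM × EG, HasVelocity (EM × EG) (fun r : ℝ => Ψ (x + r • u)) 0 u := fun u => by
    have hl : HasDerivAt (fun r : ℝ => x + r • u) u 0 := by
      simpa using ((hasDerivAt_id (0 : ℝ)).smul_const u).const_add x
    have h := hasVelocity_extChart_symm (p := p) hl (by simp [hx])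
    have h0 : x + (0 : ℝ) • u = extChartAt 𝓘(ℝ, EM × EG) p p := by simp [hx]
    rw [h0, chartSymmDeriv_self] at h
    refine h.congr ?_
    have hcont : Filter.Tendsto (fun r : ℝ => x + r • u) (𝓝 0) (𝓝 x) := by
      have := hl.continuousAt
      simpa [ContinuousAt] using this
    exact hcont.eventually hΨp
  have h00 : S (0, 0) = p := by
    have : Ψ x = p := hΨp.self_of_nhds.trans (extChartAt_to_inv p)
    simpa [S] using this
  have hv : partial₁ (EM × EG) S (0, 0) = v' := (hasVelocity_partial₁ hS 0 0).unique (by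
    simpa [S] using hvel v')
  have hw : partial₂ (EM × EG) S (0, 0) = w' := (hasVelocity_partial₂ hS 0 0).unique (by
    simpa [S] using hvel w')
  have h := pullback_B_of_defines hC hC' hρ hF hφs hφ hS _ _ hv hw
  have claim : C'.B.ev (F.obj p) ((F.dObj p : EM × EG →L[ℝ] EM × EG) v')
        ((F.dObj p : EM × EG →L[ℝ] EM × EG) w') =
      C.B.ev p v' w' + φ.d p v' w' + lieBr H (φ.ev p v') (φ.ev p w')
        + (X.αStar (C.A.ev p v') (φ.ev p w') - X.αStar (C.A.ev p w') (φ.ev p v')) := by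
    generalize S (0, 0) = q at h h00
    subst h00
    exact h
  subst hv' hw'
  exact claim

end SecondOrder

/-! ### Local sections and smooth families of horizontal lifts -/

section HorizontalFamilies

variable {EM : Type*} [NormedAddCommGroup EM] [NormedSpace ℝ EM]
  {M : Type*} [TopologicalSpace M] [ChartedSpace EM M]
  {EG : Type*} [NormedAddCommGroup EG] [NormedSpace ℝ EG]
  {EH : Type*} [NormedAddCommGroup EH] [NormedSpace ℝ EH]
  {G : Type*} [TopologicalSpace G] [ChartedSpace EG G] [Group G]
  {H : Type*} [TopologicalSpace H] [ChartedSpace EH H] [Group H]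
  {X : LieCrossedModule EG EH G H} {P : PrincipalTwoBundle X EM M}

/-- In the normal form of a submersion the projection forgets a factor, and fixing the value of that
factor gives a section. -/
theorem PrincipalTwoBundle.exists_local_section (P : PrincipalTwoBundle X EM M) (x₀ : M) :
    ∃ σ : M → P.P₀, ∀ᶠ x in 𝓝 x₀,
      ContMDiffAt 𝓘(ℝ, EM) 𝓘(ℝ, EM × EG) ∞ σ x ∧ P.proj (σ x) = x := by
  obtain ⟨p, rfl⟩ := P.surjective_proj x₀
  have h := P.submersion_proj.isSubmersionAt p
  have hw : ∀ w ∈ h.domChart.target,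
      h.codChart (P.proj (h.domChart.symm w)) = (h.equiv w).1 := fun w hw => by
    have := h.writtenInCharts
      (show w ∈ (h.domChart.extend 𝓘(ℝ, EM × EG)).target by
        rw [OpenPartialHomeomorph.extend_target]; exact ⟨hw, by simp⟩)
    simpa using this
  have hp := h.domChart.map_source h.mem_domChart_source
  let w : M → EM × EG := fun x => h.equiv.symm (h.codChart x, (h.equiv (h.domChart p)).2)
  have hw0 : w (P.proj p) = h.domChart p := by
    have := hw _ hp
    rw [h.domChart.left_inv h.mem_domChart_source] at this
    simp only [w, this, Prod.mk.eta, ContinuousLinearEquiv.symm_apply_apply]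
  have hcod : ∀ᶠ x in 𝓝 (P.proj p), x ∈ h.codChart.source :=
    h.codChart.open_source.mem_nhds h.mem_codChart_source
  have hws : ∀ x ∈ h.codChart.source, ContMDiffAt 𝓘(ℝ, EM) 𝓘(ℝ, EM × EG) ∞ w x := fun x hx => by
    have h1 := contMDiffAt_of_mem_maximalAtlas (I := 𝓘(ℝ, EM)) h.codChart_mem_maximalAtlas hx
    have h2 : ContDiff ℝ ∞ (fun y : EM => h.equiv.symm (y, (h.equiv (h.domChart p)).2)) :=
      h.equiv.symm.contDiff.comp (contDiff_id.prodMk contDiff_const)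
    exact h2.contMDiff.contMDiffAt.comp x h1
  have hdom : ∀ᶠ x in 𝓝 (P.proj p), w x ∈ h.domChart.target :=
    (hws _ h.mem_codChart_source).continuousAt.eventually_mem
      (h.domChart.open_target.mem_nhds (by rw [hw0]; exact hp))
  refine ⟨fun x => h.domChart.symm (w x), ?_⟩
  filter_upwards [hcod, hdom] with x hx hx'
  refine ⟨(contMDiffAt_symm_of_mem_maximalAtlas (I := 𝓘(ℝ, EM × EG)) h.domChart_mem_maximalAtlas
    hx').comp x (hws x hx), ?_⟩
  refine h.codChart.injOn (h.source_subset_preimage_source (h.domChart.map_target hx')) hx ?_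
  rw [hw _ hx']
  simp [w]

variable [LieGroup 𝓘(ℝ, EG) ∞ G] [FiniteDimensional ℝ EM] [FiniteDimensional ℝ EG]
  {W : Type} [NormedAddCommGroup W] [NormedSpace ℝ W] [FiniteDimensional ℝ W]

omit [FiniteDimensional ℝ EM] [FiniteDimensional ℝ EG] in
-- Relative to a reference lift `s`, horizontality of `s · k` is the differential equation `k' =
-- -A(s') k` in the group.
theorem TwoConnection.hasLogDeriv_of_horizontal (C : TwoConnection P) {s : ℝ → P.P₀} {k : ℝ → G}
    (hs : ContMDiff 𝓘(ℝ, ℝ) 𝓘(ℝ, EM × EG) ∞ s) (hk : ContMDiff 𝓘(ℝ, ℝ) 𝓘(ℝ, EG) ∞ k) (t : ℝ)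
    (h : C.A.ev (P.str.act₀ (s t) (k t))
      (vel (EM × EG) (fun t => P.str.act₀ (s t) (k t)) t) = 0) :
    HasLogDeriv k t (-C.A.ev (s t) (vel (EM × EG) s t)) := by
  have h1 := (hasVelocity_vel hk t).hasLogDeriv
  have h2 := ((hasVelocity_vel hs t).act₀ h1).vel_eq
  rw [h2, C.A_act] at h
  have h3 := congrArg (Ad (k t) : EG →L[ℝ] EG) h
  rw [Ad_Ad_inv, map_zero] at h3
  rwa [eq_neg_of_add_eq_zero_right h3] at h1

omit [FiniteDimensional ℝ EM] in
-- A local section provides a smooth reference lift, so smoothness of the family reduces to smooth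
-- dependence of `k`. Cutoffs in the parameter and in time make the data global, and a shift moves
-- the initial time `r` to `0`.
theorem TwoConnection.horizontal_family_local [T2Space G] (C : TwoConnection P) {γ : W × ℝ → M}
    (hγ : ContMDiff 𝓘(ℝ, W × ℝ) 𝓘(ℝ, EM) ∞ γ) {c : W × ℝ → P.P₀} (hc : ∀ z, P.proj (c z) = γ z)
    (hcs : ∀ u, ContMDiff 𝓘(ℝ, ℝ) 𝓘(ℝ, EM × EG) ∞ (fun t => c (u, t)))
    (hA : ∀ u t, C.A.ev (c (u, t)) (vel (EM × EG) (fun t => c (u, t)) t) = 0) (u₀ : W) (t₀ : ℝ) :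
    ∃ δ > 0, ∀ r ∈ Metric.ball t₀ δ,
      (∀ᶠ u in 𝓝 u₀, ContMDiffAt 𝓘(ℝ, W) 𝓘(ℝ, EM × EG) ∞ (fun u => c (u, r)) u) →
      ∀ t ∈ Metric.ball t₀ δ, ∀ᶠ z in 𝓝 (u₀, t), ContMDiffAt 𝓘(ℝ, W × ℝ) 𝓘(ℝ, EM × EG) ∞ c z := by
  obtain ⟨σ, hσ⟩ := P.exists_local_section (γ (u₀, t₀))
  have hσ' := hγ.continuous.continuousAt.eventually hσ
  rw [nhds_prod_eq, Filter.eventually_prod_iff] at hσ'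
  obtain ⟨pU, hU, pJ, hJ, hUJ⟩ := hσ'
  obtain ⟨κ₂, hκ₂, hκ₂e, hκ₂O⟩ := exists_smooth_cutoff t₀ hJ
  obtain ⟨δ, hδ, hball⟩ := Metric.eventually_nhds_iff_ball.1 hκ₂e
  refine ⟨δ, hδ, fun r hr hcr t ht => ?_⟩
  obtain ⟨κ₁, hκ₁, hκ₁e, hκ₁O⟩ := exists_smooth_cutoff u₀ (hU.and hcr)
  let κ : W × ℝ → W × ℝ := fun z => (κ₁ z.1, κ₂ z.2)
  have hκ : ContDiff ℝ ∞ κ := (hκ₁.comp contDiff_fst).prodMk (hκ₂.comp contDiff_snd)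
  have hgood : ∀ z, ContMDiffAt 𝓘(ℝ, EM) 𝓘(ℝ, EM × EG) ∞ σ (γ (κ z)) ∧
      P.proj (σ (γ (κ z))) = γ (κ z) := fun z => hUJ (hκ₁O z.1).1 (hκ₂O z.2)
  have hs : ContMDiff 𝓘(ℝ, W × ℝ) 𝓘(ℝ, EM × EG) ∞ (fun z => σ (γ (κ z))) := fun z =>
    ContMDiffAt.comp z (g := σ) (hgood z).1 ((hγ.comp hκ.contMDiff) z)
  choose k hk using fun z => (P.simply₀ (σ (γ (κ z))) (c (κ z))
    ((hgood z).2.trans (hc _).symm)).exists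
  have hcut : ∀ u, ContMDiff 𝓘(ℝ, ℝ) 𝓘(ℝ, EM × EG) ∞ (fun t => c (κ (u, t))) := fun u =>
    (hcs (κ₁ u)).comp hκ₂.contMDiff
  have hks : ∀ u, ContMDiff 𝓘(ℝ, ℝ) 𝓘(ℝ, EG) ∞ (fun t => k (u, t)) := fun u => by
    refine P.contMDiff_div₀ (p := fun t => σ (γ (κ (u, t)))) ?_ ?_
    · exact hs.comp (ContDiff.contMDiff (f := fun t : ℝ => (u, t)) (by fun_prop))
    · simp only [hk]
      exact hcut u
  have hkd : ∀ u t, HasLogDeriv (fun t => k (u, t)) t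
      (-(C.A.pullback (fun z => σ (γ (κ z))) (u, t)) (0, 1)) := fun u t => by
    have h1 : vel (EM × EG) (fun t => σ (γ (κ (u, t)))) t = (mfderiv 𝓘(ℝ, W × ℝ) 𝓘(ℝ, EM × EG)
        (fun z => σ (γ (κ z))) (u, t) : W × ℝ →L[ℝ] EM × EG) (0, 1) :=
      HasVelocity.vel_eq (HasVelocity.comp_contMDiff (hasVelocity_iff_hasDerivAt.2
        ((hasDerivAt_const t u).prodMk (hasDerivAt_id t))) hs)
    have h2 := C.hasLogDeriv_of_horizontal (s := fun t => σ (γ (κ (u, t)))) (k := fun t => k (u, t))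
      (hs.comp (ContDiff.contMDiff (f := fun t : ℝ => (u, t)) (by fun_prop))) (hks u) t ?_
    · rw [h1] at h2
      exact h2
    · simp only [hk]
      have h3 : HasVelocity (EM × EG) (fun t => c (κ (u, t))) t _ :=
        HasVelocity.comp_real (c := fun t => c (κ₁ u, t)) (f := κ₂)
          (hasVelocity_vel (hcs (κ₁ u)) (κ₂ t))
          (hκ₂.contDiffAt.differentiableAt (by simp)).hasDerivAt
      rw [h3.vel_eq, OneForm.ev_smul, hA, smul_zero]
  have hpb : ContDiff ℝ ∞ (fun z : W × ℝ =>
      -(C.A.pullback (fun z => σ (γ (κ z))) (z.1, z.2 + r)) (0, 1)) :=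
    (((C.smooth_A.contDiff_pullback hs).comp
      (contDiff_fst.prodMk (contDiff_snd.add contDiff_const))).clm_apply contDiff_const).neg
  have hκr : κ₂ r = r := hball r hr
  have hk1 : ContMDiff 𝓘(ℝ, W × ℝ) 𝓘(ℝ, EG) ∞ (fun z : W × ℝ => k (z.1, z.2 + r)) := by
    refine contMDiff_of_hasLogDeriv hpb (fun u t => ?_) ?_
    · have := HasLogDeriv.comp_real (h := fun t => k (u, t)) (f := fun t => t + r) (hkd u (t + r))
        ((hasDerivAt_id t).add_const r)
      rwa [one_smul] at this
    · simp only [zero_add]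
      refine P.contMDiff_div₀ (p := fun u => σ (γ (κ (u, r)))) ?_ ?_
      · exact hs.comp (ContDiff.contMDiff (f := fun u : W => (u, r)) (by fun_prop))
      · have e : ∀ u, P.str.act₀ (σ (γ (κ (u, r)))) (k (u, r)) = c (κ₁ u, r) := fun u => by
          rw [hk]
          simp only [κ, hκr]
        simp only [e]
        intro u
        exact ContMDiffAt.comp u (g := fun u => c (u, r)) (hκ₁O u).2 hκ₁.contMDiff.contMDiffAt
  have hk2 : ContMDiff 𝓘(ℝ, W × ℝ) 𝓘(ℝ, EG) ∞ k := by
    have := hk1.comp (ContDiff.contMDiff (f := fun z : W × ℝ => (z.1, z.2 - r)) (by fun_prop))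
    simpa [Function.comp_def] using this
  have hcs' := P.contMDiff_act₀ hs hk2
  simp only [hk] at hcs'
  have hκe : ∀ᶠ z in 𝓝 (u₀, t), c z = c (κ z) := by
    rw [nhds_prod_eq]
    filter_upwards [hκ₁e.prod_mk (Metric.isOpen_ball.eventually_mem ht)] with z hz
    simp only [κ, hz.1, hball _ hz.2]
  filter_upwards [hκe.eventually_nhds] with z hz
  exact (hcs' z).congr_of_eventuallyEq hz

omit [FiniteDimensional ℝ EM] in
-- The times `r` at which the family is smooth on a whole neighbourhood of `u₀` form a clopen set.
-- Requiring a neighbourhood, not just the point, leaves room for the cutoff in the local statement.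
theorem TwoConnection.contMDiff_horizontal_family [T2Space G] (C : TwoConnection P) {γ : W × ℝ → M}
    (hγ : ContMDiff 𝓘(ℝ, W × ℝ) 𝓘(ℝ, EM) ∞ γ) {c : W × ℝ → P.P₀} (hc : ∀ z, P.proj (c z) = γ z)
    (hcs : ∀ u, ContMDiff 𝓘(ℝ, ℝ) 𝓘(ℝ, EM × EG) ∞ (fun t => c (u, t)))
    (hA : ∀ u t, C.A.ev (c (u, t)) (vel (EM × EG) (fun t => c (u, t)) t) = 0)
    (h0 : ContMDiff 𝓘(ℝ, W) 𝓘(ℝ, EM × EG) ∞ (fun u => c (u, 0))) :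
    ContMDiff 𝓘(ℝ, W × ℝ) 𝓘(ℝ, EM × EG) ∞ c := by
  rintro ⟨u₀, t⟩
  have key := C.horizontal_family_local hγ hc hcs hA u₀
  let Q : Set ℝ := {r | ∀ᶠ u in 𝓝 u₀, ContMDiffAt 𝓘(ℝ, W) 𝓘(ℝ, EM × EG) ∞ (fun u => c (u, r)) u}
  have hQ : ∀ t₀, ∃ δ > 0, ∀ r ∈ Metric.ball t₀ δ, r ∈ Q → Metric.ball t₀ δ ⊆ Q := fun t₀ => by
    obtain ⟨δ, hδ, h⟩ := key t₀
    refine ⟨δ, hδ, fun r hr hrQ t ht => ?_⟩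
    have hm : ContMDiff 𝓘(ℝ, W) 𝓘(ℝ, W × ℝ) ∞ (fun u : W => (u, t)) :=
      ContDiff.contMDiff (by fun_prop)
    filter_upwards [hm.continuous.continuousAt.eventually (h r hr hrQ t ht)] with u hu
    exact hu.comp u (hm u)
  have hcl : IsClopen Q := by
    refine ⟨isClosed_of_closure_subset fun t₀ ht₀ => ?_, Metric.isOpen_iff.2 fun t₀ ht₀ => ?_⟩
    · obtain ⟨δ, hδ, h⟩ := hQ t₀
      obtain ⟨r, hrQ, hr⟩ := Metric.mem_closure_iff.1 ht₀ δ hδ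
      exact h r (by rwa [Metric.mem_ball, dist_comm]) hrQ (Metric.mem_ball_self hδ)
    · obtain ⟨δ, hδ, h⟩ := hQ t₀
      exact ⟨δ, hδ, h t₀ (Metric.mem_ball_self hδ) ht₀⟩
  have huniv : Q = Set.univ := hcl.eq_univ ⟨0, Filter.Eventually.of_forall h0⟩
  obtain ⟨δ, hδ, h⟩ := key t
  exact (h t (Metric.mem_ball_self hδ) (huniv ▸ Set.mem_univ t : t ∈ Q) t
    (Metric.mem_ball_self hδ)).self_of_nhds

end HorizontalFamilies

/-! ### Path-ordered exponentials along horizontal lifts -/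

section Holonomy

variable {EM : Type*} [NormedAddCommGroup EM] [NormedSpace ℝ EM]
  {M : Type*} [TopologicalSpace M] [ChartedSpace EM M]
  {EG : Type*} [NormedAddCommGroup EG] [NormedSpace ℝ EG]
  {EH : Type*} [NormedAddCommGroup EH] [NormedSpace ℝ EH]
  {G : Type*} [TopologicalSpace G] [ChartedSpace EG G] [Group G] [LieGroup 𝓘(ℝ, EG) ∞ G]
  {H : Type*} [TopologicalSpace H] [ChartedSpace EH H] [Group H] [LieGroup 𝓘(ℝ, EH) ∞ H]
  {X : LieCrossedModule EG EH G H} {P P' : PrincipalTwoBundle X EM M}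

omit [LieGroup 𝓘(ℝ, EG) ∞ G] [LieGroup 𝓘(ℝ, EH) ∞ H] in
/-- The differential of a bundle map, as an endomorphism of the model space. -/
def TwoBundleMap.dv (F : TwoBundleMap P P') (p : P.P₀) : EM × EG →L[ℝ] EM × EG := F.dObj p

omit [LieGroup 𝓘(ℝ, EG) ∞ G] [LieGroup 𝓘(ℝ, EH) ∞ H] in
theorem HasVelocity.map_obj (F : TwoBundleMap P P') {c : ℝ → P.P₀} {t : ℝ} {v : EM × EG}
    (hc : HasVelocity (EM × EG) c t v) :
    HasVelocity (EM × EG) (fun t => F.obj (c t)) t (F.dv (c t) v) :=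
  hc.comp_contMDiff F.smooth_obj

/-- A horizontal curve `c` together with a solution `h` of `h' = -φ(c') h`. -/
structure IsParallelPair (C : TwoConnection P) (φ : OneForm (EM × EG) P.P₀ EH) (c : ℝ → P.P₀)
    (h : ℝ → H) : Prop where
  smooth : ContMDiff 𝓘(ℝ, ℝ) 𝓘(ℝ, EM × EG) ∞ c
  horizontal : ∀ t, C.A.ev (c t) (vel (EM × EG) c t) = 0
  logDeriv : ∀ t, HasLogDeriv h t (-φ.ev (c t) (vel (EM × EG) c t))

namespace IsParallelPair

variable {C : TwoConnection P} {C' : TwoConnection P'} {φ : OneForm (EM × EG) P.P₀ EH}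
  {c d : ℝ → P.P₀} {h k : ℝ → H}

theorem unique [T2Space G] [T2Space H] (hc : IsParallelPair C φ c h) (hd : IsParallelPair C φ d k)
    (hp : ∀ t, P.proj (c t) = P.proj (d t)) {t₀ : ℝ} (h0 : c t₀ = d t₀) (h0' : h t₀ = k t₀) :
    c = d ∧ h = k := by
  have e : c = d := horizontal_unique C hc.smooth hd.smooth hc.horizontal hd.horizontal hp h0
  subst e
  exact ⟨rfl, eq_of_hasLogDeriv_univ hc.logDeriv hd.logDeriv t₀ h0'⟩

omit [LieGroup 𝓘(ℝ, EG) ∞ G] [LieGroup 𝓘(ℝ, EH) ∞ H] in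
theorem comp_real (hc : IsParallelPair C φ c h) {f : ℝ → ℝ} (hf : ContDiff ℝ ∞ f) :
    IsParallelPair C φ (fun t => c (f t)) (fun t => h (f t)) := by
  have hv : ∀ t, HasVelocity (EM × EG) (fun t => c (f t)) t (deriv f t • vel (EM × EG) c (f t)) :=
    fun t => HasVelocity.comp_real (hasVelocity_vel hc.smooth (f t))
      (hf.contDiffAt.differentiableAt (by simp)).hasDerivAt
  refine ⟨hc.smooth.comp hf.contMDiff, fun t => ?_, fun t => ?_⟩
  · rw [(hv t).vel_eq, OneForm.ev_smul, hc.horizontal, smul_zero]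
  · rw [(hv t).vel_eq, OneForm.ev_smul, ← smul_neg]
    exact (hc.logDeriv (f t)).comp_real (hf.contDiffAt.differentiableAt (by simp)).hasDerivAt

omit [LieGroup 𝓘(ℝ, EG) ∞ G] in
theorem mul_right (hc : IsParallelPair C φ c h) (x : H) :
    IsParallelPair C φ c (fun t => h t * x) :=
  ⟨hc.smooth, hc.horizontal, fun t => (hc.logDeriv t).mul_right x⟩

omit [LieGroup 𝓘(ℝ, EG) ∞ G] in
theorem act (hφ : ∀ (g : G) (p : P.P₀) (v : EM × EG),
      φ.ev (P.str.act₀ p g) (P.rt g p v) = X.αg g⁻¹ (φ.ev p v))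
    (hc : IsParallelPair C φ c h) (g : G) :
    IsParallelPair C φ (fun t => P.str.act₀ (c t) g) (fun t => X.α g⁻¹ (h t)) := by
  have hv : ∀ t, HasVelocity (EM × EG) (fun t => P.str.act₀ (c t) g) t _ :=
    fun t => (hasVelocity_vel hc.smooth t).rt P g
  refine ⟨P.contMDiff_act₀ hc.smooth contMDiff_const, fun t => ?_, fun t => ?_⟩
  · rw [(hv t).vel_eq]
    refine (C.A_equivariant g (c t) (vel (EM × EG) c t)).trans ?_
    have := congrArg (Ad g⁻¹ : EG →L[ℝ] EG) (hc.horizontal t)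
    rwa [map_zero] at this
  · rw [(hv t).vel_eq, hφ, ← map_neg]
    exact X.hasLogDeriv_α g⁻¹ (hc.logDeriv t)

omit [LieGroup 𝓘(ℝ, EG) ∞ G] [LieGroup 𝓘(ℝ, EH) ∞ H] in
theorem contDiff_logDeriv (hφ : φ.IsSmooth) (hc : ContMDiff 𝓘(ℝ, ℝ) 𝓘(ℝ, EM × EG) ∞ c) :
    ContDiff ℝ ∞ (fun t => -φ.ev (c t) (vel (EM × EG) c t)) :=
  ((hφ.contDiff_pullback hc).clm_apply (contDiff_const (c := (1 : ℝ)))).neg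

omit [LieGroup 𝓘(ℝ, EG) ∞ G] in
theorem contMDiff_snd [FiniteDimensional ℝ EH] [T2Space H] (hφ : φ.IsSmooth)
    (hc : IsParallelPair C φ c h) :
    ContMDiff 𝓘(ℝ, ℝ) 𝓘(ℝ, EH) ∞ h := by
  have h1 := contMDiff_of_hasLogDeriv (W := ℝ) (h := fun z => h z.2)
    ((contDiff_logDeriv hφ hc.smooth).comp contDiff_snd) (fun _ t => hc.logDeriv t)
    (contMDiff_const (c := h 0) : _)
  exact h1.comp (ContDiff.contMDiff (f := fun t : ℝ => ((0 : ℝ), t)) (by fun_prop))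

theorem image_horizontal {F : TwoBundleMap P P'} (hF : ∀ p (v : EM × EG), C'.A.ev (F.obj p) (F.dv p v) =
      C.A.ev p v + X.tStar (φ.ev p v))
    (hc : IsParallelPair C φ c h) (t : ℝ) :
    C'.A.ev (P'.str.act₀ (F.obj (c t)) (X.t (h t)))
      (vel (EM × EG) (fun t => P'.str.act₀ (F.obj (c t)) (X.t (h t))) t) = 0 := by
  have hv := ((hasVelocity_vel hc.smooth t).map_obj F).act₀
    (X.hasLogDeriv_t (hc.logDeriv t))
  rw [hv.vel_eq, C'.A_act, hF, hc.horizontal, zero_add, map_neg, add_neg_cancel, map_zero]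

end IsParallelPair

/-- The horizontal lift of `γ` starting at `p` ends at `q`, and `g` is the path-ordered exponential
of `-φ` along it. -/
def HasHolonomy (C : TwoConnection P) (φ : OneForm (EM × EG) P.P₀ EH) (γ : ℝ → M) (p q : P.P₀)
    (g : H) : Prop :=
  ∃ (c : ℝ → P.P₀) (h : ℝ → H), IsParallelPair C φ c h ∧ (∀ t, P.proj (c t) = γ t) ∧
    c 0 = p ∧ h 0 = 1 ∧ c 1 = q ∧ h 1 = g

namespace HasHolonomy

variable {C : TwoConnection P} {C' : TwoConnection P'} {φ : OneForm (EM × EG) P.P₀ EH}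
  {p q q' r : P.P₀} {g g' : H}

theorem unique [T2Space G] [T2Space H] {γ : ℝ → M} (hg : HasHolonomy C φ γ p q g)
    (hg' : HasHolonomy C φ γ p q' g') : q = q' ∧ g = g' := by
  obtain ⟨c, h, hc, hp, h0, h0', rfl, rfl⟩ := hg
  obtain ⟨d, k, hd, hp', k0, k0', rfl, rfl⟩ := hg'
  obtain ⟨rfl, rfl⟩ := hc.unique hd (fun t => (hp t).trans (hp' t).symm) (h0.trans k0.symm)
    (h0'.trans k0'.symm)
  exact ⟨rfl, rfl⟩

omit [LieGroup 𝓘(ℝ, EG) ∞ G] in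
theorem act {γ : ℝ → M} (hφ : ∀ (g : G) (p : P.P₀) (v : EM × EG),
      φ.ev (P.str.act₀ p g) (P.rt g p v) = X.αg g⁻¹ (φ.ev p v))
    (hg : HasHolonomy C φ γ p q g) (a : G) :
    HasHolonomy C φ γ (P.str.act₀ p a) (P.str.act₀ q a) (X.α a⁻¹ g) := by
  obtain ⟨c, h, hc, hp, rfl, h0, rfl, rfl⟩ := hg
  exact ⟨_, _, hc.act hφ a, fun t => (P.proj_act _ _).trans (hp t), rfl, by simp [h0], rfl, rfl⟩

theorem concat [T2Space G] [T2Space H] {x y z : M} {γ : SmoothPath EM x y} {δ : SmoothPath EM y z}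
    {q'' : P.P₀} {g'' : H}
    (hγ : HasHolonomy C φ γ.toFun p q g) (hδ : HasHolonomy C φ δ.toFun q q' g')
    (hγδ : HasHolonomy C φ (γ.concat δ).toFun p q'' g'') : q'' = q' ∧ g'' = g' * g := by
  obtain ⟨c, h, hc, hp, h0, h0', rfl, rfl⟩ := hγ
  obtain ⟨d, k, hd, hp', k0, k0', rfl, rfl⟩ := hδ
  obtain ⟨e, l, he, hp'', l0, l0', rfl, rfl⟩ := hγδ
  have hST := smoothTransition_smooth
  -- Composition with the smooth transition confines the parameter to the unit interval. Each half
  -- of the concatenation and the corresponding path thus give parallel pairs over the same curve on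
  -- all of `ℝ`, and uniqueness compares their values at `1`.
  have h1 := (he.comp_real (f := fun t => Real.smoothTransition t / 2) (by fun_prop)).unique
    (hc.comp_real hST) (t₀ := 0) (fun t => by
      have := Real.smoothTransition.le_one t
      rw [hp, hp'']
      simp only [SmoothPath.concat]
      rw [if_pos (by linarith)]
      congr 1; ring) (by simp [l0, h0]) (by simp [l0', h0'])
  have e1 : e (1 / 2) = c 1 := by simpa using congrFun h1.1 1
  have e2 : l (1 / 2) = h 1 := by simpa using congrFun h1.2 1
  have h2 := (he.comp_real (f := fun t => 1 / 2 + Real.smoothTransition t / 2) (by fun_prop)).unique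
    ((hd.mul_right (h 1)).comp_real hST) (t₀ := 0) (fun t => by
      have := Real.smoothTransition.nonneg t
      rw [hp', hp'']
      simp only [SmoothPath.concat]
      -- At parameter exactly `1/2` the concatenation uses its first branch, so the two formulas are
      -- matched at the common end point.
      split_ifs with hle
      · have h0 : Real.smoothTransition t = 0 := by linarith
        rw [h0, δ.eq_start]
        norm_num
        exact γ.eq_end
      · congr 1; ring) (by simpa [k0] using e1)
    (by simpa [k0'] using e2)
  have e3 := congrFun h2.1 1
  have e4 := congrFun h2.2 1
  norm_num at e3 e4
  exact ⟨e3, e4⟩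

theorem image [T2Space G] [T2Space H] [FiniteDimensional ℝ EH] (hφ : φ.IsSmooth) {γ : ℝ → M}
    {F : TwoBundleMap P P'} (hF : ∀ p (v : EM × EG), C'.A.ev (F.obj p) (F.dv p v) =
      C.A.ev p v + X.tStar (φ.ev p v)) (hg : HasHolonomy C φ γ p q g) {c' : ℝ → P'.P₀}
    (hc' : ContMDiff 𝓘(ℝ, ℝ) 𝓘(ℝ, EM × EG) ∞ c')
    (hA : ∀ t, C'.A.ev (c' t) (vel (EM × EG) c' t) = 0) (hp : ∀ t, P'.proj (c' t) = γ t)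
    (h0 : c' 0 = F.obj p) : c' 1 = P'.str.act₀ (F.obj q) (X.t g) := by
  obtain ⟨c, h, hc, hp', rfl, h0', rfl, rfl⟩ := hg
  have h1 := horizontal_unique C' hc' (P'.contMDiff_act₀ (F.smooth_obj.comp hc.smooth)
    (X.smooth_t.comp (hc.contMDiff_snd hφ))) hA (hc.image_horizontal hF)
    (fun t => by rw [hp, P'.proj_act, Function.comp_apply, F.map_proj, hp']) (t₀ := 0)
    (by simp [h0, h0', P'.str.act₀_one])
  rw [h1]
  rfl

end HasHolonomy

variable {𝓕 𝓕' : TransportTwoFunctor X EM M} [T2Space G] [T2Space H] [FiniteDimensional ℝ EH]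

omit [LieGroup 𝓘(ℝ, EG) ∞ G] [T2Space G] [T2Space H] in
theorem Realization.IsTransportOf.exists_hasHolonomy {ι : Realization 𝓕 P} {C : TwoConnection P}
    (hC : ι.IsTransportOf C) {φ : OneForm (EM × EG) P.P₀ EH} (hφ : φ.IsSmooth) {x y : M}
    (γ : SmoothPath EM x y) (p : (P.fiber x).Obj) :
    ∃ g, HasHolonomy C φ γ.toFun p.1 (ι.tra γ p).1 g := by
  obtain ⟨c, hc, hq⟩ := hC.parallel γ p
  obtain ⟨h, h0, hh⟩ := exists_isPathOrderedExp (K := H)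
    (IsParallelPair.contDiff_logDeriv hφ hc.smooth)
  exact ⟨h 1, c, h, ⟨hc.smooth, hc.horizontal, hh⟩, hc.lifts, hc.start, h0, hq.symm, rfl⟩

end Holonomy

/-! ### Variation of a path-ordered exponential in a transversal direction. -/

section Adjoint

variable {EH : Type*} [NormedAddCommGroup EH] [NormedSpace ℝ EH] [FiniteDimensional ℝ EH]
  {H : Type*} [TopologicalSpace H] [ChartedSpace EH H] [Group H] [LieGroup 𝓘(ℝ, EH) ∞ H]

theorem lieBr_zero_left (v : EH) : lieBr H 0 v = 0 := by
  have := lieBr_smul_left (K := H) 0 (0 : EH) v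
  simpa using this

theorem lieBr_zero_right (v : EH) : lieBr H v 0 = 0 := by
  rw [lieBr_swap, lieBr_zero_left, neg_zero]

/-- This is the derivative of `Ad (k c k⁻¹) ∘ Ad k = Ad k ∘ Ad c` along a curve `c` through `1`. -/
theorem Ad_lieBr (k : H) (v w : EH) : (Ad k : EH →L[ℝ] EH) (lieBr H v w) =
    lieBr H ((Ad k : EH →L[ℝ] EH) v) ((Ad k : EH →L[ℝ] EH) w) := by
  obtain ⟨c, -, hc0, hc⟩ := exists_curve (E := EH) (1 : H) v
  have hl : HasLogDeriv c 0 v := (hasLogDeriv_iff_of_eq_one hc0).2 hc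
  have h1 := ((hl.mul_left k).mul_right k⁻¹).hasDerivAt_Ad ((Ad k : EH →L[ℝ] EH) w)
  have h2 := (Ad k : EH →L[ℝ] EH).hasFDerivAt.comp_hasDerivAt 0 (hl.hasDerivAt_Ad w)
  have e : (fun r => (Ad (k * c r * k⁻¹) : EH →L[ℝ] EH) ((Ad k : EH →L[ℝ] EH) w)) =
      (Ad k : EH →L[ℝ] EH) ∘ fun r => (Ad (c r) : EH →L[ℝ] EH) w := by
    funext r
    simp only [Function.comp_apply, ← Ad_mul, inv_mul_cancel_right]
  rw [e] at h1
  have h3 := h1.unique h2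
  simp only [hc0, mul_one, mul_inv_cancel, Ad_one] at h3
  exact h3.symm

/-- Let `k` be the solution of `∂ₜ k = - Φ(∂ₜ) k` with `k(s, 0) = 1`.  The logarithmic derivative
of `k` in the transversal direction is determined by the curvature-like quantities `b` and `b'`. -/
theorem logForm_transversal {k : ℝ × ℝ → H} (hk : ContMDiff 𝓘(ℝ, ℝ × ℝ) 𝓘(ℝ, EH) ∞ k)
    {Φ : ℝ × ℝ → ℝ × ℝ →L[ℝ] EH} (hΦ : ContDiff ℝ ∞ Φ) {b b' : ℝ × ℝ → EH} (hb : Continuous b)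
    (hb' : Continuous b') (hkt : ∀ z, logForm EH k z (0, 1) = -Φ z (0, 1))
    (hk0 : ∀ s, k (s, 0) = 1) (hΦ0 : ∀ s, Φ (s, 0) (1, 0) = 0)
    (hbb : ∀ s t, (Ad (k (s, t)) : EH →L[ℝ] EH) (b' (s, t)) = b (s, t) +
      (fderiv ℝ Φ (s, t) (1, 0) (0, 1) - fderiv ℝ Φ (s, t) (0, 1) (1, 0)) +
      lieBr H (Φ (s, t) (1, 0)) (Φ (s, t) (0, 1)) -
      lieBr H (∫ τ in (0 : ℝ)..t, b (s, τ)) (Φ (s, t) (0, 1))) (s t : ℝ) :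
    logForm EH k (s, t) (1, 0) + Φ (s, t) (1, 0) +
      (Ad (k (s, t)) : EH →L[ℝ] EH) (∫ τ in (0 : ℝ)..t, b' (s, τ)) =
      ∫ τ in (0 : ℝ)..t, b (s, τ) := by
  have hkl := contDiff_logForm hk
  have hint : ∀ {f : ℝ × ℝ → EH}, Continuous f → ∀ t,
      HasDerivAt (fun t => ∫ τ in (0 : ℝ)..t, f (s, τ)) (f (s, t)) t := fun {f} hf t =>
    intervalIntegral.integral_hasDerivAt_right
      ((hf.comp (by fun_prop : Continuous fun τ : ℝ => (s, τ))).intervalIntegrable _ _)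
      ((hf.comp (by fun_prop : Continuous fun τ : ℝ => (s, τ))).stronglyMeasurableAtFilter _ _)
      (hf.comp (by fun_prop : Continuous fun τ : ℝ => (s, τ))).continuousAt
  let β : ℝ → EH := fun t => ∫ τ in (0 : ℝ)..t, b (s, τ)
  -- The claim is `m + Ad k (∫ b') = 0`.
  let m : ℝ → EH := fun t => logForm EH k (s, t) (1, 0) + Φ (s, t) (1, 0) - β t
  have hm : ∀ t, HasDerivAt m (fderiv ℝ (logForm EH k) (s, t) (0, 1) (1, 0) +
      fderiv ℝ Φ (s, t) (0, 1) (1, 0) - b (s, t)) t := fun t =>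
    ((hasDerivAt_slice_snd hkl s t (1, 0)).add (hasDerivAt_slice_snd hΦ s t (1, 0))).sub (hint hb t)
  have hmc : ∀ t, fderiv ℝ (logForm EH k) (s, t) (0, 1) (1, 0) =
      -fderiv ℝ Φ (s, t) (1, 0) (0, 1) - lieBr H (Φ (s, t) (0, 1)) (logForm EH k (s, t) (1, 0)) :=
    fun t => by
      have h1 := maurerCartan_equation hk (s, t) (1, 0) (0, 1)
      have h2 := (hasDerivAt_slice_fst hkl s t (0, 1)).congr_of_eventuallyEq
        (f₁ := fun s => -Φ (s, t) (0, 1)) (Filter.Eventually.of_forall fun s => (hkt (s, t)).symm)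
      rw [h2.unique (hasDerivAt_slice_fst hΦ s t (0, 1)).neg, hkt, lieBr_neg_left] at h1
      rw [sub_eq_iff_eq_add.1 h1]
      abel
  -- Conjugation by `k⁻¹` absorbs the bracket with `Φ(∂_t)` in the equation for `m`; by the
  -- Maurer-Cartan equation and `hbb`, the resulting quantity is constant in `t`.
  let D : ℝ → EH := fun t => (Ad (k (s, t))⁻¹ : EH →L[ℝ] EH) (m t) + ∫ τ in (0 : ℝ)..t, b' (s, τ)
  have hD : ∀ t, HasDerivAt D 0 t := fun t => by
    have hkd := (hasLogDeriv_logForm_snd hk s t).inv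
    rw [hkt, map_neg, neg_neg] at hkd
    have h1 := (hkd.hasDerivAt_Ad_apply (hm t)).add (hint hb' t)
    refine h1.congr_deriv ?_
    rw [← Ad_lieBr, ← map_add, ← Ad_inv_Ad (k (s, t)) (b' (s, t)), ← map_add, hbb, hmc]
    have e : lieBr H (Φ (s, t) (0, 1)) (m t) = lieBr H (Φ (s, t) (0, 1)) (logForm EH k (s, t) (1, 0)) -
        lieBr H (Φ (s, t) (1, 0)) (Φ (s, t) (0, 1)) + lieBr H (β t) (Φ (s, t) (0, 1)) := by
      simp only [m]
      rw [sub_eq_add_neg, lieBr_add_right, lieBr_add_right, lieBr_neg_right,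
        lieBr_swap (Φ (s, t) (0, 1)) (Φ (s, t) (1, 0)), lieBr_swap (Φ (s, t) (0, 1)) (β t)]
      abel
    rw [e]
    refine Eq.trans (congrArg _ ?_) (map_zero _)
    simp only [β]
    abel
  have hD0 : D 0 = 0 := by
    have h1 : logForm EH k (s, 0) (1, 0) = 0 := by
      refine (hasLogDeriv_logForm_fst hk s 0).unique ?_
      simp only [hk0]
      exact hasLogDeriv_const _ _
    simp [D, m, β, h1, hΦ0]
  have hDt : D t = 0 := (is_const_of_deriv_eq_zero (fun t => (hD t).differentiableAt)
    (fun t => (hD t).deriv) t 0).trans hD0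
  have h1 := congrArg (Ad (k (s, t)) : EH →L[ℝ] EH) hDt
  simp only [D] at h1
  rw [map_add, Ad_Ad_inv, map_zero] at h1
  simp only [m, β] at h1
  rw [← sub_eq_zero, ← h1]
  abel

end Adjoint

/-! ### Compatibility of path-ordered exponentials with bigons. -/

section BigonCompatibility

variable {EM : Type*} [NormedAddCommGroup EM] [NormedSpace ℝ EM]
  {M : Type*} [TopologicalSpace M] [ChartedSpace EM M]
  {EG : Type*} [NormedAddCommGroup EG] [NormedSpace ℝ EG]
  {EH : Type*} [NormedAddCommGroup EH] [NormedSpace ℝ EH]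
  {G : Type*} [TopologicalSpace G] [ChartedSpace EG G] [Group G] [LieGroup 𝓘(ℝ, EG) ∞ G]
  {H : Type*} [TopologicalSpace H] [ChartedSpace EH H] [Group H] [LieGroup 𝓘(ℝ, EH) ∞ H]
  {X : LieCrossedModule EG EH G H} {P P' : PrincipalTwoBundle X EM M}
  {C : TwoConnection P} {C' : TwoConnection P'} {φ : OneForm (EM × EG) P.P₀ EH}
  {F : TwoBundleMap P P'}

omit [LieGroup 𝓘(ℝ, EH) ∞ H] in
-- A curve in one fibre is an orbit curve `c(0) · g(t)`, whose velocity is a translate of a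
-- fundamental vector.
theorem IsOneMorphism.ev_vel_of_proj_const (hm : IsOneMorphism C C' F φ) {c : ℝ → P.P₀}
    (hc : ContMDiff 𝓘(ℝ, ℝ) 𝓘(ℝ, EM × EG) ∞ c) (hp : ∀ t, P.proj (c t) = P.proj (c 0)) (t : ℝ) :
    φ.ev (c t) (vel (EM × EG) c t) = 0 := by
  choose g hg using fun t => (P.simply₀ (c 0) (c t) (hp t).symm).exists
  have hgs : ContMDiff 𝓘(ℝ, ℝ) 𝓘(ℝ, EG) ∞ g := by
    refine P.contMDiff_div₀ (contMDiff_const (c := c 0)) ?_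
    simp only [hg]
    exact hc
  have h1 := (hasVelocity_fundamental (c 0) (hasVelocity_vel hgs t).hasLogDeriv).vel_eq
  simp only [hg] at h1
  rw [h1]
  have h2 : φ.ev (P.str.act₀ (c 0) (g t)) (P.rt (g t) (c 0) (P.fund (c 0)
      ((maurerCartan EG G (g t) : EG →L[ℝ] EG) (vel EG g t)))) = X.αg (g t)⁻¹ (φ.ev (c 0) _) :=
    hm.equivariant (g t) (c 0) (P.fund (c 0) _)
  have h3 : φ.ev (c 0) (P.fund (c 0) ((maurerCartan EG G (g t) : EG →L[ℝ] EG) (vel EG g t))) = 0 :=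
    hm.horizontal _ _
  rwa [h3, map_zero, hg] at h2

variable [FiniteDimensional ℝ EG] [FiniteDimensional ℝ EH]

omit [LieGroup 𝓘(ℝ, EH) ∞ H] in
-- As `A(∂_t)` vanishes identically, `∂_t (A(∂_s)) = -dA(∂_s, ∂_t)`, and this is `-t_*B(∂_s, ∂_t)`
-- by fake flatness. The initial value is zero because all lifts start at `p`.
theorem TwoConnection.ev_partial₁_of_horizontal (C : TwoConnection P) {L : ℝ × ℝ → P.P₀}
    (hL : ContMDiff 𝓘(ℝ, ℝ × ℝ) 𝓘(ℝ, EM × EG) ∞ L)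
    (hA : ∀ z, C.A.ev (L z) (partial₂ (EM × EG) L z) = 0) {p : P.P₀} (h0 : ∀ s, L (s, 0) = p)
    (s t : ℝ) :
    C.A.ev (L (s, t)) (partial₁ (EM × EG) L (s, t)) = -X.tStar (∫ τ in (0 : ℝ)..t,
      C.B.ev (L (s, τ)) (partial₁ (EM × EG) L (s, τ)) (partial₂ (EM × EG) L (s, τ))) := by
  have hpb := C.smooth_A.contDiff_pullback hL
  have hb := C.smooth_B.continuous_pullback hL (1, 0) (0, 1)
  have h1 : ∀ t, HasDerivAt (fun t => C.A.pullback L (s, t) (1, 0)) (-X.tStar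
      (C.B.ev (L (s, t)) (partial₁ (EM × EG) L (s, t)) (partial₂ (EM × EG) L (s, t)))) t :=
    fun t => by
      refine (hasDerivAt_slice_snd hpb s t (1, 0)).congr_deriv ?_
      have e1 := C.smooth_A.d_pullback hL (s, t) (1, 0) (0, 1)
      have e2 : fderiv ℝ (C.A.pullback L) (s, t) (1, 0) (0, 1) = 0 := by
        refine (hasDerivAt_slice_fst hpb s t (0, 1)).unique ?_
        have : (fun s => C.A.pullback L (s, t) (0, 1)) = fun _ => 0 := funext fun s => hA (s, t)
        rw [this]
        exact hasDerivAt_const _ _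
      have e3 := C.fake_flat (L (s, t)) (partial₁ (EM × EG) L (s, t)) (partial₂ (EM × EG) L (s, t))
      have e4 : C.A (L (s, t)) (partial₂ (EM × EG) L (s, t)) = 0 := hA (s, t)
      rw [e4, lieBr_zero_right, add_zero] at e3
      rw [e2, zero_sub] at e1
      rw [← neg_eq_iff_eq_neg]
      exact e1.trans e3.symm
  have h2 : ∀ t, HasDerivAt (fun t => C.A.pullback L (s, t) (1, 0) + X.tStar (∫ τ in (0 : ℝ)..t,
      C.B.ev (L (s, τ)) (partial₁ (EM × EG) L (s, τ)) (partial₂ (EM × EG) L (s, τ)))) 0 t :=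
    fun t => by
      have hb' := hb.comp (by fun_prop : Continuous fun τ : ℝ => (s, τ))
      have h3 := X.tStar.hasFDerivAt.comp_hasDerivAt t (intervalIntegral.integral_hasDerivAt_right
        (hb'.intervalIntegrable 0 t) (hb'.stronglyMeasurableAtFilter _ _) hb'.continuousAt)
      exact ((h1 t).add h3).congr_deriv (neg_add_cancel _)
  have h3 := is_const_of_deriv_eq_zero (fun t => (h2 t).differentiableAt)
    (fun t => (h2 t).deriv) t 0
  have h4 : C.A.pullback L (s, 0) (1, 0) = 0 := by
    have e : partial₁ (EM × EG) L (s, 0) = (0 : EM × EG) := by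
      refine (hasVelocity_partial₁ hL s 0).unique ?_
      simp only [h0]
      exact hasVelocity_const _ _
    exact (congrArg (C.A.ev (L (s, 0))) e).trans (map_zero (C.A (L (s, 0)) : EM × EG →L[ℝ] EG))
  rw [h4, intervalIntegral.integral_same, map_zero, add_zero] at h3
  exact eq_neg_of_add_eq_zero_left h3

/-- Equivariance and horizontality of `B'` remove the factor `t(k)`, with `α_{t(k)} = Ad k`. In the
pullback formula only `A(∂_s)` survives; as it lies in the image of `t_*`, the term `α_*(A(∂_s),
φ(∂_t))` becomes a bracket in `𝔥` with the integral of `B`. -/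
theorem IsOneMorphism.Ad_B_eq (hm : IsOneMorphism C C' F φ) {L : ℝ × ℝ → P.P₀}
    (hL : ContMDiff 𝓘(ℝ, ℝ × ℝ) 𝓘(ℝ, EM × EG) ∞ L)
    (hA : ∀ z, C.A.ev (L z) (partial₂ (EM × EG) L z) = 0) {p : P.P₀} (h0 : ∀ s, L (s, 0) = p)
    {k : ℝ × ℝ → H} (hk : ContMDiff 𝓘(ℝ, ℝ × ℝ) 𝓘(ℝ, EH) ∞ k) {L' : ℝ × ℝ → P'.P₀}
    (hL' : ∀ z, L' z = P'.str.act₀ (F.obj (L z)) (X.t (k z))) (s t : ℝ) :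
    (Ad (k (s, t)) : EH →L[ℝ] EH) (C'.B.ev (L' (s, t)) (partial₁ (EM × EG) L' (s, t))
        (partial₂ (EM × EG) L' (s, t))) =
      C.B.ev (L (s, t)) (partial₁ (EM × EG) L (s, t)) (partial₂ (EM × EG) L (s, t)) +
      (fderiv ℝ (φ.pullback L) (s, t) (1, 0) (0, 1) -
        fderiv ℝ (φ.pullback L) (s, t) (0, 1) (1, 0)) +
      lieBr H (φ.pullback L (s, t) (1, 0)) (φ.pullback L (s, t) (0, 1)) -
      lieBr H (∫ τ in (0 : ℝ)..t, C.B.ev (L (s, τ)) (partial₁ (EM × EG) L (s, τ))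
        (partial₂ (EM × EG) L (s, τ))) (φ.pullback L (s, t) (0, 1)) := by
  have hL's : ContMDiff 𝓘(ℝ, ℝ × ℝ) 𝓘(ℝ, EM × EG) ∞ L' := by
    rw [funext hL']
    exact P'.contMDiff_act₀ (F.smooth_obj.comp hL) (X.smooth_t.comp hk)
  have hv₁ := (((hasVelocity_partial₁ hL s t).map_obj F).act₀
    (X.hasLogDeriv_t (hasLogDeriv_logForm_fst hk s t)))
  have hv₂ := (((hasVelocity_partial₂ hL s t).map_obj F).act₀
    (X.hasLogDeriv_t (hasLogDeriv_logForm_snd hk s t)))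
  simp only [← hL'] at hv₁ hv₂
  have e₁ := (hasVelocity_partial₁ hL's s t).unique hv₁
  have e₂ := (hasVelocity_partial₂ hL's s t).unique hv₂
  have e : C'.B.ev (L' (s, t)) (partial₁ (EM × EG) L' (s, t)) (partial₂ (EM × EG) L' (s, t)) =
      (Ad (k (s, t))⁻¹ : EH →L[ℝ] EH) (C'.B.ev (F.obj (L (s, t)))
        (F.dv (L (s, t)) (partial₁ (EM × EG) L (s, t)))
        (F.dv (L (s, t)) (partial₂ (EM × EG) L (s, t)))) := by
    rw [e₁, e₂, hL', C'.B_act, ← map_inv, X.αg_t]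
  rw [e, Ad_Ad_inv]
  refine (hm.pullback_B (L (s, t)) (partial₁ (EM × EG) L (s, t))
    (partial₂ (EM × EG) L (s, t))).trans ?_
  have a₁ : C.A (L (s, t)) (partial₁ (EM × EG) L (s, t)) = _ :=
    C.ev_partial₁_of_horizontal hL hA h0 s t
  have a₂ : C.A (L (s, t)) (partial₂ (EM × EG) L (s, t)) = 0 := hA (s, t)
  rw [a₁, a₂, X.αStar_zero_left, X.αStar_neg_left, X.αStar_tStar, sub_zero,
    hm.smooth.d_pullback hL (s, t) (1, 0) (0, 1), sub_eq_add_neg]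
  rfl

/-- The compatibility of the path-ordered exponentials of `-φ` with bigons. -/
theorem IsOneMorphism.bigon [T2Space G] [T2Space H] (hm : IsOneMorphism C C' F φ)
    {L : ℝ × ℝ → P.P₀} (hL : ContMDiff 𝓘(ℝ, ℝ × ℝ) 𝓘(ℝ, EM × EG) ∞ L)
    (hA : ∀ z, C.A.ev (L z) (partial₂ (EM × EG) L z) = 0) {p : P.P₀} (h0 : ∀ s, L (s, 0) = p)
    (h1 : ∀ s, P.proj (L (s, 1)) = P.proj (L (0, 1))) {L' : ℝ × ℝ → P'.P₀}
    (hL' : ContMDiff 𝓘(ℝ, ℝ × ℝ) 𝓘(ℝ, EM × EG) ∞ L')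
    (hA' : ∀ z, C'.A.ev (L' z) (partial₂ (EM × EG) L' z) = 0) (h0' : ∀ s, L' (s, 0) = F.obj p)
    (hp : ∀ z, P'.proj (L' z) = P.proj (L z)) {h h' : ℝ → H}
    (hh : IsPathOrderedExp (fun s => ∫ t in (0 : ℝ)..1, C.B.ev (L (s, t))
      (partial₁ (EM × EG) L (s, t)) (partial₂ (EM × EG) L (s, t))) h)
    (hh' : IsPathOrderedExp (fun s => ∫ t in (0 : ℝ)..1, C'.B.ev (L' (s, t))
      (partial₁ (EM × EG) L' (s, t)) (partial₂ (EM × EG) L' (s, t))) h') :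
    ∃ g g', HasHolonomy C φ (fun t => P.proj (L (0, t))) p (L (0, 1)) g ∧
      HasHolonomy C φ (fun t => P.proj (L (1, t))) p (L (1, 1)) g' ∧ h 1 * g = g' * h' 1 := by
  have hLs : ∀ s, ContMDiff 𝓘(ℝ, ℝ) 𝓘(ℝ, EM × EG) ∞ (fun t => L (s, t)) :=
    contMDiff_slice_snd hL
  have hLs' : ∀ s, ContMDiff 𝓘(ℝ, ℝ) 𝓘(ℝ, EM × EG) ∞ (fun t => L' (s, t)) :=
    contMDiff_slice_snd hL'
  have hv : ∀ s t, vel (EM × EG) (fun t => L (s, t)) t = partial₂ (EM × EG) L (s, t) := fun s t =>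
    (hasVelocity_partial₂ hL s t).vel_eq
  have hpb := hm.smooth.contDiff_pullback hL
  choose x hx0 hx using fun s => exists_isPathOrderedExp (K := H)
    (IsParallelPair.contDiff_logDeriv hm.smooth (hLs s))
  let k : ℝ × ℝ → H := fun z => x z.1 z.2
  have hpair : ∀ s, IsParallelPair C φ (fun t => L (s, t)) (fun t => k (s, t)) := fun s =>
    ⟨hLs s, fun t => by rw [hv]; exact hA (s, t), hx s⟩
  have hkt : ∀ s t, HasLogDeriv (fun t => k (s, t)) t (-φ.pullback L (s, t) (0, 1)) := fun s t => by
    have := (hpair s).logDeriv t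
    rw [hv] at this
    exact this
  have hk : ContMDiff 𝓘(ℝ, ℝ × ℝ) 𝓘(ℝ, EH) ∞ k := by
    refine contMDiff_of_hasLogDeriv ((hpb.clm_apply contDiff_const).neg) hkt ?_
    simp only [k, hx0]
    exact contMDiff_const
  -- For each `s` both sides are horizontal lifts for `A'` of the same path from the same point,
  -- hence equal.
  have hLk : ∀ z, L' z = P'.str.act₀ (F.obj (L z)) (X.t (k z)) := fun z => by
    have e := horizontal_unique C' (hLs' z.1) (P'.contMDiff_act₀ (F.smooth_obj.comp (hLs z.1))
      (X.smooth_t.comp ((hpair z.1).contMDiff_snd hm.smooth)))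
      (fun t => by rw [(hasVelocity_partial₂ hL' z.1 t).vel_eq]; exact hA' _)
      ((hpair z.1).image_horizontal (fun p v => hm.pullback_A p v))
      (fun t => by rw [hp, P'.proj_act, Function.comp_apply, F.map_proj]) (t₀ := 0)
      (by simp [h0', h0, k, hx0, P'.str.act₀_one])
    exact congrFun e z.2
  have key := logForm_transversal hk hpb (C.smooth_B.continuous_pullback hL (1, 0) (0, 1))
    (C'.smooth_B.continuous_pullback hL' (1, 0) (0, 1))
    (fun z => (hasLogDeriv_logForm_snd hk z.1 z.2).unique (hkt z.1 z.2)) (fun s => hx0 s)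
    (fun s => ?_) (fun s t => hm.Ad_B_eq hL hA h0 hk hLk s t)
  swap
  · have e : partial₁ (EM × EG) L (s, 0) = (0 : EM × EG) := by
      refine (hasVelocity_partial₁ hL s 0).unique ?_
      simp only [h0]
      exact hasVelocity_const _ _
    exact (congrArg (φ.ev (L (s, 0))) e).trans (map_zero (φ (L (s, 0)) : EM × EG →L[ℝ] EH))
  -- The end points `L (s, 1)` stay in one fibre, so the boundary term `φ(∂_s)` in the transversal
  -- formula is absent at `t = 1`.
  have hend : ∀ s, φ.pullback L (s, 1) (1, 0) = 0 := fun s => by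
    have e := hm.ev_vel_of_proj_const (contMDiff_slice_fst hL 1) h1 s
    rw [(hasVelocity_partial₁ hL s 1).vel_eq] at e
    exact e
  refine ⟨k (0, 1), k (1, 1), ⟨_, _, hpair 0, fun _ => rfl, h0 0, hx0 0, rfl, rfl⟩,
    ⟨_, _, hpair 1, fun _ => rfl, h0 1, hx0 1, rfl, rfl⟩, ?_⟩
  have hhl : ∀ s, HasLogDeriv h s _ := hh.2
  have hhl' : ∀ s, HasLogDeriv h' s _ := hh'.2
  -- Both `h(s) k(0, 1)` and `k(s, 1) h'(s)` have logarithmic derivative `∫₀¹ B(∂_s, ∂_t) dt`, and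
  -- they agree at `s = 0`; the assertion is their equality at `s = 1`.
  have hfin := eq_of_hasLogDeriv_univ (fun s => HasLogDeriv.mul_right (hhl s) (k (0, 1)))
    (b := fun s => k (s, 1) * h' s) (fun s => ?_) 0 ?_
  · exact congrFun hfin 1
  · have e := HasLogDeriv.mul (hasLogDeriv_logForm_fst hk s 1) (hhl' s)
    have e' := key s 1
    rw [hend, add_zero] at e'
    exact (congrArg (HasLogDeriv (fun s => k (s, 1) * h' s) s) e').mp e
  · simp [hh.1, hh'.1, k]

end BigonCompatibility

/-! ### Pseudonatural transformations from fibrewise data. -/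

section Construction

variable {EM : Type*} [NormedAddCommGroup EM] [NormedSpace ℝ EM]
  {M : Type*} [TopologicalSpace M] [ChartedSpace EM M]
  {EG : Type*} [NormedAddCommGroup EG] [NormedSpace ℝ EG]
  {EH : Type*} [NormedAddCommGroup EH] [NormedSpace ℝ EH]
  {G : Type*} [TopologicalSpace G] [ChartedSpace EG G] [Group G]
  {H : Type*} [TopologicalSpace H] [ChartedSpace EH H] [Group H]
  {X : LieCrossedModule EG EH G H} {P P' : PrincipalTwoBundle X EM M}

theorem TwoTorsor.comp_ext (T : TwoTorsor X) {a b a' b' : T.Arr} (h : T.str.tgt a = T.str.src b)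
    (h' : T.str.tgt a' = T.str.src b') (hs : T.str.src a = T.str.src a')
    (hh : T.arrHol a * T.arrHol b = T.arrHol a' * T.arrHol b') :
    T.str.comp b a = T.str.comp b' a' := by
  refine T.arr_ext ?_ ?_
  · rw [T.str.src_comp _ _ h, T.str.src_comp _ _ h', hs]
  · rw [T.arrHol_comp h, T.arrHol_comp h', hh]

/-- The restriction of a bundle map to a fibre. -/
def TwoBundleMap.onFiber (F : TwoBundleMap P P') (x : M) : TorHom (P.fiber x) (P'.fiber x) where
  obj p := ⟨F.obj p.1, (F.map_proj _).trans p.2⟩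
  arr a := ⟨F.arr a.1, by rw [F.map_src, F.map_proj, a.2]⟩
  map_src a := Subtype.ext (F.map_src _)
  map_tgt a := Subtype.ext (F.map_tgt _)
  map_ident p := Subtype.ext (F.map_ident _)
  map_comp b a h := Subtype.ext (by
    have h' : P.str.tgt a.1 = P.str.src b.1 := congrArg Subtype.val h
    refine Eq.trans ?_ (P'.fiberComp_val _ _ ?_).symm
    · exact (congrArg F.arr (P.fiberComp_val b a h')).trans (F.map_comp _ _ h')
    · exact (F.map_tgt _).trans ((congrArg F.obj h').trans (F.map_src _).symm))
  map_act₀ p g := Subtype.ext (F.map_act₀ _ _)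
  map_act₁ a k := Subtype.ext (F.map_act₁ _ _)

variable {𝓕 𝓕' : TransportTwoFunctor X EM M} (ι : Realization 𝓕 P) (ι' : Realization 𝓕' P')

namespace PseudoNat

theorem ext_hol {ρ ρ' : PseudoNat 𝓕 𝓕'} (h : ∀ x q, (ρ.obj x).obj q = (ρ'.obj x).obj q)
    (h' : ∀ {x y : M} (γ : SmoothPath EM x y) q, (ρ.map γ).hol q = (ρ'.map γ).hol q) : ρ = ρ' := by
  have e : ρ.obj = ρ'.obj := funext fun x => TorHom.ext_obj (h x)
  obtain ⟨o, m, h1, h2, h3⟩ := ρ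
  obtain ⟨o', m', h1', h2', h3'⟩ := ρ'
  obtain rfl : o = o' := e
  obtain rfl : @m = @m' := by
    funext x y γ
    exact TwoMor.ext_hol (h' γ)
  rfl

/-- The data of a pseudonatural transformation on the fibres of 2-bundles. -/
structure FiberData where
  fib : ∀ x, TorHom (P.fiber x) (P'.fiber x)
  hol : ∀ {x y : M}, SmoothPath EM x y → (P.fiber x).Obj → H
  hol_act : ∀ {x y : M} (γ : SmoothPath EM x y) (p : (P.fiber x).Obj) (k : G),
    hol γ ((P.fiber x).str.act₀ p k) = X.α k⁻¹ (hol γ p)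
  tra_fib : ∀ {x y : M} (γ : SmoothPath EM x y) (p : (P.fiber x).Obj),
    ι'.tra γ ((fib x).obj p) = (P'.fiber y).str.act₀ ((fib y).obj (ι.tra γ p)) (X.t (hol γ p))
  hol_concat : ∀ {x y z : M} (γ : SmoothPath EM x y) (δ : SmoothPath EM y z)
    (p : (P.fiber x).Obj), hol (γ.concat δ) p = hol δ (ι.tra γ p) * hol γ p
  hol_bigon : ∀ {x y : M} {γ γ' : SmoothPath EM x y} (S : Bigon γ γ') (p : (P.fiber x).Obj),
    hol γ p * ι'.tra₂ S ((fib x).obj p) = ι.tra₂ S p * hol γ' p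

variable {ι ι'}

namespace FiberData

variable (D : FiberData ι ι')

/-- Thin invariance is not a separate axiom of the fibrewise data: a bigon of rank one has trivial
2-transport in both functors, so the bigon identity reduces to equality of the two values. -/
theorem hol_thin {x y : M} {γ γ' : SmoothPath EM x y} (h : ThinPath γ γ') (p : (P.fiber x).Obj) :
    D.hol γ p = D.hol γ' p := by
  obtain ⟨S, hS⟩ := h
  have h1 := D.hol_bigon S p
  unfold Realization.tra₂ at h1
  rwa [Realization.hol_of_rankLE S hS, Realization.hol_of_rankLE S hS, mul_one, one_mul] at h1

/-- The 1-morphisms of the pseudonatural transformation. -/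
def obj (x : M) : TorHom (𝓕.obj x) (𝓕'.obj x) :=
  TorHom.ofObj (fun q => (ι' x).objInv ((D.fib x).obj ((ι x).obj q)))
    (fun q g => by rw [(ι x).map_act₀, (D.fib x).map_act₀, (ι' x).objInv_act])

theorem obj_obj (x : M) (q : (𝓕.obj x).Obj) :
    (ι' x).obj ((D.obj x).obj q) = (D.fib x).obj ((ι x).obj q) := (ι' x).obj_objInv _

/-- The 2-morphisms of the pseudonatural transformation. -/
def map {x y : M} (γ : SmoothPath EM x y) :
    TwoMor ((D.obj y).comp (𝓕.map γ)) ((𝓕'.map γ).comp (D.obj x)) :=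
  TwoMor.ofHol (fun q => D.hol γ ((ι x).obj q))
    (fun q => (ι' y).obj_bijective.1 (by
      have h := D.tra_fib γ ((ι x).obj q)
      unfold Realization.tra at h
      rw [(ι x).objInv_obj] at h
      rw [(ι' y).map_act₀]
      refine h.trans (congrArg (fun z => (P'.fiber y).str.act₀ z _) ?_)
      exact (D.obj_obj y _).symm))
    (fun q k => by rw [(ι x).map_act₀, D.hol_act])

theorem map_hol {x y : M} (γ : SmoothPath EM x y) (q : (𝓕.obj x).Obj) :
    (D.map γ).hol q = D.hol γ ((ι x).obj q) := TwoMor.ofHol_hol _ _ _ _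

/-- The pseudonatural transformation given by data on the fibres of 2-bundles. -/
def toPseudoNat : PseudoNat 𝓕 𝓕' where
  obj := D.obj
  map := D.map
  map_thin γ γ' h := by
    funext q
    rw [TwoMor.app_eq, TwoMor.app_eq, D.map_hol, D.map_hol, D.hol_thin h]
    exact congrArg (fun f : TorHom _ _ => (𝓕'.obj _).str.arrow ((D.obj _).obj (f.obj q)) _)
      (𝓕.map_thin γ γ' h)
  map_concat {x y z} γ δ q := by
    have e : (𝓕'.obj z).str.tgt ((D.map δ).app ((𝓕.map γ).obj q)) =
        (𝓕'.obj z).str.src ((𝓕'.map δ).arr ((D.map γ).app q)) := by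
      rw [(D.map δ).tgt_app, (𝓕'.map δ).map_src, (D.map γ).src_app]
      rfl
    refine TwoTorsor.arr_ext _ ?_ ?_
    · rw [(𝓕'.obj z).str.src_comp _ _ e, (D.map δ).src_app, (D.map (γ.concat δ)).src_app,
        𝓕.map_concat]
      rfl
    · rw [TwoTorsor.arrHol_comp _ e, TorHom.arrHol_arr, ← TwoMor.hol_eq, ← TwoMor.hol_eq,
        ← TwoMor.hol_eq, D.map_hol, D.map_hol, D.map_hol, D.hol_concat]
      unfold Realization.tra
      rw [(ι x).objInv_obj]
  map_bigon {x y} γ γ' S q := by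
    refine TwoTorsor.comp_ext _ ?_ ?_ ?_ ?_
    · rw [(D.map γ).tgt_app, (𝓕'.map₂ S).src_app]
      rfl
    · rw [(D.map γ').src_app, (D.obj y).map_tgt, (𝓕.map₂ S).tgt_app]
      rfl
    · rw [(D.map γ).src_app, (D.obj y).map_src, (𝓕.map₂ S).src_app]
      rfl
    · rw [TorHom.arrHol_arr, ← TwoMor.hol_eq, ← TwoMor.hol_eq, ← TwoMor.hol_eq, ← TwoMor.hol_eq,
        D.map_hol, D.map_hol]
      have h := D.hol_bigon S ((ι x).obj q)
      unfold Realization.tra₂ at h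
      rwa [← D.obj_obj, (ι x).objInv_obj, (ι' x).objInv_obj] at h

theorem hol_toPseudoNat {x y : M} (γ : SmoothPath EM x y) (p : (P.fiber x).Obj) :
    D.toPseudoNat.hol ι γ p = D.hol γ p :=
  (D.map_hol γ _).trans (congrArg (D.hol γ) ((ι x).obj_objInv p))

theorem obj_toPseudoNat (x : M) (p : (P.fiber x).Obj) :
    (ι' x).obj ((D.toPseudoNat.obj x).obj ((ι x).objInv p)) = (D.fib x).obj p :=
  (D.obj_obj x _).trans (congrArg (D.fib x).obj ((ι x).obj_objInv p))

end FiberData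

theorem induces_of_obj {ρ : PseudoNat 𝓕 𝓕'} {F : TwoBundleMap P P'}
    (h : ∀ (x : M) (q : (𝓕.obj x).Obj), F.obj ((ι x).obj q).1 = ((ι' x).obj ((ρ.obj x).obj q)).1) :
    ρ.Induces ι ι' F where
  obj := h
  arr x a := by
    have e : (F.onFiber x).comp (ι x) = (ι' x).comp (ρ.obj x) :=
      TorHom.ext_obj fun q => Subtype.ext (h x q)
    have e' : ((F.onFiber x).comp (ι x)).arr a = ((ι' x).comp (ρ.obj x)).arr a := by rw [e]
    exact congrArg Subtype.val e'

end PseudoNat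

end Construction

/-! ### From 1-morphisms of 2-bundles with 2-connection to pseudonatural transformations -/

section Integration

variable {EM : Type*} [NormedAddCommGroup EM] [NormedSpace ℝ EM]
  {M : Type*} [TopologicalSpace M] [ChartedSpace EM M]
  {EG : Type*} [NormedAddCommGroup EG] [NormedSpace ℝ EG] [FiniteDimensional ℝ EG]
  {EH : Type*} [NormedAddCommGroup EH] [NormedSpace ℝ EH] [FiniteDimensional ℝ EH]
  {G : Type*} [TopologicalSpace G] [ChartedSpace EG G] [Group G] [LieGroup 𝓘(ℝ, EG) ∞ G]
  [T2Space G]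
  {H : Type*} [TopologicalSpace H] [ChartedSpace EH H] [Group H] [LieGroup 𝓘(ℝ, EH) ∞ H]
  [T2Space H]
  {X : LieCrossedModule EG EH G H} {P P' : PrincipalTwoBundle X EM M}
  {C : TwoConnection P} {C' : TwoConnection P'} {φ : OneForm (EM × EG) P.P₀ EH}
  {F : TwoBundleMap P P'} {𝓕 𝓕' : TransportTwoFunctor X EM M} {ι : Realization 𝓕 P}
  {ι' : Realization 𝓕' P'}

/-- Smooth dependence of the holonomy on the path. -/
theorem HasHolonomy.contMDiff {W : Type} [NormedAddCommGroup W] [NormedSpace ℝ W]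
    [FiniteDimensional ℝ W] (hφ : φ.IsSmooth) {γ : W × ℝ → M}
    (hγ : ContMDiff 𝓘(ℝ, W × ℝ) 𝓘(ℝ, EM) ∞ γ) {p q : W → P.P₀} {g : W → H}
    (hp : ContMDiff 𝓘(ℝ, W) 𝓘(ℝ, EM × EG) ∞ p)
    (hg : ∀ u, HasHolonomy C φ (fun t => γ (u, t)) (p u) (q u) (g u)) :
    ContMDiff 𝓘(ℝ, W) 𝓘(ℝ, EH) ∞ g := by
  choose c h hch hpr hc0 hh0 hc1 hh1 using hg
  have hc : ContMDiff 𝓘(ℝ, W × ℝ) 𝓘(ℝ, EM × EG) ∞ (fun z : W × ℝ => c z.1 z.2) := by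
    refine C.contMDiff_horizontal_family hγ (fun z => hpr z.1 z.2) (fun u => (hch u).smooth)
      (fun u => (hch u).horizontal) ?_
    simp only [hc0]
    exact hp
  have hh : ContMDiff 𝓘(ℝ, W × ℝ) 𝓘(ℝ, EH) ∞ (fun z : W × ℝ => h z.1 z.2) := by
    refine contMDiff_of_hasLogDeriv (ξ := fun z => -φ.pullback (fun z : W × ℝ => c z.1 z.2) z (0, 1))
      (((hφ.contDiff_pullback hc).clm_apply contDiff_const).neg) (fun u t => ?_) ?_
    · have h1 : HasVelocity (EM × EG) (fun t => c u t) t _ :=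
        HasVelocity.comp_contMDiff (hasVelocity_iff_hasDerivAt.2
          ((hasDerivAt_const t u).prodMk (hasDerivAt_id t))) hc
      have h2 := (hch u).logDeriv t
      rw [h1.vel_eq] at h2
      exact h2
    · simp only [hh0]
      exact contMDiff_const
  have h1 := hh.comp (ContDiff.contMDiff (f := fun u : W => (u, (1 : ℝ))) (by fun_prop))
  simp only [Function.comp_def, hh1] at h1
  exact h1

/-- The fibrewise data defined by a 1-morphism of 2-bundles with 2-connection. -/
def IsOneMorphism.fiberData (hm : IsOneMorphism C C' F φ) (hC : ι.IsTransportOf C)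
    (hC' : ι'.IsTransportOf C') : PseudoNat.FiberData ι ι' where
  fib := F.onFiber
  hol γ p := (hC.exists_hasHolonomy hm.smooth γ p).choose
  hol_act γ p k := by
    have h1 := (hC.exists_hasHolonomy hm.smooth γ p).choose_spec
    have h2 := (hC.exists_hasHolonomy hm.smooth γ ((P.fiber _).str.act₀ p k)).choose_spec
    exact (h2.unique (h1.act hm.equivariant k)).2
  tra_fib γ p := by
    have h1 := (hC.exists_hasHolonomy hm.smooth γ p).choose_spec
    obtain ⟨c, hc, hq⟩ := hC'.parallel γ ((F.onFiber _).obj p)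
    exact Subtype.ext (hq.trans (h1.image hm.smooth hm.pullback_A hc.smooth hc.horizontal hc.lifts
      hc.start))
  hol_concat γ δ p := by
    have h1 := (hC.exists_hasHolonomy hm.smooth γ p).choose_spec
    have h2 := (hC.exists_hasHolonomy hm.smooth δ (ι.tra γ p)).choose_spec
    have h3 := (hC.exists_hasHolonomy hm.smooth (γ.concat δ) p).choose_spec
    exact (h1.concat h2 h3).2
  hol_bigon {x y γ γ'} S p := by
    obtain ⟨L, hL, h, hh, e⟩ := hC.parallel₂ S p
    obtain ⟨L', hL', h', hh', e'⟩ := hC'.parallel₂ S ((F.onFiber x).obj p)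
    obtain ⟨ε, hε, -, a1, a2, a3⟩ := S.sitting
    have hp1 : ∀ s, P.proj (L (s, 1)) = y := fun s => by
      rw [hL.lifts, a1 s 1 (by linarith)]
    obtain ⟨g, g', hg, hg', hgg⟩ := hm.bigon hL.smooth hL.horizontal hL.start
      (fun s => (hp1 s).trans (hp1 0).symm) hL'.smooth hL'.horizontal hL'.start
      (fun z => (hL'.lifts z).trans (hL.lifts z).symm) hh hh'
    have r : (fun t => P.proj (L (0, t))) = γ.toFun := funext fun t =>
      (hL.lifts _).trans (a2 0 hε.le t)
    have r' : (fun t => P.proj (L (1, t))) = γ'.toFun := funext fun t =>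
      (hL.lifts _).trans (a3 1 (by linarith) t)
    rw [r] at hg
    rw [r'] at hg'
    have h1 := (hg.unique (hC.exists_hasHolonomy hm.smooth γ p).choose_spec).2
    have h2 := (hg'.unique (hC.exists_hasHolonomy hm.smooth γ' p).choose_spec).2
    -- The 2-transport is the inverse of the path-ordered exponential, so the identity `h(1) g = g'
    -- h'(1)` is rearranged to `g h'(1)⁻¹ = h(1)⁻¹ g'`.
    rw [e, e', ← h1, ← h2, mul_inv_eq_iff_eq_mul, mul_assoc, ← hgg, inv_mul_cancel_left]

omit [FiniteDimensional ℝ EG] [FiniteDimensional ℝ EH] [LieGroup 𝓘(ℝ, EG) ∞ G] [T2Space G]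
  [LieGroup 𝓘(ℝ, EH) ∞ H] [T2Space H] in
theorem PseudoNat.IsIntegral.hasHolonomy {ρ : PseudoNat 𝓕 𝓕'} (hρ : ρ.IsIntegral ι C φ) {x y : M}
    (γ : SmoothPath EM x y) (p : (P.fiber x).Obj) :
    ∃ q, HasHolonomy C φ γ.toFun p.1 q (ρ.hol ι γ p) := by
  obtain ⟨c, hc, h, hh, e⟩ := hρ γ p
  exact ⟨c 1, c, h, ⟨hc.smooth, hc.horizontal, hh.2⟩, hc.lifts, hc.start, hh.1, rfl, e.symm⟩

omit [FiniteDimensional ℝ EG] [FiniteDimensional ℝ EH] in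
-- The horizontal lift and the path-ordered exponential along it are unique, so `F` determines the
-- 1-morphisms and `φ` the values `ρ_H`; these determine `ρ`.
theorem PseudoNat.eq_of_isIntegral {ρ ρ' : PseudoNat 𝓕 𝓕'} (hF : ρ.Induces ι ι' F)
    (hF' : ρ'.Induces ι ι' F) (hρ : ρ.IsIntegral ι C φ) (hρ' : ρ'.IsIntegral ι C φ) : ρ = ρ' := by
  refine PseudoNat.ext_hol (fun x q => (ι' x).obj_bijective.1 (Subtype.ext
    ((hF.obj x q).symm.trans (hF'.obj x q)))) (fun {x y} γ q => ?_)
  obtain ⟨_, h1⟩ := hρ.hasHolonomy γ ((ι x).obj q)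
  obtain ⟨_, h2⟩ := hρ'.hasHolonomy γ ((ι x).obj q)
  have h3 := (h1.unique h2).2
  unfold PseudoNat.hol at h3
  rwa [(ι x).objInv_obj] at h3

theorem existsUnique_pseudoNat (hC : ι.IsTransportOf C) (hC' : ι'.IsTransportOf C')
    (hm : IsOneMorphism C C' F φ) :
    ∃! ρ : PseudoNat 𝓕 𝓕', ρ.IsSmooth ι ι' ∧ ρ.Induces ι ι' F ∧ ρ.IsIntegral ι C φ := by
  let D := hm.fiberData hC hC'
  have hol : ∀ {x y : M} (γ : SmoothPath EM x y) (p : (P.fiber x).Obj),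
      HasHolonomy C φ γ.toFun p.1 (ι.tra γ p).1 (D.toPseudoNat.hol ι γ p) := fun γ p => by
    rw [D.hol_toPseudoNat]
    exact (hC.exists_hasHolonomy hm.smooth γ p).choose_spec
  have hind : D.toPseudoNat.Induces ι ι' F := PseudoNat.induces_of_obj fun x q =>
    (congrArg Subtype.val (D.obj_obj x q)).symm
  have hint : D.toPseudoNat.IsIntegral ι C φ := fun {x y} γ p => by
    obtain ⟨c, h, hch, hp, h0, h0', -, h1⟩ := hol γ p
    exact ⟨c, ⟨hch.smooth, hp, h0, hch.horizontal⟩, h, ⟨h0', hch.logDeriv⟩, h1.symm⟩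
  refine ⟨D.toPseudoNat, ⟨⟨fun k p hp => ?_, fun k p y γ hp hγ => ?_⟩, hind, hint⟩,
    fun ρ' h' => PseudoNat.eq_of_isIntegral h'.2.1 hind h'.2.2 hint⟩
  · exact (F.smooth_obj.comp hp).congr fun u =>
      congrArg Subtype.val (D.obj_toPseudoNat (P.proj (p u)) (P.pt (p u) rfl))
  · exact HasHolonomy.contMDiff hm.smooth hγ hp fun u => hol (γ u) ⟨p u, rfl⟩

end Integration

end TwoTransport

end

open TwoTransport in
theorem mainTheorem7
    {EM : Type*} [NormedAddCommGroup EM] [NormedSpace ℝ EM] [FiniteDimensional ℝ EM]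
    {M : Type*} [TopologicalSpace M] [ChartedSpace EM M] [IsManifold 𝓘(ℝ, EM) ∞ M] [T2Space M]
    {EG : Type*} [NormedAddCommGroup EG] [NormedSpace ℝ EG] [FiniteDimensional ℝ EG]
    {G : Type*} [TopologicalSpace G] [ChartedSpace EG G] [Group G]
    [LieGroup 𝓘(ℝ, EG) ∞ G] [T2Space G]
    {EH : Type*} [NormedAddCommGroup EH] [NormedSpace ℝ EH] [FiniteDimensional ℝ EH]
    {H : Type*} [TopologicalSpace H] [ChartedSpace EH H] [Group H]
    [LieGroup 𝓘(ℝ, EH) ∞ H] [T2Space H]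
    (X : LieCrossedModule EG EH G H)
    (𝓕 𝓕' : TransportTwoFunctor X EM M)
    (P P' : PrincipalTwoBundle X EM M) (C : TwoConnection P) (C' : TwoConnection P')
    (ι : Realization 𝓕 P) (ι' : Realization 𝓕' P') :
    -- from pseudonatural transformations to 1-morphisms of 2-bundles with 2-connection
    (ι.Defines C → ι'.Defines C' → ∀ ρ : PseudoNat 𝓕 𝓕', ρ.IsSmooth ι ι' →
      ∃ (F : TwoBundleMap P P') (φ : OneForm (EM × EG) P.P₀ EH),
        ρ.Induces ι ι' F ∧ ρ.HasDerivative ι φ ∧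
        IsOneMorphism C C' F φ ∧ IsGaugeEquivariant φ ∧
        (∀ F', ρ.Induces ι ι' F' → F' = F) ∧ (∀ φ', ρ.HasDerivative ι φ' → φ' = φ)) ∧
    -- from 1-morphisms of 2-bundles with 2-connection to pseudonatural transformations
    (ι.IsTransportOf C → ι'.IsTransportOf C' →
      ∀ (F : TwoBundleMap P P') (φ : OneForm (EM × EG) P.P₀ EH), IsOneMorphism C C' F φ →
        ∃! ρ : PseudoNat 𝓕 𝓕', ρ.IsSmooth ι ι' ∧ ρ.Induces ι ι' F ∧ ρ.IsIntegral ι C φ) := by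
  refine ⟨fun hC hC' ρ hρ => exists_oneMorphism hC hC' hρ,
    fun hC hC' F φ hm => existsUnique_pseudoNat hC hC' hm⟩
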